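/- Let $F$ be a complete discrete valuation field whose residue field $k$ is perfect of characteristic $p>0$, and suppose that $\wp(k)\neq k$, where $\wp(a)=a^p-a$. Fix a separable closure of $F$; all extensions below are taken inside it. For a finite extension $K/F$ let $U_K$ be the group of units of the ring of integers of $K$, let $U_{1,K}$ be the group of principal units (units congruent to $1$ modulo the maximal ideal), and let $N_{K/F}$ be the norm. Let $\tilde F$ be the maximal abelian unramified $p$-extension of $F$, let $L/F$ be a finite totally ramified Galois $p$-extension, and put $\tilde L=L\tilde F$. For a Galois extension $E/F$ put $$\mathrm{Gal}(E/F)^\sim=\mathrm{Hom}_{\mathrm{cont}}(\mathrm{Gal}(\tilde F/F),\mathrm{Gal}(E/F)),$$ which is a group under pointwise multiplication if $E/F$ is abelian. For $\chi\in\mathrm{Gal}(L/F)^\sim$ let $\Sigma_\chi$ be the field of all $\alpha\in\tilde L$ that are fixed, for every $\varphi\in \mathrm{Gal}(\tilde F/F)$, by the automorphism $\varphi\chi(\varphi)$ of $\tilde L/F$, that is, the automorphism that acts as $\varphi$ on $\tilde F$ and as $\chi(\varphi)$ on $L$. Put $$\Upsilon_{L/F}(\chi)=N_{\Sigma_\chi/F}(\pi_\chi)/N_{L/F}(\pi_L)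 \bmod N_{L/F}U_L,$$ where $\pi_\chi$ and $\pi_L$ are prime elements of $\Sigma_\chi$ and $L$. Then: 1. Such prime elements exist, the quotient lies in $U_F$, and its class does not depend on the choice of $\pi_\chi$ and $\pi_L$, so that $\Upsilon_{L/F}:\mathrm{Gal}(L/F)^\sim\to U_F/N_{L/F}U_L$ is a well-defined map. 2. $\Upsilon_{L/F}$ is a homomorphism: $\Upsilon_{L/F}(\chi_1\chi_2)=\Upsilon_{L/F}(\chi_1)\Upsilon_{L/F}(\chi_2)$ for all $\chi_1,\chi_2\in \mathrm{Gal}(L/F)^\sim$ whose pointwise product $\chi_1\chi_2$ is again in $\mathrm{Gal}(L/F)^\sim$ (which is automatic if $L/F$ is abelian). 3. $\Upsilon_{L/F}$ induces an isomorphism $\mathrm{Gal}(L\cap F^{\mathrm{ab}}/F)^\sim\cong U_F/N_{L/F}U_L$: there is a group isomorphism $\Phi$ between these groups with $\Phi(\chi|_{L\cap F^{\mathrm{ab}}})=\Upsilon_{L/F}(\chi)$ for all $\chi\in\mathrm{Gal}(L/F)^\sim$, where $F^{\mathrm{ab}}$ is the maximal abelian extension of $F$ and $\chi|_{L\cap F^{\mathrm{ab}}}$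 is $\chi$ followed by the restriction $\mathrm{Gal}(L/F)\to\mathrm{Gal}(L\cap F^{\mathrm{ab}}/F)$. 4. There is an isomorphism $U_F/N_{L/F}U_L\cong U_{1,F}/N_{L/F}U_{1,L}$ that sends the class of each $u\in U_{1,F}$ to the class of $u$; that is, it is inverse to the map induced by the inclusion $U_{1,F}\subseteq U_F$. -/

import Mathlib

namespace PClassFieldTheory

noncomputable section

/-! Throughout, `O` is the ring of integers of a complete discrete valuation field `F`, and `Ω` is a
separable closure of `F`. For a finite extension `K` of `F` the ring of integers `O_K` is
`integralClosure O K`; it is again a complete discrete valuation ring. -/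

section Integers

variable (O K : Type*) [CommRing O] [Field K] [Algebra O K]

/-- The group of units `U_K = O_Kˣ`, as a subgroup of `Kˣ`. -/
def unitGroup : Subgroup Kˣ :=
  (Units.map (algebraMap (integralClosure O K) K : integralClosure O K →* K)).range

/-- The group of principal units `U_{1,K} = 1 + m_K`, as a subgroup of `Kˣ`: the units of `O_K` that
are trivial modulo the maximal ideal of `O_K` (written as the Jacobson radical, i.e. the
intersection of all the maximal ideals). -/
def principalUnitGroup : Subgroup Kˣ :=
  (Units.map (Ideal.Quotient.mk
      (Ideal.jacobson (⊥ : Ideal (integralClosure O K))) :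
        integralClosure O K →*
          integralClosure O K ⧸ Ideal.jacobson (⊥ : Ideal (integralClosure O K)))).ker.map
    (Units.map (algebraMap (integralClosure O K) K : integralClosure O K →* K))

/-- `π` is a prime element (uniformizer) of `K`: an irreducible element of `O_K`. -/
def IsPrimeElement (π : Kˣ) : Prop :=
  ∃ ϖ : integralClosure O K, Irreducible ϖ ∧ algebraMap (integralClosure O K) K ϖ = π

/-- `K` is totally ramified over the fraction field of `O`: the residue field extension is
trivial. -/
def IsTotallyRamified : Prop :=
  ∀ P : Ideal (integralClosure O K), P.IsMaximal →
    Function.Surjective (algebraMap O (integralClosure O K ⧸ P))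

end Integers

section Norm

variable (O F L : Type*) [CommRing O] [Field F] [Field L] [Algebra O F] [Algebra O L]
  [Algebra F L]

/-- The norm `N_{L/F} : Lˣ → Fˣ`. -/
def unitsNorm : Lˣ →* Fˣ := Units.map (Algebra.norm F : L →* F)

/-- `U_F / N_{L/F} U_L`. -/
abbrev UnitNormQuotient : Type _ :=
  unitGroup O F ⧸ ((unitGroup O L).map (unitsNorm F L)).subgroupOf (unitGroup O F)

/-- `U_{1,F} / N_{L/F} U_{1,L}`. -/
abbrev PrincipalUnitNormQuotient : Type _ :=
  principalUnitGroup O F ⧸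
    ((principalUnitGroup O L).map (unitsNorm F L)).subgroupOf (principalUnitGroup O F)

/-- The inclusion `U_{1,F} ⊆ U_F`. -/
theorem principalUnitGroup_le_unitGroup : principalUnitGroup O F ≤ unitGroup O F := by
  rintro _ ⟨u, -, rfl⟩
  exact ⟨u, rfl⟩

end Norm

section Abelian

variable (F Ω : Type*) [Field F] [Field Ω] [Algebra F Ω]

/-- The maximal abelian extension `F^ab` of `F` in `Ω`. -/
def maxAbelian : IntermediateField F Ω :=
  ⨆ K : {K : IntermediateField F Ω // IsAbelianGalois F K}, K.1

instance isAbelianGalois_maxAbelian : IsAbelianGalois F (maxAbelian F Ω) := by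
  have hgal : ∀ K : {K : IntermediateField F Ω // IsAbelianGalois F K}, IsGalois F K.1 :=
    fun K => K.2.toIsGalois
  have : IsGalois F (maxAbelian F Ω) := by
    unfold maxAbelian
    exact { to_isSeparable := IntermediateField.isSeparable_iSup (h := fun K => (hgal K).to_isSeparable)
            to_normal := IntermediateField.normal_iSup (h := fun K => (hgal K).to_normal) }
  refine { is_comm.comm := fun σ τ => ?_ }
  have key : ∀ K : {K : IntermediateField F Ω // IsAbelianGalois F K},
      ∀ x : maxAbelian F Ω, (x : Ω) ∈ K.1 → σ (τ x) = τ (σ x) := by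
    intro K x hx
    have hle : K.1 ≤ maxAbelian F Ω :=
      le_iSup (fun K : {K : IntermediateField F Ω // IsAbelianGalois F K} => K.1) K
    have := K.2
    have : IsAbelianGalois F (IntermediateField.restrict hle) :=
      IsAbelianGalois.of_algHom (IntermediateField.restrictAlgEquiv hle).symm.toAlgHom
    have hx' : x ∈ IntermediateField.restrict hle := (IntermediateField.mem_restrict hle x).2 hx
    have hc := IsMulCommutative.is_comm.comm
      (AlgEquiv.restrictNormalHom (IntermediateField.restrict hle) σ)
      (AlgEquiv.restrictNormalHom (IntermediateField.restrict hle) τ)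
    rw [← map_mul, ← map_mul] at hc
    have h1 := congrArg (fun e => ((e ⟨x, hx'⟩ : IntermediateField.restrict hle) :
      maxAbelian F Ω)) hc
    simpa [AlgEquiv.restrictNormalHom_apply] using h1
  -- the locus where the two composites agree is a subfield containing every abelian extension
  let E : IntermediateField F (maxAbelian F Ω) :=
    { carrier := {x | σ (τ x) = τ (σ x)}
      mul_mem' := by intro a b ha hb; simp_all
      add_mem' := by intro a b ha hb; simp_all
      algebraMap_mem' := by intro a; simp
      inv_mem' := by intro a ha; simp_all }
  have hE : maxAbelian F Ω ≤ IntermediateField.lift E := by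
    conv_lhs => unfold maxAbelian
    refine iSup_le fun K x hx => ?_
    have hle : K.1 ≤ maxAbelian F Ω :=
      le_iSup (fun K : {K : IntermediateField F Ω // IsAbelianGalois F K} => K.1) K
    exact (IntermediateField.mem_lift (⟨x, hle hx⟩ : maxAbelian F Ω)).2
      (key K ⟨x, hle hx⟩ hx)
  ext x
  exact congrArg Subtype.val ((IntermediateField.mem_lift x).1 (hE x.2) : σ (τ x) = τ (σ x))

variable {F Ω}

/-- `L ∩ F^ab`, as a subextension of `L/F`. -/
def abelianPart (L : IntermediateField F Ω) : IntermediateField F L :=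
  (maxAbelian F Ω).comap L.val

instance isAbelianGalois_abelianPart (L : IntermediateField F Ω) :
    IsAbelianGalois F (abelianPart L) :=
  IsAbelianGalois.of_algHom (M := maxAbelian F Ω)
    ((L.val.comp (abelianPart L).val).codRestrict (maxAbelian F Ω).toSubalgebra fun x => x.2)

end Abelian

section Neukirch

variable (p : ℕ) (O : Type*) {F Ω : Type*} [CommRing O] [Field F] [Field Ω] [Algebra O F]
  [Algebra O Ω] [Algebra F Ω] [IsScalarTower O F Ω]

variable (F Ω) in
/-- `F~`, the maximal abelian unramified `p`-extension of `F` in `Ω`: the compositum of all finite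
abelian extensions `K/F` of `p`-power degree such that `O_K` is unramified over `O`. -/
def maxAbUnramified : IntermediateField F Ω :=
  ⨆ K : {K : IntermediateField F Ω // FiniteDimensional F K ∧ IsAbelianGalois F K ∧
    IsPGroup p Gal(K/F) ∧ Algebra.FormallyUnramified O (integralClosure O K)}, K.1

/-- `Gal(E/F)^~`: the continuous homomorphisms from `Gal(F~/F)` to `Gal(E/F)`, both with the Krull
topology. -/
abbrev GalTilde (F Ω : Type*) [Field F] [Field Ω] [Algebra O F] [Algebra O Ω] [Algebra F Ω]
    [IsScalarTower O F Ω] (E : Type*) [Field E] [Algebra F E] : Type _ :=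
  Gal(maxAbUnramified p O F Ω/F) →ₜ* Gal(E/F)

open scoped IsMulCommutative in
/-- For an abelian extension `E/F`, `Gal(E/F)^~` is a group under pointwise multiplication. -/
instance galTildeCommGroup (E : Type*) [Field E] [Algebra F E] [IsAbelianGalois F E] :
    CommGroup (GalTilde p O F Ω E) :=
  inferInstanceAs (CommGroup (ContinuousMonoidHom Gal(maxAbUnramified p O F Ω/F) Gal(E/F)))

variable (L : IntermediateField F Ω)

/-- The map `Gal(L/F)^~ → Gal(L ∩ F^ab/F)^~` induced by restriction of automorphisms. -/
def galTildeRestrict [IsGalois F L] (χ : GalTilde p O F Ω L) :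
    GalTilde p O F Ω (abelianPart L) where
  toMonoidHom := (AlgEquiv.restrictNormalHom (abelianPart L)).comp χ.toMonoidHom
  continuous_toFun :=
    (InfiniteGalois.restrictNormalHom_continuous (abelianPart L)).comp χ.continuous_toFun

variable {p O L}

/-- The field `Σ_χ` of all `α ∈ L~ = L F~` that are fixed by `φ χ(φ)` for all `φ ∈ Gal(F~/F)`.
Here `φ χ(φ)` is the automorphism of `L~/F` that acts as `φ` on `F~` and as `χ(φ)` on `L`; it is
applied to `α` through any automorphism `τ` of `Ω` that extends it. -/
def sigmaField (χ : GalTilde p O F Ω L) : IntermediateField F Ω where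
  carrier := {α | α ∈ L ⊔ maxAbUnramified p O F Ω ∧
    ∀ (φ : Gal(maxAbUnramified p O F Ω/F)) (τ : Gal(Ω/F)),
      (∀ x : maxAbUnramified p O F Ω, τ x = φ x) → (∀ y : L, τ y = χ φ y) → τ α = α}
  mul_mem' := fun ha hb => ⟨mul_mem ha.1 hb.1, fun φ τ h1 h2 => by
    rw [map_mul, ha.2 φ τ h1 h2, hb.2 φ τ h1 h2]⟩
  add_mem' := fun ha hb => ⟨add_mem ha.1 hb.1, fun φ τ h1 h2 => by
    rw [map_add, ha.2 φ τ h1 h2, hb.2 φ τ h1 h2]⟩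
  algebraMap_mem' := fun r => ⟨IntermediateField.algebraMap_mem _ r, fun _ τ _ _ => τ.commutes r⟩
  inv_mem' := fun _ ha => ⟨inv_mem ha.1, fun φ τ h1 h2 => by rw [map_inv₀, ha.2 φ τ h1 h2]⟩

/-- The unit `u` of `F` equals `N_{Σ_χ/F} π_χ / N_{L/F} π_L`. -/
def IsUpsilonUnit (χ : GalTilde p O F Ω L) (πχ : (sigmaField χ)ˣ) (πL : Lˣ)
    (u : unitGroup O F) : Prop :=
  (u : Fˣ) = unitsNorm F (sigmaField χ) πχ / unitsNorm F L πL

open scoped Classical in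
/-- The map `Υ_{L/F} : Gal(L/F)^~ → U_F / N_{L/F} U_L`, sending `χ` to the class of
`N_{Σ_χ/F} π_χ / N_{L/F} π_L` for some choice of prime elements `π_χ` of `Σ_χ` and `π_L` of `L`. (The
default value `1` is irrelevant, as such elements exist for a totally ramified `p`-extension.) -/
def upsilon (χ : GalTilde p O F Ω L) : UnitNormQuotient O F L :=
  if h : ∃ u : unitGroup O F, ∃ (πχ : (sigmaField χ)ˣ) (πL : Lˣ),
      IsPrimeElement O (sigmaField χ) πχ ∧ IsPrimeElement O L πL ∧ IsUpsilonUnit χ πχ πL u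
  then QuotientGroup.mk h.choose
  else 1

end Neukirch

end

end PClassFieldTheory

open PClassFieldTheory

/-! Put `G = Gal(Ω/F)`, `T = Gal(Ω/L)`, and let `I` be the inertia group. Total ramification of
`L/F` means `G = T·I`. Hence passing to the maximal unramified extension, the field fixed by `I`,
changes neither the degree nor the norm of `L/F`, while it makes the residue field algebraically
closed. There two facts hold. The norm on units is surjective (`Pair.exists_N_eq`). Modulo the group
`Aug` generated by the quotients `g u / u` with `u` a unit and `g` an inertia automorphism, the
kernel of the norm is the abelianized Galois group `Q` of the base-changed extension, through `σ ↦ σ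
π / π` for a prime element `π` of `L` (`Pair.mk_eq_mk_iff`, `Pair.exists_mul_mem_Aug`). This `Q` is
`Gal(L ∩ F^ab/F)` (`Pair.galEquiv`).

The isomorphism is obtained from its inverse, the symbol. Given a unit `u` of `F`, write `u = N β`
over the unramified base change. For `φ ∈ T` the unit `φ β / β` has norm `1`, so it is inverse to `i
π / π` modulo `Aug` for a unique class `i ∈ Q`. Since `T` fixes `π` and commutes with inertia on the
base-changed field, `φ ↦ i` is a homomorphism. Extended by `1` on `I` it becomes an unramified
homomorphism `G → Q`, and as `Q` is an abelian `p`-group this is the same as an element of `Gal(L ∩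
F^ab/F)^~`. For `u = N π_χ / N π_L` one may take `β = π_χ / π_L`. If `i` is an inertia automorphism
acting on `L` as `χ(φ)`, then `i φ` fixes `π_χ`, so the symbol of `u` is `χ`
(`Pair.symbol_div_unif`). It remains to see that the symbol gives a bijection from units modulo
norms to unramified homomorphisms.

Norms have trivial symbol (`HasSymbol.eq_one`). Every unramified homomorphism is a symbol, by the
same computation with a twisted form of the abelian part of the extension (`Pair.exists_of_hom`).

A unit with trivial symbol is a norm (`Pair.exists_fixed_N_eq`). This is proved by induction along a
tower of steps of degree `p`. In one step, the norm acts on a layer of the unit filtration as a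
`p`-th power, a linear map or an Artin–Schreier polynomial (`CyclicStep.level_cases`). Only the last
may fail to be surjective over a perfect residue field, and there triviality of the symbol makes the
residue of a solution over the base change invariant under `T` (`StepExt.exists_descent`). To climb
the tower, `β` is modified until its symbol over the intermediate field vanishes. That symbol takes
values of the form `(σ - 1) q`. It can be cancelled by some `σ ζ / ζ` because unramified
homomorphisms lift through surjections of finite abelian `p`-groups (`Unramified.exists_lift`). The
lifting reflects that the absolute Galois group of a field of characteristic `p` has
`p`-cohomological dimension at most `1`, and it rests on Artin–Schreier theory.

For principal units: on residues the norm is `x ↦ x ^ (p ^ n)`, which is bijective on a perfect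
field of characteristic `p`. -/

set_option linter.unusedSectionVars false

/-! ### The valued closure, its residue field and the inertia group -/

namespace PClassFieldTheory

/-- A Galois extension `Ω` of a field `F`, with a nonarchimedean absolute value on `Ω` that is
invariant under the Galois group, discrete on `F`, complete on every finite subextension, and whose
residue field on `F` is perfect of characteristic `p`. -/
structure ValuedClosure (p : ℕ) (F Ω : Type*) [Field F] [Field Ω] [Algebra F Ω] where
  /-- the absolute value -/
  v : AbsoluteValue Ω ℝ
  v_add_le : ∀ x y, v (x + y) ≤ max (v x) (v y)
  v_gal : ∀ (g : Gal(Ω/F)) x, v (g x) = v x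
  /-- a uniformizer of the base field -/
  unif : F
  unif_ne_zero : unif ≠ 0
  v_unif_lt : v (algebraMap F Ω unif) < 1
  exists_zpow : ∀ x : F, x ≠ 0 → ∃ n : ℤ, v (algebraMap F Ω x) = v (algebraMap F Ω unif) ^ n
  -- `Ω` itself is not assumed complete. Limits are only taken inside finite subextensions, and only
  -- for the geometrically convergent sequences that successive approximation produces.
  complete : ∀ (M : IntermediateField F Ω) [FiniteDimensional F M] (u : ℕ → Ω) (ρ : ℝ),
    0 ≤ ρ → ρ < 1 → (∀ n, u n ∈ M) → (∀ n, v (u (n + 1) - u n) ≤ ρ ^ n) →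
    ∃ l ∈ M, ∀ n, v (l - u n) ≤ ρ ^ n
  v_p_lt : v (p : Ω) < 1
  perfect : ∀ x : F, v (algebraMap F Ω x) ≤ 1 →
    ∃ y : F, v (algebraMap F Ω (y ^ p - x)) < 1

namespace ValuedClosure

variable {p : ℕ} {F Ω : Type*} [Field F] [Field Ω] [Algebra F Ω] (D : ValuedClosure p F Ω)

theorem v_neg (x : Ω) : D.v (-x) = D.v x := D.v.map_neg x

theorem v_sub_le (x y : Ω) : D.v (x - y) ≤ max (D.v x) (D.v y) := by
  have := D.v_add_le x (-y)
  rwa [v_neg, ← sub_eq_add_neg] at this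

theorem v_sub_comm (x y : Ω) : D.v (x - y) = D.v (y - x) := D.v.map_sub x y

theorem v_add_lt {x y : Ω} {r : ℝ} (hx : D.v x < r) (hy : D.v y < r) : D.v (x + y) < r :=
  (D.v_add_le x y).trans_lt (max_lt hx hy)

theorem v_sub_lt {x y : Ω} {r : ℝ} (hx : D.v x < r) (hy : D.v y < r) : D.v (x - y) < r :=
  (D.v_sub_le x y).trans_lt (max_lt hx hy)

theorem v_add_le' {x y : Ω} {r : ℝ} (hx : D.v x ≤ r) (hy : D.v y ≤ r) : D.v (x + y) ≤ r :=
  (D.v_add_le x y).trans (max_le hx hy)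

theorem v_sub_le' {x y : Ω} {r : ℝ} (hx : D.v x ≤ r) (hy : D.v y ≤ r) : D.v (x - y) ≤ r :=
  (D.v_sub_le x y).trans (max_le hx hy)

theorem v_pos {x : Ω} (hx : x ≠ 0) : 0 < D.v x := D.v.pos hx

theorem v_add_eq_of_lt {x y : Ω} (h : D.v y < D.v x) : D.v (x + y) = D.v x := by
  refine le_antisymm (D.v_add_le' le_rfl h.le) ?_
  by_contra! h1
  have := D.v_sub_lt h1 h
  simp at this

theorem v_sum_lt {ι : Type*} (s : Finset ι) (f : ι → Ω) {r : ℝ} (hr : 0 < r)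
    (h : ∀ i ∈ s, D.v (f i) < r) : D.v (∑ i ∈ s, f i) < r := by
  classical
  induction s using Finset.induction_on with
  | empty => simpa
  | insert a s ha ih =>
    rw [Finset.sum_insert ha]
    exact D.v_add_lt (h a (by simp)) (ih fun i hi => h i (by simp [hi]))

theorem v_sum_le {ι : Type*} (s : Finset ι) (f : ι → Ω) {r : ℝ} (hr : 0 ≤ r)
    (h : ∀ i ∈ s, D.v (f i) ≤ r) : D.v (∑ i ∈ s, f i) ≤ r := by
  classical
  induction s using Finset.induction_on with
  | empty => simpa
  | insert a s ha ih =>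
    rw [Finset.sum_insert ha]
    exact D.v_add_le' (h a (by simp)) (ih fun i hi => h i (by simp [hi]))

theorem v_eq_one_of_sub_lt {x y : Ω} (hx : D.v x = 1) (h : D.v (x - y) < 1) : D.v y = 1 := by
  have h1 : D.v (x + -(x - y)) = D.v x := D.v_add_eq_of_lt (by rwa [v_neg, hx])
  rw [← hx, ← h1]; congr 1; ring

/-- The valuation ring of `Ω`. -/
def integers : Subring Ω where
  carrier := {x | D.v x ≤ 1}
  mul_mem' := fun {a b} ha hb => by
    simp only [Set.mem_ofPred_eq, map_mul] at *
    exact mul_le_one₀ ha (D.v.nonneg b) hb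
  one_mem' := by simp
  add_mem' := fun ha hb => D.v_add_le' ha hb
  zero_mem' := by simp
  neg_mem' := fun {a} ha => by simpa using ha

theorem mem_integers {x : Ω} : x ∈ D.integers ↔ D.v x ≤ 1 := Iff.rfl

theorem isUnit_integers_iff {x : D.integers} : IsUnit x ↔ D.v x = 1 := by
  constructor
  · rintro ⟨u, rfl⟩
    have h1 : D.v (u : D.integers) * D.v ((u⁻¹ : D.integersˣ) : D.integers) = 1 := by
      rw [← map_mul, ← Subring.coe_mul]; simp
    have h2 : D.v (u : D.integers) ≤ 1 := (u : D.integers).2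
    have h3 : D.v ((u⁻¹ : D.integersˣ) : D.integers) ≤ 1 := ((u⁻¹ : D.integersˣ) : D.integers).2
    have h4 := D.v.nonneg ((u : D.integers) : Ω)
    nlinarith
  · intro h
    have h0 : (x : Ω) ≠ 0 := by intro h0; simp [h0] at h
    refine IsUnit.of_mul_eq_one ⟨(x : Ω)⁻¹, by simp [mem_integers, h]⟩ ?_
    ext; simp [h0]

instance : IsLocalRing D.integers := by
  refine IsLocalRing.of_nonunits_add fun a b ha hb => ?_
  simp only [mem_nonunits_iff, isUnit_integers_iff] at *
  exact (D.v_add_lt (lt_of_le_of_ne a.2 ha) (lt_of_le_of_ne b.2 hb)).ne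

instance : MulSemiringAction Gal(Ω/F) D.integers where
  smul g x := ⟨g x, by rw [mem_integers, D.v_gal]; exact x.2⟩
  one_smul x := rfl
  mul_smul g h x := rfl
  smul_zero g := Subtype.ext (map_zero g)
  smul_add g x y := Subtype.ext (map_add g _ _)
  smul_one g := Subtype.ext (map_one g)
  smul_mul g x y := Subtype.ext (map_mul g _ _)

@[simp] theorem coe_smul_integers (g : Gal(Ω/F)) (x : D.integers) :
    ((g • x : D.integers) : Ω) = g x := rfl

/-- The residue field of `Ω`. -/
abbrev resField : Type _ := IsLocalRing.ResidueField D.integers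

/-- The residue map. -/
noncomputable abbrev res : D.integers →+* D.resField := IsLocalRing.residue D.integers

theorem res_eq_zero_iff {x : D.integers} : D.res x = 0 ↔ D.v x < 1 := by
  rw [IsLocalRing.residue_eq_zero_iff, IsLocalRing.mem_maximalIdeal, mem_nonunits_iff,
    isUnit_integers_iff]
  exact ⟨fun h => lt_of_le_of_ne x.2 h, fun h => h.ne⟩

theorem res_eq_iff {x y : D.integers} : D.res x = D.res y ↔ D.v (x - y : Ω) < 1 := by
  rw [← sub_eq_zero, ← map_sub, res_eq_zero_iff]; rfl

theorem res_surjective : Function.Surjective D.res := IsLocalRing.residue_surjective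

/-- The inertia group. -/
def inertia : Subgroup Gal(Ω/F) where
  carrier := {g | ∀ x, D.v x ≤ 1 → D.v (g x - x) < 1}
  mul_mem' := fun {a b} ha hb x hx => by
    have h1 := ha (b x) (by rwa [D.v_gal])
    have h2 := hb x hx
    simpa using D.v_add_lt h1 h2
  one_mem' := fun x _ => by simp
  inv_mem' := fun {a} ha x hx => by
    have h1 := ha (a⁻¹ x) (by rwa [D.v_gal])
    rw [D.v_sub_comm]
    simpa using h1

theorem mem_inertia {g : Gal(Ω/F)} :
    g ∈ D.inertia ↔ ∀ x, D.v x ≤ 1 → D.v (g x - x) < 1 := Iff.rfl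

instance : D.inertia.Normal where
  conj_mem n hn g x hx := by
    have h1 := hn (g⁻¹ x) (by rwa [D.v_gal])
    rw [← D.v_gal g] at h1
    simpa using h1

theorem isOpen_stabilizer [Algebra.IsAlgebraic F Ω] (x : Ω) :
    IsOpen {g : Gal(Ω/F) | g x = x} :=
  stabilizer_isOpen_of_isIntegral (K := F) x

/-- Such a `g` induces an automorphism of the residue field of `Ω` over the residue ring of the
integers fixed by `S`. For a profinite group the stabilizer of a prime surjects onto these
automorphisms, so some `s ∈ S` acts in the same way, and `s⁻¹ g` is in the inertia group. This is
the source of the decomposition `G = T·I` and of the distinctness of residual characters. -/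
theorem mem_mul_inertia_of_fix_residues [IsGalois F Ω] {S : Subgroup Gal(Ω/F)}
    (hS : IsClosed (S : Set Gal(Ω/F))) (g : Gal(Ω/F))
    (hg : ∀ x, D.v x ≤ 1 → (∀ s ∈ S, s x = x) → D.v (g x - x) < 1) :
    ∃ s ∈ S, ∃ i ∈ D.inertia, g = s * i := by
  let A := FixedPoints.subalgebra ℤ D.integers S
  let Q := IsLocalRing.maximalIdeal D.integers
  let P := Q.under A
  -- With the discrete topology on the integers, continuity of the action of `S` says that point
  -- stabilizers are open, which holds because `Ω/F` is algebraic.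
  let : TopologicalSpace D.integers := ⊥
  have : DiscreteTopology D.integers := ⟨rfl⟩
  have : CompactSpace S := isCompact_iff_compactSpace.mp hS.isCompact
  have : Algebra.IsInvariant A D.integers S :=
    ⟨fun b hb => ⟨⟨b, fun s => hb s⟩, rfl⟩⟩
  have : ContinuousSMul S D.integers := by
    refine ⟨continuous_def.2 fun U _ => isOpen_iff_forall_mem_open.2 ?_⟩
    rintro ⟨s, x⟩ hsx
    refine ⟨{s' : S | (s⁻¹ * s' : Gal(Ω/F)) (x : Ω) = x} ×ˢ {x}, ?_, ?_, ?_⟩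
    · rintro ⟨s', x'⟩ ⟨h1, h2⟩
      obtain rfl : x' = x := h2
      have : s' • x' = s • x' := by
        apply Subtype.ext
        have h3 : s'.1 (x' : Ω) = s.1 x' := by simpa using congrArg (s : Gal(Ω/F)) h1
        exact h3
      change s' • x' ∈ U
      rw [this]; exact hsx
    · refine IsOpen.prod ?_ (isOpen_discrete _)
      exact (isOpen_stabilizer (F := F) (x : Ω)).preimage
        (f := fun s' : S => (s⁻¹ * s' : Gal(Ω/F))) (by fun_prop)
    · simp
  -- The integers form a local ring, so every automorphism preserves `Q`: the decomposition group is
  -- everything.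
  have hQ : ∀ h : Gal(Ω/F), Q = Q.map (MulSemiringAction.toRingEquiv Gal(Ω/F) D.integers h :
      D.integers →+* D.integers) := by
    intro h
    symm
    exact IsLocalRing.eq_maximalIdeal (Ideal.map_isMaximal_of_equiv _)
  let σ : (D.integers ⧸ Q) ≃ₐ[A ⧸ P] (D.integers ⧸ Q) :=
    AlgEquiv.ofRingEquiv (f := Ideal.quotientEquiv Q Q
      (MulSemiringAction.toRingEquiv Gal(Ω/F) D.integers g) (hQ g)) (by
        intro r
        obtain ⟨a, rfl⟩ := Ideal.Quotient.mk_surjective r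
        change Ideal.Quotient.mk Q (g • (a : D.integers)) = Ideal.Quotient.mk Q (a : D.integers)
        refine (D.res_eq_iff (x := g • (a : D.integers)) (y := a)).2 ?_
        exact hg _ a.1.2 fun s hs => congrArg Subtype.val (a.2 ⟨s, hs⟩))
  obtain ⟨τ, hτ⟩ := Ideal.Quotient.stabilizerHom_surjective_of_profinite (G := S) P Q σ
  refine ⟨τ.1, τ.1.2, (τ.1 : Gal(Ω/F))⁻¹ * g, ?_, by simp⟩
  intro x hx
  have h1 := DFunLike.congr_fun hτ (Ideal.Quotient.mk Q ⟨x, hx⟩)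
  have h2 : D.v ((τ.1 : Gal(Ω/F)) x - g x) < 1 :=
    (D.res_eq_iff (x := (τ.1 : Gal(Ω/F)) • (⟨x, hx⟩ : D.integers)) (y := g • (⟨x, hx⟩ : D.integers))).1 h1
  rw [← D.v_gal (τ.1 : Gal(Ω/F)), map_sub, D.v_sub_comm]
  simpa using h2

end ValuedClosure

end PClassFieldTheory

/-! ### Coset representatives and relative norms -/

namespace PClassFieldTheory

section Transversal

variable {G : Type*} [Group G]

/-- `e` is a system of representatives of the left cosets of `B` that meet `A`. -/
structure IsTransversal (A B : Subgroup G) {ι : Type*} (e : ι → G) : Prop where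
  mem : ∀ i, e i ∈ A
  existsUnique : ∀ a ∈ A, ∃! i, (e i)⁻¹ * a ∈ B

variable {A B C : Subgroup G} {ι κ : Type*} {e : ι → G} {e' : κ → G}

theorem IsTransversal.eq_of_mem (he : IsTransversal A B e) {i j : ι} (h : (e i)⁻¹ * e j ∈ B) :
    i = j :=
  (he.existsUnique (e j) (he.mem j)).unique h (by simp)

theorem IsTransversal.prod_eq {X : Type*} [CommMonoid X] [Fintype ι] [Fintype κ]
    (he : IsTransversal A B e) (he' : IsTransversal A B e') (f : G → X)
    (hf : ∀ a ∈ A, ∀ b ∈ B, f (a * b) = f a) : ∏ i, f (e i) = ∏ j, f (e' j) := by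
  choose φ hφ hφ' using fun i => he'.existsUnique (e i) (he.mem i)
  simp only at hφ hφ'
  refine Fintype.prod_bijective φ ⟨fun i j hij => ?_, fun j => ?_⟩ _ _ fun i => ?_
  · refine he.eq_of_mem ?_
    have h1 := hφ i
    have h2 := hφ j
    rw [hij] at h1
    simpa [mul_assoc] using B.mul_mem (B.inv_mem h1) h2
  · obtain ⟨i, hi, -⟩ := he.existsUnique (e' j) (he'.mem j)
    refine ⟨i, (hφ' i j ?_).symm⟩
    simpa using B.inv_mem hi
  · rw [← hf _ (he'.mem _) _ (hφ i)]
    simp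

theorem IsTransversal.sum_eq {X : Type*} [AddCommMonoid X] [Fintype ι] [Fintype κ]
    (he : IsTransversal A B e) (he' : IsTransversal A B e') (f : G → X)
    (hf : ∀ a ∈ A, ∀ b ∈ B, f (a * b) = f a) : ∑ i, f (e i) = ∑ j, f (e' j) :=
  he.prod_eq (X := Multiplicative X) he' f hf

theorem IsTransversal.relIndex_eq [Fintype ι] (he : IsTransversal A B e) :
    B.relIndex A = Fintype.card ι := by
  rw [Subgroup.relIndex, Subgroup.index, ← Nat.card_eq_fintype_card]
  symm
  refine Nat.card_eq_of_bijective
    (fun i => (QuotientGroup.mk ⟨e i, he.mem i⟩ : A ⧸ B.subgroupOf A)) ⟨fun i j hij => ?_, ?_⟩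
  · exact he.eq_of_mem (by simpa [QuotientGroup.eq, Subgroup.mem_subgroupOf] using hij)
  · intro q
    obtain ⟨a, rfl⟩ := QuotientGroup.mk_surjective q
    obtain ⟨i, hi, -⟩ := he.existsUnique a a.2
    exact ⟨i, by simpa [QuotientGroup.eq, Subgroup.mem_subgroupOf] using hi⟩

theorem IsTransversal.relIndex_ne_zero [Fintype ι] (he : IsTransversal A B e) :
    B.relIndex A ≠ 0 := by
  rw [he.relIndex_eq]
  obtain ⟨i, -⟩ := he.existsUnique 1 A.one_mem
  have : Nonempty ι := ⟨i⟩
  exact Fintype.card_ne_zero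

theorem exists_isTransversal (h : B.relIndex A ≠ 0) :
    ∃ e : Fin (B.relIndex A) → G, IsTransversal A B e := by
  have : Finite (A ⧸ B.subgroupOf A) := Nat.finite_of_card_ne_zero h
  let ε : (A ⧸ B.subgroupOf A) ≃ Fin (B.relIndex A) := Finite.equivFin _
  refine ⟨fun i => ((ε.symm i).out : A), fun i => Subtype.prop _, fun a ha => ?_⟩
  refine ⟨ε (QuotientGroup.mk ⟨a, ha⟩), ?_, fun j hj => ?_⟩
  · have h1 : (QuotientGroup.mk (ε.symm (ε (QuotientGroup.mk ⟨a, ha⟩))).out :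
        A ⧸ B.subgroupOf A) = QuotientGroup.mk ⟨a, ha⟩ := by simp
    rw [QuotientGroup.eq, Subgroup.mem_subgroupOf] at h1
    exact h1
  · have h1 : (QuotientGroup.mk (ε.symm j).out : A ⧸ B.subgroupOf A) = QuotientGroup.mk ⟨a, ha⟩ := by
      rw [QuotientGroup.eq, Subgroup.mem_subgroupOf]; simpa using hj
    rw [← h1]; simp

theorem IsTransversal.comp {e : ι → G} {e' : κ → G} (he : IsTransversal A B e)
    (he' : IsTransversal B C e') (hBA : B ≤ A) (hCB : C ≤ B) :
    IsTransversal A C fun x : ι × κ => e x.1 * e' x.2 := by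
  refine ⟨fun x => A.mul_mem (he.mem _) (hBA (he'.mem _)), fun a ha => ?_⟩
  obtain ⟨i, hi, hi'⟩ := he.existsUnique a ha
  obtain ⟨j, hj, hj'⟩ := he'.existsUnique _ hi
  refine ⟨(i, j), by simpa [mul_assoc] using hj, ?_⟩
  rintro ⟨i', j'⟩ h
  have h1 : (e' j')⁻¹ * ((e i')⁻¹ * a) ∈ C := by simpa [mul_assoc] using h
  obtain rfl : i' = i := by
    refine hi' i' ?_
    have := B.mul_mem (he'.mem j') (hCB h1)
    simpa using this
  rw [hj' j' h1]

theorem IsTransversal.mul_left (he : IsTransversal A B e) {a : G} (ha : a ∈ A) :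
    IsTransversal A B fun i => a * e i := by
  refine ⟨fun i => A.mul_mem ha (he.mem i), fun b hb => ?_⟩
  obtain ⟨i, hi, hi'⟩ := he.existsUnique (a⁻¹ * b) (A.mul_mem (A.inv_mem ha) hb)
  exact ⟨i, by simpa [mul_assoc] using hi, fun j hj => hi' j (by simpa [mul_assoc] using hj)⟩

theorem IsTransversal.conj (he : IsTransversal A B e) {n : G} (hA : ∀ a, n * a * n⁻¹ ∈ A ↔ a ∈ A)
    (hB : ∀ b, n * b * n⁻¹ ∈ B ↔ b ∈ B) : IsTransversal A B fun i => n * e i * n⁻¹ := by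
  refine ⟨fun i => (hA _).2 (he.mem i), fun b hb => ?_⟩
  obtain ⟨i, hi, hi'⟩ := he.existsUnique (n⁻¹ * b * n) ((hA _).1 (by simpa [mul_assoc] using hb))
  refine ⟨i, ?_, fun j hj => hi' j ?_⟩
  · have := (hB _).2 hi
    simpa [mul_assoc] using this
  · refine (hB _).1 ?_
    simpa [mul_assoc] using hj

/-- Second isomorphism theorem for cosets: as `A` meets every coset of `B₂` in `A₂`, the cosets
`A₂/B₂` and `A/(A ⊓ B₂)` correspond. -/
theorem IsTransversal.of_sup {A₂ B₂ : Subgroup G} (he : IsTransversal A (A ⊓ B₂) e) (hA : A ≤ A₂)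
    (h : ∀ a ∈ A₂, ∃ a' ∈ A, a'⁻¹ * a ∈ B₂) : IsTransversal A₂ B₂ e := by
  refine ⟨fun i => hA (he.mem i), fun a ha => ?_⟩
  obtain ⟨a', ha', hb⟩ := h a ha
  obtain ⟨i, hi, hi'⟩ := he.existsUnique a' ha'
  refine ⟨i, ?_, fun j hj => hi' j ⟨A.mul_mem (A.inv_mem (he.mem j)) ha', ?_⟩⟩
  · have := B₂.mul_mem hi.2 hb
    simpa [mul_assoc] using this
  · have := B₂.mul_mem hj (B₂.inv_mem hb)
    simpa [mul_assoc] using this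

theorem isTransversal_self : IsTransversal A A fun _ : Unit => 1 :=
  ⟨fun _ => A.one_mem, fun a ha => ⟨(), by simpa using ha, fun _ _ => rfl⟩⟩

end Transversal

section RelNorm

variable {F Ω : Type*} [Field F] [Field Ω] [Algebra F Ω]

open IntermediateField

theorem mem_fixedField {S : Subgroup Gal(Ω/F)} {x : Ω} :
    x ∈ fixedField S ↔ ∀ s ∈ S, s x = x := mem_fixedField_iff S x

theorem fixedField_le {A B : Subgroup Gal(Ω/F)} (h : B ≤ A) {x : Ω} (hx : x ∈ fixedField A) :
    x ∈ fixedField B :=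
  mem_fixedField.2 fun s hs => mem_fixedField.1 hx s (h hs)

theorem apply_mem_fixedField {A : Subgroup Gal(Ω/F)} {n : Gal(Ω/F)}
    (hn : ∀ a ∈ A, n⁻¹ * a * n ∈ A) {x : Ω} (hx : x ∈ fixedField A) : n x ∈ fixedField A := by
  refine mem_fixedField.2 fun s hs => ?_
  have := congrArg n (mem_fixedField.1 hx _ (hn s hs))
  simpa using this

open scoped Classical in
/-- The norm of an element fixed by `B`, down to the field fixed by `A`. -/
noncomputable def relNorm (A B : Subgroup Gal(Ω/F)) : Ω →*₀ Ω where
  -- With a fixed choice of representatives the product is multiplicative on all of `Ω`, although it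
  -- is independent of the choice only for `x` fixed by `B`. The identity is a default value for
  -- infinite index.
  toFun x := if h : B.relIndex A ≠ 0 then ∏ i, (exists_isTransversal h).choose i x else x
  map_zero' := by
    split_ifs with h
    · have : NeZero (B.relIndex A) := ⟨h⟩
      simp [h]
    · rfl
  map_one' := by simp
  map_mul' x y := by split_ifs <;> simp [Finset.prod_mul_distrib]

variable {A B C : Subgroup Gal(Ω/F)}

theorem relNorm_eq_prod {ι : Type*} [Fintype ι] {e : ι → Gal(Ω/F)} (he : IsTransversal A B e)
    {x : Ω} (hx : x ∈ fixedField B) : relNorm A B x = ∏ i, e i x := by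
  have h := he.relIndex_ne_zero
  change dite _ _ _ = _
  rw [dif_pos h]
  exact (exists_isTransversal h).choose_spec.prod_eq he (fun g => g x) fun a _ b hb => by
    rw [AlgEquiv.mul_apply, mem_fixedField.1 hx b hb]

theorem relNorm_mem (h : B.relIndex A ≠ 0) {x : Ω} (hx : x ∈ fixedField B) :
    relNorm A B x ∈ fixedField A := by
  obtain ⟨e, he⟩ := exists_isTransversal h
  refine mem_fixedField.2 fun a ha => ?_
  rw [relNorm_eq_prod he hx, map_prod, ← relNorm_eq_prod he hx,
    relNorm_eq_prod (he.mul_left ha) hx]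
  rfl

theorem relNorm_trans (hBA : B ≤ A) (hCB : C ≤ B) (h1 : B.relIndex A ≠ 0) (h2 : C.relIndex B ≠ 0)
    {x : Ω} (hx : x ∈ fixedField C) : relNorm A C x = relNorm A B (relNorm B C x) := by
  obtain ⟨e, he⟩ := exists_isTransversal h1
  obtain ⟨e', he'⟩ := exists_isTransversal h2
  rw [relNorm_eq_prod (he.comp he' hBA hCB) hx, relNorm_eq_prod he (relNorm_mem h2 hx),
    relNorm_eq_prod he' hx, Fintype.prod_prod_type]
  simp

theorem apply_relNorm (h : B.relIndex A ≠ 0) {n : Gal(Ω/F)} (hA : ∀ a, n * a * n⁻¹ ∈ A ↔ a ∈ A)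
    (hB : ∀ b, n * b * n⁻¹ ∈ B ↔ b ∈ B) {x : Ω} (hx : x ∈ fixedField B) :
    n (relNorm A B x) = relNorm A B (n x) := by
  obtain ⟨e, he⟩ := exists_isTransversal h
  have hx' : n x ∈ fixedField B := apply_mem_fixedField
    (fun a ha => (hB _).1 (by simpa [mul_assoc] using ha)) hx
  rw [relNorm_eq_prod (he.conj hA hB) hx', relNorm_eq_prod he hx, map_prod]
  simp

theorem relNorm_self {x : Ω} (hx : x ∈ fixedField A) : relNorm A A x = x := by
  rw [relNorm_eq_prod isTransversal_self hx]; simp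

/-- Invariance of the norm under a linearly disjoint base change: both sides are products over the
same representatives. It will be used with the base change to the maximal unramified extension. -/
theorem relNorm_inf {A₂ B₂ : Subgroup Gal(Ω/F)} (h0 : (A ⊓ B₂).relIndex A ≠ 0) (hA : A ≤ A₂)
    (h : ∀ a ∈ A₂, ∃ a' ∈ A, a'⁻¹ * a ∈ B₂) {x : Ω} (hx : x ∈ fixedField B₂) :
    relNorm A₂ B₂ x = relNorm A (A ⊓ B₂) x := by
  obtain ⟨e, he⟩ := exists_isTransversal h0
  rw [relNorm_eq_prod he (fixedField_le inf_le_right hx), relNorm_eq_prod (he.of_sup hA h) hx]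

theorem ValuedClosure.v_relNorm {p : ℕ} (D : ValuedClosure p F Ω) (h : B.relIndex A ≠ 0) (x : Ω) :
    D.v (relNorm A B x) = D.v x ^ B.relIndex A := by
  change D.v (dite _ _ _) = _
  rw [dif_pos h, map_prod]
  simp [D.v_gal]

end RelNorm

end PClassFieldTheory

/-! ### Values and residues of elements fixed by an open subgroup -/

namespace PClassFieldTheory

open IntermediateField Polynomial

theorem relIndex_ne_zero_of_isOpen {F Ω : Type*} [Field F] [Field Ω] [Algebra F Ω] [IsGalois F Ω]
    {N : Subgroup Gal(Ω/F)} (hN : IsOpen (N : Set Gal(Ω/F))) (S : Subgroup Gal(Ω/F)) :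
    N.relIndex S ≠ 0 := by
  have := N.quotient_finite_of_isOpen hN
  have : N.FiniteIndex := Subgroup.finiteIndex_of_finite_quotient
  exact (inferInstance : (N.subgroupOf S).FiniteIndex).index_ne_zero

/-- The minimal polynomial of `y` is squarefree over `K` and divides a power of `X - y`, so it is
linear. -/
theorem mem_range_of_map_eq_pow {k K : Type*} [Field k] [Field K] [Algebra k K] {f : k[X]} {y : K}
    {n : ℕ} (hn : n ≠ 0) (hf : f.map (algebraMap k K) = (X - C y) ^ n) (hint : IsIntegral k y)
    (hs : IsSeparable k y) : y ∈ (algebraMap k K).range := by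
  have hs' : (minpoly k y).Separable := hs
  have hdvd : (minpoly k y).map (algebraMap k K) ∣ X - C y := by
    rw [← (hs'.map).squarefree.dvd_pow_iff_dvd hn, ← hf]
    refine Polynomial.map_dvd _ (minpoly.dvd _ _ ?_)
    rw [aeval_def, eval₂_eq_eval_map, hf]
    simp [hn]
  have hdeg : (minpoly k y).natDegree ≤ 1 := by
    have := natDegree_le_of_dvd hdvd (X_sub_C_ne_zero y)
    rwa [natDegree_map, natDegree_X_sub_C] at this
  exact minpoly.natDegree_eq_one_iff.1 (le_antisymm hdeg (minpoly.natDegree_pos hint))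

namespace ValuedClosure

variable {p : ℕ} {F Ω : Type*} [Field F] [Field Ω] [Algebra F Ω] (D : ValuedClosure p F Ω)

theorem isOpen_inf_stabilizer [Algebra.IsAlgebraic F Ω] {S : Subgroup Gal(Ω/F)}
    (hS : IsOpen (S : Set Gal(Ω/F))) (x : Ω) :
    IsOpen ((S ⊓ MulAction.stabilizer Gal(Ω/F) x : Subgroup Gal(Ω/F)) : Set Gal(Ω/F)) :=
  hS.inter (stabilizer_isOpen_of_isIntegral (K := F) x)

/-- An element fixed by the inertia subgroup of `S` has the same absolute value as some element
fixed by `S`. -/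
theorem exists_fixed_v_eq [IsGalois F Ω] {S : Subgroup Gal(Ω/F)} (hS : IsOpen (S : Set Gal(Ω/F)))
    {x : Ω} (hx : x ∈ fixedField (S ⊓ D.inertia)) (hx0 : x ≠ 0) :
    ∃ z ∈ fixedField S, D.v z = D.v x := by
  set N := S ⊓ MulAction.stabilizer Gal(Ω/F) x with hN
  have hNo : IsOpen (N : Set Gal(Ω/F)) := isOpen_inf_stabilizer hS x
  obtain ⟨e, he⟩ := exists_isTransversal (relIndex_ne_zero_of_isOpen hNo S)
  -- The element sought is a trace of `x d` with `d` an integer fixed by `N`. Dedekind independence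
  -- of the residues of the conjugates, as characters of these integers, will prevent cancellation
  -- for a suitable `d`.
  let R : Subring D.integers := (fixedField N).toSubring.comap D.integers.subtype
  let χ : Fin (N.relIndex S) → (R →* D.resField) := fun i =>
    ((D.res.comp (MulSemiringAction.toRingHom Gal(Ω/F) D.integers (e i))).comp R.subtype :
      R →+* D.resField)
  have hχ : Function.Injective χ := by
    intro i j hij
    refine he.eq_of_mem ?_
    obtain ⟨n, hn, t, ht, hnt⟩ := D.mem_mul_inertia_of_fix_residues
      (Subgroup.isClosed_of_isOpen N hNo) ((e i)⁻¹ * e j) (by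
        intro y hy hyN
        have h1 : D.res (e i • (⟨y, hy⟩ : D.integers)) = D.res (e j • (⟨y, hy⟩ : D.integers)) :=
          DFunLike.congr_fun hij ⟨⟨y, hy⟩, mem_fixedField.2 hyN⟩
        rw [res_eq_iff] at h1
        rw [← D.v_gal (e i), map_sub, D.v_sub_comm]
        simpa using h1)
    rw [hnt]
    refine N.mul_mem hn ?_
    -- The inertia factor `t` belongs to `S ⊓ D.inertia`, and so fixes `x` by hypothesis. This is
    -- the point where the characters are seen to be distinct.
    have htS : t ∈ S := by
      have h2 : n⁻¹ * ((e i)⁻¹ * e j) ∈ S :=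
        S.mul_mem (S.inv_mem hn.1) (S.mul_mem (S.inv_mem (he.mem i)) (he.mem j))
      rw [hnt] at h2
      simpa using h2
    exact ⟨htS, mem_fixedField.1 hx t ⟨htS, ht⟩⟩
  have hli := (linearIndependent_monoidHom R D.resField).comp χ hχ
  rw [Fintype.linearIndependent_iff] at hli
  have hu : ∀ i, D.v (e i x / x) = 1 := fun i => by
    rw [map_div₀, D.v_gal, div_self (D.v_pos hx0).ne']
  let c : Fin (N.relIndex S) → D.integers := fun i => ⟨e i x / x, (hu i).le⟩
  have hne : ∃ d : R, ∑ i, D.res (c i) * D.res (e i • (d : D.integers)) ≠ 0 := by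
    by_contra! hall
    obtain ⟨i, -⟩ := he.existsUnique 1 S.one_mem
    have h1 := hli (fun i => D.res (c i)) (by
      funext d
      simpa using! hall d) i
    rw [res_eq_zero_iff] at h1
    exact absurd (hu i) h1.ne
  obtain ⟨d, hd⟩ := hne
  have hdN : (d : D.integers).1 ∈ fixedField N := d.2
  have hxN : x ∈ fixedField N := mem_fixedField.2 fun s hs => hs.2
  -- After dividing by `x` the trace becomes an integer with non-zero residue, hence a unit.
  refine ⟨∑ i, e i (x * (d : D.integers).1), mem_fixedField.2 fun s hs => ?_, ?_⟩
  · rw [map_sum]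
    exact (he.mul_left hs).sum_eq he (fun g => g (x * (d : D.integers).1)) fun a _ b hb => by
      rw [AlgEquiv.mul_apply, mem_fixedField.1 (mul_mem hxN hdN) b hb]
  · have h1 : ∑ i, e i (x * (d : D.integers).1) =
        x * ((∑ i, c i * e i • (d : D.integers) : D.integers) : Ω) := by
      simp only [map_mul, AddSubmonoidClass.coe_finsetSum, Subring.coe_mul, Finset.mul_sum]
      refine Finset.sum_congr rfl fun i _ => ?_
      simp only [c, coe_smul_integers]
      field_simp
    rw [h1, map_mul]
    have h2 : D.res (∑ i, c i * e i • (d : D.integers)) ≠ 0 := by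
      rw [map_sum]; simpa only [map_mul] using hd
    rw [Ne, res_eq_zero_iff, not_lt] at h2
    rw [le_antisymm (Subtype.prop (∑ i, c i * e i • (d : D.integers) : D.integers)) h2, mul_one]

theorem v_le_one_of_isRoot {f : D.integers[X]} (hf : f.Monic) {x : Ω}
    (hx : (f.map D.integers.subtype).eval x = 0) : D.v x ≤ 1 := by
  by_contra! h
  have hx0 : x ≠ 0 := by rintro rfl; simp at h; linarith
  rw [eval_map, eval₂_eq_sum_range, Finset.sum_range_succ] at hx
  have hlt : D.v (∑ i ∈ Finset.range f.natDegree, D.integers.subtype (f.coeff i) * x ^ i) <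
      D.v (x ^ f.natDegree) := by
    refine D.v_sum_lt _ _ (D.v_pos (pow_ne_zero _ hx0)) fun i hi => ?_
    rw [map_mul, map_pow, map_pow]
    have h1 : D.v (D.integers.subtype (f.coeff i)) ≤ 1 := (f.coeff i).2
    have h2 := pow_lt_pow_right₀ h (Finset.mem_range.1 hi)
    have h3 : 0 ≤ D.v x ^ i := pow_nonneg (D.v.nonneg x) i
    nlinarith
  have h4 : D.v (D.integers.subtype (f.coeff f.natDegree) * x ^ f.natDegree +
      ∑ i ∈ Finset.range f.natDegree, D.integers.subtype (f.coeff i) * x ^ i) =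
      D.v (x ^ f.natDegree) := by
    rw [hf.coeff_natDegree, map_one, one_mul]
    exact D.v_add_eq_of_lt hlt
  rw [add_comm, hx, map_zero] at h4
  exact (D.v_pos (pow_ne_zero f.natDegree hx0)).ne h4

theorem infinite_small : {t : Ω | D.v t < 1 ∧ t ≠ 0}.Infinite := by
  have h0 : algebraMap F Ω D.unif ≠ 0 := by simpa using D.unif_ne_zero
  have h1 := D.v_unif_lt
  have h2 := D.v_pos h0
  refine Set.infinite_of_injective_forall_mem (f := fun n : ℕ => algebraMap F Ω D.unif ^ (n + 1))
    (fun m n hmn => ?_) fun n => ⟨?_, pow_ne_zero _ h0⟩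
  · have h3 := congrArg D.v hmn
    simp only [map_pow] at h3
    have := pow_right_injective₀ h2 h1.ne h3
    omega
  · rw [map_pow]
    exact pow_lt_one₀ h2.le h1 (by omega)

/-- `Ω` is only separably closed, so a lift of a residual polynomial has to be made separable
without changing its reduction. If the derivative vanishes, adding `t X` with `t` small turns it
into the non-zero constant `t`. Otherwise a small constant `t` is added that avoids the finitely
many values creating a multiple root. -/
theorem exists_separable_lift {f : D.integers[X]} (hf : f.Monic) (hd : 1 < f.natDegree) :
    ∃ g : D.integers[X], g.Monic ∧ g.natDegree = f.natDegree ∧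
      g.map D.res = f.map D.res ∧ (g.map D.integers.subtype).Separable := by
  have hinj : Function.Injective D.integers.subtype := Subtype.val_injective
  by_cases h' : derivative (f.map D.integers.subtype) = 0
  · obtain ⟨t, ht, ht0⟩ := D.infinite_small.nonempty
    have hdeg : (C (⟨t, ht.le⟩ : D.integers) * X).degree < f.degree := by
      refine (degree_C_mul_X_le _).trans_lt ?_
      rw [degree_eq_natDegree hf.ne_zero]; exact_mod_cast hd
    refine ⟨f + C ⟨t, ht.le⟩ * X, hf.add_of_left hdeg, natDegree_add_eq_left_of_degree_lt hdeg, ?_, ?_⟩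
    · rw [Polynomial.map_add, Polynomial.map_mul, Polynomial.map_C]
      rw [(D.res_eq_zero_iff (x := ⟨t, ht.le⟩)).2 ht]; simp
    · rw [separable_def, Polynomial.map_add, derivative_add, h', zero_add]
      simp only [Polynomial.map_mul, Polynomial.map_C, map_X, derivative_mul, derivative_C, zero_mul,
        derivative_X, mul_one, zero_add]
      exact ⟨0, C t⁻¹, by simp [← C_mul, ht0]⟩
  · set h := f.map D.integers.subtype with hh
    let E := AlgebraicClosure Ω
    have hfin : {t : Ω | ∃ x ∈ (derivative h).aroots E, algebraMap Ω E t = - aeval x h}.Finite := by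
      have : ((fun x => - aeval x h) '' {x | x ∈ (derivative h).aroots E}).Finite :=
        Set.Finite.image _ (Multiset.finite_toSet _)
      refine (this.preimage (f := algebraMap Ω E) ((algebraMap Ω E).injective.injOn)).subset ?_
      rintro t ⟨x, hx, hxt⟩
      exact ⟨x, hx, hxt.symm⟩
    obtain ⟨t, ⟨ht, ht0⟩, htb⟩ := (D.infinite_small.sdiff hfin).nonempty
    have hdeg : (C (⟨t, ht.le⟩ : D.integers)).degree < f.degree := by
      refine degree_C_le.trans_lt ?_
      rw [degree_eq_natDegree hf.ne_zero]; exact_mod_cast (by omega)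
    refine ⟨f + C ⟨t, ht.le⟩, hf.add_of_left hdeg, natDegree_add_eq_left_of_degree_lt hdeg, ?_, ?_⟩
    · rw [Polynomial.map_add, Polynomial.map_C, (D.res_eq_zero_iff (x := ⟨t, ht.le⟩)).2 ht]; simp
    · rw [separable_def, Polynomial.map_add, Polynomial.map_C, ← hh]
      simp only [derivative_add, derivative_C, add_zero]
      by_contra hc
      rw [← Polynomial.isCoprime_map (algebraMap Ω E)] at hc
      obtain ⟨x, hx1, hx2⟩ : ∃ x, ((h + C t).map (algebraMap Ω E)).IsRoot x ∧
          ((derivative h).map (algebraMap Ω E)).IsRoot x := by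
        by_contra! hno
        refine hc (isCoprime_of_irreducible_dvd ?_ ?_)
        · rintro ⟨-, h2⟩
          rw [Polynomial.map_eq_zero] at h2
          exact h' h2
        · intro z hz hz1 hz2
          obtain ⟨x, hx⟩ := IsAlgClosed.exists_root z (degree_pos_of_irreducible hz).ne'
          exact hno x (hx.dvd hz1) (hx.dvd hz2)
      refine htb ⟨x, ?_, ?_⟩
      · rw [mem_aroots]; exact ⟨h', by rw [aeval_def, eval₂_eq_eval_map]; exact hx2⟩
      · have : aeval x h + algebraMap Ω E t = 0 := by
          have h3 : aeval x (h + C t) = 0 := by rw [aeval_def, eval₂_eq_eval_map]; exact hx1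
          simpa using h3
        linear_combination this

/-- An irreducible residual polynomial lifts to a separable monic polynomial over the integers. The
latter has a root in `Ω`, the root is integral, and its residue is the root wanted. -/
instance [IsSepClosed Ω] : IsAlgClosed D.resField := by
  refine IsAlgClosed.of_exists_root _ fun q hq hirr => ?_
  obtain ⟨f, rfl, hfd, hf⟩ := lifts_and_natDegree_eq_and_monic
    (lifts_iff_coeff_lifts _ |>.2 fun n => D.res_surjective _ : q ∈ lifts D.res) hq
  rcases eq_or_ne (f.map D.res).natDegree 1 with h1 | h1
  · refine ⟨-(f.map D.res).coeff 0, ?_⟩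
    rw [hq.eq_X_add_C h1]; simp
  have h2 : 1 < f.natDegree := by
    have := hirr.natDegree_pos
    omega
  obtain ⟨g, hg, hgd, hgf, hgs⟩ := D.exists_separable_lift hf h2
  obtain ⟨x, hx⟩ := IsSepClosed.exists_root _ (by
    rw [hg.degree_map, degree_eq_natDegree hg.ne_zero, hgd]
    exact_mod_cast (by omega)) hgs
  have hx1 : D.v x ≤ 1 := D.v_le_one_of_isRoot hg hx
  refine ⟨D.res ⟨x, hx1⟩, ?_⟩
  rw [← hgf, eval_map, eval₂_at_apply]
  have : g.eval (⟨x, hx1⟩ : D.integers) = 0 := by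
    apply Subtype.val_injective
    have h3 : eval (D.integers.subtype ⟨x, hx1⟩) (g.map D.integers.subtype) = 0 := hx
    rw [eval_map, eval₂_at_apply] at h3
    exact h3
  rw [this, map_zero]

/-- The residue field of the field fixed by `S`. -/
noncomputable def resSubfield (S : Subgroup Gal(Ω/F)) : Subfield D.resField where
  toSubring := ((fixedField S).toSubring.comap D.integers.subtype).map D.res
  inv_mem' := by
    rintro _ ⟨x, hx, rfl⟩
    by_cases h : D.res x = 0
    · rw [h, inv_zero, ← h]; exact ⟨x, hx, rfl⟩
    have h1 : D.v x = 1 := le_antisymm x.2 (by rwa [res_eq_zero_iff, not_lt] at h)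
    have h0 : (x : Ω) ≠ 0 := by intro h0; simp [h0] at h1
    refine ⟨⟨(x : Ω)⁻¹, by simp [mem_integers, h1]⟩, 
      show (x : Ω)⁻¹ ∈ fixedField S from inv_mem (show (x : Ω) ∈ fixedField S from hx), ?_⟩
    refine eq_inv_of_mul_eq_one_left ?_
    rw [← map_mul, ← map_one D.res]
    congr 1
    ext; simp [h0]

/-- The product of `X - e i x` over the conjugates of `x` has coefficients fixed by `S`, so its
reduction is defined over the residue field of the field fixed by `S`. Since some `e i` fixes `x`,
the residue of `x` is a root. -/
theorem exists_conj_poly [IsGalois F Ω] {S : Subgroup Gal(Ω/F)} (hS : IsOpen (S : Set Gal(Ω/F)))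
    (x : D.integers) : ∃ (n : ℕ) (e : Fin n → Gal(Ω/F)) (f : (D.resSubfield S)[X]),
      n ≠ 0 ∧ (∀ i, e i ∈ S) ∧ f.Monic ∧ (∃ i, e i ∈ MulAction.stabilizer Gal(Ω/F) (x : Ω)) ∧
      f.map (algebraMap (D.resSubfield S) D.resField) = ∏ i, (X - C (D.res (e i • x))) := by
  set N := S ⊓ MulAction.stabilizer Gal(Ω/F) (x : Ω) with hN
  have hNo : IsOpen (N : Set Gal(Ω/F)) := isOpen_inf_stabilizer hS x
  have hidx := relIndex_ne_zero_of_isOpen hNo S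
  obtain ⟨e, he⟩ := exists_isTransversal hidx
  let P : D.integers[X] := ∏ i, (X - C (e i • x))
  have hP : ∀ s ∈ S, P.map (MulSemiringAction.toRingHom Gal(Ω/F) D.integers s) = P := by
    intro s hs
    rw [Polynomial.map_prod]
    simp only [Polynomial.map_sub, map_X, Polynomial.map_C]
    refine Eq.trans ?_ ((he.mul_left hs).prod_eq he (fun g => X - C (g • x)) ?_)
    · refine Finset.prod_congr rfl fun i _ => ?_
      rw [mul_smul]; rfl
    · intro a _ b hb
      have : b • x = x := Subtype.ext hb.2
      rw [mul_smul, this]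
  have hres : P.map D.res = ∏ i, (X - C (D.res (e i • x))) := by
    rw [Polynomial.map_prod]; simp
  have hmon : (P.map D.res).Monic := by
    rw [hres]; exact monic_prod_of_monic _ _ fun i _ => monic_X_sub_C _
  have hl : P.map D.res ∈ lifts (algebraMap (D.resSubfield S) D.resField) := by
    refine (lifts_iff_coeff_lifts _).2 fun n => ⟨⟨D.res (P.coeff n), P.coeff n, ?_, rfl⟩, ?_⟩
    · refine mem_fixedField.2 fun s hs => ?_
      have h1 := congrArg (fun q => q.coeff n) (hP s hs)
      simp only [coeff_map] at h1
      exact congrArg Subtype.val h1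
    · simp [coeff_map]; rfl
  obtain ⟨f, hf1, -, hf2⟩ := lifts_and_natDegree_eq_and_monic hl hmon
  refine ⟨_, e, f, hidx, he.mem, hf2, ?_, hf1.trans hres⟩
  obtain ⟨i, hi, -⟩ := he.existsUnique 1 S.one_mem
  exact ⟨i, by simpa using N.inv_mem hi |>.2⟩

theorem isIntegral_resSubfield [IsGalois F Ω] {S : Subgroup Gal(Ω/F)}
    (hS : IsOpen (S : Set Gal(Ω/F))) (y : D.resField) : IsIntegral (D.resSubfield S) y := by
  obtain ⟨x, rfl⟩ := D.res_surjective y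
  obtain ⟨n, e, f, hn, he, hf, ⟨i, hi⟩, hfe⟩ := D.exists_conj_poly hS x
  refine ⟨f, hf, ?_⟩
  rw [eval₂_eq_eval_map, hfe, eval_prod]
  refine Finset.prod_eq_zero (Finset.mem_univ i) ?_
  have : e i • x = x := Subtype.ext hi
  simp [this]

instance [Fact p.Prime] : CharP D.resField p := by
  refine (CharP.charP_iff_prime_eq_zero Fact.out).2 ?_
  have := (D.res_eq_zero_iff (x := (p : D.integers))).2 (by simpa using D.v_p_lt)
  simpa using this

theorem mem_fixedField_top_iff [IsGalois F Ω] {x : Ω} :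
    x ∈ fixedField (⊤ : Subgroup Gal(Ω/F)) ↔ ∃ a, algebraMap F Ω a = x := by
  rw [mem_fixedField, ← Set.mem_range, InfiniteGalois.mem_range_algebraMap_iff_fixed]
  simp

theorem perfectField_resSubfield_top [IsGalois F Ω] [hp : Fact p.Prime] :
    PerfectField (D.resSubfield ⊤) := by
  have : CharP (D.resSubfield ⊤) p := (algebraMap (D.resSubfield ⊤) D.resField).charP
    (algebraMap (D.resSubfield ⊤) D.resField).injective p
  have : ExpChar (D.resSubfield ⊤) p := ExpChar.prime hp.out
  have : PerfectRing (D.resSubfield ⊤) p := by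
    refine PerfectRing.ofSurjective _ p ?_
    rintro ⟨_, x, hx, rfl⟩
    obtain ⟨a, ha⟩ := mem_fixedField_top_iff.1 hx
    obtain ⟨b, hb⟩ := D.perfect a (by rw [ha]; exact x.2)
    have hb1 : D.v (algebraMap F Ω b) ≤ 1 := by
      by_contra! h1
      have h2 : D.v (algebraMap F Ω (b ^ p)) ≤ 1 := by
        have := D.v_add_le' (r := 1) hb.le (show D.v (algebraMap F Ω a) ≤ 1 by rw [ha]; exact x.2)
        rwa [← map_add, sub_add_cancel] at this
      rw [map_pow, map_pow] at h2
      exact absurd (one_lt_pow₀ h1 hp.out.ne_zero) (not_lt.2 h2)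
    refine ⟨⟨D.res ⟨_, hb1⟩, ⟨_, hb1⟩,
      (fixedField (⊤ : Subgroup Gal(Ω/F))).algebraMap_mem b, rfl⟩, Subtype.ext ?_⟩
    change D.res ⟨_, hb1⟩ ^ p = D.res x
    rw [← map_pow, res_eq_iff]
    simpa [ha] using hb
  exact PerfectRing.toPerfectField _ p

theorem isSeparable_resSubfield [IsGalois F Ω] [Fact p.Prime] {S : Subgroup Gal(Ω/F)}
    (y : D.resField) : IsSeparable (D.resSubfield S) y := by
  have := D.perfectField_resSubfield_top
  have hle : D.resSubfield ⊤ ≤ D.resSubfield S := by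
    rintro _ ⟨x, hx, rfl⟩
    exact ⟨x, fixedField_le le_top hx, rfl⟩
  let : Algebra (D.resSubfield ⊤) (D.resSubfield S) := (Subfield.inclusion hle).toAlgebra
  have : IsScalarTower (D.resSubfield ⊤) (D.resSubfield S) D.resField :=
    IsScalarTower.of_algebraMap_eq fun _ => rfl
  have h1 : IsSeparable (D.resSubfield ⊤) y :=
    PerfectField.separable_of_irreducible
      (minpoly.irreducible (D.isIntegral_resSubfield isOpen_univ y))
  exact IsSeparable.tower_top _ h1

/-- An integer whose residue is fixed by `S` is congruent to an element fixed by `S`. -/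
theorem exists_fixed_sub_lt [IsGalois F Ω] [Fact p.Prime] {S : Subgroup Gal(Ω/F)}
    (hS : IsOpen (S : Set Gal(Ω/F))) {x : Ω} (hx : D.v x ≤ 1)
    (h : ∀ s ∈ S, D.v (s x - x) < 1) : ∃ a ∈ fixedField S, D.v (x - a) < 1 := by
  obtain ⟨n, e, f, hn, he, -, -, hfe⟩ := D.exists_conj_poly hS ⟨x, hx⟩
  set y : D.resField := D.res ⟨x, hx⟩ with hy
  have h1 : ∀ i, D.res (e i • ⟨x, hx⟩) = y := fun i => D.res_eq_iff.2 (h _ (he i))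
  -- All conjugates have the same residue `y`, so the polynomial is a power of `X - y`, and
  -- separability of `y` makes it rational.
  have hfe' : f.map (algebraMap (D.resSubfield S) D.resField) = (X - C y) ^ n := by
    rw [hfe, Finset.prod_congr rfl fun i _ => by rw [h1 i]]
    simp
  have hmem : y ∈ (algebraMap (D.resSubfield S) D.resField).range :=
    mem_range_of_map_eq_pow hn hfe' (D.isIntegral_resSubfield hS y) (D.isSeparable_resSubfield y)
  obtain ⟨⟨_, a, ha, rfl⟩, hay⟩ := hmem
  refine ⟨a, ha, ?_⟩
  rw [D.v_sub_comm]
  exact D.res_eq_iff.1 hay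

/-- Every integer is congruent to an element fixed by the inertia group. -/
theorem exists_inertia_fixed_sub_lt [IsGalois F Ω] [Fact p.Prime] {x : Ω} (hx : D.v x ≤ 1) :
    ∃ a ∈ fixedField D.inertia, D.v (x - a) < 1 := by
  -- The stabilizer of the residue of `x`: it is open and contains the inertia group.
  let S : Subgroup Gal(Ω/F) :=
    { carrier := {g | D.v (g x - x) < 1}
      mul_mem' := fun {a b} ha hb => by
        have h1 : D.v (a (b x - x)) < 1 := by rwa [D.v_gal]
        have := D.v_add_lt h1 ha
        simpa using this
      one_mem' := by simp
      inv_mem' := fun {a} ha => by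
        have h1 : D.v (a⁻¹ (a x - x)) < 1 := by rwa [D.v_gal]
        rw [map_sub, D.v_sub_comm] at h1
        simpa using h1 }
  have hS : IsOpen (S : Set Gal(Ω/F)) := by
    refine Subgroup.isOpen_mono (H₁ := MulAction.stabilizer Gal(Ω/F) x) ?_
      (stabilizer_isOpen_of_isIntegral (K := F) x)
    intro g hg
    change D.v (g • x - x) < 1
    rw [hg]; simp
  obtain ⟨a, ha, hxa⟩ := D.exists_fixed_sub_lt hS hx fun s hs => hs
  exact ⟨a, fixedField_le (fun g hg => D.mem_inertia.1 hg x hx) ha, hxa⟩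

end ValuedClosure

end PClassFieldTheory

/-! ### Elementary symmetric functions of the conjugates under a cyclic action of order p -/

namespace PClassFieldTheory

open IntermediateField

section CyclicSymm

variable (p : ℕ) [hp : Fact p.Prime] {F Ω : Type*} [Field F] [Field Ω] [Algebra F Ω]
  (σ : Gal(Ω/F))

/-- The `a`-th power of `σ`, for a residue class `a` modulo `p`. -/
def zpowZMod (a : ZMod p) : Gal(Ω/F) := σ ^ a.val

/-- The sum of the conjugates of `y` under the powers of `σ`. -/
noncomputable def cycTrace (y : Ω) : Ω := ∑ a : ZMod p, zpowZMod p σ a y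

/-- The product of the conjugates of `y` under the powers of `σ`. -/
noncomputable def cycNorm (y : Ω) : Ω := ∏ a : ZMod p, zpowZMod p σ a y

/-- The `k`-th elementary symmetric function of the conjugates of `y` under the powers of `σ`. -/
noncomputable def cycSymm (k : ℕ) (y : Ω) : Ω :=
  ∑ A ∈ Finset.powersetCard k (Finset.univ : Finset (ZMod p)), ∏ a ∈ A, zpowZMod p σ a y

variable {p σ}

theorem pow_apply_eq_self {x : Ω} (h : σ x = x) (n : ℕ) : (σ ^ n) x = x := by
  induction n with
  | zero => rfl
  | succ n ih => rw [pow_succ, AlgEquiv.mul_apply, h, ih]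

omit hp in
theorem zpowZMod_apply_eq_self {x : Ω} (h : σ x = x) (a : ZMod p) : zpowZMod p σ a x = x :=
  pow_apply_eq_self h _

theorem zpowZMod_add {y : Ω} (hy : (σ ^ p) y = y) (a b : ZMod p) :
    zpowZMod p σ a (zpowZMod p σ b y) = zpowZMod p σ (a + b) y := by
  have h1 : ∀ n, (σ ^ n) y = (σ ^ (n % p)) y := fun n => by
    conv_lhs => rw [← Nat.mod_add_div n p, pow_add, pow_mul, AlgEquiv.mul_apply,
      pow_apply_eq_self hy]
  rw [zpowZMod, zpowZMod, zpowZMod, ← AlgEquiv.mul_apply, ← pow_add, h1, ← ZMod.val_add]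

theorem apply_eq_zpowZMod_one (y : Ω) : σ y = zpowZMod p σ 1 y := by
  have : Fact (1 < p) := ⟨hp.out.one_lt⟩
  rw [zpowZMod, ZMod.val_one, pow_one]

theorem apply_cycTrace {y : Ω} (hy : (σ ^ p) y = y) : σ (cycTrace p σ y) = cycTrace p σ y := by
  rw [cycTrace, map_sum]
  simp_rw [apply_eq_zpowZMod_one (p := p) (σ := σ) (zpowZMod p σ _ y), zpowZMod_add hy]
  exact Fintype.sum_equiv (Equiv.addLeft 1) _ _ fun a => rfl

theorem cycNorm_mul (x y : Ω) : cycNorm p σ (x * y) = cycNorm p σ x * cycNorm p σ y := by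
  simp [cycNorm, Finset.prod_mul_distrib]

theorem cycNorm_div (x y : Ω) : cycNorm p σ (x / y) = cycNorm p σ x / cycNorm p σ y := by
  simp [cycNorm, Finset.prod_div_distrib]

theorem cycNorm_of_apply_eq {x : Ω} (h : σ x = x) : cycNorm p σ x = x ^ p := by
  simp [cycNorm, zpowZMod_apply_eq_self h, ZMod.card]

theorem apply_cycNorm {y : Ω} (hy : (σ ^ p) y = y) : σ (cycNorm p σ y) = cycNorm p σ y := by
  rw [cycNorm, map_prod]
  simp_rw [apply_eq_zpowZMod_one (p := p) (σ := σ) (zpowZMod p σ _ y), zpowZMod_add hy]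
  exact Fintype.prod_equiv (Equiv.addLeft 1) _ _ fun a => rfl

theorem cycNorm_apply_div {y : Ω} (hy : (σ ^ p) y = y) (hy0 : y ≠ 0) :
    cycNorm p σ (σ y / y) = 1 := by
  rw [cycNorm_div]
  have : cycNorm p σ (σ y) = cycNorm p σ y := by
    rw [apply_eq_zpowZMod_one (p := p) (σ := σ) y, cycNorm]
    simp_rw [zpowZMod_add hy]
    exact Fintype.prod_equiv (Equiv.addRight 1) _ _ fun a => rfl
  rw [this]
  refine div_self (Finset.prod_ne_zero_iff.2 fun a _ => ?_)
  simpa using hy0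

theorem cycSymm_zero (y : Ω) : cycSymm p σ 0 y = 1 := by simp [cycSymm]

theorem cycSymm_one (y : Ω) : cycSymm p σ 1 y = cycTrace p σ y := by
  simp [cycSymm, cycTrace, Finset.powersetCard_one]

theorem cycSymm_card (y : Ω) : cycSymm p σ p y = cycNorm p σ y := by
  have : Finset.powersetCard p (Finset.univ : Finset (ZMod p)) = {Finset.univ} := by
    have h := Finset.powersetCard_self (Finset.univ : Finset (ZMod p))
    rwa [Finset.card_univ, ZMod.card] at h
  simp [cycSymm, cycNorm, this]

theorem cycSymm_mul {c : Ω} (hc : σ c = c) (k : ℕ) (y : Ω) :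
    cycSymm p σ k (c * y) = c ^ k * cycSymm p σ k y := by
  rw [cycSymm, cycSymm, Finset.mul_sum]
  refine Finset.sum_congr rfl fun A hA => ?_
  simp only [map_mul, Finset.prod_mul_distrib, zpowZMod_apply_eq_self hc, Finset.prod_const,
    (Finset.mem_powersetCard.1 hA).2]

theorem cycTrace_mul {c : Ω} (hc : σ c = c) (y : Ω) :
    cycTrace p σ (c * y) = c * cycTrace p σ y := by
  rw [← cycSymm_one, cycSymm_mul hc, pow_one, cycSymm_one]

theorem cycNorm_one_add {θ : Ω} (hθ : σ θ = θ) (y : Ω) :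
    cycNorm p σ (1 + θ * y) = ∑ k ∈ Finset.range (p + 1), cycSymm p σ k y * θ ^ k := by
  have h1 : cycNorm p σ (1 + θ * y) = ∏ a : ZMod p, (1 + zpowZMod p σ a (θ * y)) := by
    simp [cycNorm]
  rw [h1, Finset.prod_one_add, Finset.sum_powerset, Finset.card_univ, ZMod.card]
  refine Finset.sum_congr rfl fun k _ => ?_
  exact (cycSymm_mul hθ k y).trans (mul_comm _ _)

omit hp in
theorem cycSymm_mem {L : IntermediateField F Ω} (hL : ∀ x ∈ L, σ x ∈ L) {y : Ω} (hy : y ∈ L)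
    (A : Finset (ZMod p)) : ∏ a ∈ A, zpowZMod p σ a y ∈ L := by
  refine prod_mem fun a _ => ?_
  rw [zpowZMod]
  induction a.val with
  | zero => exact hy
  | succ n ih => rw [pow_succ', AlgEquiv.mul_apply]; exact hL _ ih

/-- Translation by `j` changes the sum of the elements of a `k`-subset of `ZMod p` by `k j`, and `k`
is invertible. So translations act freely on the `k`-subsets, those of sum zero represent the
orbits, and summing the conjugates over an orbit is a trace. All symmetric functions except the norm
are thereby controlled by the trace. -/
theorem exists_cycSymm_eq_cycTrace (D : ValuedClosure p F Ω) {L : IntermediateField F Ω}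
    (hL : ∀ x ∈ L, σ x ∈ L) {y : Ω} (hyL : y ∈ L) (hy : (σ ^ p) y = y) {k : ℕ} (hk0 : 0 < k)
    (hkp : k < p) :
    ∃ z ∈ L, D.v z ≤ D.v y ^ k ∧ cycSymm p σ k y = cycTrace p σ z := by
  have hk : (k : ZMod p) ≠ 0 := by
    rw [Ne, ZMod.natCast_eq_zero_iff]
    exact fun h => absurd (Nat.le_of_dvd hk0 h) (by omega)
  let w : Finset (ZMod p) → Ω := fun A => ∏ a ∈ A, zpowZMod p σ a y
  let P := Finset.powersetCard k (Finset.univ : Finset (ZMod p))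
  refine ⟨∑ A ∈ P with ∑ a ∈ A, a = 0, w A, sum_mem fun A _ => cycSymm_mem hL hyL A,
    D.v_sum_le _ _ (by positivity) fun A hA => ?_, ?_⟩
  · have hA' := (Finset.mem_powersetCard.1 (Finset.mem_filter.1 hA).1).2
    simp only [w, map_prod, D.v_gal, Finset.prod_const, hA', le_refl]
  -- The fibre over `j` consists of the translates by `j` of the subsets of sum zero.
  · rw [cycSymm, cycTrace, ← Finset.sum_fiberwise P (fun A => (k : ZMod p)⁻¹ * ∑ a ∈ A, a)]
    refine Finset.sum_congr rfl fun j _ => ?_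
    rw [map_sum]
    symm
    refine Finset.sum_bij (fun A _ => A.map (addLeftEmbedding j)) ?_ ?_ ?_ ?_
    · intro A hA
      simp only [Finset.mem_filter, P, Finset.mem_powersetCard, Finset.subset_univ, true_and,
        Finset.card_map, Finset.sum_map, addLeftEmbedding_apply] at hA ⊢
      refine ⟨hA.1, ?_⟩
      erw [Finset.sum_add_distrib, Finset.sum_const, hA.1, hA.2]
      rw [add_zero, nsmul_eq_mul, inv_mul_cancel_left₀ hk]
    · intro A _ B _ hAB
      exact Finset.map_injective _ hAB
    · intro B hB
      simp only [Finset.mem_filter, P, Finset.mem_powersetCard, Finset.subset_univ,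
        true_and] at hB
      refine ⟨B.map (addLeftEmbedding (-j)), ?_, ?_⟩
      · simp only [Finset.mem_filter, P, Finset.mem_powersetCard, Finset.subset_univ, true_and,
          Finset.card_map, Finset.sum_map, addLeftEmbedding_apply]
        refine ⟨hB.1, ?_⟩
        erw [Finset.sum_add_distrib, Finset.sum_const]
        rw [hB.1, nsmul_eq_mul, ← hB.2]
        field_simp
        ring
      · ext b; simp
    · intro A _
      simp only [w, map_prod, Finset.prod_map, addLeftEmbedding_apply]
      exact Finset.prod_congr rfl fun a _ => zpowZMod_add hy j a

end CyclicSymm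

end PClassFieldTheory

/-! ### Trace, norm and ramification in a totally ramified step of degree p -/

namespace PClassFieldTheory

open IntermediateField

/-- `σ` generates a totally ramified cyclic extension `L/M` of degree `p` of discretely valued
subfields of `Ω`, with uniformizers `πL` and `πM`. -/
structure CyclicStep {p : ℕ} {F Ω : Type*} [Field F] [Field Ω] [Algebra F Ω]
    [Fact p.Prime] (D : ValuedClosure p F Ω) (σ : Gal(Ω/F)) (L M : IntermediateField F Ω)
    (πL πM : Ω) : Prop where
  mem_inertia : σ ∈ D.inertia
  apply_mem : ∀ x ∈ L, σ x ∈ L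
  pow_apply : ∀ x ∈ L, (σ ^ p) x = x
  mem_iff : ∀ x, x ∈ M ↔ x ∈ L ∧ σ x = x
  πL_mem : πL ∈ L
  πM_mem : πM ∈ M
  πL_ne : πL ≠ 0
  v_πL_lt : D.v πL < 1
  v_πM : D.v πM = D.v πL ^ p
  exists_zpow : ∀ x ∈ L, x ≠ 0 → ∃ n : ℤ, D.v x = D.v πL ^ n
  exists_zpow' : ∀ x ∈ M, x ≠ 0 → ∃ n : ℤ, D.v x = D.v πM ^ n
  exists_trace_ne : ∃ x ∈ L, cycTrace p σ x ≠ 0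

variable {p : ℕ} [hp : Fact p.Prime] {F Ω : Type*} [Field F] [Field Ω] [Algebra F Ω]
  {D : ValuedClosure p F Ω} {σ : Gal(Ω/F)} {L M : IntermediateField F Ω} {πL πM : Ω}

theorem ValuedClosure.v_cycTrace_le (D : ValuedClosure p F Ω) (y : Ω) :
    D.v (cycTrace p σ y) ≤ D.v y :=
  D.v_sum_le _ _ (D.v.nonneg y) fun _ _ => (D.v_gal _ y).le

theorem ValuedClosure.v_cycNorm (D : ValuedClosure p F Ω) (y : Ω) :
    D.v (cycNorm p σ y) = D.v y ^ p := by
  simp [cycNorm, D.v_gal, ZMod.card]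

/-- The norm of `1 + θ y` is `1 + Tr(y) θ + N(y) θ ^ p` up to small terms. -/
theorem ValuedClosure.v_cycNorm_one_add_sub_lt (D : ValuedClosure p F Ω) {y θ : Ω} {r : ℝ}
    (hr : 0 < r) (hy : ∀ k, 1 < k → k < p → D.v (cycSymm p σ k y) < r) (hθ : σ θ = θ)
    (hθ1 : D.v θ ≤ 1) :
    D.v (cycNorm p σ (1 + θ * y) - (1 + cycTrace p σ y * θ + cycNorm p σ y * θ ^ p)) < r := by
  have h2 := hp.out.two_le
  rw [cycNorm_one_add hθ, Finset.sum_range_succ, cycSymm_card, Finset.range_eq_Ico,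
    Finset.sum_eq_sum_Ico_succ_bot (by omega), Finset.sum_eq_sum_Ico_succ_bot (by omega),
    cycSymm_zero]
  simp only [zero_add, pow_zero, mul_one, pow_one, cycSymm_one]
  have h3 : D.v (∑ k ∈ Finset.Ico (1 + 1) p, cycSymm p σ k y * θ ^ k) < r := by
    refine D.v_sum_lt _ _ hr fun k hk => ?_
    rw [Finset.mem_Ico] at hk
    rw [map_mul, map_pow]
    exact (mul_le_of_le_one_right (D.v.nonneg _) (pow_le_one₀ (D.v.nonneg _) hθ1)).trans_lt
      (hy k (by omega) hk.2)
  convert h3 using 2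
  ring

omit hp in
theorem ValuedClosure.v_pow_sub_pow_le (D : ValuedClosure p F Ω) {a b : Ω} (ha : D.v a ≤ 1)
    (hb : D.v b ≤ 1) (k : ℕ) : D.v (a ^ k - b ^ k) ≤ D.v (a - b) := by
  have h := (Commute.all a b).geom_sum₂_mul k
  rw [← h, map_mul]
  refine mul_le_of_le_one_left (D.v.nonneg _) (D.v_sum_le _ _ zero_le_one fun i _ => ?_)
  rw [map_mul, map_pow, map_pow]
  exact mul_le_one₀ (pow_le_one₀ (D.v.nonneg _) ha) (pow_nonneg (D.v.nonneg _) _)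
    (pow_le_one₀ (D.v.nonneg _) hb)

omit hp in
/-- A form of Hensel's lemma: a polynomial congruent to `θ - c` modulo the maximal ideal has an
integral root. -/
theorem ValuedClosure.exists_root [Algebra.IsAlgebraic F Ω] (D : ValuedClosure p F Ω)
    (K : IntermediateField F Ω) (s : Finset ℕ) (a : ℕ → Ω) (c : Ω) (haK : ∀ k ∈ s, a k ∈ K)
    (ha : ∀ k ∈ s, D.v (a k) < 1) (hcK : c ∈ K) (hc : D.v c ≤ 1) :
    ∃ θ ∈ K, D.v θ ≤ 1 ∧ θ + ∑ k ∈ s, a k * θ ^ k = c := by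
  classical
  -- A common bound for the coefficients, which serves as contraction constant.
  obtain ⟨ρ, hρ0, hρ1, hρ⟩ : ∃ ρ : ℝ, 0 ≤ ρ ∧ ρ < 1 ∧ ∀ k ∈ s, D.v (a k) ≤ ρ := by
    clear haK
    induction s using Finset.induction_on with
    | empty => exact ⟨0, le_rfl, one_pos, by simp⟩
    | insert b s _ ih =>
      obtain ⟨ρ, h0, h1, h2⟩ := ih fun k hk => ha k (by simp [hk])
      refine ⟨max ρ (D.v (a b)), le_max_of_le_left h0, max_lt h1 (ha b (by simp)), ?_⟩
      intro k hk
      rcases Finset.mem_insert.1 hk with rfl | hk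
      · exact le_max_right _ _
      · exact (h2 k hk).trans (le_max_left _ _)
  -- `K` may be infinite over `F`, hence not complete. The finite extension generated by the
  -- coefficients is complete and contains the whole iteration.
  let K₀ := adjoin F (insert c (a '' s) : Set Ω)
  have hfin : Finite (insert c (a '' s) : Set Ω) := ((s.finite_toSet.image a).insert c).to_subtype
  have hK₀ : FiniteDimensional F K₀ :=
    finiteDimensional_adjoin fun x _ => Algebra.IsIntegral.isIntegral x
  have hle : K₀ ≤ K := by
    refine adjoin_le_iff.2 ?_
    rintro x (rfl | ⟨k, hk, rfl⟩)
    · exact hcK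
    · exact haK k hk
  have hc₀ : c ∈ K₀ := subset_adjoin F _ (by simp)
  have ha₀ : ∀ k ∈ s, a k ∈ K₀ := fun k hk => subset_adjoin F _ (Or.inr ⟨k, hk, rfl⟩)
  -- A root of the equation is a fixed point of `Φ`, which contracts distances between integers by
  -- the factor `ρ`.
  let Φ : Ω → Ω := fun θ => c - ∑ k ∈ s, a k * θ ^ k
  have hΦ1 : ∀ θ, D.v θ ≤ 1 → D.v (Φ θ) ≤ 1 := fun θ hθ => by
    refine D.v_sub_le' hc (D.v_sum_le _ _ zero_le_one fun k hk => ?_)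
    rw [map_mul, map_pow]
    exact mul_le_one₀ (ha k hk).le (pow_nonneg (D.v.nonneg _) _) (pow_le_one₀ (D.v.nonneg _) hθ)
  have hΦ2 : ∀ x y, D.v x ≤ 1 → D.v y ≤ 1 → D.v (Φ x - Φ y) ≤ ρ * D.v (x - y) := by
    intro x y hx hy
    have h1 : Φ x - Φ y = ∑ k ∈ s, a k * (y ^ k - x ^ k) := by
      simp only [Φ, mul_sub, Finset.sum_sub_distrib]; ring
    rw [h1]
    refine D.v_sum_le _ _ (by positivity) fun k hk => ?_
    rw [map_mul, D.v_sub_comm x]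
    exact mul_le_mul (hρ k hk) (D.v_pow_sub_pow_le hy hx k) (D.v.nonneg _) hρ0
  let u : ℕ → Ω := fun n => Φ^[n] 0
  have hu : ∀ n, u (n + 1) = Φ (u n) := fun n => Function.iterate_succ_apply' Φ n 0
  have hu1 : ∀ n, D.v (u n) ≤ 1 := by
    intro n
    induction n with
    | zero => simp [u]
    | succ n ih => rw [hu]; exact hΦ1 _ ih
  have huK : ∀ n, u n ∈ K₀ := by
    intro n
    induction n with
    | zero => exact zero_mem _
    | succ n ih =>
      rw [hu]
      exact sub_mem hc₀ (sum_mem fun k hk => mul_mem (ha₀ k hk) (pow_mem ih k))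
  have hdiff : ∀ n, D.v (u (n + 1) - u n) ≤ ρ ^ n := by
    intro n
    induction n with
    | zero => exact D.v_sub_le' (hu1 1) (hu1 0)
    | succ n ih =>
      rw [hu (n + 1), hu n, pow_succ']
      refine (hΦ2 _ _ (by rw [← hu]; exact hu1 _) (hu1 n)).trans ?_
      rw [← hu]
      exact mul_le_mul_of_nonneg_left ih hρ0
  obtain ⟨l, hlK, hl⟩ := D.complete K₀ u ρ hρ0 hρ1 huK hdiff
  have hl1 : D.v l ≤ 1 := by
    have := D.v_add_le' ((hl 0).trans (by simp)) (hu1 0)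
    simpa using this
  have hroot : l - Φ l = 0 := by
    by_contra hne
    obtain ⟨n, hn⟩ := exists_pow_lt_of_lt_one (D.v_pos hne) hρ1
    have h1 : D.v (l - u (n + 1)) ≤ ρ ^ n :=
      (hl (n + 1)).trans (pow_le_pow_of_le_one hρ0 hρ1.le (by omega))
    have h2 : D.v (Φ (u n) - Φ l) ≤ ρ ^ n := by
      refine (hΦ2 _ _ (hu1 n) hl1).trans ?_
      rw [D.v_sub_comm]
      exact (mul_le_of_le_one_left (D.v.nonneg _) hρ1.le).trans (hl n)
    have h3 := D.v_add_le' h1 h2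
    rw [hu, sub_add_sub_cancel] at h3
    linarith
  refine ⟨l, hle hlK, hl1, ?_⟩
  linear_combination hroot

namespace CyclicStep

variable (h : CyclicStep D σ L M πL πM)
include h

theorem v_πL_pos : 0 < D.v πL := D.v_pos h.πL_ne

theorem v_πM_pos : 0 < D.v πM := by rw [h.v_πM]; exact pow_pos h.v_πL_pos p

theorem v_πM_lt : D.v πM < 1 := by
  rw [h.v_πM]; exact pow_lt_one₀ h.v_πL_pos.le h.v_πL_lt hp.out.ne_zero

theorem M_le : M ≤ L := fun x hx => ((h.mem_iff x).1 hx).1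

theorem apply_eq {x : Ω} (hx : x ∈ M) : σ x = x := ((h.mem_iff x).1 hx).2

theorem cycTrace_mem {x : Ω} (hx : x ∈ L) : cycTrace p σ x ∈ M := by
  refine (h.mem_iff _).2 ⟨sum_mem fun a _ => ?_, apply_cycTrace (h.pow_apply x hx)⟩
  simpa using cycSymm_mem h.apply_mem hx {a}

theorem cycNorm_mem {x : Ω} (hx : x ∈ L) : cycNorm p σ x ∈ M :=
  (h.mem_iff _).2 ⟨cycSymm_mem h.apply_mem hx _, apply_cycNorm (h.pow_apply x hx)⟩

theorem cycSymm_mem_M {y : Ω} (hy : y ∈ L) {k : ℕ} (hk0 : 0 < k) (hkp : k ≤ p) :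
    cycSymm p σ k y ∈ M := by
  rcases hkp.lt_or_eq with hkp | rfl
  · obtain ⟨z, hz, -, hz'⟩ := exists_cycSymm_eq_cycTrace D h.apply_mem hy (h.pow_apply y hy) hk0 hkp
    rw [hz']; exact h.cycTrace_mem hz
  · rw [cycSymm_card]; exact h.cycNorm_mem hy

/-- If the trace attains the value `v πM ^ i` on elements of absolute value at most `v πL ^ i`, then
there is a smallest element with this property. -/
theorem exists_trace_extremal {i : ℕ} (hx : ∃ x ∈ L, D.v x ≤ D.v πL ^ i ∧
      D.v πM ^ i ≤ D.v (cycTrace p σ x)) :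
    ∃ j, i ≤ j ∧ ∃ y ∈ L, D.v y = D.v πL ^ j ∧ D.v (cycTrace p σ y) = D.v πM ^ i ∧
      ∀ z ∈ L, D.v z < D.v y → D.v (cycTrace p σ z) < D.v πM ^ i := by
  classical
  have hq := h.v_πL_pos
  have hq1 := h.v_πL_lt
  have hQ := h.v_πM_pos
  have hQ1 := h.v_πM_lt
  let P : ℕ → Prop := fun j => ∃ x ∈ L, D.v x = D.v πL ^ j ∧ D.v πM ^ i ≤ D.v (cycTrace p σ x)
  -- The trace does not increase absolute values, so the possible exponents `j` are bounded and a
  -- largest one exists.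
  have hPb : ∀ j, P j → j ≤ p * i := by
    rintro j ⟨x, -, hxj, hxt⟩
    have := hxt.trans (D.v_cycTrace_le x)
    rw [hxj, h.v_πM, ← pow_mul] at this
    exact (pow_le_pow_iff_right_of_lt_one₀ hq hq1).1 this
  have hP0 : ∃ j, i ≤ j ∧ P j := by
    obtain ⟨x, hxL, hxi, hxt⟩ := hx
    have hx0 : x ≠ 0 := by
      rintro rfl
      have := pow_pos hQ i
      simp [cycTrace] at hxt
      linarith
    obtain ⟨n, hn⟩ := h.exists_zpow x hxL hx0
    rw [hn, ← zpow_natCast, zpow_le_zpow_iff_right_of_lt_one₀ hq hq1] at hxi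
    lift n to ℕ using by omega
    exact ⟨n, by omega, x, hxL, by simpa using hn, hxt⟩
  obtain ⟨j₀, hij₀, hPj₀⟩ := hP0
  set j := Nat.findGreatest P (p * i) with hj
  have hPj : P j := Nat.findGreatest_spec (hPb _ hPj₀) hPj₀
  have hmax : ∀ k, P k → k ≤ j := fun k hk => Nat.le_findGreatest (hPb k hk) hk
  obtain ⟨y, hyL, hyj, hyt⟩ := hPj
  have hsmall : ∀ z ∈ L, D.v z < D.v y → D.v (cycTrace p σ z) < D.v πM ^ i := by
    intro z hzL hzy
    by_contra! hzt
    have hz0 : z ≠ 0 := by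
      rintro rfl
      have := pow_pos hQ i
      simp [cycTrace] at hzt
      linarith
    obtain ⟨n, hn⟩ := h.exists_zpow z hzL hz0
    rw [hn, hyj, ← zpow_natCast, zpow_lt_zpow_iff_right_of_lt_one₀ hq hq1] at hzy
    lift n to ℕ using by omega
    have := hmax n ⟨z, hzL, by simpa using hn, hzt⟩
    omega
  refine ⟨j, hij₀.trans (hmax _ hPj₀), y, hyL, hyj, ?_, hsmall⟩
  have ht0 : cycTrace p σ y ≠ 0 := by
    intro h0
    have := pow_pos hQ i
    rw [h0, map_zero] at hyt
    linarith
  obtain ⟨m, hm⟩ := h.exists_zpow' _ (h.cycTrace_mem hyL) ht0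
  have hmi : m ≤ i := by
    rwa [hm, ← zpow_natCast, zpow_le_zpow_iff_right_of_lt_one₀ hQ hQ1] at hyt
  rcases hmi.lt_or_eq with hmi | rfl
  -- If the trace of `y` were larger than the level, `πM * y` would be a smaller element whose trace
  -- still reaches the level, against the maximality of `j`.
  · exfalso
    have h1 := hsmall (πM * y) (mul_mem (h.M_le h.πM_mem) hyL) (by
      rw [map_mul]
      have : 0 < D.v y := by rw [hyj]; positivity
      nlinarith)
    rw [cycTrace_mul (h.apply_eq h.πM_mem), map_mul, hm, ← zpow_one_add₀ hQ.ne', ← zpow_natCast,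
      zpow_lt_zpow_iff_right_of_lt_one₀ hQ hQ1] at h1
    omega
  · rw [hm, zpow_natCast]

/-- For `0 < k < p` the symmetric function is the trace of an element of absolute value at most `D.v
y ^ k`, so bounds on traces transfer to it. In the strict variant that follows, `k > 1` makes that
element strictly smaller than `y`. -/
theorem v_cycSymm_lt_of_le {y : Ω} (hy : y ∈ L) (hy1 : D.v y ≤ 1) {r : ℝ}
    (hz : ∀ z ∈ L, D.v z ≤ D.v y → D.v (cycTrace p σ z) < r) {k : ℕ} (hk0 : 0 < k) (hkp : k < p) :
    D.v (cycSymm p σ k y) < r := by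
  obtain ⟨z, hzL, hzk, hz'⟩ :=
    exists_cycSymm_eq_cycTrace D h.apply_mem hy (h.pow_apply y hy) hk0 hkp
  rw [hz']
  exact hz z hzL (hzk.trans (pow_le_of_le_one (D.v.nonneg _) hy1 hk0.ne'))

theorem v_cycSymm_lt_of_lt {y : Ω} (hy : y ∈ L) (hy0 : y ≠ 0) (hy1 : D.v y < 1) {r : ℝ}
    (hz : ∀ z ∈ L, D.v z < D.v y → D.v (cycTrace p σ z) < r) {k : ℕ} (hk0 : 1 < k) (hkp : k < p) :
    D.v (cycSymm p σ k y) < r := by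
  obtain ⟨z, hzL, hzk, hz'⟩ :=
    exists_cycSymm_eq_cycTrace D h.apply_mem hy (h.pow_apply y hy) (by omega) hkp
  rw [hz']
  refine hz z hzL (hzk.trans_lt ?_)
  have := pow_lt_pow_right_of_lt_one₀ (D.v_pos hy0) hy1 hk0
  rwa [pow_one] at this

/-- If the trace of `y` dominates, the norm is surjective on `1 + Tr(y) O_K`. -/
theorem exists_norm_eq_of_trace_dominant [Algebra.IsAlgebraic F Ω] {y : Ω} (hy : y ∈ L)
    (hdom : ∀ k, 1 < k → k ≤ p → D.v (cycSymm p σ k y) < D.v (cycTrace p σ y))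
    {K : IntermediateField F Ω} (hMK : M ≤ K) (hK : ∀ x ∈ K, σ x = x) {c : Ω} (hcK : c ∈ K)
    (hc : D.v c ≤ D.v (cycTrace p σ y)) :
    ∃ θ ∈ K, D.v θ ≤ 1 ∧ cycNorm p σ (1 + θ * y) = 1 + c := by
  set τ := cycTrace p σ y with hτ
  have hτ0 : 0 < D.v τ := (D.v.nonneg _).trans_lt (hdom p hp.out.one_lt le_rfl)
  have hτne : τ ≠ 0 := by intro h0; simp [h0] at hτ0
  have hτK : τ ∈ K := hMK (h.cycTrace_mem hy)
  -- Dividing the expansion of `N(1 + θ y) = 1 + c` by the trace `τ` gives `θ` plus terms with small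
  -- coefficients.
  obtain ⟨θ, hθK, hθ1, hθ⟩ := D.exists_root K (Finset.Ico 2 (p + 1))
    (fun k => cycSymm p σ k y / τ) (c / τ) (fun k hk => by
      rw [Finset.mem_Ico] at hk
      exact div_mem (hMK (h.cycSymm_mem_M hy (by omega) (by omega))) hτK) (fun k hk => by
      rw [Finset.mem_Ico] at hk
      rw [map_div₀, div_lt_one hτ0]
      exact hdom k (by omega) (by omega)) (div_mem hcK hτK) (by
      rw [map_div₀]; exact div_le_one_of_le₀ hc hτ0.le)
  refine ⟨θ, hθK, hθ1, ?_⟩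
  have h2 := hp.out.two_le
  rw [cycNorm_one_add (hK θ hθK), Finset.range_eq_Ico,
    Finset.sum_eq_sum_Ico_succ_bot (by omega), Finset.sum_eq_sum_Ico_succ_bot (by omega),
    cycSymm_zero]
  simp only [zero_add, pow_zero, mul_one, pow_one, cycSymm_one]
  have h3 : ∑ k ∈ Finset.Ico (1 + 1) (p + 1), cycSymm p σ k y * θ ^ k =
      τ * ∑ k ∈ Finset.Ico 2 (p + 1), cycSymm p σ k y / τ * θ ^ k := by
    rw [Finset.mul_sum]
    refine Finset.sum_congr rfl fun k _ => ?_
    field_simp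
  rw [h3, ← hτ]
  have h4 := congrArg (τ * ·) hθ
  simp only [mul_add] at h4
  rw [mul_div_cancel₀ _ hτne] at h4
  rw [h4]

/-- Multiplying by `πM` multiplies the `k`-th symmetric function by `πM ^ k`. The higher ones, which
are at most as large as the trace for `y`, thus become strictly smaller than the trace. For the norm
itself the comparison uses `i ≤ j`. -/
theorem trace_dominant_mul {i j : ℕ} (hi : 1 ≤ i) (hij : i ≤ j) {y : Ω} (hyL : y ∈ L)
    (hyj : D.v y = D.v πL ^ j) (hyt : D.v (cycTrace p σ y) = D.v πM ^ i)
    (hys : ∀ z ∈ L, D.v z < D.v y → D.v (cycTrace p σ z) < D.v πM ^ i) (k : ℕ) (hk1 : 1 < k)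
    (hkp : k ≤ p) : D.v (cycSymm p σ k (πM * y)) < D.v (cycTrace p σ (πM * y)) := by
  have hq := h.v_πL_pos
  have hq1 := h.v_πL_lt
  have hQ := h.v_πM_pos
  have hQ1 := h.v_πM_lt
  have hy0 : y ≠ 0 := by
    intro h0; rw [h0, map_zero] at hyj; have := pow_pos hq j; linarith
  have hy1 : D.v y < 1 := by rw [hyj]; exact pow_lt_one₀ hq.le hq1 (by omega)
  rw [cycSymm_mul (h.apply_eq h.πM_mem), cycTrace_mul (h.apply_eq h.πM_mem), map_mul, map_mul, hyt,
    map_pow]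
  have h1 : D.v (cycSymm p σ k y) ≤ D.v πM ^ i := by
    rcases hkp.lt_or_eq with hkp | rfl
    · exact (h.v_cycSymm_lt_of_lt hyL hy0 hy1 hys hk1 hkp).le
    · rw [cycSymm_card, D.v_cycNorm, hyj, h.v_πM, ← pow_mul, ← pow_mul]
      exact pow_le_pow_of_le_one hq.le hq1.le (by nlinarith)
  have h2 : D.v πM ^ k < D.v πM := by
    have := pow_lt_pow_right_of_lt_one₀ hQ hQ1 hk1
    rwa [pow_one] at this
  have h3 := pow_pos hQ i
  nlinarith [pow_pos hQ k]

/-- Take `x` with non-zero trace. Multiplying it by `πM ^ n` adds `p n` to its exponent in terms of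
`πL`, but only `n` to the exponent of its trace in terms of `πM`. As `p ≥ 2`, the former exponent
eventually overtakes the latter. -/
theorem exists_trace_level : ∃ i, 1 ≤ i ∧ ∃ x ∈ L, D.v x ≤ D.v πL ^ i ∧
      D.v πM ^ i ≤ D.v (cycTrace p σ x) := by
  have hq := h.v_πL_pos
  have hq1 := h.v_πL_lt
  have hQ := h.v_πM_pos
  have hQ1 := h.v_πM_lt
  have hp2 := hp.out.two_le
  obtain ⟨x, hxL, hxt⟩ := h.exists_trace_ne
  have hx0 : x ≠ 0 := by rintro rfl; simp [cycTrace] at hxt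
  obtain ⟨a, ha⟩ := h.exists_zpow x hxL hx0
  obtain ⟨b, hb⟩ := h.exists_zpow' _ (h.cycTrace_mem hxL) hxt
  -- multiply by a large power of the uniformizer
  let n : ℕ := a.natAbs + b.natAbs + 1
  have hn : (n : ℤ) = |a| + |b| + 1 := by simp [n]
  have hna := neg_abs_le a
  have hnb := neg_abs_le b
  have hnb' := le_abs_self b
  have hi0 : 0 ≤ b + n := by have := abs_nonneg a; omega
  have hab := abs_nonneg a
  refine ⟨(b + n).toNat, by omega, πM ^ n * x,
    mul_mem (pow_mem (h.M_le h.πM_mem) n) hxL, ?_, ?_⟩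
  · rw [map_mul, map_pow, ha, h.v_πM, ← pow_mul, ← zpow_natCast, ← zpow_natCast, ← zpow_add₀ hq.ne',
      zpow_le_zpow_iff_right_of_lt_one₀ hq hq1]
    push_cast
    rw [Int.toNat_of_nonneg hi0]
    have : (2 : ℤ) * n ≤ p * n := by
      have : (2 : ℤ) ≤ p := by exact_mod_cast hp2
      nlinarith
    linarith
  · rw [cycTrace_mul (by rw [map_pow, h.apply_eq h.πM_mem]), map_mul, map_pow, hb, ← zpow_natCast,
      ← zpow_natCast, ← zpow_add₀ hQ.ne', zpow_le_zpow_iff_right_of_lt_one₀ hQ hQ1]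
    omega

/-- The unit `w = σ x / x` has norm `1`, and inertia leaves its residue unchanged, so that residue
is a `p`-th root of unity in characteristic `p`, hence `1`. -/
theorem v_apply_div_sub_one_lt_one {x : Ω} (hx : x ∈ L) (hx0 : x ≠ 0) :
    D.v (σ x / x - 1) < 1 := by
  set w := σ x / x with hw
  have hw1 : D.v w = 1 := by rw [hw, map_div₀, D.v_gal, div_self (D.v_pos hx0).ne']
  have hN : cycNorm p σ w = 1 := cycNorm_apply_div (h.pow_apply x hx) hx0
  have h1 : D.res ⟨w, hw1.le⟩ ^ p = 1 := by
    have h2 : ∀ a : ZMod p, D.v (zpowZMod p σ a w) ≤ 1 := fun a => by rw [D.v_gal]; exact hw1.le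
    have h3 : ∏ a : ZMod p, (⟨_, h2 a⟩ : D.integers) = 1 := by
      apply Subtype.ext
      rw [SubmonoidClass.coe_finsetProd]; exact hN
    have h4 := congrArg D.res h3
    rw [map_prod, map_one] at h4
    rw [← h4, Finset.prod_congr rfl fun a _ => ?_, Finset.prod_const, Finset.card_univ, ZMod.card]
    refine D.res_eq_iff.2 ?_
    exact D.mem_inertia.1 (D.inertia.pow_mem h.mem_inertia _) w hw1.le
  have h5 : D.res ⟨w, hw1.le⟩ = D.res 1 := by
    rw [map_one]
    have h6 : (D.res ⟨w, hw1.le⟩ - 1) ^ p = 0 := by rw [sub_pow_char, h1]; simp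
    exact sub_eq_zero.1 (eq_zero_of_pow_eq_zero h6)
  exact D.res_eq_iff.1 h5

/-- At the level where the norm is of Artin–Schreier type, `σ` acts trivially on uniformizers to
that level. -/
theorem v_apply_πL_le {i : ℕ} (hys : ∀ z ∈ L, D.v z < D.v πL ^ i →
      D.v (cycTrace p σ z) < D.v πM ^ i) : D.v (σ πL / πL - 1) ≤ D.v πL ^ i := by
  have hq := h.v_πL_pos
  have hq1 := h.v_πL_lt
  have hQ := h.v_πM_pos
  have hQ1 := h.v_πM_lt
  have hp2 := hp.out.two_le
  by_contra! hlt
  set x := σ πL / πL - 1 with hx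
  have hxL : x ∈ L := sub_mem (div_mem (h.apply_mem _ h.πL_mem) h.πL_mem) (one_mem _)
  have hx0 : x ≠ 0 := by
    intro h0; rw [h0, map_zero] at hlt; have := pow_pos hq i; linarith
  have hx1 : D.v x < 1 := h.v_apply_div_sub_one_lt_one h.πL_mem h.πL_ne
  obtain ⟨r, hr⟩ := h.exists_zpow x hxL hx0
  have hr0 : 0 < r := by
    rw [hr, ← zpow_zero (D.v πL), zpow_lt_zpow_iff_right_of_lt_one₀ hq hq1] at hx1
    exact hx1
  have hri : r < i := by
    rwa [hr, ← zpow_natCast, zpow_lt_zpow_iff_right_of_lt_one₀ hq hq1] at hlt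
  lift r to ℕ using hr0.le
  rw [zpow_natCast] at hr
  -- Multiplication by `πM ^ (i - r)` carries the bound at level `i` down to level `r`, because `p
  -- (i - r) + r > i`.
  have htr : ∀ z ∈ L, D.v z ≤ D.v x → D.v (cycTrace p σ z) < D.v πM ^ r := by
    intro z hzL hzx
    have h1 := hys (πM ^ (i - r) * z) (mul_mem (pow_mem (h.M_le h.πM_mem) _) hzL) (by
      rw [map_mul, map_pow, h.v_πM, ← pow_mul]
      have h2 : p * (i - r) + r > i := by
        have : 1 ≤ i - r := by omega
        have : 2 * (i - r) ≤ p * (i - r) := Nat.mul_le_mul_right _ hp2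
        omega
      calc _ ≤ D.v πL ^ (p * (i - r)) * D.v πL ^ r := by rw [← hr]; gcongr
        _ = D.v πL ^ (p * (i - r) + r) := by rw [pow_add]
        _ < D.v πL ^ i := pow_lt_pow_right_of_lt_one₀ hq hq1 h2)
    rw [cycTrace_mul (by rw [map_pow, h.apply_eq h.πM_mem]), map_mul, map_pow] at h1
    have h3 : D.v πM ^ i = D.v πM ^ (i - r) * D.v πM ^ r := by rw [← pow_add]; congr 1; omega
    rw [h3] at h1
    exact lt_of_mul_lt_mul_left h1 (pow_pos hQ _).le
  have hN : cycNorm p σ (1 + 1 * x) = 1 := by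
    rw [one_mul, hx, add_sub_cancel]
    exact cycNorm_apply_div (h.pow_apply _ h.πL_mem) h.πL_ne
  have hrr : D.v (cycNorm p σ x) = D.v πM ^ r := by
    rw [D.v_cycNorm, hr, h.v_πM, ← pow_mul, ← pow_mul, mul_comm]
  -- In the expansion of `N(1 + x) = 1` the norm of `x` has absolute value exactly `D.v πM ^ r` and
  -- every other non-constant term is smaller, a contradiction.
  have h4 := D.v_cycNorm_one_add_sub_lt (σ := σ) (y := x) (θ := 1) (pow_pos hQ r)
    (fun k hk hkp => h.v_cycSymm_lt_of_le hxL hx1.le htr (by omega) hkp) (map_one σ) (by simp)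
  rw [hN] at h4
  have h5 := D.v_add_lt h4 (htr x hxL le_rfl)
  have h6 : 1 - (1 + cycTrace p σ x * 1 + cycNorm p σ x * 1 ^ p) + cycTrace p σ x =
      - cycNorm p σ x := by ring
  rw [h6, D.v_neg, hrr] at h5
  exact lt_irrefl _ h5

/-- Expand `x` in powers of `πL` with coefficients fixed by `σ`. Writing `x = a + πL x'`, the
difference `σ x - x` is `σ πL (σ x' - x')` plus a term bounded by the action on `πL`, and iterating
makes the first part arbitrarily small. So the action on the uniformizer controls the action on all
integers. -/
theorem v_apply_sub_le {r : ℝ} (hr0 : 0 < r) (hr : D.v (σ πL / πL - 1) ≤ r)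
    {L' : IntermediateField F Ω} (hL'π : πL ∈ L')
    (hL' : ∀ x ∈ L', x ≠ 0 → ∃ n : ℤ, D.v x = D.v πL ^ n)
    (happ : ∀ x ∈ L', D.v x ≤ 1 → ∃ a ∈ L', σ a = a ∧ D.v (x - a) < 1) {x : Ω} (hxL : x ∈ L')
    (hx : D.v x ≤ 1) : D.v (σ x - x) ≤ D.v πL * r := by
  have hq := h.v_πL_pos
  have hq1 := h.v_πL_lt
  have key : ∀ n : ℕ, ∀ x ∈ L', D.v x ≤ 1 → D.v (σ x - x) ≤ max (D.v πL * r) (D.v πL ^ n) := by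
    intro n
    induction n with
    | zero =>
      intro x _ hx
      rw [pow_zero]
      exact (D.v_sub_le' (by rwa [D.v_gal]) hx).trans (le_max_right _ _)
    | succ n ih =>
      intro x hxL hx
      obtain ⟨a, haL, ha, hxa⟩ := happ x hxL hx
      set x' := (x - a) / πL with hx'
      have hx'L : x' ∈ L' := div_mem (sub_mem hxL haL) hL'π
      have hx'1 : D.v x' ≤ 1 := by
        by_cases h0 : x - a = 0
        · simp [hx', h0]
        obtain ⟨m, hm⟩ := hL' _ (sub_mem hxL haL) h0
        have hm0 : 0 < m := by
          rw [hm, ← zpow_zero (D.v πL), zpow_lt_zpow_iff_right_of_lt_one₀ hq hq1] at hxa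
          exact hxa
        rw [hx', map_div₀, hm, div_le_one hq]
        conv_rhs => rw [← zpow_one (D.v πL)]
        rw [zpow_le_zpow_iff_right_of_lt_one₀ hq hq1]; omega
      have hxe : x = a + πL * x' := by
        rw [hx', mul_div_cancel₀ _ h.πL_ne]; ring
      have h1 : σ x - x = σ πL * (σ x' - x') + πL * (σ πL / πL - 1) * x' := by
        have := h.πL_ne
        rw [hxe, map_add, map_mul, ha]
        field_simp
        ring
      rw [h1]
      refine D.v_add_le' ?_ ?_
      · rw [map_mul, D.v_gal]
        have h2 := ih x' hx'L hx'1
        refine (mul_le_mul_of_nonneg_left h2 hq.le).trans ?_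
        rw [mul_max_of_nonneg _ _ hq.le, pow_succ']
        refine max_le_max_right _ (mul_le_of_le_one_left (by positivity) hq1.le)
      · refine le_max_of_le_left ?_
        rw [map_mul, map_mul]
        calc _ ≤ D.v πL * r * 1 := by gcongr
          _ = _ := mul_one _
  obtain ⟨n, hn⟩ := exists_pow_lt_of_lt_one (mul_pos hq hr0) hq1
  have := key n x hxL hx
  rwa [max_eq_left hn.le] at this

end CyclicStep

end PClassFieldTheory

/-! ### The norm on the layers of the unit filtration -/

namespace PClassFieldTheory

open IntermediateField

variable {p : ℕ} [hp : Fact p.Prime] {F Ω : Type*} [Field F] [Field Ω] [Algebra F Ω]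
  {D : ValuedClosure p F Ω} {σ : Gal(Ω/F)} {L M : IntermediateField F Ω} {πL πM : Ω}

/-- The behaviour of the norm on the `i`-th layer of the unit filtration: it is given by a `p`-th
power, a linear map, or an Artin–Schreier polynomial. -/
theorem CyclicStep.level_cases (h : CyclicStep D σ L M πL πM) {i : ℕ} (hi : 1 ≤ i) :
    ∃ y ∈ L, D.v y < 1 ∧ (∀ k, 1 < k → k < p → D.v (cycSymm p σ k y) < D.v πM ^ i) ∧
      ((D.v (cycTrace p σ y) < D.v πM ^ i ∧ D.v (cycNorm p σ y) = D.v πM ^ i) ∨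
       (D.v (cycTrace p σ y) = D.v πM ^ i ∧ D.v (cycNorm p σ y) < D.v πM ^ i) ∨
       (D.v (cycTrace p σ y) = D.v πM ^ i ∧ D.v (cycNorm p σ y) = D.v πM ^ i ∧
         D.v y = D.v πL ^ i ∧
         ∀ z ∈ L, D.v z < D.v y → D.v (cycTrace p σ z) < D.v πM ^ i)) := by
  have hq := h.v_πL_pos
  have hq1 := h.v_πL_lt
  -- If traces reach level `i`, an extremal `y` of exponent `j ≥ i` is used: for `j > i` its norm is
  -- negligible (linear layer), and for `j = i` norm and trace have the same size (Artin–Schreier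
  -- layer). If they do not, `πL ^ i` gives the layer of `p`-th powers.
  by_cases hP : ∃ x ∈ L, D.v x ≤ D.v πL ^ i ∧ D.v πM ^ i ≤ D.v (cycTrace p σ x)
  · obtain ⟨j, hij, y, hyL, hyj, hyt, hys⟩ := h.exists_trace_extremal hP
    have hy1 : D.v y < 1 := by rw [hyj]; exact pow_lt_one₀ hq.le hq1 (by omega)
    have hy0 : y ≠ 0 := by
      intro h0; rw [h0, map_zero] at hyj; have := pow_pos hq j; linarith
    have hN : D.v (cycNorm p σ y) = D.v πM ^ j := by
      rw [D.v_cycNorm, hyj, h.v_πM, ← pow_mul, ← pow_mul, mul_comm]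
    refine ⟨y, hyL, hy1, fun k hk hkp => h.v_cycSymm_lt_of_lt hyL hy0 hy1 hys hk hkp, Or.inr ?_⟩
    rcases hij.lt_or_eq with hij | rfl
    · refine Or.inl ⟨hyt, ?_⟩
      rw [hN]
      exact pow_lt_pow_right_of_lt_one₀ h.v_πM_pos h.v_πM_lt hij
    · exact Or.inr ⟨hyt, hN, hyj, hys⟩
  · push Not at hP
    have hv : D.v (πL ^ i) = D.v πL ^ i := map_pow _ _ _
    have hy1 : D.v (πL ^ i) < 1 := by rw [hv]; exact pow_lt_one₀ hq.le hq1 (by omega)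
    refine ⟨πL ^ i, pow_mem h.πL_mem i, hy1, fun k hk hkp =>
      h.v_cycSymm_lt_of_le (pow_mem h.πL_mem i) hy1.le (fun z hz hzv => hP z hz ?_) (by omega) hkp,
      Or.inl ⟨hP _ (pow_mem h.πL_mem i) hv.le, ?_⟩⟩
    · rwa [hv] at hzv
    · rw [D.v_cycNorm, hv, h.v_πM, ← pow_mul, ← pow_mul, mul_comm]

namespace ValuedClosure

variable (D)

/-- Over the algebraically closed residue field the reduced polynomial has a root: it is separable
when the coefficient of `θ` is a unit, and otherwise the equation is the extraction of a `p`-th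
root. -/
theorem exists_root_integers [IsSepClosed Ω] {a b c : Ω} (ha : D.v a ≤ 1) (hb : D.v b ≤ 1)
    (hc : D.v c ≤ 1) (hab : D.v a = 1 ∨ D.v b = 1) :
    ∃ θ, D.v θ ≤ 1 ∧ D.v (a * θ ^ p + b * θ - c) < 1 := by
  set a' : D.integers := ⟨a, ha⟩
  set b' : D.integers := ⟨b, hb⟩
  set c' : D.integers := ⟨c, hc⟩
  obtain ⟨x, hx⟩ : ∃ x : D.resField, D.res a' * x ^ p + D.res b' * x + - D.res c' = 0 := by
    by_cases hb0 : D.res b' = 0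
    · have ha0 : D.res a' ≠ 0 := by
        rw [res_eq_zero_iff] at hb0
        rw [Ne, res_eq_zero_iff, not_lt]
        rcases hab with h | h
        · exact h.ge
        · exact absurd h hb0.ne
      obtain ⟨x, hx⟩ := IsAlgClosed.exists_pow_nat_eq (D.res c' / D.res a') hp.out.pos
      refine ⟨x, ?_⟩
      rw [hx, hb0]; field_simp; ring
    · exact IsSepClosed.exists_root_C_mul_X_pow_add_C_mul_X_add_C' p p _ _ _ dvd_rfl
        hp.out.two_le hb0
  obtain ⟨θ, rfl⟩ := D.res_surjective x
  refine ⟨θ, θ.2, ?_⟩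
  rw [← sub_eq_add_neg, sub_eq_zero, ← map_pow, ← map_mul, ← map_mul, ← map_add, res_eq_iff] at hx
  exact hx

theorem v_sub_lt_of_pow {x y : Ω} (hx : D.v x ≤ 1) (hy : D.v y ≤ 1) (h : D.v (x ^ p - y ^ p) < 1) :
    D.v (x - y) < 1 := by
  have h1 : D.res (⟨x, hx⟩ ^ p) = D.res (⟨y, hy⟩ ^ p) := D.res_eq_iff.2 h
  rw [map_pow, map_pow, ← sub_eq_zero, ← sub_pow_char] at h1
  exact D.res_eq_iff.1 (sub_eq_zero.1 (eq_zero_of_pow_eq_zero h1))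

omit hp in
theorem v_one_add {θ y : Ω} (hθ : D.v θ ≤ 1) (hy : D.v y < 1) : D.v (1 + θ * y) = 1 := by
  rw [D.v_add_eq_of_lt, map_one]
  rw [map_mul, map_one]
  exact (mul_le_of_le_one_left (D.v.nonneg _) hθ).trans_lt hy

omit hp in
theorem v_div_sub_one {α N : Ω} (hN : D.v N = 1) : D.v (α / N - 1) = D.v (N - α) := by
  have hN0 : N ≠ 0 := by intro h0; simp [h0] at hN
  rw [div_sub_one hN0, map_div₀, hN, div_one, D.v_sub_comm]

theorem v_cycNorm_eq_one {β : Ω} (hβ : D.v β = 1) : D.v (cycNorm p σ β) = 1 := by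
  rw [D.v_cycNorm, hβ, one_pow]

end ValuedClosure

/-- A totally ramified cyclic step `L/M` together with an unramified base change `L'/K` with
separably closed residue field, and a group `T` of automorphisms of `L'/L`. -/
structure StepExt (D : ValuedClosure p F Ω) (σ : Gal(Ω/F)) (L M : IntermediateField F Ω)
    (πL πM : Ω) (L' K : IntermediateField F Ω) (T : Subgroup Gal(Ω/F)) : Prop extends
    CyclicStep D σ L M πL πM where
  L_le : L ≤ L'
  K_le : K ≤ L'
  M_le_K : M ≤ K
  apply_K : ∀ x ∈ K, σ x = x
  exists_zpow_L' : ∀ x ∈ L', x ≠ 0 → ∃ n : ℤ, D.v x = D.v πL ^ n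
  exists_zpow_K : ∀ x ∈ K, x ≠ 0 → ∃ n : ℤ, D.v x = D.v πM ^ n
  res_K : ∀ a, D.v a ≤ 1 → ∃ b ∈ K, D.v (a - b) < 1
  T_apply : ∀ φ ∈ T, ∀ x ∈ L, φ x = x
  T_mem : ∀ φ ∈ T, ∀ x ∈ L', φ x ∈ L'
  T_comm : ∀ φ ∈ T, ∀ x ∈ L', φ (σ x) = σ (φ x)
  res_T : ∀ x, D.v x ≤ 1 → (∀ φ ∈ T, D.v (φ x - x) < 1) → ∃ a ∈ M, D.v (x - a) < 1
  hilbert90 : ∀ x ∈ L', cycNorm p σ x = 1 → ∃ w ∈ L', w ≠ 0 ∧ x = σ w / w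

namespace StepExt

variable {L' K : IntermediateField F Ω} {T : Subgroup Gal(Ω/F)}
  (h : StepExt D σ L M πL πM L' K T)
include h

theorem le_succ_of_lt {x : Ω} (hx : x ∈ K) {i : ℕ} (hlt : D.v x < D.v πM ^ i) :
    D.v x ≤ D.v πM ^ (i + 1) := by
  by_cases h0 : x = 0
  · rw [h0, map_zero]; exact pow_nonneg (D.v.nonneg _) _
  obtain ⟨n, hn⟩ := h.exists_zpow_K x hx h0
  rw [hn, ← zpow_natCast, zpow_lt_zpow_iff_right_of_lt_one₀ h.v_πM_pos h.v_πM_lt] at hlt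
  rw [hn, ← zpow_natCast, zpow_le_zpow_iff_right_of_lt_one₀ h.v_πM_pos h.v_πM_lt]
  push_cast; omega

/-- Solving the norm equation on the `i`-th layer over the unramified base change. -/
theorem exists_root_level [IsSepClosed Ω] {i : ℕ} {y : Ω}
    (hle : D.v (cycTrace p σ y) ≤ D.v πM ^ i ∧ D.v (cycNorm p σ y) ≤ D.v πM ^ i)
    (heq : D.v (cycNorm p σ y) = D.v πM ^ i ∨ D.v (cycTrace p σ y) = D.v πM ^ i) {c : Ω}
    (hc : D.v c ≤ D.v πM ^ i) :
    ∃ θ ∈ K, D.v θ ≤ 1 ∧ D.v (cycTrace p σ y * θ + cycNorm p σ y * θ ^ p - c) < D.v πM ^ i := by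
  have hQ := pow_pos h.v_πM_pos i
  have hπ0 : πM ^ i ≠ 0 := by intro h0; rw [← map_pow, h0, map_zero] at hQ; exact lt_irrefl _ hQ
  have hd : ∀ x, D.v x ≤ D.v πM ^ i → D.v (x / πM ^ i) ≤ 1 := fun x hx => by
    rw [map_div₀, map_pow]; exact div_le_one_of_le₀ hx hQ.le
  have he : ∀ x, D.v x = D.v πM ^ i → D.v (x / πM ^ i) = 1 := fun x hx => by
    rw [map_div₀, map_pow, hx, div_self hQ.ne']
  obtain ⟨θ₀, hθ₀, hroot⟩ := D.exists_root_integers (hd _ hle.2) (hd _ hle.1) (hd _ hc)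
    (heq.imp (he _) (he _))
  -- The root lies in `Ω`. Only its residue matters, so it is replaced by a congruent element of
  -- `K`.
  obtain ⟨θ, hθK, hθ⟩ := h.res_K θ₀ hθ₀
  have hθ1 : D.v θ ≤ 1 := by
    have := D.v_sub_le' hθ₀ hθ.le
    simpa using this
  refine ⟨θ, hθK, hθ1, ?_⟩
  have h1 : D.v (cycNorm p σ y / πM ^ i * (θ₀ ^ p - θ ^ p)) < 1 := by
    rw [map_mul]
    exact (mul_le_of_le_one_left (D.v.nonneg _) (hd _ hle.2)).trans_lt
      ((D.v_pow_sub_pow_le hθ₀ hθ1 p).trans_lt hθ)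
  have h2 : D.v (cycTrace p σ y / πM ^ i * (θ₀ - θ)) < 1 := by
    rw [map_mul]
    exact (mul_le_of_le_one_left (D.v.nonneg _) (hd _ hle.1)).trans_lt hθ
  have h3 := D.v_sub_lt hroot (D.v_add_lt h1 h2)
  have h4 : cycTrace p σ y * θ + cycNorm p σ y * θ ^ p - c = πM ^ i *
      (cycNorm p σ y / πM ^ i * θ₀ ^ p + cycTrace p σ y / πM ^ i * θ₀ - c / πM ^ i -
        (cycNorm p σ y / πM ^ i * (θ₀ ^ p - θ ^ p) + cycTrace p σ y / πM ^ i * (θ₀ - θ))) := by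
    field_simp; ring
  rw [h4, map_mul, map_pow]
  exact mul_lt_of_lt_one_right hQ h3

theorem v_norm_sub_lt {i : ℕ} {y : Ω}
    (hy : ∀ k, 1 < k → k < p → D.v (cycSymm p σ k y) < D.v πM ^ i) {θ c : Ω} (hθ : σ θ = θ)
    (hθ1 : D.v θ ≤ 1)
    (hc : D.v (cycTrace p σ y * θ + cycNorm p σ y * θ ^ p - c) < D.v πM ^ i) :
    D.v (cycNorm p σ (1 + θ * y) - (1 + c)) < D.v πM ^ i := by
  have h1 := D.v_cycNorm_one_add_sub_lt (σ := σ) (pow_pos h.v_πM_pos i) hy hθ hθ1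
  have := D.v_add_lt h1 hc
  convert this using 2
  ring

theorem cycNorm_one_add_mem {N : IntermediateField F Ω} (hMN : M ≤ N) {y θ : Ω} (hy : y ∈ L)
    (hθ : θ ∈ N) (hθσ : σ θ = θ) : cycNorm p σ (1 + θ * y) ∈ N := by
  rw [cycNorm_one_add hθσ]
  refine sum_mem fun k hk => mul_mem ?_ (pow_mem hθ k)
  rcases Nat.eq_zero_or_pos k with rfl | hk0
  · rw [cycSymm_zero]; exact one_mem _
  · exact hMN (h.cycSymm_mem_M hy hk0 (by rw [Finset.mem_range] at hk; omega))

/-- From level `i₀` on, the norm equation is solved exactly by Hensel's lemma. Successive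
approximation therefore ends after finitely many layers, and no completeness of the infinite
extension `L'` is needed. -/
theorem exists_dominant : ∃ i₀, ∃ y ∈ L, D.v y < 1 ∧ D.v (cycTrace p σ y) = D.v πM ^ i₀ ∧
    ∀ k, 1 < k → k ≤ p → D.v (cycSymm p σ k y) < D.v (cycTrace p σ y) := by
  obtain ⟨i, hi, hx⟩ := h.exists_trace_level
  obtain ⟨j, hij, y, hyL, hyj, hyt, hys⟩ := h.exists_trace_extremal hx
  refine ⟨i + 1, πM * y, mul_mem (h.M_le h.πM_mem) hyL, ?_, ?_,
    h.trace_dominant_mul hi hij hyL hyj hyt hys⟩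
  · rw [map_mul, hyj]
    exact (mul_le_of_le_one_right h.v_πM_pos.le
      (pow_le_one₀ h.v_πL_pos.le h.v_πL_lt.le)).trans_lt h.v_πM_lt
  · rw [cycTrace_mul (h.apply_eq h.πM_mem), map_mul, hyt, pow_succ']

/-- One layer at a time: a solution of the leading equation gives `1 + θ y` in `L'`, and dividing
`α` by its norm moves `α` to the next layer, until the trace dominates. -/
theorem exists_norm_eq_principal [IsSepClosed Ω] [Algebra.IsAlgebraic F Ω] {i : ℕ} (hi : 1 ≤ i)
    {α : Ω} (hα : α ∈ K) (hαi : D.v (α - 1) ≤ D.v πM ^ i) :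
    ∃ β ∈ L', D.v β = 1 ∧ cycNorm p σ β = α := by
  obtain ⟨i₀, y₀, hy₀L, hy₀1, hy₀t, hdom⟩ := h.exists_dominant
  -- Only `i₀ ≤ n + i` is retained: `n` bounds the number of layers left before the dominated range.
  obtain ⟨m, hm⟩ : ∃ m, m + i = i₀ + i := ⟨i₀, rfl⟩
  generalize hn : m = n at hm
  have hm' : i₀ ≤ n + i := by omega
  clear hm hn m
  induction n generalizing i α with
  | zero =>
    obtain ⟨θ, hθK, hθ1, hθ⟩ := h.exists_norm_eq_of_trace_dominant hy₀L hdom h.M_le_K h.apply_K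
      (sub_mem hα (one_mem _)) (hαi.trans (by
        rw [hy₀t]; exact pow_le_pow_of_le_one h.v_πM_pos.le h.v_πM_lt.le (by omega)))
    exact ⟨1 + θ * y₀, add_mem (one_mem _) (mul_mem (h.K_le hθK) (h.L_le hy₀L)),
      D.v_one_add hθ1 hy₀1, by rw [hθ]; ring⟩
  | succ n ih =>
    obtain ⟨y, hyL, hy1, hys, hcases⟩ := h.level_cases hi
    obtain ⟨θ, hθK, hθ1, hθ⟩ := h.exists_root_level (i := i) (by
        rcases hcases with h1 | h1 | h1
        · exact ⟨h1.1.le, h1.2.le⟩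
        · exact ⟨h1.1.le, h1.2.le⟩
        · exact ⟨h1.1.le, h1.2.1.le⟩) (by
        rcases hcases with h1 | h1 | h1
        · exact Or.inl h1.2
        · exact Or.inr h1.1
        · exact Or.inr h1.1) hαi
    have h1 := h.v_norm_sub_lt hys (h.apply_K θ hθK) hθ1 hθ
    rw [add_sub_cancel] at h1
    have hv := D.v_one_add hθ1 hy1
    have hN1 := D.v_cycNorm_eq_one (σ := σ) hv
    have hNK := h.cycNorm_one_add_mem h.M_le_K hyL hθK (h.apply_K θ hθK)
    obtain ⟨β, hβL, hβ1, hβ⟩ := ih (i := i + 1) (by omega) (div_mem hα hNK) (by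
      refine h.le_succ_of_lt (sub_mem (div_mem hα hNK) (one_mem _)) ?_
      rwa [D.v_div_sub_one hN1]) (by omega)
    have hN0 : cycNorm p σ (1 + θ * y) ≠ 0 := by intro h0; simp [h0] at hN1
    refine ⟨(1 + θ * y) * β, mul_mem (add_mem (one_mem _) (mul_mem (h.K_le hθK) (h.L_le hyL))) hβL,
      by rw [map_mul, hv, hβ1, one_mul], ?_⟩
    rw [cycNorm_mul, hβ, mul_div_cancel₀ _ hN0]

/-- The norm is surjective on units over the unramified base change. -/
theorem exists_norm_eq [IsSepClosed Ω] [Algebra.IsAlgebraic F Ω] {α : Ω} (hα : α ∈ K)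
    (hα1 : D.v α = 1) : ∃ β ∈ L', D.v β = 1 ∧ cycNorm p σ β = α := by
  -- Elements of `K` have norm equal to their `p`-th power, so a `p`-th root of the residue reduces
  -- the problem to principal units.
  obtain ⟨θ₀, hθ₀, hroot⟩ := D.exists_root_integers (a := 1) (b := 0) (c := α) (by simp) (by simp)
    hα1.le (by simp)
  rw [one_mul, zero_mul, add_zero] at hroot
  obtain ⟨θ, hθK, hθ⟩ := h.res_K θ₀ hθ₀
  have hθ1 : D.v θ ≤ 1 := by
    have := D.v_sub_le' hθ₀ hθ.le
    simpa using this
  have h1 : D.v (θ ^ p - α) < 1 := by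
    have h2 := D.v_sub_lt hroot ((D.v_pow_sub_pow_le hθ₀ hθ1 p).trans_lt hθ)
    simpa using h2
  have h3 : D.v (θ ^ p) = 1 := D.v_eq_one_of_sub_lt hα1 (by rwa [D.v_sub_comm])
  have hθv : D.v θ = 1 := by
    rw [map_pow] at h3
    exact (pow_eq_one_iff_of_nonneg (D.v.nonneg _) hp.out.ne_zero).1 h3
  have hαθ : α / θ ^ p ∈ K := div_mem hα (pow_mem hθK p)
  obtain ⟨β, hβL, hβ1, hβ⟩ := h.exists_norm_eq_principal le_rfl hαθ (by
    refine h.le_succ_of_lt (i := 0) (sub_mem hαθ (one_mem _)) ?_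
    rwa [D.v_div_sub_one h3, pow_zero])
  refine ⟨θ * β, mul_mem (h.K_le hθK) hβL, by rw [map_mul, hθv, hβ1, one_mul], ?_⟩
  have h0 : θ ^ p ≠ 0 := by intro h0; simp [h0] at h3
  rw [cycNorm_mul, hβ, cycNorm_of_apply_eq (h.apply_K θ hθK), mul_div_cancel₀ _ h0]

/-- On the Artin–Schreier layer, a norm `1 + c` from the base change whose preimage is fixed by `T`
up to `σ - 1` is congruent to a norm from `L`. -/
theorem exists_descent [IsSepClosed Ω] [Algebra.IsAlgebraic F Ω] {i : ℕ} (hi : 1 ≤ i) {y : Ω}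
    (hyL : y ∈ L) (hy1 : D.v y < 1)
    (hyk : ∀ k, 1 < k → k < p → D.v (cycSymm p σ k y) < D.v πM ^ i)
    (ht : D.v (cycTrace p σ y) = D.v πM ^ i) (hN : D.v (cycNorm p σ y) = D.v πM ^ i)
    (hyi : D.v y = D.v πL ^ i)
    (hys : ∀ z ∈ L, D.v z < D.v y → D.v (cycTrace p σ z) < D.v πM ^ i)
    {α : Ω} (hα : α ∈ M) (hαi : D.v (α - 1) ≤ D.v πM ^ i)
    {β : Ω} (hβ : β ∈ L') (hβ1 : D.v β = 1) (hβα : cycNorm p σ β = α)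
    (hT : ∀ φ ∈ T, ∃ u ∈ L', D.v u = 1 ∧ φ β / β = σ u / u) :
    ∃ θ ∈ M, D.v θ ≤ 1 ∧
      D.v (cycTrace p σ y * θ + cycNorm p σ y * θ ^ p - (α - 1)) < D.v πM ^ i := by
  have hq := h.v_πL_pos
  have hqi := pow_pos hq i
  have hy0 : y ≠ 0 := by intro h0; rw [h0, map_zero] at hyi; linarith
  have hne : ∀ x, D.v x = 1 → x ≠ 0 := fun x hx h0 => by simp [h0] at hx
  obtain ⟨θ, hθK, hθ1, hθ⟩ := h.exists_root_level ⟨ht.le, hN.le⟩ (Or.inl hN) hαi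
  have h1 := h.v_norm_sub_lt hyk (h.apply_K θ hθK) hθ1 hθ
  rw [add_sub_cancel] at h1
  have hv := D.v_one_add hθ1 hy1
  have hN1 := D.v_cycNorm_eq_one (σ := σ) hv
  have hNK := h.cycNorm_one_add_mem h.M_le_K hyL hθK (h.apply_K θ hθK)
  have hquot : α / cycNorm p σ (1 + θ * y) - 1 ∈ K :=
    sub_mem (div_mem (h.M_le_K hα) hNK) (one_mem _)
  have hπy : D.v (πM * y) < D.v y := by
    rw [map_mul]; exact mul_lt_of_lt_one_left (D.v_pos hy0) h.v_πM_lt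
  -- The solution on the layer is corrected to an exact one, `β'`, by a factor `1 + θ' πM y`, which
  -- is closer to `1` than `y` is small.
  obtain ⟨θ', hθ'K, hθ'1, hθ'⟩ := h.exists_norm_eq_of_trace_dominant
    (mul_mem (h.M_le h.πM_mem) hyL) (h.trace_dominant_mul hi le_rfl hyL hyi ht hys) h.M_le_K
    h.apply_K hquot (by
      rw [cycTrace_mul (h.apply_eq h.πM_mem), map_mul, ht, ← pow_succ']
      refine h.le_succ_of_lt hquot ?_
      rwa [D.v_div_sub_one hN1])
  rw [add_sub_cancel] at hθ'
  set β' := (1 + θ * y) * (1 + θ' * (πM * y)) with hβ'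
  have hβ'L : β' ∈ L' := mul_mem (add_mem (one_mem _) (mul_mem (h.K_le hθK) (h.L_le hyL)))
    (add_mem (one_mem _) (mul_mem (h.K_le hθ'K) (h.L_le (mul_mem (h.M_le h.πM_mem) hyL))))
  have hβ'1 : D.v β' = 1 := by
    rw [hβ', map_mul, hv, D.v_one_add hθ'1 (hπy.trans hy1), one_mul]
  have hβ'α : cycNorm p σ β' = α := by
    rw [hβ', cycNorm_mul, hθ', mul_div_cancel₀ _ (hne _ hN1)]
  -- `β` and `β'` have the same norm, so they differ by some `σ w / w`. Hence `φ β' / β'` is again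
  -- of the form `σ` of a unit over that unit, since `w / φ w` is a unit even if `w` is not.
  obtain ⟨w, hwL, hw0, hw⟩ := h.hilbert90 (β / β') (div_mem hβ hβ'L) (by
    rw [cycNorm_div, hβα, hβ'α, div_self]
    rw [← hβα]; exact hne _ (D.v_cycNorm_eq_one hβ1))
  -- On the Artin–Schreier layer `i`, the action of `σ` on units is trivial beyond that layer.
  have hram : ∀ u ∈ L', D.v u = 1 → D.v (σ u / u - 1) < D.v πL ^ i := by
    intro u huL hu
    rw [D.v_div_sub_one hu, D.v_sub_comm]
    refine (h.v_apply_sub_le hqi (h.v_apply_πL_le fun z hz hzv => hys z hz (by rwa [hyi]))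
      (h.L_le h.πL_mem) h.exists_zpow_L' (fun x _ hx => ?_) huL hu.le).trans_lt
      (mul_lt_of_lt_one_left hqi h.v_πL_lt)
    obtain ⟨b, hbK, hb⟩ := h.res_K x hx
    exact ⟨b, h.K_le hbK, h.apply_K b hbK, hb⟩
  have hφ : ∀ φ ∈ T, D.v (φ θ - θ) < 1 := by
    intro φ hφT
    obtain ⟨u, huL, hu1, hu⟩ := hT φ hφT
    have hφw0 : φ w ≠ 0 := by simpa using hw0
    have hu0 := hne u hu1
    have hβ0 := hne β hβ1
    have hβ'0 := hne β' hβ'1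
    have hφL := h.T_mem φ hφT w hwL
    have h2 : φ β' / β' = σ (u * (w / φ w)) / (u * (w / φ w)) := by
      have h3 : β' = β * w / σ w := by
        have : σ w ≠ 0 := by simpa using hw0
        field_simp at hw ⊢
        linear_combination -hw
      have hσw : σ w ≠ 0 := by simpa using hw0
      have hσφw : σ (φ w) ≠ 0 := by simpa using hw0
      have hu' : φ β = β * (σ u / u) := by rw [← hu, mul_div_cancel₀ _ hβ0]
      rw [h3, map_div₀, map_mul, h.T_comm φ hφT w hwL, hu', map_mul, map_div₀]
      field_simp
    have h4 : D.v (u * (w / φ w)) = 1 := by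
      rw [map_mul, hu1, one_mul, map_div₀, D.v_gal, div_self (D.v_pos hw0).ne']
    have h5 := hram _ (mul_mem huL (div_mem hwL hφL)) h4
    rw [← h2, D.v_div_sub_one hβ'1, D.v_sub_comm] at h5
    have h6 : D.v (β' - (1 + θ * y)) < D.v πL ^ i := by
      have : β' - (1 + θ * y) = (1 + θ * y) * (θ' * (πM * y)) := by rw [hβ']; ring
      rw [this, map_mul, hv, one_mul, map_mul, ← hyi]
      exact (mul_le_of_le_one_left (D.v.nonneg _) hθ'1).trans_lt hπy
    have h7 : D.v (φ (β' - (1 + θ * y))) < D.v πL ^ i := by rwa [D.v_gal]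
    -- Both the correction factor and `φ β' - β'` are smaller than `y`, which leaves `(φ θ - θ) y`
    -- smaller than `y`: the residue of `θ` is invariant under `T`.
    have h8 := D.v_add_lt (D.v_sub_lt h6 h7) h5
    have h9 : β' - (1 + θ * y) - φ (β' - (1 + θ * y)) + (φ β' - β') = (φ θ - θ) * y := by
      simp only [map_sub, map_add, map_mul, map_one, h.T_apply φ hφT y hyL]; ring
    rw [D.v_sub_comm] at h5
    have h10 : β' - (1 + θ * y) - φ (β' - (1 + θ * y)) + (φ β' - β') = (φ θ - θ) * y := h9
    rw [h10, map_mul, hyi] at h8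
    by_contra! hcon
    nlinarith
  obtain ⟨a, haM, ha⟩ := h.res_T θ hθ1 hφ
  have ha1 : D.v a ≤ 1 := by
    have := D.v_sub_le' hθ1 ha.le
    simpa using this
  refine ⟨a, haM, ha1, ?_⟩
  have hQ := pow_pos h.v_πM_pos i
  have h11 : D.v (cycTrace p σ y * (θ - a)) < D.v πM ^ i := by
    rw [map_mul, ht]; exact mul_lt_of_lt_one_right hQ ha
  have h12 : D.v (cycNorm p σ y * (θ ^ p - a ^ p)) < D.v πM ^ i := by
    rw [map_mul, hN]
    exact mul_lt_of_lt_one_right hQ ((D.v_pow_sub_pow_le hθ1 ha1 p).trans_lt ha)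
  have h13 := D.v_sub_lt hθ (D.v_add_lt h11 h12)
  convert h13 using 2
  ring

/-- A `p`-th root of a residue is unique in characteristic `p`. So it is fixed by `T` along with the
residue of `c`, and it comes from `M`. -/
theorem exists_pow_sub_lt [IsSepClosed Ω] {c : Ω} (hc : c ∈ M) (hc1 : D.v c ≤ 1) :
    ∃ θ ∈ M, D.v θ ≤ 1 ∧ D.v (θ ^ p - c) < 1 := by
  obtain ⟨θ₀, hθ₀, hroot⟩ := D.exists_root_integers (a := 1) (b := 0) (c := c) (by simp) (by simp)
    hc1 (by simp)
  rw [one_mul, zero_mul, add_zero] at hroot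
  obtain ⟨a, haM, ha⟩ := h.res_T θ₀ hθ₀ (fun φ hφ => by
    refine D.v_sub_lt_of_pow (by rwa [D.v_gal]) hθ₀ ?_
    have h1 : D.v (φ (θ₀ ^ p - c)) < 1 := by rwa [D.v_gal]
    have h2 := D.v_sub_lt h1 hroot
    rw [map_sub φ, h.T_apply φ hφ c (h.M_le hc), map_pow] at h2
    convert h2 using 2
    ring)
  have ha1 : D.v a ≤ 1 := by
    have := D.v_sub_le' hθ₀ ha.le
    simpa using this
  refine ⟨a, haM, ha1, ?_⟩
  have h2 := D.v_sub_lt hroot ((D.v_pow_sub_pow_le hθ₀ ha1 p).trans_lt ha)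
  simpa using h2

/-- The same approximation as over the base change, but with solutions in `M`. Layers of `p`-th
powers and linear layers are solvable there unconditionally. The condition on `φ β / β` enters only
on an Artin–Schreier layer. -/
theorem exists_norm_of_level [IsSepClosed Ω] [Algebra.IsAlgebraic F Ω] {i : ℕ} (hi : 1 ≤ i)
    {α : Ω} (hα : α ∈ M) (hαi : D.v (α - 1) ≤ D.v πM ^ i) {β : Ω} (hβ : β ∈ L')
    (hβ1 : D.v β = 1) (hβα : cycNorm p σ β = α)
    (hT : ∀ φ ∈ T, ∃ u ∈ L', D.v u = 1 ∧ φ β / β = σ u / u) :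
    ∃ γ ∈ L, D.v γ = 1 ∧ cycNorm p σ γ = α := by
  obtain ⟨i₀, y₀, hy₀L, hy₀1, hy₀t, hdom⟩ := h.exists_dominant
  obtain ⟨n, hm'⟩ : ∃ n, i₀ ≤ n + i := ⟨i₀, by omega⟩
  induction n generalizing i α β with
  | zero =>
    obtain ⟨θ, hθK, hθ1, hθ⟩ := h.exists_norm_eq_of_trace_dominant hy₀L hdom le_rfl
      (fun x hx => h.apply_eq hx) (sub_mem hα (one_mem _)) (hαi.trans (by
        rw [hy₀t]; exact pow_le_pow_of_le_one h.v_πM_pos.le h.v_πM_lt.le (by omega)))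
    exact ⟨1 + θ * y₀, add_mem (one_mem _) (mul_mem (h.M_le hθK) hy₀L),
      D.v_one_add hθ1 hy₀1, by rw [hθ]; ring⟩
  | succ n ih =>
    obtain ⟨y, hyL, hy1, hys, hcases⟩ := h.level_cases hi
    have hQ := pow_pos h.v_πM_pos i
    obtain ⟨θ, hθM, hθ1, hθ⟩ : ∃ θ ∈ M, D.v θ ≤ 1 ∧
        D.v (cycTrace p σ y * θ + cycNorm p σ y * θ ^ p - (α - 1)) < D.v πM ^ i := by
      rcases hcases with ⟨h1, h2⟩ | ⟨h1, h2⟩ | ⟨h1, h2, h3, h4⟩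
      · have hNM := h.cycNorm_mem hyL
        have hN0 : cycNorm p σ y ≠ 0 := by intro h0; rw [h0, map_zero] at h2; linarith
        obtain ⟨θ, hθM, hθ1, hθ⟩ := h.exists_pow_sub_lt
          (div_mem (sub_mem hα (one_mem _)) hNM) (by
            rw [map_div₀, h2]; exact div_le_one_of_le₀ hαi hQ.le)
        refine ⟨θ, hθM, hθ1, ?_⟩
        have h5 : D.v (cycNorm p σ y * (θ ^ p - (α - 1) / cycNorm p σ y)) < D.v πM ^ i := by
          rw [map_mul, h2]; exact mul_lt_of_lt_one_right hQ hθ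
        have h6 : D.v (cycTrace p σ y * θ) < D.v πM ^ i := by
          rw [map_mul]; exact (mul_le_of_le_one_right (D.v.nonneg _) hθ1).trans_lt h1
        have h7 := D.v_add_lt h6 h5
        convert h7 using 2
        field_simp
        ring
      · have hTM := h.cycTrace_mem hyL
        have hT0 : cycTrace p σ y ≠ 0 := by intro h0; rw [h0, map_zero] at h1; linarith
        have hθ1 : D.v ((α - 1) / cycTrace p σ y) ≤ 1 := by
          rw [map_div₀, h1]; exact div_le_one_of_le₀ hαi hQ.le
        refine ⟨(α - 1) / cycTrace p σ y, div_mem (sub_mem hα (one_mem _)) hTM, hθ1, ?_⟩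
        rw [mul_div_cancel₀ _ hT0, add_sub_cancel_left, map_mul, map_pow]
        exact (mul_le_of_le_one_right (D.v.nonneg _)
          (pow_le_one₀ (D.v.nonneg _) hθ1)).trans_lt h2
      · exact h.exists_descent hi hyL hy1 hys h1 h2 h3 h4 hα hαi hβ hβ1 hβα hT
    have h1 := h.v_norm_sub_lt hys (h.apply_eq hθM) hθ1 hθ
    rw [add_sub_cancel] at h1
    have hv := D.v_one_add hθ1 hy1
    have hN1 := D.v_cycNorm_eq_one (σ := σ) hv
    have hNM := h.cycNorm_one_add_mem le_rfl hyL hθM (h.apply_eq hθM)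
    have hγL : 1 + θ * y ∈ L := add_mem (one_mem _) (mul_mem (h.M_le hθM) hyL)
    have hN0 : cycNorm p σ (1 + θ * y) ≠ 0 := by intro h0; simp [h0] at hN1
    have hv0 : 1 + θ * y ≠ 0 := by intro h0; simp [h0] at hv
    -- Since `1 + θ y` is in `L`, it is fixed by `T`, and dividing `β` by it leaves `φ β / β`
    -- unchanged.
    obtain ⟨γ, hγL', hγ1, hγ⟩ := ih (i := i + 1) (by omega) (div_mem hα hNM) (by
      refine h.le_succ_of_lt (sub_mem (div_mem (h.M_le_K hα) (h.M_le_K hNM)) (one_mem _)) ?_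
      rwa [D.v_div_sub_one hN1]) (div_mem hβ (h.L_le hγL)) (by rw [map_div₀, hβ1, hv, div_one])
      (by rw [cycNorm_div, hβα]) (fun φ hφ => by
        obtain ⟨u, huL, hu1, hu⟩ := hT φ hφ
        refine ⟨u, huL, hu1, ?_⟩
        rw [← hu, map_div₀, h.T_apply φ hφ _ hγL, div_div_div_cancel_right₀ hv0]) (by omega)
    refine ⟨(1 + θ * y) * γ, mul_mem hγL hγL', by rw [map_mul, hv, hγ1, one_mul], ?_⟩
    rw [cycNorm_mul, hγ, mul_div_cancel₀ _ hN0]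

/-- A unit of `M` that is the norm of some `β` with `φ β / β` in `(σ - 1) U` for all `φ ∈ T` is the
norm of a unit of `L`. -/
theorem exists_norm_of_descent [IsSepClosed Ω] [Algebra.IsAlgebraic F Ω] {α : Ω} (hα : α ∈ M)
    {β : Ω} (hβ : β ∈ L') (hβ1 : D.v β = 1) (hβα : cycNorm p σ β = α)
    (hT : ∀ φ ∈ T, ∃ u ∈ L', D.v u = 1 ∧ φ β / β = σ u / u) :
    ∃ γ ∈ L, D.v γ = 1 ∧ cycNorm p σ γ = α := by
  have hα1 : D.v α = 1 := by rw [← hβα]; exact D.v_cycNorm_eq_one hβ1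
  obtain ⟨θ, hθM, hθ1, h1⟩ := h.exists_pow_sub_lt hα hα1.le
  have h3 : D.v (θ ^ p) = 1 := D.v_eq_one_of_sub_lt hα1 (by rwa [D.v_sub_comm])
  have hθv : D.v θ = 1 := by
    rw [map_pow] at h3
    exact (pow_eq_one_iff_of_nonneg (D.v.nonneg _) hp.out.ne_zero).1 h3
  have h0 : θ ^ p ≠ 0 := by intro h0; simp [h0] at h3
  have hθ0 : θ ≠ 0 := by intro h0; simp [h0] at hθv
  have hαθ : α / θ ^ p ∈ M := div_mem hα (pow_mem hθM p)
  have hNθ := cycNorm_of_apply_eq (p := p) (h.apply_eq hθM)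
  obtain ⟨γ, hγL, hγ1, hγ⟩ := h.exists_norm_of_level le_rfl hαθ (by
    refine h.le_succ_of_lt (i := 0) (h.M_le_K (sub_mem hαθ (one_mem _))) ?_
    rwa [D.v_div_sub_one h3, pow_zero]) (div_mem hβ (h.L_le (h.M_le hθM)))
    (by rw [map_div₀, hβ1, hθv, div_one]) (by rw [cycNorm_div, hβα, hNθ])
    (fun φ hφ => by
        obtain ⟨u, huL, hu1, hu⟩ := hT φ hφ
        refine ⟨u, huL, hu1, ?_⟩
        rw [← hu, map_div₀, h.T_apply φ hφ _ (h.M_le hθM), div_div_div_cancel_right₀ hθ0])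
  refine ⟨θ * γ, mul_mem (h.M_le hθM) hγL, by rw [map_mul, hθv, hγ1, one_mul], ?_⟩
  rw [cycNorm_mul, hγ, hNθ, mul_div_cancel₀ _ h0]

end StepExt

end PClassFieldTheory

/-! ### Totally ramified extensions as subgroups, uniformizers, and steps of degree p -/

namespace PClassFieldTheory

open IntermediateField

variable {p : ℕ} [hp : Fact p.Prime] {F Ω : Type*} [Field F] [Field Ω] [Algebra F Ω]

theorem isTransversal_zpowZMod {A B : Subgroup Gal(Ω/F)}
    (hn : ∀ a ∈ A, ∀ b ∈ B, a * b * a⁻¹ ∈ B) (hidx : B.relIndex A = p) {σ : Gal(Ω/F)}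
    (hσA : σ ∈ A) (hσB : σ ∉ B) : σ ^ p ∈ B ∧ IsTransversal A B (zpowZMod p σ) := by
  have hnorm : (B.subgroupOf A).Normal := ⟨fun b hb a => hn a a.2 b hb⟩
  have hcard : Nat.card (A ⧸ B.subgroupOf A) = p := hidx
  set s : A ⧸ B.subgroupOf A := QuotientGroup.mk ⟨σ, hσA⟩ with hs
  have hs1 : s ≠ 1 := by
    rw [hs, Ne, QuotientGroup.eq_one_iff, Subgroup.mem_subgroupOf]; exact hσB
  have hsp : s ^ p = 1 := by rw [← hcard]; exact pow_card_eq_one'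
  have hord : orderOf s = p := orderOf_eq_prime hsp hs1
  have hmk : ∀ n : ℕ, (QuotientGroup.mk ⟨σ ^ n, A.pow_mem hσA n⟩ : A ⧸ B.subgroupOf A) = s ^ n :=
    fun n => rfl
  refine ⟨?_, fun a => A.pow_mem hσA _, fun a ha => ?_⟩
  · rw [← hmk, QuotientGroup.eq_one_iff, Subgroup.mem_subgroupOf] at hsp; exact hsp
  have hmem : (QuotientGroup.mk ⟨a, ha⟩ : A ⧸ B.subgroupOf A) ∈ Submonoid.powers s := by
    have : Finite (A ⧸ B.subgroupOf A) := Nat.finite_of_card_ne_zero (by rw [hcard]; exact hp.out.ne_zero)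
    rw [mem_powers_iff_mem_zpowers]
    exact mem_zpowers_of_prime_card hcard hs1
  obtain ⟨n, hn'⟩ := hmem
  have hiff : ∀ m : ZMod p, (zpowZMod p σ m)⁻¹ * a ∈ B ↔ s ^ m.val = s ^ n := by
    intro m
    change _ ↔ s ^ m.val = (fun k => s ^ k) n
    rw [hn', ← hmk, QuotientGroup.eq, Subgroup.mem_subgroupOf]
    rfl
  refine ⟨(n : ZMod p), ?_, fun m hm => ?_⟩
  · simp only [hiff]
    rw [ZMod.val_natCast, ← hord, pow_mod_orderOf]
  · simp only [hiff] at hm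
    rw [pow_inj_mod, hord, Nat.mod_eq_of_lt (ZMod.val_lt m), ← ZMod.val_natCast] at hm
    exact ZMod.val_injective p hm

namespace ValuedClosure

variable (D : ValuedClosure p F Ω)

/-- `S` is the group of a finite totally ramified extension of `F`. -/
structure TotRam (S : Subgroup Gal(Ω/F)) : Prop where
  isOpen : IsOpen (S : Set Gal(Ω/F))
  exists_mul : ∀ g, ∃ s ∈ S, ∃ i ∈ D.inertia, g = s * i

/-- `T` is normal in `S` of `p`-power index, and belongs to a totally ramified extension. -/
structure Pair (S T : Subgroup Gal(Ω/F)) : Prop where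
  le : T ≤ S
  normal : ∀ s ∈ S, ∀ t ∈ T, s * t * s⁻¹ ∈ T
  totRam : D.TotRam T
  exists_pow : ∃ n, T.relIndex S = p ^ n

/-- `π` is a uniformizer of the field fixed by `S`. -/
structure IsUnif (S : Subgroup Gal(Ω/F)) (π : Ω) : Prop where
  mem : π ∈ fixedField S
  ne_zero : π ≠ 0
  v_lt : D.v π < 1
  exists_zpow : ∀ x ∈ fixedField S, x ≠ 0 → ∃ n : ℤ, D.v x = D.v π ^ n

variable {D} {S T H : Subgroup Gal(Ω/F)}

theorem IsUnif.v_pos {π : Ω} (h : D.IsUnif S π) : 0 < D.v π := D.v_pos h.ne_zero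

omit hp in
theorem TotRam.mono (h : D.TotRam T) (hTS : T ≤ S) : D.TotRam S := by
  refine ⟨Subgroup.isOpen_mono hTS h.isOpen, fun g => ?_⟩
  obtain ⟨s, hs, i, hi, rfl⟩ := h.exists_mul g
  exact ⟨s, hTS hs, i, hi, rfl⟩

theorem Pair.totRam_left (h : D.Pair S T) : D.TotRam S := h.totRam.mono h.le

omit hp in
theorem TotRam.exists_mul_of_mem (h : D.TotRam T) (hTS : T ≤ S) {s : Gal(Ω/F)} (hs : s ∈ S) :
    ∃ t ∈ T, ∃ i ∈ S ⊓ D.inertia, s = t * i := by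
  obtain ⟨t, ht, i, hi, rfl⟩ := h.exists_mul s
  refine ⟨t, ht, i, ⟨?_, hi⟩, rfl⟩
  have := S.mul_mem (S.inv_mem (hTS ht)) hs
  simpa using this

omit hp in
theorem TotRam.exists_mul_of_mem' (h : D.TotRam T) (hTS : T ≤ S) {s : Gal(Ω/F)} (hs : s ∈ S) :
    ∃ t ∈ T, ∃ i ∈ S ⊓ D.inertia, s = i * t := by
  obtain ⟨t, ht, i, hi, hti⟩ := h.exists_mul_of_mem hTS (S.inv_mem hs)
  refine ⟨t⁻¹, T.inv_mem ht, i⁻¹, inv_mem hi, ?_⟩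
  rw [← inv_inj, hti]; simp

theorem Pair.conj_iff (h : D.Pair S T) {s : Gal(Ω/F)} (hs : s ∈ S) (t : Gal(Ω/F)) :
    s * t * s⁻¹ ∈ T ↔ t ∈ T := by
  refine ⟨fun ht => ?_, h.normal s hs t⟩
  have := h.normal _ (S.inv_mem hs) _ ht
  simpa [mul_assoc] using this

omit hp in
theorem conj_inertia_iff (s t : Gal(Ω/F)) : s * t * s⁻¹ ∈ D.inertia ↔ t ∈ D.inertia :=
  (Subgroup.Normal.mem_comm_iff (H := D.inertia) inferInstance).trans (by simp)

omit hp in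
theorem conj_self_iff {s : Gal(Ω/F)} (hs : s ∈ S) (t : Gal(Ω/F)) : s * t * s⁻¹ ∈ S ↔ t ∈ S := by
  rw [S.mul_mem_cancel_right (S.inv_mem hs), S.mul_mem_cancel_left hs]

theorem Pair.conj_iff' (h : D.Pair S T) {s : Gal(Ω/F)} (hs : s ∈ S) (t : Gal(Ω/F)) :
    s * t * s⁻¹ ∈ T ⊓ D.inertia ↔ t ∈ T ⊓ D.inertia := by
  rw [Subgroup.mem_inf, Subgroup.mem_inf, h.conj_iff hs, conj_inertia_iff]

omit hp in
theorem conj_self_iff' {s : Gal(Ω/F)} (hs : s ∈ S) (t : Gal(Ω/F)) :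
    s * t * s⁻¹ ∈ S ⊓ D.inertia ↔ t ∈ S ⊓ D.inertia := by
  rw [Subgroup.mem_inf, Subgroup.mem_inf, conj_self_iff hs, conj_inertia_iff]

section Galois

variable [IsGalois F Ω]

omit hp in
theorem relIndex_inf_ne_zero (hT : IsOpen (T : Set Gal(Ω/F))) :
    (T ⊓ D.inertia).relIndex (S ⊓ D.inertia) ≠ 0 := by
  have h1 : (T ⊓ D.inertia).relIndex (S ⊓ D.inertia) = T.relIndex (S ⊓ D.inertia) := by
    rw [← Subgroup.inf_relIndex_right (T ⊓ D.inertia), ← Subgroup.inf_relIndex_right T]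
    congr 1
    ext x; simp only [Subgroup.mem_inf]; tauto
  rw [h1]
  exact relIndex_ne_zero_of_isOpen hT _

omit hp in
-- From `G = T·I` one gets `S = (S ⊓ I)·T`, so the unramified base change is linearly disjoint and
-- keeps the degree.
theorem TotRam.relIndex_inf (h : D.TotRam T) (hTS : T ≤ S) :
    (T ⊓ D.inertia).relIndex (S ⊓ D.inertia) = T.relIndex S := by
  have h0 := relIndex_inf_ne_zero (D := D) (S := S) h.isOpen
  have he : T ⊓ D.inertia = (S ⊓ D.inertia) ⊓ T := by
    ext x; simp only [Subgroup.mem_inf]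
    exact ⟨fun hx => ⟨⟨hTS hx.1, hx.2⟩, hx.1⟩, fun hx => ⟨hx.2, hx.1.2⟩⟩
  rw [he] at h0 ⊢
  obtain ⟨e, he'⟩ := exists_isTransversal h0
  have := he'.of_sup (A₂ := S) inf_le_left fun s hs => by
    obtain ⟨t, ht, i, hi, rfl⟩ := h.exists_mul_of_mem' hTS hs
    exact ⟨i, hi, by simpa using ht⟩
  rw [this.relIndex_eq, Fintype.card_fin]

omit hp in
/-- On the field fixed by `T`, the norm over the inertia groups is the usual norm. -/
theorem TotRam.relNorm_inf (h : D.TotRam T) (hTS : T ≤ S) {x : Ω} (hx : x ∈ fixedField T) :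
    relNorm (S ⊓ D.inertia) (T ⊓ D.inertia) x = relNorm S T x := by
  have h0 := relIndex_inf_ne_zero (D := D) (S := S) h.isOpen
  have he : T ⊓ D.inertia = (S ⊓ D.inertia) ⊓ T := by
    ext x; simp only [Subgroup.mem_inf]
    exact ⟨fun hx => ⟨⟨hTS hx.1, hx.2⟩, hx.1⟩, fun hx => ⟨hx.2, hx.1.2⟩⟩
  rw [he] at h0 ⊢
  symm
  exact PClassFieldTheory.relNorm_inf h0 inf_le_left (fun s hs => by
    obtain ⟨t, ht, i, hi, rfl⟩ := h.exists_mul_of_mem' hTS hs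
    exact ⟨i, hi, by simpa using ht⟩) hx

omit hp in
-- Taking the norm to `F` shows that the `n`-th power of each value is an integral power of the
-- value of the uniformizer of `F`. An element with the least positive exponent generates the value
-- group, by division with remainder.
theorem exists_isUnif (D : ValuedClosure p F Ω) (hS : IsOpen (S : Set Gal(Ω/F))) :
    ∃ π, D.IsUnif S π := by
  classical
  have h0 := relIndex_ne_zero_of_isOpen hS ⊤
  set n := S.relIndex ⊤ with hn
  set Q := D.v (algebraMap F Ω D.unif) with hQ
  have hu0 : algebraMap F Ω D.unif ≠ 0 := by simpa using D.unif_ne_zero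
  have hQ0 : 0 < Q := D.v_pos hu0
  have hQ1 : Q < 1 := D.v_unif_lt
  have hval : ∀ x ∈ fixedField S, x ≠ 0 → ∃ m : ℤ, D.v x ^ n = Q ^ m := by
    intro x hx hx0
    obtain ⟨a, ha⟩ := mem_fixedField_top_iff.1 (relNorm_mem h0 hx)
    have hv := D.v_relNorm h0 x
    have ha0 : a ≠ 0 := by
      rintro rfl
      rw [map_zero] at ha
      rw [← ha, map_zero] at hv
      exact (pow_pos (D.v_pos hx0) _).ne hv
    obtain ⟨m, hm⟩ := D.exists_zpow a ha0
    exact ⟨m, by rw [← hv, ← ha, hm]⟩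
  have hex : ∃ m : ℕ, 0 < m ∧ ∃ x ∈ fixedField S, x ≠ 0 ∧ D.v x ^ n = Q ^ m :=
    ⟨n, Nat.pos_of_ne_zero h0, algebraMap F Ω D.unif, (fixedField S).algebraMap_mem _, hu0, rfl⟩
  obtain ⟨hm0, π, hπ, hπ0, hπv⟩ := Nat.find_spec hex
  have hmin := fun k => Nat.find_min hex (m := k)
  set m := Nat.find hex with hm
  refine ⟨π, hπ, hπ0, ?_, fun x hx hx0 => ?_⟩
  · by_contra! h1
    have h2 : Q ^ m < 1 := pow_lt_one₀ hQ0.le hQ1 hm0.ne'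
    rw [← hπv] at h2
    exact absurd (one_le_pow₀ h1) (not_le.2 h2)
  · obtain ⟨k, hk⟩ := hval x hx hx0
    refine ⟨k / m, ?_⟩
    set x' := x / π ^ (k / (m : ℤ)) with hx'
    have hx'0 : x' ≠ 0 := div_ne_zero hx0 (zpow_ne_zero _ hπ0)
    have hx'v : D.v x' ^ n = Q ^ (k % (m : ℤ)).toNat := by
      have h1 : 0 ≤ k % (m : ℤ) := Int.emod_nonneg _ (by omega)
      rw [← zpow_natCast Q, Int.toNat_of_nonneg h1, hx', map_div₀, map_zpow₀, div_pow, hk,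
        ← zpow_natCast, ← zpow_mul, mul_comm, zpow_mul, zpow_natCast, hπv, ← zpow_natCast,
        ← zpow_mul, ← zpow_sub₀ hQ0.ne']
      congr 1
      have := Int.mul_ediv_add_emod k m
      linarith
    have hlt : (k % (m : ℤ)).toNat < m := by
      have := Int.emod_lt_of_pos k (show (0 : ℤ) < m by omega)
      omega
    have hz : (k % (m : ℤ)).toNat = 0 := by
      by_contra hne
      exact hmin _ hlt ⟨Nat.pos_of_ne_zero hne, x', div_mem hx (zpow_mem hπ _), hx'0, hx'v⟩
    rw [hz, pow_zero, pow_eq_one_iff_of_nonneg (D.v.nonneg _) h0, hx', map_div₀, map_zpow₀,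
      div_eq_one_iff_eq (zpow_pos (D.v_pos hπ0) _).ne'] at hx'v
    exact hx'v

omit hp in
theorem IsUnif.exists_zpow_inf {π : Ω} (h : D.IsUnif S π) (hS : IsOpen (S : Set Gal(Ω/F))) {x : Ω}
    (hx : x ∈ fixedField (S ⊓ D.inertia)) (hx0 : x ≠ 0) : ∃ n : ℤ, D.v x = D.v π ^ n := by
  obtain ⟨z, hz, hzx⟩ := D.exists_fixed_v_eq hS hx hx0
  rw [← hzx]
  exact h.exists_zpow z hz (fun h0 => by
    rw [h0, map_zero] at hzx; exact (D.v_pos hx0).ne hzx)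

omit hp in
theorem mem_of_forall_fixedField (hH : IsOpen (H : Set Gal(Ω/F))) {g : Gal(Ω/F)}
    (hg : ∀ x ∈ fixedField H, g x = x) : g ∈ H := by
  have h1 := InfiniteGalois.fixingSubgroup_fixedField
    (⟨H, Subgroup.isClosed_of_isOpen H hH⟩ : ClosedSubgroup Gal(Ω/F))
  have h2 : g ∈ (fixedField H).fixingSubgroup := by
    rw [IntermediateField.mem_fixingSubgroup_iff]; exact hg
  rw [h1] at h2
  exact h2

/-- Independence of the distinct characters given by the powers of `σ`. It supplies both an element
of non-zero trace and the resolvent in Hilbert's Theorem 90. -/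
theorem exists_combination_ne_zero {A B : Subgroup Gal(Ω/F)} {σ : Gal(Ω/F)}
    (hB : IsOpen (B : Set Gal(Ω/F))) (he : IsTransversal A B (zpowZMod p σ))
    {L' : IntermediateField F Ω} (hL' : fixedField B ≤ L') (c : ZMod p → Ω) {a : ZMod p}
    (ha : c a ≠ 0) : ∃ z ∈ L', ∑ a, c a * zpowZMod p σ a z ≠ 0 := by
  let χ : ZMod p → (L' →* Ω) := fun a =>
    (((zpowZMod p σ a : Ω →ₐ[F] Ω) : Ω →+* Ω).comp L'.val.toRingHom : L' →+* Ω)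
  have hχ : Function.Injective χ := by
    intro a b hab
    refine he.eq_of_mem (mem_of_forall_fixedField hB fun x hx => ?_)
    have h1 : zpowZMod p σ a x = zpowZMod p σ b x := DFunLike.congr_fun hab ⟨x, hL' hx⟩
    rw [AlgEquiv.mul_apply, ← h1]; simp
  have hli := (linearIndependent_monoidHom L' Ω).comp χ hχ
  rw [Fintype.linearIndependent_iff] at hli
  by_contra! hall
  refine ha (hli c ?_ a)
  funext z
  simpa using! hall z z.2

theorem prod_zmod_eq_prod_range {X : Type*} [CommMonoid X] (f : ℕ → X) :
    ∏ a : ZMod p, f a.val = ∏ n ∈ Finset.range p, f n := by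
  refine Finset.prod_bij (fun a _ => a.val) (fun a _ => Finset.mem_range.2 (ZMod.val_lt a))
    (fun a _ b _ h => ZMod.val_injective p h) (fun n hn => ⟨n, Finset.mem_univ _, ?_⟩)
    fun _ _ => rfl
  exact ZMod.val_cast_of_lt (Finset.mem_range.1 hn)

theorem sum_zmod_eq_sum_range {X : Type*} [AddCommMonoid X] (f : ℕ → X) :
    ∑ a : ZMod p, f a.val = ∑ n ∈ Finset.range p, f n :=
  prod_zmod_eq_prod_range (X := Multiplicative X) f

/-- The classical resolvent argument: with `c n = x · σ x ⋯ σ ^ (n - 1) x`, the sum `w` of the `c n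
· σ ^ n z` satisfies `x · σ w = w` because `c p = N x = 1`. The witness is `w⁻¹`. -/
theorem hilbert90_cyclic {A B : Subgroup Gal(Ω/F)} {σ : Gal(Ω/F)}
    (hB : IsOpen (B : Set Gal(Ω/F))) (he : IsTransversal A B (zpowZMod p σ))
    {L' : IntermediateField F Ω} (hL' : fixedField B ≤ L') (hσ : ∀ x ∈ L', σ x ∈ L')
    (hσp : ∀ x ∈ L', (σ ^ p) x = x) {x : Ω} (hx : x ∈ L') (hN : cycNorm p σ x = 1) :
    ∃ w ∈ L', w ≠ 0 ∧ x = σ w / w := by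
  have hpow : ∀ n : ℕ, ∀ y ∈ L', (σ ^ n) y ∈ L' := by
    intro n y hy
    induction n with
    | zero => exact hy
    | succ n ih => rw [pow_succ', AlgEquiv.mul_apply]; exact hσ _ ih
  let c : ℕ → Ω := fun n => ∏ b ∈ Finset.range n, (σ ^ b) x
  have hc0 : c 0 = 1 := by simp [c]
  have hcp : c p = 1 := by
    rw [← hN, cycNorm]
    exact (prod_zmod_eq_prod_range fun n => (σ ^ n) x).symm
  have hcs : ∀ n, x * σ (c n) = c (n + 1) := by
    intro n
    simp only [c, map_prod]
    rw [Finset.prod_range_succ']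
    rw [mul_comm]
    congr 1
    refine Finset.prod_congr rfl fun b _ => ?_
    rw [pow_succ', AlgEquiv.mul_apply]
  obtain ⟨z, hz, hne⟩ := exists_combination_ne_zero hB he hL' (fun a => c a.val) (a := 0)
    (by rw [ZMod.val_zero, hc0]; exact one_ne_zero)
  have hs : ∑ a : ZMod p, c a.val * zpowZMod p σ a z = ∑ n ∈ Finset.range p, c n * (σ ^ n) z :=
    sum_zmod_eq_sum_range fun n => c n * (σ ^ n) z
  rw [hs] at hne
  set w := ∑ n ∈ Finset.range p, c n * (σ ^ n) z with hw
  have hwL : w ∈ L' := sum_mem fun n _ => mul_mem (prod_mem fun b _ => hpow b x hx) (hpow n z hz)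
  have hxw : x * σ w = w := by
    have h1 : x * σ w = ∑ n ∈ Finset.range p, c (n + 1) * (σ ^ (n + 1)) z := by
      rw [hw, map_sum, Finset.mul_sum]
      refine Finset.sum_congr rfl fun n _ => ?_
      rw [map_mul, ← mul_assoc, hcs, pow_succ', AlgEquiv.mul_apply]
    have h2 := Finset.sum_range_succ' (fun n => c n * (σ ^ n) z) p
    rw [Finset.sum_range_succ, hcp, hσp z hz, hc0, pow_zero, AlgEquiv.one_apply] at h2
    rw [h1, hw]
    exact (add_right_cancel h2).symm
  refine ⟨w⁻¹, inv_mem hwL, inv_ne_zero hne, ?_⟩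
  have hσw : σ w ≠ 0 := by simpa using hne
  rw [map_inv₀]
  field_simp
  exact hxw

/-- If `πM` has exponent `m` with respect to `πL`, the value of the norm of `πL` shows `m ∣ p`. For
`m = 1` the value groups and the residue fields would both be unchanged, which forces the extension
to be trivial. -/
theorem v_unif_eq_pow_of_index_eq (h : D.Pair S H) (hidx : H.relIndex S = p) {πL πM : Ω}
    (hL : D.IsUnif H πL) (hM : D.IsUnif S πM) : D.v πM = D.v πL ^ p := by
  have hq := hL.v_pos
  have hq1 := hL.v_lt
  have hQ := hM.v_pos
  have hQ1 := hM.v_lt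
  obtain ⟨m, hm⟩ := hL.exists_zpow πM (fixedField_le h.le hM.mem) hM.ne_zero
  have h0 : H.relIndex S ≠ 0 := by rw [hidx]; exact hp.out.ne_zero
  obtain ⟨n, hn⟩ := hM.exists_zpow _ (relNorm_mem h0 hL.mem) (by simpa using hL.ne_zero)
  rw [D.v_relNorm h0, hidx, hm, ← zpow_mul, ← zpow_natCast] at hn
  have hmn : (p : ℤ) = m * n := zpow_right_injective₀ hq hq1.ne hn
  have hm0 : 0 < m := by
    rw [hm, ← zpow_zero (D.v πL), zpow_lt_zpow_iff_right_of_lt_one₀ hq hq1] at hQ1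
    exact hQ1
  lift m to ℕ using hm0.le
  have hdvd : m ∣ p := by
    have : (m : ℤ) ∣ p := ⟨n, hmn⟩
    exact_mod_cast this
  rcases (Nat.dvd_prime hp.out).1 hdvd with rfl | rfl
  · exfalso
    -- equal value groups and residue fields force `H = S`
    have hlt : ¬ S ≤ H := by
      intro hle
      rw [Subgroup.relIndex_eq_one.2 hle] at hidx
      exact hp.out.one_lt.ne hidx
    obtain ⟨s, hs, hsH⟩ := Set.not_subset.1 hlt
    obtain ⟨t, ht, σ, hσ, rfl⟩ := h.totRam.exists_mul_of_mem h.le hs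
    refine hsH (H.mul_mem ht (mem_of_forall_fixedField h.totRam.isOpen fun x hx => ?_))
    -- Expanding `x` in powers of `πM` with coefficients fixed by `S`, on which `σ` acts trivially,
    -- shows that `σ` moves `x` by arbitrarily little.
    have key : ∀ n : ℕ, ∀ x ∈ fixedField H, D.v x ≤ 1 → D.v (σ x - x) ≤ D.v πM ^ n := by
      intro n
      induction n with
      | zero =>
        intro x _ hx
        rw [pow_zero]
        exact D.v_sub_le' (by rwa [D.v_gal]) hx
      | succ n ih =>
        intro x hxH hx
        obtain ⟨a, haS, ha⟩ := D.exists_fixed_sub_lt h.totRam_left.isOpen hx (fun s hs => by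
          obtain ⟨t, ht, i, hi, rfl⟩ := h.totRam.exists_mul_of_mem' h.le hs
          rw [AlgEquiv.mul_apply, mem_fixedField.1 hxH t ht]
          exact D.mem_inertia.1 hi.2 x hx)
        have haH := fixedField_le h.le haS
        have hπH := fixedField_le h.le hM.mem
        set x' := (x - a) / πM with hx'
        have hx'1 : D.v x' ≤ 1 := by
          by_cases h0 : x - a = 0
          · simp [hx', h0]
          obtain ⟨k, hk⟩ := hL.exists_zpow _ (sub_mem hxH haH) h0
          have hk0 : 0 < k := by
            rw [hk, ← zpow_zero (D.v πL), zpow_lt_zpow_iff_right_of_lt_one₀ hq hq1] at ha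
            exact ha
          rw [hx', map_div₀, hk, hm, ← zpow_sub₀ hq.ne', ← zpow_zero (D.v πL),
            zpow_le_zpow_iff_right_of_lt_one₀ hq hq1]
          push_cast; omega
        have hxe : x = a + πM * x' := by rw [hx', mul_div_cancel₀ _ hM.ne_zero]; ring
        have h1 : σ x - x = πM * (σ x' - x') := by
          rw [hxe, map_add, map_mul, mem_fixedField.1 haS σ hσ.1, mem_fixedField.1 hM.mem σ hσ.1]
          ring
        rw [h1, map_mul, pow_succ']
        exact mul_le_mul_of_nonneg_left (ih x' (div_mem (sub_mem hxH haH) hπH) hx'1) hQ.le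
    have hint : ∀ x ∈ fixedField H, D.v x ≤ 1 → σ x = x := by
      intro x hx hx1
      by_contra hne
      obtain ⟨n, hn⟩ := exists_pow_lt_of_lt_one (D.v_pos (sub_ne_zero.2 hne)) hQ1
      exact absurd (key n x hx hx1) (not_le.2 hn)
    rcases le_total (D.v x) 1 with h1 | h1
    · exact hint x hx h1
    · have h2 := hint x⁻¹ (inv_mem hx) (by rw [map_inv₀]; exact inv_le_one_of_one_le₀ h1)
      rw [map_inv₀, inv_inj] at h2
      exact h2
  · rw [hm, zpow_natCast]

omit hp in
-- The commutator of `φ` and `σ` lies in `T`, which is normalized by `S`, and in the normal inertia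
-- group, so it acts trivially on `x`.
theorem Pair.comm_apply [Fact p.Prime] (h : D.Pair S T) {φ σ : Gal(Ω/F)} (hφ : φ ∈ T)
    (hσ : σ ∈ S ⊓ D.inertia) {x : Ω} (hx : x ∈ fixedField (T ⊓ D.inertia)) :
    φ (σ x) = σ (φ x) := by
  have h1 : φ⁻¹ * σ⁻¹ * φ * σ ∈ T ⊓ D.inertia := by
    refine ⟨?_, ?_⟩
    · have := h.normal _ (S.inv_mem hσ.1) φ hφ
      rw [inv_inv] at this
      simpa [mul_assoc] using T.mul_mem (T.inv_mem hφ) this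
    · have := (conj_inertia_iff (D := D) φ⁻¹ σ⁻¹).2 (D.inertia.inv_mem hσ.2)
      rw [inv_inv] at this
      exact D.inertia.mul_mem this hσ.2
  have h2 := mem_fixedField.1 hx _ h1
  have h3 := congrArg (fun y => σ (φ y)) h2
  simpa using h3

/-- Turns a normal subgroup of index `p` into the field data of the preceding part, with the base
changes `L'` and `K` cut out by inertia and `H` acting on the residues. -/
theorem Pair.stepExt (h : D.Pair S H) (hidx : H.relIndex S = p) {σ : Gal(Ω/F)}
    (hσ : σ ∈ S ⊓ D.inertia) (hσH : σ ∉ H) {πL πM : Ω} (hL : D.IsUnif H πL) (hM : D.IsUnif S πM) :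
    StepExt D σ (fixedField H) (fixedField S) πL πM (fixedField (H ⊓ D.inertia))
      (fixedField (S ⊓ D.inertia)) H := by
  obtain ⟨hσp, he⟩ := isTransversal_zpowZMod h.normal hidx hσ.1 hσH
  have hpow : ∀ x ∈ fixedField (H ⊓ D.inertia), (σ ^ p) x = x := fun x hx =>
    mem_fixedField.1 hx _ ⟨hσp, D.inertia.pow_mem hσ.2 p⟩
  have hmem : ∀ x ∈ fixedField (H ⊓ D.inertia), σ x ∈ fixedField (H ⊓ D.inertia) := fun x hx =>
    apply_mem_fixedField (fun a ha => by
      have := (h.conj_iff' (S.inv_mem hσ.1) a).2 ha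
      rwa [inv_inv] at this) hx
  have hle : fixedField H ≤ fixedField (H ⊓ D.inertia) := fun x hx => fixedField_le inf_le_left hx
  exact
  { mem_inertia := hσ.2
    apply_mem := fun x hx => apply_mem_fixedField (fun a ha => by
      have := h.normal _ (S.inv_mem hσ.1) a ha
      rwa [inv_inv] at this) hx
    pow_apply := fun x hx => mem_fixedField.1 hx _ hσp
    mem_iff := fun x => by
      refine ⟨fun hx => ⟨fixedField_le h.le hx, mem_fixedField.1 hx _ hσ.1⟩, fun hx => ?_⟩
      refine mem_fixedField.2 fun s hs => ?_
      obtain ⟨a, ha, -⟩ := he.existsUnique s hs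
      have h1 : s = zpowZMod p σ a * ((zpowZMod p σ a)⁻¹ * s) := by simp
      rw [h1, AlgEquiv.mul_apply, mem_fixedField.1 hx.1 _ ha, zpowZMod_apply_eq_self hx.2]
    πL_mem := hL.mem
    πM_mem := hM.mem
    πL_ne := hL.ne_zero
    v_πL_lt := hL.v_lt
    v_πM := v_unif_eq_pow_of_index_eq h hidx hL hM
    exists_zpow := hL.exists_zpow
    exists_zpow' := hM.exists_zpow
    exists_trace_ne := by
      obtain ⟨z, hz, hne⟩ := exists_combination_ne_zero h.totRam.isOpen he le_rfl (fun _ => 1)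
        (a := 0) one_ne_zero
      exact ⟨z, hz, by simpa [cycTrace] using hne⟩
    L_le := hle
    K_le := fun x hx => fixedField_le (inf_le_inf_right _ h.le) hx
    M_le_K := fun x hx => fixedField_le inf_le_left hx
    apply_K := fun x hx => mem_fixedField.1 hx _ hσ
    exists_zpow_L' := fun x hx hx0 => hL.exists_zpow_inf h.totRam.isOpen hx hx0
    exists_zpow_K := fun x hx hx0 => hM.exists_zpow_inf h.totRam_left.isOpen hx hx0
    res_K := fun a ha => by
      obtain ⟨b, hb, hab⟩ := D.exists_inertia_fixed_sub_lt ha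
      exact ⟨b, fixedField_le inf_le_right hb, hab⟩
    T_apply := fun φ hφ x hx => mem_fixedField.1 hx φ hφ
    T_mem := fun φ hφ x hx => apply_mem_fixedField (fun a ha => by
      have := (conj_self_iff' (D := D) (H.inv_mem hφ) a).2 ha
      rwa [inv_inv] at this) hx
    T_comm := fun φ hφ x hx => h.comm_apply hφ hσ hx
    res_T := fun x hx hφ => D.exists_fixed_sub_lt h.totRam_left.isOpen hx fun s hs => by
      obtain ⟨t, ht, i, hi, rfl⟩ := h.totRam.exists_mul_of_mem' h.le hs
      have h1 := D.mem_inertia.1 hi.2 (t x) (by rwa [D.v_gal])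
      have h2 := D.v_add_lt h1 (hφ t ht)
      simpa using h2
    hilbert90 := fun x hx hN => hilbert90_cyclic h.totRam.isOpen he hle hmem hpow hx hN }

end Galois

end ValuedClosure

end PClassFieldTheory

/-! ### Towers of steps and surjectivity of the norm on units after unramified base change -/

namespace PClassFieldTheory

open IntermediateField

/-- In the `p`-group `S/T` a subgroup of index `p` exists by Sylow's theorem. It is normal because
its index is the smallest prime factor of the order. -/
theorem exists_normal_index_eq {G : Type*} [Group G] {S T : Subgroup G} {p n : ℕ} (hp : p.Prime)
    (hle : T ≤ S) (hT : ∀ s ∈ S, ∀ t ∈ T, s * t * s⁻¹ ∈ T) (hn : T.relIndex S = p ^ (n + 1)) :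
    ∃ H, T ≤ H ∧ H ≤ S ∧ (∀ s ∈ S, ∀ t ∈ H, s * t * s⁻¹ ∈ H) ∧ H.relIndex S = p ∧
      T.relIndex H = p ^ n := by
  have : Fact p.Prime := ⟨hp⟩
  have hnorm : (T.subgroupOf S).Normal := ⟨fun b hb a => hT a a.2 b hb⟩
  have hcard : Nat.card (S ⧸ T.subgroupOf S) = p ^ (n + 1) := hn
  have : Finite (S ⧸ T.subgroupOf S) :=
    Nat.finite_of_card_ne_zero (by rw [hcard]; exact pow_ne_zero _ hp.ne_zero)
  obtain ⟨K, hK⟩ := Sylow.exists_subgroup_card_pow_prime p (G := S ⧸ T.subgroupOf S) (n := n)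
    (by rw [hcard]; exact pow_dvd_pow _ (Nat.le_succ n))
  have hKi : K.index = p := by
    have := K.card_mul_index
    rw [hK, hcard, pow_succ] at this
    exact Nat.eq_of_mul_eq_mul_left (pow_pos hp.pos n) this
  have hKn : K.Normal := Subgroup.normal_of_index_eq_minFac_card (by
    rw [hKi, hcard, Nat.Prime.pow_minFac hp (Nat.succ_ne_zero n)])
  set H : Subgroup G := (K.comap (QuotientGroup.mk' _)).map S.subtype with hH
  have hHS : H ≤ S := Subgroup.map_subtype_le _
  have hTH : T ≤ H := by
    intro t ht
    refine ⟨⟨t, hle ht⟩, ?_, rfl⟩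
    have : (QuotientGroup.mk' (T.subgroupOf S)) ⟨t, hle ht⟩ = 1 := by
      rw [QuotientGroup.mk'_apply, QuotientGroup.eq_one_iff]; exact ht
    rw [SetLike.mem_coe, Subgroup.mem_comap, this]; exact K.one_mem
  have hHi : H.relIndex S = p := by
    rw [Subgroup.relIndex, hH, Subgroup.subgroupOf, Subgroup.comap_map_eq_self_of_injective
      S.subtype_injective, Subgroup.index_comap_of_surjective _ (QuotientGroup.mk'_surjective _), hKi]
  have hTHi : T.relIndex H = p ^ n := by
    have := Subgroup.relIndex_mul_relIndex T H S hTH hHS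
    rw [hHi, hn, pow_succ] at this
    exact Nat.eq_of_mul_eq_mul_right hp.pos this
  refine ⟨H, hTH, hHS, ?_, hHi, hTHi⟩
  rintro s hs _ ⟨t, ht, rfl⟩
  have hcomap : (K.comap (QuotientGroup.mk' (T.subgroupOf S))).Normal := hKn.comap _
  exact ⟨⟨s, hs⟩ * t * ⟨s, hs⟩⁻¹, hcomap.conj_mem t ht _, rfl⟩

variable {p : ℕ} [hp : Fact p.Prime] {F Ω : Type*} [Field F] [Field Ω] [Algebra F Ω]

namespace ValuedClosure

variable {D : ValuedClosure p F Ω} {S T H : Subgroup Gal(Ω/F)}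

/-- A non-trivial `p`-extension has a subextension of degree `p`. -/
theorem Pair.exists_index_eq {n : ℕ} (h : D.Pair S T) (hn : T.relIndex S = p ^ (n + 1)) :
    ∃ H, D.Pair S H ∧ D.Pair H T ∧ H.relIndex S = p ∧ T.relIndex H = p ^ n := by
  obtain ⟨H, hTH, hHS, hHn, hHi, hTHi⟩ := exists_normal_index_eq hp.out h.le h.normal hn
  exact ⟨H, ⟨hHS, hHn, h.totRam.mono hTH, 1, by rw [hHi, pow_one]⟩,
    ⟨hTH, fun s hs => h.normal s (hHS hs), h.totRam, n, hTHi⟩, hHi, hTHi⟩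

theorem Pair.relIndex_ne_zero (h : D.Pair S T) : T.relIndex S ≠ 0 := by
  obtain ⟨n, hn⟩ := h.exists_pow
  rw [hn]
  exact pow_ne_zero _ hp.out.ne_zero

/-- The step of degree `p` is split off at the bottom: `H` is normal in `S`, and the assertion is
already known for the smaller extension given by `H` and `T`. -/
theorem Pair.induction {motive : ∀ S T : Subgroup Gal(Ω/F), D.Pair S T → Prop}
    (refl : ∀ S h, motive S S h)
    (step : ∀ S H T (h : D.Pair S T) (_ : D.Pair S H) (h₂ : D.Pair H T), H.relIndex S = p →
      motive H T h₂ → motive S T h) (h : D.Pair S T) : motive S T h := by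
  obtain ⟨n, hn⟩ := h.exists_pow
  induction n generalizing S with
  | zero =>
    rw [pow_zero, Subgroup.relIndex_eq_one] at hn
    obtain rfl := le_antisymm hn h.le
    exact refl S h
  | succ n ih =>
    obtain ⟨H, h1, h2, h3, h4⟩ := h.exists_index_eq hn
    exact step S H T h h1 h2 h3 (ih h2 h4)

variable (D) in
/-- The units of the field fixed by the inertia subgroup of `T`. -/
def U (T : Subgroup Gal(Ω/F)) : Submonoid Ω where
  carrier := {x | x ∈ fixedField (T ⊓ D.inertia) ∧ D.v x = 1}
  mul_mem' := fun ha hb => ⟨mul_mem ha.1 hb.1, by rw [map_mul, ha.2, hb.2, one_mul]⟩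
  one_mem' := ⟨one_mem _, map_one _⟩

variable (D) in
/-- The norm between the fields fixed by the inertia subgroups of `T` and `S`. -/
noncomputable abbrev N (S T : Subgroup Gal(Ω/F)) : Ω →*₀ Ω := relNorm (S ⊓ D.inertia) (T ⊓ D.inertia)

theorem ne_zero_of_mem_U {x : Ω} (hx : x ∈ D.U T) : x ≠ 0 := by
  rintro rfl
  simpa using hx.2

theorem inv_mem_U {x : Ω} (hx : x ∈ D.U T) : x⁻¹ ∈ D.U T :=
  ⟨inv_mem hx.1, by rw [map_inv₀, hx.2, inv_one]⟩

theorem div_mem_U {x y : Ω} (hx : x ∈ D.U T) (hy : y ∈ D.U T) : x / y ∈ D.U T := by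
  rw [div_eq_mul_inv]; exact mul_mem hx (inv_mem_U hy)

theorem Pair.apply_mem_inf (h : D.Pair S T) {s : Gal(Ω/F)} (hs : s ∈ S) {x : Ω}
    (hx : x ∈ fixedField (T ⊓ D.inertia)) : s x ∈ fixedField (T ⊓ D.inertia) :=
  apply_mem_fixedField (fun a ha => by
    have := h.normal _ (S.inv_mem hs) a ha.1
    have h2 := (conj_inertia_iff (D := D) s⁻¹ a).2 ha.2
    rw [inv_inv] at this h2
    exact ⟨this, h2⟩) hx

theorem Pair.apply_mem_U (h : D.Pair S T) {s : Gal(Ω/F)} (hs : s ∈ S) {x : Ω} (hx : x ∈ D.U T) :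
    s x ∈ D.U T := ⟨h.apply_mem_inf hs hx.1, by rw [D.v_gal, hx.2]⟩

theorem Pair.apply_div_mem_U (h : D.Pair S T) {s : Gal(Ω/F)} (hs : s ∈ S) {x : Ω}
    (hx : x ∈ fixedField (T ⊓ D.inertia)) (hx0 : x ≠ 0) : s x / x ∈ D.U T :=
  ⟨div_mem (h.apply_mem_inf hs hx) hx,
    by rw [map_div₀, D.v_gal, div_self (D.v_pos hx0).ne']⟩

theorem IsUnif.mem_inf {π : Ω} (h : D.IsUnif S π) : π ∈ fixedField (S ⊓ D.inertia) :=
  fixedField_le inf_le_left h.mem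

section Galois

variable [IsGalois F Ω]

theorem TotRam.N_mem (h : D.TotRam T) {x : Ω} (hx : x ∈ fixedField (T ⊓ D.inertia)) :
    D.N S T x ∈ fixedField (S ⊓ D.inertia) :=
  relNorm_mem (relIndex_inf_ne_zero h.isOpen) hx

theorem TotRam.N_mem_U (h : D.TotRam T) {x : Ω} (hx : x ∈ D.U T) : D.N S T x ∈ D.U S :=
  ⟨h.N_mem hx.1, by rw [D.v_relNorm (relIndex_inf_ne_zero h.isOpen), hx.2, one_pow]⟩

theorem TotRam.v_N (h : D.TotRam T) (hTS : T ≤ S) (x : Ω) :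
    D.v (D.N S T x) = D.v x ^ T.relIndex S := by
  rw [D.v_relNorm (relIndex_inf_ne_zero h.isOpen), h.relIndex_inf hTS]

theorem TotRam.N_trans (hH : D.TotRam H) (hT : D.TotRam T) (hHS : H ≤ S) (hTH : T ≤ H) {x : Ω}
    (hx : x ∈ fixedField (T ⊓ D.inertia)) : D.N S T x = D.N S H (D.N H T x) :=
  relNorm_trans (inf_le_inf_right _ hHS) (inf_le_inf_right _ hTH) (relIndex_inf_ne_zero hH.isOpen)
    (relIndex_inf_ne_zero hT.isOpen) hx

/-- The norm from `T` to `H` commutes with the group of a field below both. -/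
theorem Pair.apply_N (hT : D.Pair S T) (hH : D.Pair S H) {s : Gal(Ω/F)} (hs : s ∈ S) {x : Ω}
    (hx : x ∈ fixedField (T ⊓ D.inertia)) : s (D.N H T x) = D.N H T (s x) :=
  apply_relNorm (relIndex_inf_ne_zero hT.totRam.isOpen)
    (fun a => by rw [Subgroup.mem_inf, Subgroup.mem_inf, hH.conj_iff hs, conj_inertia_iff])
    (fun a => by rw [Subgroup.mem_inf, Subgroup.mem_inf, hT.conj_iff hs, conj_inertia_iff]) hx

theorem Pair.N_apply_div (hT : D.Pair S T) (hH : D.Pair S H) {s : Gal(Ω/F)} (hs : s ∈ S) {x : Ω}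
    (hx : x ∈ fixedField (T ⊓ D.inertia)) :
    D.N H T (s x / x) = s (D.N H T x) / D.N H T x := by
  rw [map_div₀, hT.apply_N hH hs hx]

theorem Pair.refl_left (h : D.Pair S T) : D.Pair S S :=
  ⟨le_rfl, fun s hs t ht => S.mul_mem (S.mul_mem hs ht) (S.inv_mem hs), h.totRam_left, 0, by simp⟩

theorem Pair.v_unif (h : D.Pair S T) {πT πS : Ω} (hT : D.IsUnif T πT) (hS : D.IsUnif S πS) :
    D.v πS = D.v πT ^ T.relIndex S := by
  induction h using Pair.induction generalizing πS with
  | refl S h =>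
    rw [Subgroup.relIndex_self, pow_one]
    obtain ⟨m, hm⟩ := hT.exists_zpow _ hS.mem hS.ne_zero
    obtain ⟨n, hn⟩ := hS.exists_zpow _ hT.mem hT.ne_zero
    have hm0 : 0 < m := by
      have := hS.v_lt
      rwa [hm, ← zpow_zero (D.v πT), zpow_lt_zpow_iff_right_of_lt_one₀ hT.v_pos hT.v_lt] at this
    have hn0 : 0 < n := by
      have := hT.v_lt
      rwa [hn, ← zpow_zero (D.v πS), zpow_lt_zpow_iff_right_of_lt_one₀ hS.v_pos hS.v_lt] at this
    have h1 : D.v πT ^ (1 : ℤ) = D.v πT ^ (m * n) := by rw [zpow_mul, ← hm, ← hn, zpow_one]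
    have h2 := zpow_right_injective₀ hT.v_pos hT.v_lt.ne h1
    have hm1 : m = 1 := Int.eq_one_of_dvd_one hm0.le ⟨n, h2⟩
    rw [hm, hm1, zpow_one]
  | step S H T h h₁ h₂ hidx ih =>
    obtain ⟨πH, hH⟩ := D.exists_isUnif h₁.totRam.isOpen
    rw [v_unif_eq_pow_of_index_eq h₁ hidx hH hS, ih hT hH, ← pow_mul,
      ← Subgroup.relIndex_mul_relIndex _ _ _ h₂.le h₁.le, hidx]

/-- In a totally ramified extension the norm raises values to the power of the degree, and this is
exactly the relation between the values of the two uniformizers. -/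
theorem Pair.isUnif_N (h : D.Pair S T) {π : Ω} (hπ : D.IsUnif T π) : D.IsUnif S (D.N S T π) := by
  obtain ⟨πS, hS⟩ := D.exists_isUnif h.totRam_left.isOpen
  have hv : D.v (D.N S T π) = D.v πS := by rw [h.totRam.v_N h.le, h.v_unif hπ hS]
  refine ⟨?_, ?_, hv ▸ hS.v_lt, fun x hx hx0 => hv ▸ hS.exists_zpow x hx hx0⟩
  · rw [N, h.totRam.relNorm_inf h.le hπ.mem]
    exact relNorm_mem h.relIndex_ne_zero hπ.mem
  · simpa using hπ.ne_zero

theorem Pair.exists_generator (h : D.Pair S H) (hidx : H.relIndex S = p) :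
    ∃ σ ∈ S ⊓ D.inertia, σ ∉ H := by
  by_contra! hall
  have hlt : ¬ S ≤ H := by
    intro hle
    rw [Subgroup.relIndex_eq_one.2 hle] at hidx
    exact hp.out.one_lt.ne hidx
  obtain ⟨s, hs, hsH⟩ := Set.not_subset.1 hlt
  obtain ⟨t, ht, σ, hσ, rfl⟩ := h.totRam.exists_mul_of_mem h.le hs
  exact hsH (H.mul_mem ht (hall σ hσ))

theorem Pair.isTransversal_inf (h : D.Pair S H) (hidx : H.relIndex S = p) {σ : Gal(Ω/F)}
    (hσ : σ ∈ S ⊓ D.inertia) (hσH : σ ∉ H) :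
    IsTransversal (S ⊓ D.inertia) (H ⊓ D.inertia) (zpowZMod p σ) :=
  (isTransversal_zpowZMod (A := S ⊓ D.inertia) (B := H ⊓ D.inertia)
    (fun a ha b hb => (h.conj_iff' ha.1 b).2 hb) (by rw [h.totRam.relIndex_inf h.le, hidx]) hσ
    fun hm => hσH hm.1).2

theorem Pair.N_eq_cycNorm (h : D.Pair S H) (hidx : H.relIndex S = p) {σ : Gal(Ω/F)}
    (hσ : σ ∈ S ⊓ D.inertia) (hσH : σ ∉ H) {x : Ω} (hx : x ∈ fixedField (H ⊓ D.inertia)) :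
    D.N S H x = cycNorm p σ x :=
  relNorm_eq_prod (h.isTransversal_inf hidx hσ hσH) hx

/-- The norm is surjective on units after a maximal unramified extension. -/
theorem Pair.exists_N_eq [IsSepClosed Ω] (h : D.Pair S T) {α : Ω} (hα : α ∈ D.U S) :
    ∃ β ∈ D.U T, D.N S T β = α := by
  induction h using Pair.induction generalizing α with
  | refl S h => exact ⟨α, hα, relNorm_self hα.1⟩
  | step S H T h h₁ h₂ hidx ih =>
    obtain ⟨πH, hH⟩ := D.exists_isUnif h₁.totRam.isOpen
    obtain ⟨πS, hS⟩ := D.exists_isUnif h.totRam_left.isOpen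
    obtain ⟨σ, hσ, hσH⟩ := h₁.exists_generator hidx
    obtain ⟨γ, hγ, hγv, hγN⟩ := (h₁.stepExt hidx hσ hσH hH hS).exists_norm_eq hα.1 hα.2
    obtain ⟨β, hβ, hβN⟩ := ih ⟨hγ, hγv⟩
    refine ⟨β, hβ, ?_⟩
    rw [h₁.totRam.N_trans h₂.totRam h₁.le h₂.le hβ.1, hβN, h₁.N_eq_cycNorm hidx hσ hσH hγ, hγN]

end Galois

end ValuedClosure

end PClassFieldTheory

/-! ### Abelianized quotients -/

namespace PClassFieldTheory

section AbQuot

variable {G : Type*} [Group G]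

/-- The largest abelian quotient of `A` in which `B` is trivial. -/
def AbQuot (A B : Subgroup G) : Type _ :=
  Abelianization A ⧸ (B.subgroupOf A).map (Abelianization.of (G := A))

instance (A B : Subgroup G) : CommGroup (AbQuot A B) :=
  inferInstanceAs (CommGroup (Abelianization A ⧸ (B.subgroupOf A).map Abelianization.of))

variable {A B : Subgroup G}

variable (A B) in
/-- The projection to `AbQuot A B`. -/
def AbQuot.mk : A →* AbQuot A B :=
  (QuotientGroup.mk' ((B.subgroupOf A).map (Abelianization.of (G := A)))).comp Abelianization.of

theorem AbQuot.mk_surjective : Function.Surjective (AbQuot.mk A B) :=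
  (QuotientGroup.mk'_surjective _).comp fun x => QuotientGroup.mk_surjective x

theorem AbQuot.mk_eq_one_of_mem (a : A) (ha : (a : G) ∈ B) : AbQuot.mk A B a = 1 :=
  (QuotientGroup.eq_one_iff _).2 ⟨a, ha, rfl⟩

theorem AbQuot.mk_eq_one {a : A} :
    AbQuot.mk A B a = 1 ↔ ∃ b : A, (b : G) ∈ B ∧ ∃ c ∈ commutator A, a = b * c := by
  constructor
  · intro h
    obtain ⟨b, hb, hba⟩ := (QuotientGroup.eq_one_iff _).1 h
    refine ⟨b, hb, b⁻¹ * a, ?_, by simp⟩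
    exact QuotientGroup.eq.1 hba
  · rintro ⟨b, hb, c, hc, rfl⟩
    rw [map_mul, AbQuot.mk_eq_one_of_mem b hb, one_mul]
    have : (Abelianization.of c) = 1 := by
      rw [← MonoidHom.mem_ker, Abelianization.ker_of]; exact hc
    change (QuotientGroup.mk' _) (Abelianization.of c) = 1
    rw [this, map_one]; rfl

/-- Elimination principle: whatever becomes trivial in `AbQuot A B` lies in every subgroup that
contains `B` and all commutators. -/
theorem AbQuot.mem_of_mk_eq_one {a : A} (h : AbQuot.mk A B a = 1) {K : Subgroup A}
    (hB : ∀ b : A, (b : G) ∈ B → b ∈ K) (hc : ∀ a b : A, a * b * a⁻¹ * b⁻¹ ∈ K) : a ∈ K := by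
  obtain ⟨b, hb, c, hc', rfl⟩ := AbQuot.mk_eq_one.1 h
  refine K.mul_mem (hB b hb) ?_
  have : commutator A ≤ K := by
    rw [commutator_def, Subgroup.commutator_le]
    intro a _ b _
    exact hc a b
  exact this hc'

theorem AbQuot.finite (h : B.relIndex A ≠ 0) : Finite (AbQuot A B) := by
  obtain ⟨e, he⟩ := exists_isTransversal h
  refine Finite.of_surjective (fun i => AbQuot.mk A B ⟨e i, he.mem i⟩) fun q => ?_
  obtain ⟨a, rfl⟩ := AbQuot.mk_surjective q
  obtain ⟨i, hi, -⟩ := he.existsUnique a a.2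
  refine ⟨i, ?_⟩
  have := AbQuot.mk_eq_one_of_mem (A := A) (B := B) (⟨e i, he.mem i⟩⁻¹ * a) hi
  rwa [map_mul, map_inv, inv_mul_eq_one] at this

/-- An element that is non-trivial in `AbQuot A B` is non-trivial in a cyclic quotient. -/
theorem AbQuot.exists_cyclic_quotient (h : B.relIndex A ≠ 0) {a : A} (ha : AbQuot.mk A B a ≠ 1)
    (hBA : B ≤ A) :
    ∃ C : Subgroup G, ∃ ω ∈ A, B ≤ C ∧ C ≤ A ∧ (∀ a ∈ A, ∀ b, a * b * a⁻¹ ∈ C ↔ b ∈ C) ∧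
      (a : G) ∉ C ∧ (∀ a ∈ A, ∃ j : ℕ, (ω ^ j)⁻¹ * a ∈ C) ∧
      ∀ n : ℕ, C.relIndex A ∣ n → ω ^ n ∈ C := by
  have := AbQuot.finite h
  -- A complex character separates the class of `a` from `1`. Its image is a finite subgroup of
  -- `ℂˣ`, hence cyclic. Its kernel is `C`, and `ω` maps to a generator.
  obtain ⟨χ, hχ⟩ := CommGroup.exists_apply_ne_one_of_hasEnoughRootsOfUnity (AbQuot A B) ℂ ha
  let ψ : A →* ℂˣ := χ.comp (AbQuot.mk A B)
  have hfin : Finite ψ.range := by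
    refine Set.Finite.subset (Set.finite_range χ) ?_
    rintro _ ⟨x, rfl⟩
    exact ⟨AbQuot.mk A B x, rfl⟩
  obtain ⟨⟨_, ω, rfl⟩, hω⟩ := IsCyclic.exists_monoid_generator (α := ψ.range)
  have hmem : ∀ x : A, (x : G) ∈ ψ.ker.map A.subtype ↔ ψ x = 1 := by
    intro x
    rw [Subgroup.mem_map]
    constructor
    · rintro ⟨y, hy, hyx⟩
      rw [← Subtype.ext hyx]; exact hy
    · intro hx
      exact ⟨x, hx, rfl⟩
  refine ⟨ψ.ker.map A.subtype, ω, ω.2, fun b hb => ?_, Subgroup.map_subtype_le _, ?_, ?_, ?_, ?_⟩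
  · refine (hmem ⟨b, hBA hb⟩).2 ?_
    change χ _ = 1
    rw [AbQuot.mk_eq_one_of_mem _ hb, map_one]
  · intro x hx b
    have hbA : x * b * x⁻¹ ∈ A ↔ b ∈ A := by
      rw [A.mul_mem_cancel_right (A.inv_mem hx), A.mul_mem_cancel_left hx]
    have key : ∀ hb : b ∈ A, (x * b * x⁻¹ ∈ ψ.ker.map A.subtype ↔ b ∈ ψ.ker.map A.subtype) := by
      intro hb
      have h1 := hmem (⟨x, hx⟩ * ⟨b, hb⟩ * ⟨x, hx⟩⁻¹)
      have h2 := hmem ⟨b, hb⟩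
      rw [map_mul, map_mul, map_inv, mul_inv_cancel_comm] at h1
      exact h1.trans h2.symm
    exact ⟨fun hb => (key (hbA.1 (Subgroup.map_subtype_le _ hb))).1 hb,
      fun hb => (key (Subgroup.map_subtype_le _ hb)).2 hb⟩
  · rw [hmem]; exact hχ
  · intro x hx
    obtain ⟨j, hj⟩ := hω ⟨ψ ⟨x, hx⟩, ⟨x, hx⟩, rfl⟩
    refine ⟨j, (hmem ((ω ^ j)⁻¹ * ⟨x, hx⟩)).2 ?_⟩
    have := congrArg Subtype.val hj
    rw [map_mul, map_inv, map_pow, inv_mul_eq_one]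
    simpa using this
  · rintro n ⟨k, rfl⟩
    refine (hmem (ω ^ _)).2 ?_
    rw [map_pow, pow_mul]
    have hidx : (ψ.ker.map A.subtype).relIndex A = Nat.card ψ.range := by
      rw [Subgroup.relIndex, Subgroup.subgroupOf, Subgroup.comap_map_eq_self_of_injective
        A.subtype_injective, Subgroup.index_ker]
    have h1 : (⟨ψ ω, ω, rfl⟩ : ψ.range) ^ Nat.card ψ.range = 1 := pow_card_eq_one'
    have h2 := congrArg Subtype.val h1
    rw [hidx]
    have h3 : ψ ω ^ Nat.card ψ.range = 1 := by simpa using h2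
    rw [h3, one_pow]

end AbQuot

end PClassFieldTheory

/-! ### The augmentation subgroup of the units and the map σ ↦ σ π / π -/

namespace PClassFieldTheory

open IntermediateField

variable {p : ℕ} [hp : Fact p.Prime] {F Ω : Type*} [Field F] [Field Ω] [Algebra F Ω]

/-- For a cyclic action, `ω ^ j` may be replaced by `ω`. -/
theorem pow_apply_div_eq (ω : Gal(Ω/F)) {x : Ω} (hx : x ≠ 0) (j : ℕ) :
    (ω ^ j) x / x = ω (∏ i ∈ Finset.range j, (ω ^ i) x) / ∏ i ∈ Finset.range j, (ω ^ i) x := by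
  have h0 : ∏ i ∈ Finset.range j, (ω ^ i) x ≠ 0 :=
    Finset.prod_ne_zero_iff.2 fun i _ => (map_ne_zero (ω ^ i)).2 hx
  rw [div_eq_div_iff hx h0, mul_comm, ← Finset.prod_range_succ (fun i => (ω ^ i) x), map_prod,
    Finset.prod_range_succ', pow_zero, AlgEquiv.one_apply]
  simp only [pow_succ', AlgEquiv.mul_apply]

namespace ValuedClosure

variable {D : ValuedClosure p F Ω} {S T H : Subgroup Gal(Ω/F)}

variable (D) in
/-- The products of the elements `g u / u`, where `g` is in the inertia group of `S` and `u` is a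
unit of the field fixed by the inertia group of `T`. -/
def Aug (S T : Subgroup Gal(Ω/F)) : Submonoid Ω :=
  Submonoid.closure {x | ∃ g ∈ S ⊓ D.inertia, ∃ u ∈ D.U T, x = g u / u}

theorem apply_div_mem_Aug {g : Gal(Ω/F)} (hg : g ∈ S ⊓ D.inertia) {u : Ω} (hu : u ∈ D.U T) :
    g u / u ∈ D.Aug S T := Submonoid.subset_closure ⟨g, hg, u, hu, rfl⟩

theorem inv_mem_Aug {a : Ω} (ha : a ∈ D.Aug S T) : a⁻¹ ∈ D.Aug S T := by
  induction ha using Submonoid.closure_induction with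
  | mem x hx =>
    obtain ⟨g, hg, u, hu, rfl⟩ := hx
    have := apply_div_mem_Aug hg (inv_mem_U hu)
    rwa [map_inv₀, ← inv_div_inv, inv_inv, inv_inv, ← inv_div] at this
  | one => simp
  | mul x y _ _ hx hy => rw [mul_inv]; exact mul_mem hx hy

theorem div_mem_Aug {a b : Ω} (ha : a ∈ D.Aug S T) (hb : b ∈ D.Aug S T) : a / b ∈ D.Aug S T := by
  rw [div_eq_mul_inv]; exact mul_mem ha (inv_mem_Aug hb)

theorem Aug_mono (h : H ≤ S) : D.Aug H T ≤ D.Aug S T :=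
  Submonoid.closure_mono fun _ ⟨g, hg, u, hu, hx⟩ => ⟨g, ⟨h hg.1, hg.2⟩, u, hu, hx⟩

theorem Pair.Aug_le (h : D.Pair S T) : D.Aug S T ≤ D.U T := by
  refine Submonoid.closure_le.2 ?_
  rintro _ ⟨g, hg, u, hu, rfl⟩
  exact h.apply_div_mem_U hg.1 hu.1 (ne_zero_of_mem_U hu)

/-- `Aug H T` is stable under any `s` that normalizes `H` and `T`. -/
theorem Pair.apply_mem_Aug (h : D.Pair S T) (hH : D.Pair S H) {s : Gal(Ω/F)} (hs : s ∈ S) {a : Ω}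
    (ha : a ∈ D.Aug H T) : s a ∈ D.Aug H T := by
  induction ha using Submonoid.closure_induction with
  | mem x hx =>
    obtain ⟨g, hg, u, hu, rfl⟩ := hx
    have := apply_div_mem_Aug ((hH.conj_iff' hs g).2 hg) (h.apply_mem_U hs hu)
    simpa using this
  | one => simp
  | mul x y _ _ hx hy => rw [map_mul]; exact mul_mem hx hy

/-- The map `σ ↦ σ x / x` is multiplicative modulo `Aug`. -/
theorem Pair.mul_apply_div (h : D.Pair S T) {σ τ : Gal(Ω/F)} (hσ : σ ∈ S ⊓ D.inertia) (hτ : τ ∈ S)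
    {x : Ω} (hx : x ∈ fixedField (T ⊓ D.inertia)) (hx0 : x ≠ 0) :
    ∃ a ∈ D.Aug S T, (σ * τ) x / x = (σ x / x) * (τ x / x) * a := by
  have hu := h.apply_div_mem_U hτ hx hx0
  refine ⟨_, apply_div_mem_Aug hσ hu, ?_⟩
  have h1 : τ x ≠ 0 := by simpa using hx0
  have h2 : σ x ≠ 0 := by simpa using hx0
  rw [map_div₀, AlgEquiv.mul_apply]
  field_simp

section Galois

variable [IsGalois F Ω]

theorem Pair.N_mem_Aug (h : D.Pair S T) (hH : D.Pair S H) {a : Ω} (ha : a ∈ D.Aug S T) :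
    D.N H T a ∈ D.Aug S H := by
  induction ha using Submonoid.closure_induction with
  | mem x hx =>
    obtain ⟨g, hg, u, hu, rfl⟩ := hx
    rw [h.N_apply_div hH hg.1 hu.1]
    exact apply_div_mem_Aug hg (h.totRam.N_mem_U hu)
  | one => simp
  | mul x y _ _ hx hy => rw [map_mul]; exact mul_mem hx hy

variable (D) in
/-- `Aug S T` as a group of units. -/
def augUnits (S T : Subgroup Gal(Ω/F)) : Subgroup Ωˣ where
  carrier := {u | (u : Ω) ∈ D.Aug S T}
  one_mem' := (D.Aug S T).one_mem
  mul_mem' := fun {a b} ha hb => (D.Aug S T).mul_mem ha hb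
  inv_mem' := fun {a} ha => by
    have := inv_mem_Aug (D := D) ha
    rwa [← Units.val_inv_eq_inv_val] at this

variable (D) in
/-- The homomorphism `σ ↦ σ x / x` modulo `Aug`. -/
def augHom (h : D.Pair S T) {x : Ω} (hx : x ∈ fixedField (T ⊓ D.inertia)) (hx0 : x ≠ 0) :
    ↥(S ⊓ D.inertia) →* Ωˣ ⧸ D.augUnits S T :=
  MonoidHom.mk' (fun σ => QuotientGroup.mk
    (Units.mk0 (σ.1 x / x) (div_ne_zero ((map_ne_zero σ.1).2 hx0) hx0))) fun σ τ => by
    obtain ⟨a, ha, hs⟩ := h.mul_apply_div σ.2 τ.2.1 hx hx0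
    rw [← QuotientGroup.mk_mul, eq_comm, QuotientGroup.eq]
    change (((_ * _)⁻¹ * _ : Ωˣ) : Ω) ∈ D.Aug S T
    have : (σ * τ).1 = σ.1 * τ.1 := rfl
    have h0 : σ.1 x / x * (τ.1 x / x) ≠ 0 := mul_ne_zero
      (div_ne_zero ((map_ne_zero σ.1).2 hx0) hx0) (div_ne_zero ((map_ne_zero τ.1).2 hx0) hx0)
    simp only [Units.val_mul, Units.val_inv_eq_inv_val, Units.val_mk0, this]
    rw [hs, inv_mul_cancel_left₀ h0]
    exact ha

theorem augHom_eq_iff (h : D.Pair S T) {x : Ω} (hx : x ∈ fixedField (T ⊓ D.inertia)) (hx0 : x ≠ 0)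
    {σ τ : ↥(S ⊓ D.inertia)} :
    D.augHom h hx hx0 σ = D.augHom h hx hx0 τ ↔ τ.1 x / x / (σ.1 x / x) ∈ D.Aug S T := by
  change QuotientGroup.mk _ = QuotientGroup.mk _ ↔ _
  rw [QuotientGroup.eq]
  change ((_⁻¹ * _ : Ωˣ) : Ω) ∈ D.Aug S T ↔ _
  simp only [Units.val_mul, Units.val_inv_eq_inv_val, Units.val_mk0]
  rw [mul_comm, div_eq_mul_inv _ (σ.1 x / x)]

theorem augHom_eq_one_iff (h : D.Pair S T) {x : Ω} (hx : x ∈ fixedField (T ⊓ D.inertia))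
    (hx0 : x ≠ 0) {σ : ↥(S ⊓ D.inertia)} :
    D.augHom h hx hx0 σ = 1 ↔ σ.1 x / x ∈ D.Aug S T := by
  rw [← map_one (D.augHom h hx hx0), eq_comm, augHom_eq_iff]
  simp [div_self hx0]

theorem Pair.augHom_eq_one_of_mk (h : D.Pair S T) {x : Ω}
    (hx : x ∈ fixedField (T ⊓ D.inertia)) (hx0 : x ≠ 0) {σ : ↥(S ⊓ D.inertia)}
    (hσ : AbQuot.mk (S ⊓ D.inertia) (T ⊓ D.inertia) σ = 1) : D.augHom h hx hx0 σ = 1 := by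
  refine AbQuot.mem_of_mk_eq_one hσ (K := (D.augHom h hx hx0).ker) (fun b hb => ?_) fun a b => ?_
  · rw [MonoidHom.mem_ker, augHom_eq_one_iff, mem_fixedField.1 hx _ hb, div_self hx0]
    exact one_mem _
  · rw [MonoidHom.mem_ker]
    rw [map_mul, map_mul, map_mul, map_inv, map_inv, mul_inv_eq_one, mul_inv_eq_iff_eq_mul]
    exact mul_comm (D.augHom h hx hx0 a) (D.augHom h hx hx0 b)

/-- If `σ π / π` is trivial modulo `Aug`, then `σ` is trivial in the abelianization. -/
theorem Pair.mk_eq_one_of_augHom (h : D.Pair S T) {π : Ω} (hπ : D.IsUnif T π)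
    {σ : ↥(S ⊓ D.inertia)} (hσ : D.augHom h hπ.mem_inf hπ.ne_zero σ = 1) :
    AbQuot.mk (S ⊓ D.inertia) (T ⊓ D.inertia) σ = 1 := by
  by_contra hne
  have hidx0 := relIndex_inf_ne_zero (D := D) (S := S) h.totRam.isOpen
  have hle : T ⊓ D.inertia ≤ S ⊓ D.inertia := inf_le_inf_right _ h.le
  -- A class that is non-trivial in the abelianization survives in a cyclic quotient by some `C`, so
  -- after taking norms to the field of `C` one argues in a cyclic extension.
  obtain ⟨C, ω, hω, hTC, hCS, hCn, hσC, hgen, hdvd⟩ := AbQuot.exists_cyclic_quotient hidx0 hne hle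
  have hmul := Subgroup.relIndex_mul_relIndex _ _ _ hTC hCS
  have hTC0 : (T ⊓ D.inertia).relIndex C ≠ 0 := fun h0 => hidx0 (by rw [← hmul, h0, zero_mul])
  have hTn : ∀ g ∈ S ⊓ D.inertia, ∀ b, g * b * g⁻¹ ∈ T ⊓ D.inertia ↔ b ∈ T ⊓ D.inertia :=
    fun g hg b => h.conj_iff' hg.1 b
  have hequiv : ∀ g ∈ S ⊓ D.inertia, ∀ x ∈ fixedField (T ⊓ D.inertia),
      g (relNorm C (T ⊓ D.inertia) x) = relNorm C (T ⊓ D.inertia) (g x) :=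
    fun g hg x hx => apply_relNorm hTC0 (hCn g hg) (hTn g hg) hx
  have hωC : ∀ x ∈ fixedField C, ∀ i : ℕ, (ω ^ i) x ∈ fixedField C := fun x hx i =>
    apply_mem_fixedField (fun a ha => by
      have := (hCn _ (inv_mem (pow_mem hω i)) a).2 ha
      rwa [inv_inv] at this) hx
  -- every `g x / x` with `x` fixed by `C` has the form `ω y / y`
  have hcyc : ∀ g ∈ S ⊓ D.inertia, ∀ x ∈ fixedField C, x ≠ 0 → ∃ j : ℕ, (ω ^ j)⁻¹ * g ∈ C ∧
      ∃ y ∈ fixedField C, D.v y = D.v x ^ j ∧ y ≠ 0 ∧ g x / x = ω y / y := by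
    intro g hg x hx hx0
    obtain ⟨j, hj⟩ := hgen g hg
    refine ⟨j, hj, ∏ i ∈ Finset.range j, (ω ^ i) x, prod_mem fun i _ => hωC x hx i, ?_, ?_, ?_⟩
    · simp [map_prod, -AlgEquiv.coe_pow, D.v_gal]
    · exact Finset.prod_ne_zero_iff.2 fun i _ => (map_ne_zero (ω ^ i)).2 hx0
    · rw [← pow_apply_div_eq ω hx0]
      have h1 : g = ω ^ j * ((ω ^ j)⁻¹ * g) := by simp
      conv_lhs => rw [h1, AlgEquiv.mul_apply, mem_fixedField.1 hx _ hj]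
  -- Norms of elements of `Aug` become `ω w / w` with `w` of absolute value `1`. It is the value of
  -- `w` that distinguishes them from the contribution of `π`.
  have hAug : ∀ a ∈ D.Aug S T, ∃ w ∈ fixedField C, D.v w = 1 ∧ w ≠ 0 ∧
      relNorm C (T ⊓ D.inertia) a = ω w / w := by
    intro a ha
    induction ha using Submonoid.closure_induction with
    | mem x hx =>
      obtain ⟨g, hg, u, hu, rfl⟩ := hx
      have hu0 := ne_zero_of_mem_U hu
      obtain ⟨j, -, y, hy, hyv, hy0, hyu⟩ := hcyc g hg _ (relNorm_mem hTC0 hu.1)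
        ((map_ne_zero _).2 hu0)
      refine ⟨y, hy, ?_, hy0, ?_⟩
      · rw [hyv, D.v_relNorm hTC0, hu.2, one_pow, one_pow]
      · rw [map_div₀, ← hequiv g hg u hu.1, hyu]
    | one => exact ⟨1, one_mem _, by simp, one_ne_zero, by simp⟩
    | mul x y _ _ hx hy =>
      obtain ⟨w, hw, hwv, hw0, hwx⟩ := hx
      obtain ⟨z, hz, hzv, hz0, hzx⟩ := hy
      refine ⟨w * z, mul_mem hw hz, by rw [map_mul, hwv, hzv, one_mul], mul_ne_zero hw0 hz0, ?_⟩
      rw [map_mul, hwx, hzx, map_mul, div_mul_div_comm]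
  rw [augHom_eq_one_iff] at hσ
  obtain ⟨w, hw, hwv, hw0, hwx⟩ := hAug _ hσ
  have hP0 : relNorm C (T ⊓ D.inertia) π ≠ 0 := (map_ne_zero _).2 hπ.ne_zero
  obtain ⟨j, hj, y, hy, hyv, hy0, hyu⟩ := hcyc σ σ.2 _ (relNorm_mem hTC0 hπ.mem_inf) hP0
  rw [map_div₀, ← hequiv _ σ.2 _ hπ.mem_inf, hyu] at hwx
  -- `y / w` is fixed by the whole inertia group of `S`
  have hfix : ω (y / w) = y / w := by
    have hωw : ω w ≠ 0 := (map_ne_zero ω).2 hw0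
    rw [map_div₀, div_eq_div_iff hωw hw0]
    rw [div_eq_div_iff hy0 hw0] at hwx
    rw [hwx]; ring
  have hz : y / w ∈ fixedField (S ⊓ D.inertia) := by
    refine mem_fixedField.2 fun g hg => ?_
    obtain ⟨i, hi⟩ := hgen g hg
    have h1 : g = ω ^ i * ((ω ^ i)⁻¹ * g) := by simp
    rw [h1, AlgEquiv.mul_apply, mem_fixedField.1 (div_mem hy hw) _ hi]
    clear hi h1
    induction i with
    | zero => simp
    | succ i ih => rw [pow_succ, AlgEquiv.mul_apply, hfix, ih]
  obtain ⟨πS, hS⟩ := D.exists_isUnif h.totRam_left.isOpen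
  -- If `σ ≡ ω ^ j` modulo `C`, then `y` has the value of `N π` to the power `j`, while an element
  -- of the bottom field has exponent divisible by the full ramification index. So the order of the
  -- cyclic quotient divides `j`, which puts `σ` into `C`.
  obtain ⟨n, hn⟩ := hS.exists_zpow_inf h.totRam_left.isOpen hz (div_ne_zero hy0 hw0)
  rw [map_div₀, hwv, div_one, hyv, D.v_relNorm hTC0, h.v_unif hπ hS, ← h.totRam.relIndex_inf h.le,
    ← hmul, ← pow_mul, ← zpow_natCast, ← zpow_natCast, ← zpow_mul] at hn
  have hn' := zpow_right_injective₀ hπ.v_pos hπ.v_lt.ne hn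
  push_cast at hn'
  rw [mul_assoc] at hn'
  have hjd : (j : ℤ) = (C.relIndex (S ⊓ D.inertia) : ℤ) * n :=
    mul_left_cancel₀ (by exact_mod_cast hTC0) hn'
  have hjd' : C.relIndex (S ⊓ D.inertia) ∣ j := by
    have : (C.relIndex (S ⊓ D.inertia) : ℤ) ∣ j := ⟨n, hjd⟩
    exact_mod_cast this
  refine hσC ?_
  have := C.mul_mem (hdvd j hjd') hj
  simpa using this

/-- Exactness on the left: the class of `σ π / π` modulo `Aug` determines, and is determined by, the
class of `σ` in the abelianization. -/
theorem Pair.mk_eq_mk_iff (h : D.Pair S T) {π : Ω} (hπ : D.IsUnif T π) {σ τ : ↥(S ⊓ D.inertia)} :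
    AbQuot.mk (S ⊓ D.inertia) (T ⊓ D.inertia) σ = AbQuot.mk (S ⊓ D.inertia) (T ⊓ D.inertia) τ ↔
      τ.1 π / π / (σ.1 π / π) ∈ D.Aug S T := by
  rw [← augHom_eq_iff h hπ.mem_inf hπ.ne_zero, ← inv_mul_eq_one, ← inv_mul_eq_one (a := D.augHom _ _ _ _),
    ← map_inv, ← map_inv, ← map_mul, ← map_mul]
  exact ⟨h.augHom_eq_one_of_mk hπ.mem_inf hπ.ne_zero, h.mk_eq_one_of_augHom hπ⟩

end Galois

end ValuedClosure

end PClassFieldTheory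

/-! ### The kernel of the norm -/

namespace PClassFieldTheory

open IntermediateField

variable {p : ℕ} [hp : Fact p.Prime] {F Ω : Type*} [Field F] [Field Ω] [Algebra F Ω]

namespace ValuedClosure

variable {D : ValuedClosure p F Ω} {S T H : Subgroup Gal(Ω/F)} [IsGalois F Ω] [IsSepClosed Ω]

/-- A unit of norm `1` in a step of degree `p` is a norm of an explicit element. -/
theorem Pair.eq_N_of_N_eq_one (h : D.Pair S T) (h₁ : D.Pair S H) (h₂ : D.Pair H T)
    (hidx : H.relIndex S = p) {σ : Gal(Ω/F)} (hσ : σ ∈ S ⊓ D.inertia) (hσH : σ ∉ H) {π : Ω}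
    (hπ : D.IsUnif T π) {η : Ω} (hη : η ∈ D.U H) (hN : D.N S H η = 1) :
    ∃ k : ℤ, ∃ u ∈ D.U T, η = D.N H T ((σ π / π) ^ k * (σ u / u)) := by
  obtain ⟨πS, hS⟩ := D.exists_isUnif h.totRam_left.isOpen
  have hH := h₂.isUnif_N hπ
  rw [h₁.N_eq_cycNorm hidx hσ hσH hη.1] at hN
  obtain ⟨w, hw, hw0, hηw⟩ := (h₁.stepExt hidx hσ hσH hH hS).hilbert90 η hη.1 hN
  obtain ⟨k, hk⟩ := hH.exists_zpow_inf h₁.totRam.isOpen hw hw0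
  have hPk : D.N H T π ^ k ≠ 0 := zpow_ne_zero _ hH.ne_zero
  -- Hilbert 90 gives `η = σ w / w`. The element `w` is a power of the uniformizer `N π` times a
  -- unit, and that unit is again a norm from above.
  obtain ⟨u, hu, huN⟩ := h₂.exists_N_eq (α := w / D.N H T π ^ k)
    ⟨div_mem hw (zpow_mem hH.mem_inf k), by
      rw [map_div₀, hk, map_zpow₀, div_self (zpow_ne_zero _ hH.v_pos.ne')]⟩
  refine ⟨k, u, hu, ?_⟩
  rw [map_mul, map_zpow₀, h.N_apply_div h₁ hσ.1 hπ.mem_inf, h.N_apply_div h₁ hσ.1 hu.1, huN, hηw,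
    map_div₀, map_zpow₀]
  have h1 : σ (D.N H T π) ≠ 0 := (map_ne_zero σ).2 hH.ne_zero
  have h2 : σ (D.N H T π) ^ k ≠ 0 := zpow_ne_zero _ h1
  rw [div_zpow]
  field_simp

/-- A unit of norm `1` is, modulo `Aug`, of the form `σ π / π`. -/
theorem Pair.exists_mul_mem_Aug (h : D.Pair S T) {π : Ω} (hπ : D.IsUnif T π) {ε : Ω}
    (hε : ε ∈ D.U T) (hN : D.N S T ε = 1) :
    ∃ σ ∈ S ⊓ D.inertia, ε * (σ π / π) ∈ D.Aug S T := by
  induction h using Pair.induction generalizing ε with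
  | refl S h =>
    refine ⟨1, one_mem _, ?_⟩
    rw [N, relNorm_self hε.1] at hN
    rw [hN, AlgEquiv.one_apply, div_self hπ.ne_zero, one_mul]
    exact one_mem _
  | step S H T h h₁ h₂ hidx ih =>
    obtain ⟨σ, hσ, hσH⟩ := h₁.exists_generator hidx
    -- The norm of `ε` to the intermediate field is the norm of an explicit `y`, so `ε / y` has norm
    -- `1` in the upper extension and the induction hypothesis applies to it.
    obtain ⟨k, u, hu, hku⟩ := h.eq_N_of_N_eq_one h₁ h₂ hidx hσ hσH hπ
      (h₂.totRam.N_mem_U (S := H) hε) (by rw [← h₁.totRam.N_trans h₂.totRam h₁.le h₂.le hε.1, hN])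
    have hσπ := h.apply_div_mem_U hσ.1 hπ.mem_inf hπ.ne_zero
    have hσu := h.apply_div_mem_U hσ.1 hu.1 (ne_zero_of_mem_U hu)
    have hσπk : (σ π / π) ^ k ∈ D.U T :=
      ⟨zpow_mem hσπ.1 k, by rw [map_zpow₀, hσπ.2, one_zpow]⟩
    set y := (σ π / π) ^ k * (σ u / u) with hy
    have hyU : y ∈ D.U T := mul_mem hσπk hσu
    have hy0 := ne_zero_of_mem_U hyU
    obtain ⟨τ, hτ, hτA⟩ := ih hπ (div_mem_U hε hyU) (by
      rw [map_div₀, hku, div_self ((map_ne_zero _).2 hy0)])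
    have hτA := Aug_mono (S := S) h₁.le hτA
    have hτ' : τ ∈ S ⊓ D.inertia := ⟨h₁.le hτ.1, hτ.2⟩
    -- combine the two parts
    set f := D.augHom h hπ.mem_inf hπ.ne_zero with hf
    let s : ↥(S ⊓ D.inertia) := ⟨σ, hσ⟩
    let t : ↥(S ⊓ D.inertia) := ⟨τ, hτ'⟩
    -- Modulo `Aug`, `y` is `(σ π / π) ^ k` and `ε / y` is inverse to `τ π / π`. Hence `σ ^ (-k) τ`
    -- inverts `ε`.
    refine ⟨(s ^ (-k) * t).1, (s ^ (-k) * t).2, ?_⟩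
    have hmk : ∀ a b : Ωˣ, (QuotientGroup.mk a : Ωˣ ⧸ D.augUnits S T) = QuotientGroup.mk b →
        (a : Ω) ∈ D.Aug S T → (b : Ω) ∈ D.Aug S T := by
      intro a b hab ha
      have h1 := (QuotientGroup.eq (s := D.augUnits S T)).1 hab
      have : b ∈ D.augUnits S T := by simpa using (D.augUnits S T).mul_mem ha h1
      exact this
    have hε0 := ne_zero_of_mem_U hε
    have hn0 : ∀ g : Gal(Ω/F), g π / π ≠ 0 := fun g => div_ne_zero ((map_ne_zero g).2 hπ.ne_zero) hπ.ne_zero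
    have hu0 := ne_zero_of_mem_U hσu
    refine hmk (Units.mk0 (ε / y) (div_ne_zero hε0 hy0) * Units.mk0 _ (hn0 τ) *
      Units.mk0 _ hu0) (Units.mk0 ε hε0 * Units.mk0 _ (hn0 (s ^ (-k) * t).1)) ?_ ?_
    · have e1 : (QuotientGroup.mk (Units.mk0 _ (hn0 (s ^ (-k) * t).1)) : Ωˣ ⧸ D.augUnits S T) =
          QuotientGroup.mk (Units.mk0 _ (hn0 σ)) ^ (-k) * QuotientGroup.mk (Units.mk0 _ (hn0 τ)) := by
        have := map_mul f (s ^ (-k)) t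
        rw [map_zpow] at this
        exact this
      rw [QuotientGroup.mk_mul _ (Units.mk0 ε hε0), e1, ← QuotientGroup.mk_zpow, ← QuotientGroup.mk_mul,
        ← QuotientGroup.mk_mul]
      congr 1
      ext
      have hz : (σ π / π) ^ k ≠ 0 := zpow_ne_zero _ (hn0 σ)
      simp only [Units.val_mul, Units.val_zpow_eq_zpow_val, Units.val_mk0]
      rw [zpow_neg, hy]
      generalize σ u / u = w at hu0
      generalize τ π / π = t
      generalize (σ π / π) ^ k = z at hz
      field_simp
    · simp only [Units.val_mul, Units.val_mk0]
      exact mul_mem hτA (apply_div_mem_Aug hσ hu)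

end ValuedClosure

end PClassFieldTheory

/-! ### Symbols and twisted forms -/

namespace PClassFieldTheory

open IntermediateField

section AbQuot

variable {G : Type*} [Group G] {A B : Subgroup G}

/-- The universal property of `AbQuot`. -/
def AbQuot.lift {X : Type*} [CommGroup X] (ψ : A →* X) (hψ : ∀ b : A, (b : G) ∈ B → ψ b = 1) :
    AbQuot A B →* X :=
  QuotientGroup.lift _ (Abelianization.lift ψ) (by
    rintro _ ⟨b, hb, rfl⟩
    exact (Abelianization.lift_apply_of ψ b).trans (hψ b hb))

@[simp]
theorem AbQuot.lift_mk {X : Type*} [CommGroup X] (ψ : A →* X)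
    (hψ : ∀ b : A, (b : G) ∈ B → ψ b = 1) (a : A) : AbQuot.lift ψ hψ (AbQuot.mk A B a) = ψ a :=
  Abelianization.lift_apply_of ψ a

/-- Conjugation by an element that normalizes `A`. -/
@[simps!]
def conjHom (A : Subgroup G) (s : G) (hs : ∀ a ∈ A, s * a * s⁻¹ ∈ A) : A →* A :=
  ((MulAut.conj s).toMonoidHom.comp A.subtype).codRestrict A fun a => hs a a.2

/-- The action of an element that normalizes `A` and `B` on `AbQuot A B`. -/
def AbQuot.conj (s : G) (hA : ∀ a ∈ A, s * a * s⁻¹ ∈ A) (hB : ∀ b ∈ B, s * b * s⁻¹ ∈ B) :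
    AbQuot A B →* AbQuot A B :=
  AbQuot.lift ((AbQuot.mk A B).comp (conjHom A s hA)) fun b hb =>
    AbQuot.mk_eq_one_of_mem _ (hB b hb)

@[simp]
theorem AbQuot.conj_mk (s : G) (hA : ∀ a ∈ A, s * a * s⁻¹ ∈ A) (hB : ∀ b ∈ B, s * b * s⁻¹ ∈ B)
    (a : A) : AbQuot.conj s hA hB (AbQuot.mk A B a) = AbQuot.mk A B (conjHom A s hA a) :=
  AbQuot.lift_mk _ _ a

end AbQuot

variable {p : ℕ} [hp : Fact p.Prime] {F Ω : Type*} [Field F] [Field Ω] [Algebra F Ω]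

namespace ValuedClosure

variable {D : ValuedClosure p F Ω} {S T H Δ : Subgroup Gal(Ω/F)}

variable (D) in
/-- A homomorphism that is continuous and trivial on the inertia group. -/
structure Unramified {X : Type*} [Group X] (f : Gal(Ω/F) →* X) : Prop where
  apply_eq_one : ∀ i ∈ D.inertia, f i = 1
  isOpen_ker : IsOpen (f.ker : Set Gal(Ω/F))

variable (D) in
/-- The abelianized inertia quotient of `S` modulo `T`. -/
abbrev Q (S T : Subgroup Gal(Ω/F)) : Type _ := AbQuot (S ⊓ D.inertia) (T ⊓ D.inertia)

variable (D) in
/-- The projection to `D.Q S T`. -/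
abbrev mkQ (S T : Subgroup Gal(Ω/F)) : ↥(S ⊓ D.inertia) →* D.Q S T := AbQuot.mk _ _

variable (D) in
/-- The homomorphism `f` describes the classes of `φ β / β` in terms of `i π / π`. -/
def IsSymbol (S T : Subgroup Gal(Ω/F)) (π β : Ω) (f : Gal(Ω/F) →* D.Q S T) : Prop :=
  ∀ φ ∈ T, ∀ i : ↥(S ⊓ D.inertia), D.mkQ S T i = f φ → φ β / β * (i.1 π / π) ∈ D.Aug S T

section Galois

variable [IsGalois F Ω]

theorem Pair.mul_mem_Aug_of_mk_eq (h : D.Pair S T) {π x : Ω} (hπ : D.IsUnif T π)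
    {i j : ↥(S ⊓ D.inertia)} (hi : x * (i.1 π / π) ∈ D.Aug S T) (hij : D.mkQ S T i = D.mkQ S T j) :
    x * (j.1 π / π) ∈ D.Aug S T := by
  have h1 := mul_mem hi ((h.mk_eq_mk_iff hπ).1 hij)
  have h0 : i.1 π / π ≠ 0 := div_ne_zero ((map_ne_zero i.1).2 hπ.ne_zero) hπ.ne_zero
  rwa [mul_assoc, mul_div_cancel₀ _ h0] at h1

theorem Pair.mk_eq_of_mul_mem_Aug (h : D.Pair S T) {π x : Ω} (hπ : D.IsUnif T π) (hx : x ≠ 0)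
    {i j : ↥(S ⊓ D.inertia)} (hi : x * (i.1 π / π) ∈ D.Aug S T)
    (hj : x * (j.1 π / π) ∈ D.Aug S T) : D.mkQ S T i = D.mkQ S T j := by
  rw [h.mk_eq_mk_iff hπ]
  have := div_mem_Aug hj hi
  rwa [mul_div_mul_left _ _ hx] at this

/-- An element `s ∈ T` fixes `π` and commutes with inertia on the field in question. Applying `s` to
the relation for `t` therefore changes only its `β`-part, and the symbol is a true homomorphism, not
a crossed one. -/
theorem Pair.symbol_mul (h : D.Pair S T) {π β : Ω} (hπ : D.IsUnif T π)
    {s t : Gal(Ω/F)} (hs : s ∈ T) {i j : ↥(S ⊓ D.inertia)} (hβ : β ≠ 0)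
    (hi : s β / β * (i.1 π / π) ∈ D.Aug S T) (hj : t β / β * (j.1 π / π) ∈ D.Aug S T) :
    (s * t) β / β * ((i * j).1 π / π) ∈ D.Aug S T := by
  have h1 := h.apply_mem_Aug h.refl_left (h.le hs) hj
  have hπ0 := hπ.ne_zero
  rw [map_mul, map_div₀, map_div₀, h.comm_apply hs j.2 hπ.mem_inf, mem_fixedField.1 hπ.mem s hs] at h1
  obtain ⟨a, ha, hij⟩ := h.mul_apply_div i.2 j.2.1 hπ.mem_inf hπ0
  have h2 := mul_mem (mul_mem h1 hi) ha
  have hsβ : s β ≠ 0 := (map_ne_zero s).2 hβ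
  change (s * t) β / β * ((i.1 * j.1) π / π) ∈ _
  rw [hij]
  convert h2 using 1
  rw [AlgEquiv.mul_apply]
  field_simp

/-- Every unit whose norm is fixed by `T` has a symbol. -/
theorem Pair.exists_symbol [IsSepClosed Ω] (h : D.Pair S T) {π β : Ω} (hπ : D.IsUnif T π)
    (hβ : β ∈ D.U T) (hN : ∀ φ ∈ T, φ (D.N S T β) = D.N S T β) :
    ∃ f : Gal(Ω/F) →* D.Q S T, D.Unramified f ∧ D.IsSymbol S T π β f := by
  have hβ0 := ne_zero_of_mem_U hβ
  have hex' : ∀ t ∈ T, ∃ i : ↥(S ⊓ D.inertia), t β / β * (i.1 π / π) ∈ D.Aug S T := by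
    intro t ht
    obtain ⟨σ, hσ, h1⟩ := h.exists_mul_mem_Aug hπ (h.apply_div_mem_U (h.le ht) hβ.1 hβ0) (by
      rw [h.N_apply_div h.refl_left (h.le ht) hβ.1, hN t ht, div_self ((map_ne_zero _).2 hβ0)])
    exact ⟨⟨σ, hσ⟩, h1⟩
  -- The symbol is extended from `T` to `G = T·I` by `1` on `I`. This is consistent because `T ⊓ I`
  -- fixes `β`.
  have hex : ∀ g, ∃ q, ∃ t ∈ T, ∃ i ∈ D.inertia, ∃ j : ↥(S ⊓ D.inertia), g = t * i ∧
      D.mkQ S T j = q ∧ t β / β * (j.1 π / π) ∈ D.Aug S T := by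
    intro g
    obtain ⟨t, ht, i, hi, rfl⟩ := h.totRam.exists_mul g
    obtain ⟨j, hj⟩ := hex' t ht
    exact ⟨_, t, ht, i, hi, j, rfl, rfl, hj⟩
  choose f hf using hex
  have key : ∀ g, ∀ t ∈ T, ∀ i ∈ D.inertia, ∀ j : ↥(S ⊓ D.inertia), g = t * i →
      t β / β * (j.1 π / π) ∈ D.Aug S T → f g = D.mkQ S T j := by
    intro g t ht i hi j hg hj
    obtain ⟨t', ht', i', hi', j', hg', hq, hj'⟩ := hf g
    have htt : t'⁻¹ * t ∈ T ⊓ D.inertia := by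
      refine ⟨T.mul_mem (T.inv_mem ht') ht, ?_⟩
      have : t'⁻¹ * t = i' * i⁻¹ := by
        rw [inv_mul_eq_iff_eq_mul, ← mul_assoc, ← hg', hg]; simp
      rw [this]
      exact D.inertia.mul_mem hi' (D.inertia.inv_mem hi)
    have htβ : t β = t' β := by
      have := congrArg t' (mem_fixedField.1 hβ.1 _ htt)
      simpa using this
    rw [htβ] at hj
    rw [← hq]
    exact h.mk_eq_of_mul_mem_Aug hπ (div_ne_zero ((map_ne_zero t').2 hβ0) hβ0) hj' hj
  refine ⟨MonoidHom.mk' f fun g g' => ?_, ⟨fun i hi => ?_, ?_⟩, fun φ hφ i hi => ?_⟩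
  · obtain ⟨t, ht, i, hi, j, hg, hq, hj⟩ := hf g
    obtain ⟨t', ht', i', hi', j', hg', hq', hj'⟩ := hf g'
    rw [← hq, ← hq', ← map_mul]
    refine key _ (t * t') (T.mul_mem ht ht') (t'⁻¹ * i * t'⁻¹⁻¹ * i')
      (D.inertia.mul_mem ((conj_inertia_iff _ _).2 hi) hi') _ ?_ (h.symbol_mul hπ ht hβ0 hj hj')
    rw [hg, hg']; group
  · change f i = 1
    rw [key i 1 T.one_mem i hi 1 (by simp) (by
      simp [div_self hβ0, div_self hπ.ne_zero, one_mem]), map_one]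
  -- The kernel contains the elements of `T` that fix `β`.
  · refine Subgroup.isOpen_of_mem_nhds _ (g := 1) ?_
    refine Filter.mem_of_superset (Filter.inter_mem (h.totRam.isOpen.mem_nhds T.one_mem)
      ((isOpen_stabilizer β).mem_nhds (AlgEquiv.one_apply β))) ?_
    rintro t ⟨ht, htβ⟩
    change f t = 1
    have htβ : t β = β := htβ
    rw [key t t ht 1 (one_mem _) 1 (by simp) (by
      simp [htβ, div_self hβ0, div_self hπ.ne_zero, one_mem]), map_one]
  · obtain ⟨j, hj⟩ := hex' φ hφ
    have : f φ = D.mkQ S T j := key φ φ hφ 1 (one_mem _) j (by simp) hj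
    exact h.mul_mem_Aug_of_mk_eq hπ hj (this.symm.trans hi.symm)

theorem Unramified.eq_of_forall (hT : D.TotRam T) {X : Type*} [Group X] {f f' : Gal(Ω/F) →* X}
    (hf : D.Unramified f) (hf' : D.Unramified f') (h : ∀ t ∈ T, f t = f' t) : f = f' := by
  ext g
  obtain ⟨t, ht, i, hi, rfl⟩ := hT.exists_mul g
  rw [map_mul, map_mul, hf.apply_eq_one i hi, hf'.apply_eq_one i hi, h t ht]

theorem v_unif_eq_of_inf_eq {π π' : Ω} (hT : IsOpen (T : Set Gal(Ω/F)))
    (hΔ : IsOpen (Δ : Set Gal(Ω/F))) (hinf : Δ ⊓ D.inertia = T ⊓ D.inertia) (hπ : D.IsUnif T π)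
    (hπ' : D.IsUnif Δ π') : D.v π' = D.v π := by
  obtain ⟨m, hm⟩ := hπ.exists_zpow_inf hT (hinf ▸ hπ'.mem_inf) hπ'.ne_zero
  obtain ⟨n, hn⟩ := hπ'.exists_zpow_inf hΔ (hinf.symm ▸ hπ.mem_inf) hπ.ne_zero
  have hm0 : 0 < m := by
    have := hπ'.v_lt
    rwa [hm, ← zpow_zero (D.v π), zpow_lt_zpow_iff_right_of_lt_one₀ hπ.v_pos hπ.v_lt] at this
  have h1 : D.v π ^ (1 : ℤ) = D.v π ^ (m * n) := by rw [zpow_mul, ← hm, ← hn, zpow_one]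
  have h2 := zpow_right_injective₀ hπ.v_pos hπ.v_lt.ne h1
  rw [hm, Int.eq_one_of_dvd_one hm0.le ⟨n, h2⟩, zpow_one]

/-- The quotient of the uniformizers of two fields with the same inertia group. -/
theorem Pair.div_unif_mem_U (h : D.Pair S T) (hΔ : D.TotRam Δ)
    (hinf : Δ ⊓ D.inertia = T ⊓ D.inertia) {π π' : Ω} (hπ : D.IsUnif T π) (hπ' : D.IsUnif Δ π') :
    π' / π ∈ D.U T :=
  ⟨div_mem (hinf ▸ hπ'.mem_inf) hπ.mem_inf, by
    rw [map_div₀, v_unif_eq_of_inf_eq h.totRam.isOpen hΔ.isOpen hinf hπ hπ', div_self hπ.v_pos.ne']⟩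

theorem Pair.N_div_unif (h : D.Pair S T) (hΔ : D.TotRam Δ) (hΔS : Δ ≤ S)
    (hinf : Δ ⊓ D.inertia = T ⊓ D.inertia) {π π' : Ω} (hπ : D.IsUnif T π) (hπ' : D.IsUnif Δ π') :
    D.N S T (π' / π) = relNorm S Δ π' / relNorm S T π := by
  rw [map_div₀, N, h.totRam.relNorm_inf h.le hπ.mem, ← hinf, hΔ.relNorm_inf hΔS hπ'.mem]

/-- As `i φ` fixes `π'` and `φ` fixes `π`, the quotient `φ (π'/π) / (π'/π)` equals `i⁻¹ π' / π'`. Up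
to the element `i⁻¹ (π'/π) / (π'/π)` of `Aug` this is `i⁻¹ π / π`, hence inverse to `i π / π`. -/
theorem Pair.symbol_div_unif (h : D.Pair S T) (hΔ : D.TotRam Δ)
    (hinf : Δ ⊓ D.inertia = T ⊓ D.inertia) {π π' : Ω} (hπ : D.IsUnif T π) (hπ' : D.IsUnif Δ π')
    {φ i : Gal(Ω/F)} (hφ : φ ∈ T) (hi : i ∈ S ⊓ D.inertia) (hiφ : i * φ ∈ Δ) :
    φ (π' / π) / (π' / π) * (i π / π) ∈ D.Aug S T := by
  have hU := h.div_unif_mem_U hΔ hinf hπ hπ'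
  have hπ0 := hπ.ne_zero
  have hπ'0 := hπ'.ne_zero
  have hi' : i⁻¹ ∈ S ⊓ D.inertia := inv_mem hi
  have e1 : φ π' = i⁻¹ π' := by
    have := congrArg (i⁻¹ : Gal(Ω/F)) (mem_fixedField.1 hπ'.mem _ hiφ)
    simpa using this
  obtain ⟨a, ha, h1⟩ := h.mul_apply_div hi' hi.1 hπ.mem_inf hπ0
  have h2 : (i⁻¹ * i) π / π = 1 := by simp [div_self hπ0]
  have h3 := div_mem_Aug (apply_div_mem_Aug hi' hU) ha
  have ha0 := ne_zero_of_mem_U (h.Aug_le ha)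
  convert h3 using 1
  rw [map_div₀, map_div₀, e1, mem_fixedField.1 hπ.mem φ hφ, eq_div_iff ha0]
  rw [h2] at h1
  have hn0 : i⁻¹ π ≠ 0 := (map_ne_zero (i⁻¹ : Gal(Ω/F))).2 hπ0
  have hm0 : i⁻¹ π' ≠ 0 := (map_ne_zero (i⁻¹ : Gal(Ω/F))).2 hπ'0
  calc _ = i⁻¹ π' / π' * ((i π / π) * a) := by field_simp
    _ = i⁻¹ π' / π' * (π / i⁻¹ π) := by
      congr 1
      rw [eq_div_iff hn0]
      calc _ = i⁻¹ π / π * (i π / π) * a * π := by field_simp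
        _ = π := by rw [← h1, one_mul]
    _ = _ := by field_simp

/-- The group of the totally ramified extension attached to an unramified homomorphism. -/
def twist (h : D.Pair S T) (f : Gal(Ω/F) →* D.Q S T) : Subgroup Gal(Ω/F) where
  carrier := {x | x ∈ S ∧ ∃ i : ↥(S ⊓ D.inertia), D.mkQ S T i = f x ∧ i.1⁻¹ * x ∈ T}
  one_mem' := ⟨S.one_mem, 1, by simp, by simp [T.one_mem]⟩
  mul_mem' := by
    rintro x y ⟨hx, i, hi, hix⟩ ⟨hy, j, hj, hjy⟩
    refine ⟨S.mul_mem hx hy, i * j, by rw [map_mul, map_mul, hi, hj], ?_⟩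
    have h1 := T.mul_mem hjy (h.normal _ (S.inv_mem hy) _ hix)
    convert h1 using 1
    simp only [Subgroup.coe_mul]; group
  inv_mem' := by
    rintro x ⟨hx, i, hi, hix⟩
    refine ⟨S.inv_mem hx, i⁻¹, by rw [map_inv, map_inv, hi], ?_⟩
    have h1 := h.normal _ i.2.1 _ (T.inv_mem hix)
    convert h1 using 1
    simp only [Subgroup.coe_inv]; group

/-- On inertia `f` is trivial, so the inertia subgroup of the twist does not depend on `f`: all
twists become equal over the maximal unramified extension. -/
theorem mem_twist_inf (h : D.Pair S T) {f : Gal(Ω/F) →* D.Q S T} (hf : D.Unramified f)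
    {x : Gal(Ω/F)} : x ∈ twist h f ⊓ D.inertia ↔ ∃ hx : x ∈ S ⊓ D.inertia, D.mkQ S T ⟨x, hx⟩ = 1 := by
  constructor
  · rintro ⟨⟨hxS, i, hi, hix⟩, hx⟩
    have hx' : x ∈ S ⊓ D.inertia := ⟨hxS, hx⟩
    refine ⟨hx', ?_⟩
    rw [hf.apply_eq_one x hx] at hi
    have hk : ((i⁻¹ * ⟨x, hx'⟩ : ↥(S ⊓ D.inertia)) : Gal(Ω/F)) ∈ T ⊓ D.inertia := by
      rw [Subgroup.coe_mul, Subgroup.coe_inv]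
      exact Subgroup.mem_inf.2 ⟨hix, D.inertia.mul_mem (D.inertia.inv_mem i.2.2) hx⟩
    have h1 := AbQuot.mk_eq_one_of_mem _ hk
    rw [map_mul, map_inv, inv_mul_eq_one] at h1
    rw [← h1]
    exact hi
  · rintro ⟨hx, hm⟩
    exact ⟨⟨hx.1, ⟨x, hx⟩, by rw [hm, hf.apply_eq_one x hx.2], by simp [T.one_mem]⟩, hx.2⟩

/-- Each `t ∈ T` enters the twist after multiplication by an inertia element whose class is `f t`,
so the decomposition `G = T·I` carries over to the twist. -/
theorem totRam_twist (h : D.Pair S T) {f : Gal(Ω/F) →* D.Q S T} (hf : D.Unramified f) :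
    D.TotRam (twist h f) := by
  refine ⟨?_, fun g => ?_⟩
  · refine Subgroup.isOpen_of_mem_nhds _ (g := 1) ?_
    refine Filter.mem_of_superset (Filter.inter_mem (h.totRam.isOpen.mem_nhds T.one_mem)
      (hf.isOpen_ker.mem_nhds f.ker.one_mem)) ?_
    rintro t ⟨ht, htf⟩
    exact ⟨h.le ht, 1, by rw [map_one, (show f t = 1 from htf)], by simpa using ht⟩
  · obtain ⟨t, ht, j, hj, rfl⟩ := h.totRam.exists_mul g
    obtain ⟨i, hi⟩ := AbQuot.mk_surjective (f t)
    refine ⟨i.1 * t, ⟨S.mul_mem i.2.1 (h.le ht), i, ?_, by simpa using ht⟩,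
      t⁻¹ * i.1⁻¹ * t⁻¹⁻¹ * j, D.inertia.mul_mem
        ((conj_inertia_iff _ _).2 (D.inertia.inv_mem i.2.2)) hj, by group⟩
    rw [map_mul, hf.apply_eq_one _ i.2.2, one_mul]
    exact hi

theorem unramified_one (D : ValuedClosure p F Ω) {X : Type*} [Group X] :
    D.Unramified (1 : Gal(Ω/F) →* X) :=
  ⟨fun _ _ => rfl, by rw [MonoidHom.ker_one]; exact isOpen_univ⟩

/-- Every unramified homomorphism is a symbol. -/
theorem Pair.exists_of_hom [IsSepClosed Ω] (h : D.Pair S T) {π : Ω} (hπ : D.IsUnif T π)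
    {f : Gal(Ω/F) →* D.Q S T} (hf : D.Unramified f) :
    ∃ ζ ∈ D.U T, D.N S T ζ ∈ fixedField S ∧ D.IsSymbol S T π ζ f := by
  obtain ⟨n, hn⟩ := h.exists_pow
  -- `C` is `T` enlarged by the kernel of the projection to `D.Q S T`, and `Δ` is its twist by `f`.
  -- They have the same inertia group, so their uniformizers can be compared.
  set C := twist h (1 : Gal(Ω/F) →* D.Q S T) with hC
  set Δ := twist h f with hΔ
  have hCS : C ≤ S := fun x hx => hx.1
  have hΔS : Δ ≤ S := fun x hx => hx.1
  have hTC : T ≤ C := fun t ht => ⟨h.le ht, 1, by simp, by simpa using ht⟩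
  have hmul := Subgroup.relIndex_mul_relIndex _ _ _ hTC hCS
  have hSC : D.Pair S C := by
    refine ⟨hCS, ?_, h.totRam.mono hTC, ?_⟩
    · rintro s hs x ⟨hx, i, hi, hix⟩
      have hA : ∀ a ∈ S ⊓ D.inertia, s * a * s⁻¹ ∈ S ⊓ D.inertia :=
        fun a ha => (conj_self_iff' hs a).2 ha
      have hB : ∀ a ∈ T ⊓ D.inertia, s * a * s⁻¹ ∈ T ⊓ D.inertia :=
        fun a ha => (h.conj_iff' hs a).2 ha
      refine ⟨S.mul_mem (S.mul_mem hs hx) (S.inv_mem hs), conjHom _ s hA i, ?_, ?_⟩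
      · have := AbQuot.conj_mk s hA hB i
        rw [MonoidHom.one_apply] at hi
        rw [hi, map_one] at this
        exact this.symm
      · have := h.normal s hs _ hix
        convert this using 1
        simp only [conjHom_apply_coe]; group
    · obtain ⟨k, -, hk⟩ := (Nat.dvd_prime_pow hp.out).1 (hn ▸ Dvd.intro_left _ hmul)
      exact ⟨k, hk⟩
  have hCT : D.Pair C T := by
    refine ⟨hTC, fun s hs => h.normal s (hCS hs), h.totRam, ?_⟩
    obtain ⟨k, -, hk⟩ := (Nat.dvd_prime_pow hp.out).1 (hn ▸ Dvd.intro _ hmul)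
    exact ⟨k, hk⟩
  have hinf : Δ ⊓ D.inertia = C ⊓ D.inertia := by
    ext x; rw [mem_twist_inf h hf, mem_twist_inf h D.unramified_one]
  have hπC := hCT.isUnif_N hπ
  have hΔr := totRam_twist h hf
  obtain ⟨π', hπ'⟩ := D.exists_isUnif hΔr.isOpen
  have hεU := hSC.div_unif_mem_U hΔr hinf hπC hπ'
  -- The quotient of uniformizers is a unit at the level of `C` with known symbol, and surjectivity
  -- of the norm lifts it to the level of `T`.
  obtain ⟨ζ, hζ, hζN⟩ := hCT.exists_N_eq hεU
  have hζ0 := ne_zero_of_mem_U hζ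
  have hNζ : D.N S T ζ ∈ fixedField S := by
    rw [hSC.totRam.N_trans h.totRam hCS hTC hζ.1, hζN, hSC.N_div_unif hΔr hΔS hinf hπC hπ']
    exact div_mem (relNorm_mem (relIndex_ne_zero_of_isOpen hΔr.isOpen _) hπ'.mem)
      (relNorm_mem hSC.relIndex_ne_zero hπC.mem)
  refine ⟨ζ, hζ, hNζ, fun φ hφ i hi => ?_⟩
  obtain ⟨j, hj, hjA⟩ := h.exists_mul_mem_Aug hπ (h.apply_div_mem_U (h.le hφ) hζ.1 hζ0) (by
      rw [h.N_apply_div h.refl_left (h.le hφ) hζ.1, mem_fixedField.1 hNζ _ (h.le hφ),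
        div_self ((map_ne_zero _).2 hζ0)])
  refine h.mul_mem_Aug_of_mk_eq hπ (i := ⟨j, hj⟩) hjA ?_
  -- compare the norms to the field fixed by `C`
  have h1 := h.N_mem_Aug hSC hjA
  rw [map_mul, h.N_apply_div hSC (h.le hφ) hζ.1, h.N_apply_div hSC hj.1 hπ.mem_inf, hζN] at h1
  have h2 : i.1 * φ ∈ Δ := ⟨S.mul_mem i.2.1 (h.le hφ), i, by
    rw [map_mul, hf.apply_eq_one _ i.2.2, one_mul]; exact hi, by simpa using hφ⟩
  have h3 := hSC.symbol_div_unif hΔr hinf hπC hπ' (hTC hφ) i.2 h2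
  have hε0 := ne_zero_of_mem_U hεU
  have h4 := hSC.mk_eq_of_mul_mem_Aug hπC (i := ⟨j, hj⟩) (j := i)
    (div_ne_zero ((map_ne_zero φ).2 hε0) hε0) h1 h3
  -- Nothing is lost in passing from `T` to `C`, because `C ⊓ I` is exactly the kernel of the
  -- projection to `D.Q S T`, whose target is commutative.
  rw [← inv_mul_eq_one, ← map_inv, ← map_mul] at h4 ⊢
  refine AbQuot.mem_of_mk_eq_one h4 (K := (D.mkQ S T).ker) (fun b hb => ?_) fun a b => ?_
  · obtain ⟨hx, hb⟩ := (mem_twist_inf h D.unramified_one).1 hb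
    exact hb
  · rw [MonoidHom.mem_ker, map_mul, map_mul, map_mul, map_inv, map_inv, mul_inv_cancel_comm,
      mul_inv_cancel]

end Galois

end ValuedClosure

end PClassFieldTheory

/-! ### Lifting unramified homomorphisms by Artin–Schreier theory -/

namespace PClassFieldTheory

open IntermediateField

section Splitting

open Polynomial

theorem exists_pow_sub_self_eq {κ : Type*} [Field κ] [IsAlgClosed κ] {p : ℕ} (hp : 1 < p) (y : κ) :
    ∃ x : κ, x ^ p - x = y := by
  have hd : (X ^ p - (X + C y) : κ[X]).degree = p := by
    rw [degree_sub_eq_left_of_degree_lt, degree_X_pow]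
    rw [degree_X_add_C, degree_X_pow]
    exact_mod_cast hp
  obtain ⟨x, hx⟩ := IsAlgClosed.exists_root (X ^ p - (X + C y) : κ[X]) (by
    rw [hd]; exact_mod_cast (by omega : p ≠ 0))
  refine ⟨x, ?_⟩
  simp only [IsRoot.def, eval_sub, eval_pow, eval_X, eval_add, eval_C] at hx
  linear_combination hx

/-- Inflation of a 2-cocycle with values in the prime field to a group acting on an algebraically
closed field splits, if the normal basis theorem holds. -/
theorem exists_splitting {κ G B : Type*} [Field κ] [IsAlgClosed κ] {p : ℕ} [hp : Fact p.Prime]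
    [CharP κ p] [Group G] [MulSemiringAction G κ] [CommGroup B] [Fintype B] (f : G →* B)
    (θ : B → κ) (hθ : ∀ g b, g • θ b = θ (f g * b)) (hθ1 : ∑ b, θ b = 1) (c : B → B → ZMod p)
    (hc : ∀ d a b, c d a + c (d * a) b = c a b + c d (a * b)) :
    ∃ (x : κ) (e : G → ZMod p), (∀ g h, e (g * h) = e g + e h + c (f g) (f h)) ∧
      ∀ g h, f g = f h → g • x = h • x → e g = e h := by
  let ι : ZMod p →+* κ := ZMod.castHom (dvd_refl p) κ
  have hι : ∀ (g : G) n, g • ι n = ι n := fun g n =>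
    DFunLike.congr_fun (RingHom.ext_zmod ((MulSemiringAction.toRingHom G κ g).comp ι) ι) n
  have hιinj : Function.Injective ι := ι.injective
  have hsum : ∀ a : B, ∑ b, θ (a * b) = 1 := fun a => by
    rw [← hθ1]; exact Fintype.sum_equiv (Equiv.mulLeft a) _ _ fun b => rfl
  -- Averaging against `θ` splits the cocycle in the large field: `C` is a cochain with coboundary
  -- `c`.
  let C : B → κ := fun a => ∑ b, ι (c a b) * θ (a * b)
  have hgC : ∀ g a, g • C a = ∑ b, ι (c a b) * θ (f g * a * b) := by
    intro g a
    simp only [C, Finset.smul_sum, smul_mul', hι, hθ, mul_assoc]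
  have hC : ∀ g a, g • C a - C (f g * a) + C (f g) = ι (c (f g) a) := by
    intro g a
    have h1 : C (f g) = ∑ b, ι (c (f g) (a * b)) * θ (f g * a * b) :=
      (Fintype.sum_equiv (Equiv.mulLeft a) _ _ fun b => by simp [mul_assoc]).symm
    rw [hgC, h1]
    simp only [C]
    rw [← Finset.sum_sub_distrib, ← Finset.sum_add_distrib]
    have h2 : ∀ b, ι (c a b) * θ (f g * a * b) - ι (c (f g * a) b) * θ (f g * a * b) +
        ι (c (f g) (a * b)) * θ (f g * a * b) = ι (c (f g) a) * θ (f g * a * b) := by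
      intro b
      have := congrArg ι (hc (f g) a b)
      simp only [map_add] at this
      linear_combination (-θ (f g * a * b)) * this
    rw [Finset.sum_congr rfl fun b _ => h2 b, ← Finset.mul_sum, hsum, mul_one]
  let P : κ → κ := fun x => x ^ p - x
  have hP_add : ∀ x y, P (x + y) = P x + P y := fun x y => by
    simp only [P, add_pow_char]; ring
  have hP_sub : ∀ x y, P (x - y) = P x - P y := fun x y => by
    simp only [P, sub_pow_char]; ring
  have hP_smul : ∀ (g : G) x, g • P x = P (g • x) := fun g x => by
    simp only [P, smul_sub, smul_pow']
  have hP_ι : ∀ n, P (ι n) = 0 := fun n => by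
    simp only [P]; rw [← map_pow, ZMod.pow_card, sub_self]
  have hPC : ∀ g a, P (C (f g * a)) = g • P (C a) + P (C (f g)) := by
    intro g a
    have := congrArg P (hC g a)
    rw [hP_ι, hP_add, hP_sub, ← hP_smul] at this
    linear_combination -this
  -- The map `P` kills the prime field, so `P ∘ C` is a 1-cocycle. It is split by averaging once
  -- more, and the splitting element is written as `P x`.
  obtain ⟨x, hx⟩ := exists_pow_sub_self_eq (κ := κ) hp.out.one_lt (-∑ d, P (C d) * θ d)
  have hx : P x = -∑ d, P (C d) * θ d := hx
  have hgx : ∀ g : G, P (C (f g) - (g • x - x)) = 0 := by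
    intro g
    have h1 : ∑ d, P (C d) * θ d = ∑ d, P (C (f g * d)) * θ (f g * d) :=
      (Fintype.sum_equiv (Equiv.mulLeft (f g)) _ _ fun b => rfl).symm
    rw [hP_sub, hP_sub, ← hP_smul, hx, smul_neg, Finset.smul_sum]
    rw [h1]
    have h2 : ∀ d, P (C (f g * d)) * θ (f g * d) =
        g • (P (C d) * θ d) + P (C (f g)) * θ (f g * d) := by
      intro d
      rw [hPC, smul_mul', hθ]; ring
    rw [Finset.sum_congr rfl fun d _ => h2 d, Finset.sum_add_distrib, ← Finset.mul_sum, hsum]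
    ring
  -- After the correction by `g x - x` the cochain is annihilated by `P`. It therefore takes values
  -- in the prime field, and its coboundary is still `c`.
  have hE : ∀ g : G, ∃ n : ZMod p, ι n = -(C (f g) - (g • x - x)) := by
    intro g
    have h1 : (C (f g) - (g • x - x)) ^ p = C (f g) - (g • x - x) := sub_eq_zero.1 (hgx g)
    rw [← Subfield.mem_bot_iff_pow_eq_self, mem_bot_iff_intCast p] at h1
    obtain ⟨n, hn⟩ := h1
    exact ⟨-(n : ZMod p), by rw [map_neg, map_intCast, hn]⟩
  choose e he using hE
  refine ⟨x, e, fun g h => hιinj ?_, fun g h hf hg => hιinj (by rw [he, he, hf, hg])⟩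
  rw [map_add, map_add, he, he, he, map_mul, mul_smul, ← hC g (f h)]
  have h1 := hι g (e h)
  rw [he, smul_neg, smul_sub, smul_sub] at h1
  linear_combination h1

end Splitting

variable {p : ℕ} [hp : Fact p.Prime] {F Ω : Type*} [Field F] [Field Ω] [Algebra F Ω]

namespace ValuedClosure

variable {D : ValuedClosure p F Ω} [IsGalois F Ω]

/-- The residues of the conjugates of integers fixed by the kernel are distinct characters, because
`f` is trivial on inertia. Independence gives an integer whose residual trace is non-zero, and that
trace is invariant, so one may divide by it. -/
theorem Unramified.exists_normal_basis {B : Type*} [CommGroup B] [Fintype B] {f : Gal(Ω/F) →* B}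
    (hf : D.Unramified f) (hsurj : Function.Surjective f) :
    ∃ θ : B → D.resField, (∀ g b, g • θ b = θ (f g * b)) ∧ ∑ b, θ b = 1 := by
  choose s hs using hsurj
  let R : Subring D.integers := (fixedField f.ker).toSubring.comap D.integers.subtype
  let χ : B → (R →* D.resField) := fun b =>
    ((D.res.comp (MulSemiringAction.toRingHom Gal(Ω/F) D.integers (s b))).comp R.subtype :
      R →+* D.resField)
  have hχ : Function.Injective χ := by
    intro i j hij
    obtain ⟨n, hn, t, ht, hnt⟩ := D.mem_mul_inertia_of_fix_residues
      (Subgroup.isClosed_of_isOpen f.ker hf.isOpen_ker) ((s i)⁻¹ * s j) (by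
        intro y hy hyN
        have h1 : D.res (s i • (⟨y, hy⟩ : D.integers)) = D.res (s j • (⟨y, hy⟩ : D.integers)) :=
          DFunLike.congr_fun hij ⟨⟨y, hy⟩, mem_fixedField.2 hyN⟩
        rw [res_eq_iff] at h1
        rw [← D.v_gal (s i), map_sub, D.v_sub_comm]
        simpa using h1)
    have := congrArg f hnt
    rw [map_mul, map_mul, map_inv, hs, hs, hf.apply_eq_one t ht, (show f n = 1 from hn), mul_one,
      inv_mul_eq_one] at this
    exact this
  have hli := (linearIndependent_monoidHom R D.resField).comp χ hχ
  rw [Fintype.linearIndependent_iff] at hli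
  have hne : ∃ d : R, ∑ b, D.res (s b • (d : D.integers)) ≠ 0 := by
    by_contra! hall
    refine one_ne_zero (hli (fun _ => 1) ?_ 1)
    funext d
    simpa [χ] using! hall d
  obtain ⟨d, hd⟩ := hne
  have hact : ∀ g b, g • D.res (s b • (d : D.integers)) = D.res (s (f g * b) • (d : D.integers)) := by
    intro g b
    rw [← IsLocalRing.ResidueField.residue_smul]
    congr 1
    ext
    change g (s b d) = s (f g * b) d
    have h1 : (s (f g * b))⁻¹ * (g * s b) ∈ f.ker := by
      rw [MonoidHom.mem_ker, map_mul, map_mul, map_inv, hs, hs, inv_mul_cancel]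
    have h2 := congrArg (s (f g * b)) (mem_fixedField.1 d.2 _ h1)
    simpa using h2
  set τ := ∑ b, D.res (s b • (d : D.integers)) with hτ
  have hgτ : ∀ g : Gal(Ω/F), g • τ = τ := by
    intro g
    rw [hτ, Finset.smul_sum]
    exact Fintype.sum_equiv (Equiv.mulLeft (f g)) _ _ fun b => hact g b
  refine ⟨fun b => D.res (s b • (d : D.integers)) * τ⁻¹, fun g b => ?_, ?_⟩
  · rw [smul_mul', hact, smul_inv'', hgτ]
  · rw [← Finset.sum_mul, ← hτ, mul_inv_cancel₀ hd]

theorem smul_resField_of_mem_inertia {i : Gal(Ω/F)} (hi : i ∈ D.inertia) (y : D.resField) :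
    i • y = y := by
  obtain ⟨x, rfl⟩ := D.res_surjective y
  rw [← IsLocalRing.ResidueField.residue_smul]
  exact D.res_eq_iff.2 (hi x x.2)

/-- Lifting through a central extension by a group of order `p`. -/
theorem Unramified.exists_lift_of_card_eq [IsSepClosed Ω] {A : Type*} [CommGroup A] [Finite A]
    {z : A} (hz : orderOf z = p) {f : Gal(Ω/F) →* A ⧸ Subgroup.zpowers z} (hf : D.Unramified f) :
    ∃ f' : Gal(Ω/F) →* A, D.Unramified f' ∧ ∀ g, (QuotientGroup.mk (f' g) : A ⧸ _) = f g := by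
  classical
  have hf' : D.Unramified f.rangeRestrict := by
    refine ⟨fun i hi => Subtype.ext (hf.apply_eq_one i hi), ?_⟩
    rw [MonoidHom.ker_rangeRestrict]
    exact hf.isOpen_ker
  have : Fintype f.range := Fintype.ofFinite _
  obtain ⟨θ, hθ, hθ1⟩ := hf'.exists_normal_basis f.rangeRestrict_surjective
  -- A set-theoretic section. Its failure to be multiplicative is a 2-cocycle with values in the
  -- subgroup generated by `z`, identified with `ZMod p`.
  let s : f.range → A := fun b => b.1.out
  have hs : ∀ b, (QuotientGroup.mk (s b) : A ⧸ Subgroup.zpowers z) = b.1 := fun b =>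
    QuotientGroup.out_eq' b.1
  let ζ : ZMod p → A := fun n => z ^ n.val
  have hzp : z ^ p = 1 := hz ▸ pow_orderOf_eq_one z
  have hζ_add : ∀ m n, ζ (m + n) = ζ m * ζ n := by
    intro m n
    simp only [ζ]
    have := pow_mod_orderOf z (m.val + n.val)
    rw [hz] at this
    rw [ZMod.val_add, this, pow_add]
  have hζ_inj : Function.Injective ζ := by
    intro m n hmn
    have := pow_injOn_Iio_orderOf (x := z) (by rw [hz]; exact ZMod.val_lt m)
      (by rw [hz]; exact ZMod.val_lt n) hmn
    exact ZMod.val_injective p this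
  have hζ_surj : ∀ y ∈ Subgroup.zpowers z, ∃ n, ζ n = y := by
    rintro _ ⟨k, rfl⟩
    refine ⟨(k : ZMod p), ?_⟩
    change z ^ (k : ZMod p).val = z ^ k
    rw [← zpow_natCast, ZMod.val_intCast, ← hz, zpow_mod_orderOf]
  have hex : ∀ a b : f.range, ∃ n, ζ n = (s (a * b))⁻¹ * (s a * s b) := by
    intro a b
    refine hζ_surj _ ?_
    rw [← QuotientGroup.eq_one_iff]
    simp only [QuotientGroup.mk_mul, QuotientGroup.mk_inv, hs]
    simp
  choose c hc using hex
  have hc' : ∀ a b, s a * s b = s (a * b) * ζ (c a b) := fun a b => by rw [hc]; simp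
  obtain ⟨x, e, he, he'⟩ := exists_splitting (κ := D.resField) f.rangeRestrict θ hθ hθ1 c (by
    intro d a b
    refine hζ_inj ?_
    rw [hζ_add, hζ_add, ← mul_right_inj (s (d * a * b))]
    have h1 : s d * s a * s b = s (d * a * b) * (ζ (c d a) * ζ (c (d * a) b)) := by
      rw [hc', mul_right_comm, hc', mul_assoc, mul_comm (ζ _)]
    have h2 : s d * s a * s b = s (d * a * b) * (ζ (c a b) * ζ (c d (a * b))) := by
      rw [mul_assoc (s d), hc', ← mul_assoc, hc', mul_assoc d, mul_assoc, mul_comm (ζ _)]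
    rw [← h1, h2])
  let f₁ : Gal(Ω/F) →* A := MonoidHom.mk' (fun g => s (f.rangeRestrict g) * ζ (e g)) fun g h => by
    rw [he, map_mul, hζ_add, hζ_add]
    calc _ = s (f.rangeRestrict g * f.rangeRestrict h) *
          ζ (c (f.rangeRestrict g) (f.rangeRestrict h)) * (ζ (e g) * ζ (e h)) := by
            rw [mul_comm (ζ (e g) * ζ (e h)), mul_assoc]
      _ = _ := by rw [← hc', mul_mul_mul_comm]
  -- The correction `e g` depends only on `f g` and on the action of `g` on one residue `x`, so the
  -- lift is trivial on inertia and has open kernel.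
  have hdep : ∀ g, f g = 1 → g • x = x → f₁ g = 1 := by
    intro g hg hx
    have h1 : f.rangeRestrict g = f.rangeRestrict 1 := by
      rw [map_one]; exact Subtype.ext hg
    have h2 : e g = e 1 := he' g 1 h1 (by rw [hx, one_smul])
    rw [← map_one f₁]
    change s _ * ζ _ = s _ * ζ _
    rw [h1, h2]
  refine ⟨f₁, ⟨fun i hi => hdep i (hf.apply_eq_one i hi) (smul_resField_of_mem_inertia hi x), ?_⟩, ?_⟩
  · obtain ⟨y, rfl⟩ := D.res_surjective x
    refine Subgroup.isOpen_of_mem_nhds _ (g := 1) ?_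
    refine Filter.mem_of_superset (Filter.inter_mem (hf.isOpen_ker.mem_nhds f.ker.one_mem)
      ((isOpen_stabilizer (y : Ω)).mem_nhds (AlgEquiv.one_apply (y : Ω)))) ?_
    rintro g ⟨hg, hgy⟩
    refine hdep g hg ?_
    rw [← IsLocalRing.ResidueField.residue_smul]
    congr 1
    exact Subtype.ext hgy
  · intro g
    change (QuotientGroup.mk (s _ * z ^ _) : A ⧸ Subgroup.zpowers z) = _
    rw [QuotientGroup.mk_mul, hs, (QuotientGroup.eq_one_iff (z ^ (e g).val)).2
      (Subgroup.pow_mem _ (Subgroup.mem_zpowers z) _), mul_one]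
    rfl

/-- Unramified homomorphisms lift through surjections of finite abelian `p`-groups. -/
theorem Unramified.exists_lift [IsSepClosed Ω] (n : ℕ) {A B : Type*} [CommGroup A] [Finite A]
    [CommGroup B] (hcard : Nat.card A = n) (hA : IsPGroup p A) (ψ : A →* B) {f : Gal(Ω/F) →* B}
    (hf : D.Unramified f) (hrange : ∀ g, f g ∈ ψ.range) :
    ∃ f' : Gal(Ω/F) →* A, D.Unramified f' ∧ ∀ g, ψ (f' g) = f g := by
  induction n using Nat.strong_induction_on generalizing A with
  | _ n ih =>
  by_cases hinj : Function.Injective ψ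
  · choose s hs using hrange
    let f' : Gal(Ω/F) →* A := MonoidHom.mk' s fun g h => hinj (by rw [hs, map_mul, map_mul, hs, hs])
    have hf' : ∀ g, f' g = 1 ↔ f g = 1 := fun g => by
      rw [← hs]; exact (map_eq_one_iff ψ hinj).symm
    refine ⟨f', ⟨fun i hi => (hf' i).2 (hf.apply_eq_one i hi), ?_⟩, hs⟩
    have : f'.ker = f.ker := by ext g; exact hf' g
    rw [this]; exact hf.isOpen_ker
  · have hker : ψ.ker ≠ ⊥ := fun h => hinj ((MonoidHom.ker_eq_bot_iff ψ).1 h)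
    obtain ⟨a, ha1⟩ := Subgroup.ne_bot_iff_exists_ne_one.1 hker
    have ha := a.2
    -- A subgroup of order `p` in the kernel is split off: first lift to the quotient by it, by
    -- induction on the order, then through this subgroup.
    obtain ⟨z, hzk, hz⟩ : ∃ z : A, z ∈ ψ.ker ∧ orderOf z = p := by
      obtain ⟨k, hk⟩ := IsPGroup.iff_orderOf.1 hA a.1
      have hk0 : k ≠ 0 := by
        rintro rfl
        rw [pow_zero, orderOf_eq_one_iff] at hk
        exact ha1 (Subtype.ext hk)
      refine ⟨a.1 ^ (orderOf a.1 / p), ψ.ker.pow_mem ha _, ?_⟩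
      have hdvd : p ∣ orderOf a.1 := hk ▸ dvd_pow_self p hk0
      have h0 : orderOf a.1 ≠ 0 := hk ▸ pow_ne_zero _ hp.out.ne_zero
      rw [orderOf_pow_of_dvd (Nat.div_pos (Nat.le_of_dvd (Nat.pos_of_ne_zero h0) hdvd) hp.out.pos).ne'
        (Nat.div_dvd_of_dvd hdvd), Nat.div_div_self hdvd h0]
    let ψ' : A ⧸ Subgroup.zpowers z →* B := QuotientGroup.lift _ ψ (by
      have : Subgroup.zpowers z ≤ ψ.ker := by rwa [Subgroup.zpowers_le]
      exact this)
    have hc : Nat.card (A ⧸ Subgroup.zpowers z) < n := by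
      have h1 := (Subgroup.zpowers z).card_eq_card_quotient_mul_card_subgroup
      rw [Nat.card_zpowers, hz, hcard] at h1
      have h2 : 0 < Nat.card (A ⧸ Subgroup.zpowers z) := Nat.card_pos
      rw [h1]
      exact lt_mul_of_one_lt_right h2 hp.out.one_lt
    obtain ⟨f₁, hf₁, hf₁'⟩ := ih _ hc rfl (hA.to_quotient _) ψ' (fun g => by
      obtain ⟨a, ha⟩ := hrange g
      exact ⟨QuotientGroup.mk a, ha⟩)
    obtain ⟨f₂, hf₂, hf₂'⟩ := hf₁.exists_lift_of_card_eq hz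
    refine ⟨f₂, hf₂, fun g => ?_⟩
    rw [← hf₁' g, ← hf₂' g]
    rfl

end ValuedClosure

end PClassFieldTheory

/-! ### Descent: a unit with trivial symbol is a norm -/

namespace PClassFieldTheory

open IntermediateField

section AbQuot

variable {G : Type*} [Group G] {A A₁ B : Subgroup G}

/-- If `A` is generated by `A₁` and `g`, the elements of `A₁` that become trivial in `AbQuot A B` are
commutators with `g` in `AbQuot A₁ B`. -/
theorem AbQuot.mk_mem_range_of_mk_eq_one {g : G} (hgA : g ∈ A) (hle : A₁ ≤ A)
    (hA : ∀ a ∈ A₁, g * a * g⁻¹ ∈ A₁) (hB : ∀ b ∈ B, g * b * g⁻¹ ∈ B) (hB₁ : B ≤ A₁)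
    (hgen : ∀ a ∈ A, ∃ n : ℕ, (g ^ n)⁻¹ * a ∈ A₁) {x : G} (hx : x ∈ A₁)
    (h : AbQuot.mk A B ⟨x, hle hx⟩ = 1) :
    AbQuot.mk A₁ B ⟨x, hx⟩ ∈ (AbQuot.conj g hA hB / MonoidHom.id (AbQuot A₁ B)).range := by
  set ψ : AbQuot A₁ B →* AbQuot A₁ B := AbQuot.conj g hA hB / MonoidHom.id _ with hψ
  -- The preimage of the commutators with `g`. It is normal in `A` with commutative quotient and
  -- contains `B`, so every element that dies in `AbQuot A B` lies in it.
  let M₀ : Subgroup G := (ψ.range.comap (AbQuot.mk A₁ B)).map A₁.subtype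
  have hM₀ : ∀ {y : G} (hy : y ∈ A₁), y ∈ M₀ ↔ AbQuot.mk A₁ B ⟨y, hy⟩ ∈ ψ.range := by
    intro y hy
    constructor
    · rintro ⟨z, hz, rfl⟩; exact hz
    · intro hz; exact ⟨⟨y, hy⟩, hz, rfl⟩
  have hM₀le : M₀ ≤ A₁ := Subgroup.map_subtype_le _
  have hcomm : ∀ y : A₁, ψ (AbQuot.mk A₁ B y) * AbQuot.mk A₁ B y =
      AbQuot.mk A₁ B (conjHom A₁ g hA y) := by
    intro y
    rw [hψ, MonoidHom.div_apply, AbQuot.conj_mk, MonoidHom.id_apply, div_mul_cancel]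
  have hg : ∀ y ∈ M₀, g * y * g⁻¹ ∈ M₀ := by
    intro y hy
    have hy1 := hM₀le hy
    refine (hM₀ (hA y hy1)).2 ?_
    have := hcomm ⟨y, hy1⟩
    have h2 : conjHom A₁ g hA ⟨y, hy1⟩ = ⟨g * y * g⁻¹, hA y hy1⟩ := rfl
    rw [← h2, ← this]
    exact mul_mem ⟨_, rfl⟩ ((hM₀ hy1).1 hy)
  have hgn : ∀ n : ℕ, ∀ y ∈ M₀, g ^ n * y * (g ^ n)⁻¹ ∈ M₀ := by
    intro n
    induction n with
    | zero => intro y hy; simpa using hy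
    | succ n ih =>
      intro y hy
      have := hg _ (ih y hy)
      rw [pow_succ']
      simpa [mul_assoc] using this
  have hA₁ : ∀ a ∈ A₁, ∀ y ∈ M₀, a * y * a⁻¹ ∈ M₀ := by
    intro a ha y hy
    have hy1 := hM₀le hy
    refine (hM₀ (A₁.mul_mem (A₁.mul_mem ha hy1) (A₁.inv_mem ha))).2 ?_
    have h2 : (⟨a * y * a⁻¹, A₁.mul_mem (A₁.mul_mem ha hy1) (A₁.inv_mem ha)⟩ : A₁) =
      ⟨a, ha⟩ * ⟨y, hy1⟩ * ⟨a, ha⟩⁻¹ := rfl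
    rw [h2, map_mul, map_mul, map_inv, mul_inv_cancel_comm]
    exact (hM₀ hy1).1 hy
  let M : Subgroup A := M₀.subgroupOf A
  have hMn : M.Normal := by
    constructor
    intro y hy a
    obtain ⟨n, hn⟩ := hgen a a.2
    have hy : (y : G) ∈ M₀ := hy
    have := hgn n _ (hA₁ _ hn _ hy)
    change (a : G) * y * (a : G)⁻¹ ∈ M₀
    convert this using 1
    group
  have hc1 : ∀ (a b : A), (a : G) * b * (a : G)⁻¹ * (b : G)⁻¹ ∈ M₀ →
      Commute (QuotientGroup.mk a : A ⧸ M) (QuotientGroup.mk b) := by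
    intro a b hab
    have : (QuotientGroup.mk (a * b * a⁻¹ * b⁻¹) : A ⧸ M) = 1 := (QuotientGroup.eq_one_iff _).2 hab
    rw [QuotientGroup.mk_mul, QuotientGroup.mk_inv, mul_inv_eq_one, QuotientGroup.mk_mul,
      QuotientGroup.mk_inv, mul_inv_eq_iff_eq_mul] at this
    exact this
  have hcgh : ∀ b : A, (b : G) ∈ A₁ →
      Commute (QuotientGroup.mk ⟨g, hgA⟩ : A ⧸ M) (QuotientGroup.mk b) := by
    intro b hb
    refine hc1 _ _ ((hM₀ (A₁.mul_mem (hA b hb) (A₁.inv_mem hb))).2 ?_)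
    have h2 : (⟨g * b * g⁻¹ * (b : G)⁻¹, A₁.mul_mem (hA b hb) (A₁.inv_mem hb)⟩ : A₁) =
      conjHom A₁ g hA ⟨b, hb⟩ * ⟨b, hb⟩⁻¹ := rfl
    rw [h2, map_mul, map_inv, ← hcomm, mul_inv_cancel_right]
    exact ⟨_, rfl⟩
  have hchh : ∀ a b : A, (a : G) ∈ A₁ → (b : G) ∈ A₁ →
      Commute (QuotientGroup.mk a : A ⧸ M) (QuotientGroup.mk b) := by
    intro a b ha hb
    have hm : (a : G) * b * (a : G)⁻¹ * (b : G)⁻¹ ∈ A₁ :=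
      A₁.mul_mem (A₁.mul_mem (A₁.mul_mem ha hb) (A₁.inv_mem ha)) (A₁.inv_mem hb)
    refine hc1 _ _ ((hM₀ hm).2 ?_)
    have h2 : (⟨_, hm⟩ : A₁) = ⟨a, ha⟩ * ⟨b, hb⟩ * ⟨a, ha⟩⁻¹ * ⟨b, hb⟩⁻¹ := rfl
    rw [h2, map_mul, map_mul, map_mul, map_inv, map_inv, mul_inv_cancel_comm, mul_inv_cancel]
    exact one_mem _
  -- It is enough to compare `g` and the elements of `A₁`, since together they generate `A`.
  have hall : ∀ a b : A, Commute (QuotientGroup.mk a : A ⧸ M) (QuotientGroup.mk b) := by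
    intro a b
    obtain ⟨m, hm⟩ := hgen a a.2
    obtain ⟨n, hn⟩ := hgen b b.2
    have ha : a = ⟨g, hgA⟩ ^ m * ((⟨g, hgA⟩ ^ m)⁻¹ * a) := by simp
    have hb : b = ⟨g, hgA⟩ ^ n * ((⟨g, hgA⟩ ^ n)⁻¹ * b) := by simp
    rw [ha, hb, QuotientGroup.mk_mul _ ((⟨g, hgA⟩ : A) ^ m),
      QuotientGroup.mk_mul _ ((⟨g, hgA⟩ : A) ^ n), QuotientGroup.mk_pow, QuotientGroup.mk_pow]
    refine Commute.mul_left (Commute.mul_right ?_ ?_) (Commute.mul_right ?_ ?_)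
    · exact (Commute.refl _).pow_pow _ _
    · exact (hcgh _ hn).pow_left _
    · exact ((hcgh _ hm).pow_left _).symm
    · exact hchh _ _ hm hn
  refine (hM₀ hx).1 (AbQuot.mem_of_mk_eq_one h (K := M) (fun b hb => ?_) fun a b => ?_)
  · refine (hM₀ (hB₁ hb)).2 ?_
    rw [AbQuot.mk_eq_one_of_mem (A := A₁) ⟨b, hB₁ hb⟩ hb]
    exact one_mem _
  · rw [← QuotientGroup.eq_one_iff]
    have := hall a b
    rw [QuotientGroup.mk_mul, QuotientGroup.mk_inv, mul_inv_eq_one, QuotientGroup.mk_mul,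
      QuotientGroup.mk_inv, mul_inv_eq_iff_eq_mul]
    exact this

theorem AbQuot.isPGroup {p n : ℕ} (h : B.relIndex A = p ^ n)
    (hB : ∀ a ∈ A, ∀ b ∈ B, a * b * a⁻¹ ∈ B) : IsPGroup p (AbQuot A B) := by
  intro q
  refine ⟨n, ?_⟩
  obtain ⟨a, rfl⟩ := AbQuot.mk_surjective q
  have hnorm : (B.subgroupOf A).Normal := ⟨fun b hb a => hB a a.2 b hb⟩
  have h1 : (QuotientGroup.mk a : A ⧸ B.subgroupOf A) ^ (p ^ n) = 1 := by
    rw [← h]; exact pow_card_eq_one'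
  rw [← QuotientGroup.mk_pow, QuotientGroup.eq_one_iff] at h1
  rw [← map_pow]
  exact AbQuot.mk_eq_one_of_mem _ h1

end AbQuot

variable {p : ℕ} [hp : Fact p.Prime] {F Ω : Type*} [Field F] [Field Ω] [Algebra F Ω]

namespace ValuedClosure

variable {D : ValuedClosure p F Ω} {S T H : Subgroup Gal(Ω/F)} [IsGalois F Ω]

theorem Pair.isPGroup_Q (h : D.Pair S T) : IsPGroup p (D.Q S T) := by
  obtain ⟨n, hn⟩ := h.exists_pow
  exact AbQuot.isPGroup (n := n) (by rw [h.totRam.relIndex_inf h.le, hn])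
    fun a ha b hb => (h.conj_iff' ha.1 b).2 hb

theorem Pair.finite_Q (h : D.Pair S T) : Finite (D.Q S T) :=
  AbQuot.finite (relIndex_inf_ne_zero h.totRam.isOpen)

theorem Pair.exists_pow_mul_mem (h : D.Pair S H) (hidx : H.relIndex S = p) {σ : Gal(Ω/F)}
    (hσ : σ ∈ S ⊓ D.inertia) (hσH : σ ∉ H) {g : Gal(Ω/F)} (hg : g ∈ S ⊓ D.inertia) :
    ∃ n : ℕ, (σ ^ n)⁻¹ * g ∈ H ⊓ D.inertia := by
  obtain ⟨a, ha, -⟩ := (h.isTransversal_inf hidx hσ hσH).existsUnique g hg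
  exact ⟨a.val, ha⟩

/-- In a step of degree `p`, the elements of `Aug` have the form `σ u / u`. -/
theorem Pair.exists_of_mem_Aug (h : D.Pair S H) (hidx : H.relIndex S = p) {σ : Gal(Ω/F)}
    (hσ : σ ∈ S ⊓ D.inertia) (hσH : σ ∉ H) {a : Ω} (ha : a ∈ D.Aug S H) :
    ∃ u ∈ D.U H, a = σ u / u := by
  induction ha using Submonoid.closure_induction with
  | mem x hx =>
    obtain ⟨g, hg, u, hu, rfl⟩ := hx
    obtain ⟨n, hn⟩ := h.exists_pow_mul_mem hidx hσ hσH hg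
    have h1 : g = σ ^ n * ((σ ^ n)⁻¹ * g) := by simp
    refine ⟨∏ i ∈ Finset.range n, (σ ^ i) u,
      prod_mem fun i _ => h.apply_mem_U (S.pow_mem hσ.1 i) hu, ?_⟩
    rw [← pow_apply_div_eq σ (ne_zero_of_mem_U hu)]
    conv_lhs => rw [h1, AlgEquiv.mul_apply, mem_fixedField.1 hu.1 _ hn]
  | one => exact ⟨1, one_mem _, by simp⟩
  | mul x y _ _ hx hy =>
    obtain ⟨u, hu, rfl⟩ := hx
    obtain ⟨w, hw, rfl⟩ := hy
    exact ⟨u * w, mul_mem hu hw, by rw [map_mul, div_mul_div_comm]⟩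

/-- Conjugating a symbol relation by an element of `S`. -/
theorem Pair.symbol_conj (h : D.Pair S T) (h₁ : D.Pair S H) (h₂ : D.Pair H T) {π ζ : Ω}
    (hπ : D.IsUnif T π) (hζ : ζ ≠ 0) {σ φ : Gal(Ω/F)} (hσ : σ ∈ S ⊓ D.inertia)
    (hφ : φ ∈ T) (hζT : ζ ∈ fixedField (T ⊓ D.inertia)) {i j : Gal(Ω/F)}
    (hi : i ∈ H ⊓ D.inertia) (hj : j ∈ H ⊓ D.inertia) (hij : σ * i * σ⁻¹ = j * i)
    (hA : φ ζ / ζ * (i π / π) ∈ D.Aug H T) :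
    φ (σ ζ / ζ) / (σ ζ / ζ) * (j π / π) ∈ D.Aug H T := by
  have hπ0 := hπ.ne_zero
  have hν := h.apply_div_mem_U hσ.1 hπ.mem_inf hπ0
  have hi' : σ * i * σ⁻¹ ∈ H ⊓ D.inertia := (h₁.conj_iff' hσ.1 i).2 hi
  obtain ⟨b, hb, hb'⟩ := h₂.mul_apply_div hj hi.1 hπ.mem_inf hπ0
  have h3 := apply_div_mem_Aug hi' hν
  -- The relation is transported by `σ` and divided by itself. As `σ (i π) = (σ i σ⁻¹)(σ π)`, what
  -- remains is `(σ i σ⁻¹) π / i π`, which is `j π / π` up to an element of `Aug`.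
  have h4 := div_mem_Aug (div_mem_Aug (h.apply_mem_Aug h₁ hσ.1 hA) hA) (mul_mem hb h3)
  have hb0 := ne_zero_of_mem_U (h₂.Aug_le hb)
  convert h4 using 1
  have e1 : σ (i π) = (σ * i * σ⁻¹) (σ π) := by simp
  rw [← hij] at hb'
  rw [map_mul, map_div₀, map_div₀, map_div₀, map_div₀, e1, ← h.comm_apply hφ hσ hζT]
  set i' := σ * i * σ⁻¹
  have n1 : σ π ≠ 0 := (map_ne_zero _).2 hπ0
  have n2 : i' π ≠ 0 := (map_ne_zero _).2 hπ0
  have n3 : i' (σ π) ≠ 0 := (map_ne_zero _).2 n1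
  have n4 : i π ≠ 0 := (map_ne_zero _).2 hπ0
  have n5 : j π ≠ 0 := (map_ne_zero _).2 hπ0
  have n6 : φ ζ ≠ 0 := (map_ne_zero _).2 hζ
  have n7 : σ ζ ≠ 0 := (map_ne_zero _).2 hζ
  have n8 : φ (σ ζ) ≠ 0 := (map_ne_zero _).2 n7
  have e2 : b = i' π * π / (j π * i π) := by
    rw [eq_div_iff (mul_ne_zero n5 n4)]
    field_simp at hb'
    linear_combination -hb'
  rw [e2]
  field_simp

/-- A unit of the bottom field is a norm of a unit if its symbol is trivial. -/
theorem Pair.exists_fixed_N_eq [IsSepClosed Ω] (h : D.Pair S T) {π : Ω} (hπ : D.IsUnif T π) {β : Ω}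
    (hβ : β ∈ D.U T) (hN : D.N S T β ∈ fixedField S) (hA : ∀ φ ∈ T, φ β / β ∈ D.Aug S T) :
    ∃ γ ∈ fixedField T, D.v γ = 1 ∧ D.N S T γ = D.N S T β := by
  induction h using Pair.induction generalizing β with
  | refl S h =>
    rw [N, relNorm_self hβ.1] at hN
    exact ⟨β, hN, hβ.2, rfl⟩
  | step S H T h h₁ h₂ hidx ih =>
    obtain ⟨πS, hS⟩ := D.exists_isUnif h.totRam_left.isOpen
    have hπH := h₂.isUnif_N hπ
    obtain ⟨σ, hσ, hσH⟩ := h₁.exists_generator hidx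
    have hβ0 := ne_zero_of_mem_U hβ
    have hβ₁ := h₂.totRam.N_mem_U (S := H) hβ
    have hNtrans : ∀ x ∈ fixedField (T ⊓ D.inertia), D.N S T x = D.N S H (D.N H T x) :=
      fun x hx => h₁.totRam.N_trans h₂.totRam h₁.le h₂.le hx
    -- the step of degree `p`
    obtain ⟨γ, hγ, hγv, hγN⟩ := (h₁.stepExt hidx hσ hσH hπH hS).exists_norm_of_descent
      (α := D.N S T β) hN hβ₁.1 hβ₁.2
      (by rw [hNtrans β hβ.1, h₁.N_eq_cycNorm hidx hσ hσH hβ₁.1])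
      (fun φ hφ => by
        obtain ⟨t, ht, i, hi, rfl⟩ := h₂.totRam.exists_mul_of_mem h₂.le hφ
        have h3 := h.N_mem_Aug h₁ (hA t ht)
        rw [h.N_apply_div h₁ (h.le ht) hβ.1] at h3
        obtain ⟨u, hu, hu'⟩ := h₁.exists_of_mem_Aug hidx hσ hσH h3
        exact ⟨u, hu.1, hu.2, by rw [AlgEquiv.mul_apply, mem_fixedField.1 hβ₁.1 i hi, hu']⟩)
    have hγU : γ ∈ D.U H := ⟨fixedField_le inf_le_left hγ, hγv⟩
    have hγ0 := ne_zero_of_mem_U hγU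
    have hγN' : D.N S H γ = D.N S T β := by rw [h₁.N_eq_cycNorm hidx hσ hσH hγU.1, hγN]
    -- `γ` solves the problem in the bottom step. Its difference from the norm of `β` has norm `1`,
    -- hence is the norm of an explicit `y`, which also satisfies the hypothesis on `φ`.
    obtain ⟨k, u, hu, hy⟩ := h.eq_N_of_N_eq_one h₁ h₂ hidx hσ hσH hπ (div_mem_U hβ₁ hγU) (by
      rw [map_div₀, hγN', ← hNtrans β hβ.1, div_self ((map_ne_zero _).2 hβ0)])
    have hσπ := h.apply_div_mem_U hσ.1 hπ.mem_inf hπ.ne_zero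
    have hσu := h.apply_div_mem_U hσ.1 hu.1 (ne_zero_of_mem_U hu)
    have hyU : (σ π / π) ^ k * (σ u / u) ∈ D.U T :=
      mul_mem ⟨zpow_mem hσπ.1 k, by rw [map_zpow₀, hσπ.2, one_zpow]⟩ hσu
    have hyA : ∀ φ ∈ T, φ ((σ π / π) ^ k * (σ u / u)) / ((σ π / π) ^ k * (σ u / u)) ∈
        D.Aug S T := by
      intro φ hφ
      have h3 := apply_div_mem_Aug hσ (h.apply_div_mem_U (h.le hφ) hu.1 (ne_zero_of_mem_U hu))
      convert h3 using 1
      have n0 := ne_zero_of_mem_U hu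
      have n1 : σ u ≠ 0 := (map_ne_zero _).2 n0
      have n2 : φ u ≠ 0 := (map_ne_zero _).2 n0
      have n3 : (σ π / π) ^ k ≠ 0 := zpow_ne_zero _ (ne_zero_of_mem_U hσπ)
      rw [map_mul, map_zpow₀, map_div₀, h.comm_apply hφ hσ hπ.mem_inf,
        mem_fixedField.1 hπ.mem φ hφ, map_div₀, map_div₀, h.comm_apply hφ hσ hu.1,
        mul_div_mul_left _ _ n3]
      field_simp
    set y := (σ π / π) ^ k * (σ u / u)
    have hy0 := ne_zero_of_mem_U hyU
    set β₂ := β / y with hβ₂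
    have hβ₂U : β₂ ∈ D.U T := div_mem_U hβ hyU
    have hβ₂0 := ne_zero_of_mem_U hβ₂U
    have hβ₂N : D.N H T β₂ = γ := by
      rw [map_div₀, ← hy, div_div_cancel₀ (ne_zero_of_mem_U hβ₁)]
    have hβ₂A : ∀ φ ∈ T, φ β₂ / β₂ ∈ D.Aug S T := by
      intro φ hφ
      rw [hβ₂, map_div₀, div_div_div_comm]
      exact div_mem_Aug (hA φ hφ) (hyA φ hφ)
    -- the symbol of `β₂` consists of commutators with `σ`
    obtain ⟨f, hf, hfs⟩ := h₂.exists_symbol hπ hβ₂U (fun φ hφ => by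
      rw [hβ₂N]; exact mem_fixedField.1 hγ φ (h₂.le hφ))
    have hcA : ∀ a ∈ H ⊓ D.inertia, σ * a * σ⁻¹ ∈ H ⊓ D.inertia :=
      fun a ha => (h₁.conj_iff' hσ.1 a).2 ha
    have hcB : ∀ a ∈ T ⊓ D.inertia, σ * a * σ⁻¹ ∈ T ⊓ D.inertia :=
      fun a ha => (h.conj_iff' hσ.1 a).2 ha
    set ψ : D.Q H T →* D.Q H T := AbQuot.conj σ hcA hcB / MonoidHom.id _ with hψ
    have hHS : H ⊓ D.inertia ≤ S ⊓ D.inertia := inf_le_inf_right _ h₁.le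
    -- Over the larger group `S` the symbol of `β₂` is trivial by hypothesis, so over `H` its values
    -- are commutators with `σ`.
    have hrange : ∀ g, f g ∈ ψ.range := by
      intro g
      obtain ⟨t, ht, j, hj, rfl⟩ := h.totRam.exists_mul g
      rw [map_mul, hf.apply_eq_one j hj, mul_one]
      obtain ⟨i, hi⟩ := AbQuot.mk_surjective (f t)
      have h3 := div_mem_Aug (Aug_mono (S := S) h₁.le (hfs t ht i hi)) (hβ₂A t ht)
      rw [mul_div_cancel_left₀ _ (div_ne_zero ((map_ne_zero t).2 hβ₂0) hβ₂0)] at h3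
      have h4 : D.mkQ S T ⟨i, hHS i.2⟩ = 1 :=
        h.mk_eq_one_of_augHom hπ ((augHom_eq_one_iff h hπ.mem_inf hπ.ne_zero).2 h3)
      rw [← hi]
      exact AbQuot.mk_mem_range_of_mk_eq_one hσ hHS hcA hcB (inf_le_inf_right _ h₂.le)
        (fun a ha => h₁.exists_pow_mul_mem hidx hσ hσH ha) i.2 h4
    have := h₂.finite_Q
    -- `f = (σ - 1) f'` with `f'` unramified. If `ζ` has symbol `f'`, then `σ ζ / ζ` has symbol `f`.
    obtain ⟨f', hf', hff'⟩ := hf.exists_lift _ rfl h₂.isPGroup_Q ψ hrange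
    obtain ⟨ζ, hζ, hζN, hζs⟩ := h₂.exists_of_hom hπ hf'
    have hζ0 := ne_zero_of_mem_U hζ
    have hδ := h₂.totRam.N_mem_U (S := H) hζ
    have hδ0 := ne_zero_of_mem_U hδ
    have hσζ := h.apply_div_mem_U hσ.1 hζ.1 hζ0
    have hσδ : σ (D.N H T ζ) / D.N H T ζ ∈ fixedField H :=
      div_mem (apply_mem_fixedField (fun a ha => by
        have := h₁.normal _ (S.inv_mem hσ.1) a ha
        rwa [inv_inv] at this) hζN) hζN
    have hN₃ : D.N H T (β₂ / (σ ζ / ζ)) = γ / (σ (D.N H T ζ) / D.N H T ζ) := by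
      rw [map_div₀, hβ₂N, h.N_apply_div h₁ hσ.1 hζ.1]
    -- The two symbols cancel, so the induction hypothesis over `H` applies.
    obtain ⟨ε, hε, hεv, hεN⟩ := ih hπ (β := β₂ / (σ ζ / ζ)) (div_mem_U hβ₂U hσζ)
      (by rw [hN₃]; exact div_mem hγ hσδ) (fun φ hφ => by
        obtain ⟨i, hi⟩ := AbQuot.mk_surjective (f' φ)
        let j : ↥(H ⊓ D.inertia) := conjHom _ σ hcA i * i⁻¹
        have hj : D.mkQ H T j = f φ := by
          rw [← hff' φ, ← hi, hψ, MonoidHom.div_apply, AbQuot.conj_mk, MonoidHom.id_apply,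
            map_mul, map_inv, div_eq_mul_inv]
        have h3 := hfs φ hφ j hj
        have h4 := h.symbol_conj h₁ h₂ hπ hζ0 hσ hφ hζ.1 i.2 j.2
          (by simp [j, conjHom_apply_coe]) (hζs φ hφ i hi)
        have h5 := div_mem_Aug h3 h4
        rw [mul_div_mul_right _ _ (div_ne_zero ((map_ne_zero j.1).2 hπ.ne_zero) hπ.ne_zero)] at h5
        rwa [map_div₀ φ β₂, div_div_div_comm])
    refine ⟨ε, hε, hεv, ?_⟩
    -- The factor `σ ζ / ζ` has norm `1` down to `S`, so the norm to the bottom is still that of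
    -- `β`.
    rw [hNtrans ε (fixedField_le inf_le_left hε), hεN, hN₃, map_div₀, hγN',
      h₁.N_apply_div h₁.refl_left hσ.1 hδ.1,
      mem_fixedField.1 (h₁.totRam.N_mem (S := S) hδ.1) σ hσ, div_self ((map_ne_zero _).2 hδ0), div_one]

end ValuedClosure

end PClassFieldTheory

/-! ### The absolute value on the separable closure -/

namespace PClassFieldTheory

open Polynomial

section AdicNorm

variable {O F : Type*} [CommRing O] [IsDomain O] [IsDiscreteValuationRing O] [Field F] [Algebra O F]
  [IsFractionRing O F]

theorem exists_adic_absoluteValue :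
    ∃ (w : AbsoluteValue F ℝ) (ϖ : O), Irreducible ϖ ∧ IsNonarchimedean w ∧
      w (algebraMap O F ϖ) < 1 ∧ (∀ x : F, w x ≤ 1 ↔ ∃ a, algebraMap O F a = x) ∧
      (∀ a : O, w (algebraMap O F a) < 1 ↔ a ∈ IsLocalRing.maximalIdeal O) ∧
      ∀ x : F, x ≠ 0 → ∃ n : ℤ, w x = w (algebraMap O F ϖ) ^ n := by
  let P := IsDiscreteValuationRing.maximalIdeal O
  have hb : (1 : NNReal) < 2 := one_lt_two
  let w : AbsoluteValue F ℝ := P.adicAbv hb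
  obtain ⟨ϖ, hϖ⟩ := IsDiscreteValuationRing.exists_irreducible O
  have hlt : ∀ a : O, w (algebraMap O F a) < 1 ↔ a ∈ IsLocalRing.maximalIdeal O :=
    fun a => P.adicAbv_coe_lt_one_iff hb a
  have hunit : ∀ u : Oˣ, w (algebraMap O F u) = 1 := fun u =>
    (P.adicAbv_coe_eq_one_iff hb (u : O)).2 fun h =>
      (IsLocalRing.mem_maximalIdeal _).1 h u.isUnit
  have hϖ1 : w (algebraMap O F ϖ) < 1 :=
    (hlt ϖ).2 ((IsLocalRing.mem_maximalIdeal _).2 hϖ.not_isUnit)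
  have hϖ0 : algebraMap O F ϖ ≠ 0 := by simpa using hϖ.ne_zero
  have hq0 : 0 < w (algebraMap O F ϖ) := w.pos hϖ0
  have hO : ∀ a : O, a ≠ 0 → ∃ (n : ℕ) (u : Oˣ), a = u * ϖ ^ n := by
    intro a ha
    obtain ⟨n, u, hu⟩ := IsDiscreteValuationRing.eq_unit_mul_pow_irreducible ha hϖ
    exact ⟨n, u, hu⟩
  have hF : ∀ x : F, x ≠ 0 → ∃ (n : ℤ) (u : Oˣ), x = algebraMap O F u * algebraMap O F ϖ ^ n := by
    intro x hx
    obtain ⟨a, b, hb, rfl⟩ := IsFractionRing.div_surjective (A := O) x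
    have ha0 : a ≠ 0 := by rintro rfl; simp at hx
    have hb0 : b ≠ 0 := nonZeroDivisors.ne_zero hb
    obtain ⟨m, u, rfl⟩ := hO a ha0
    obtain ⟨n, s, rfl⟩ := hO b hb0
    refine ⟨m - n, u * s⁻¹, ?_⟩
    have hs : algebraMap O F s ≠ 0 := by simp
    have hs' : algebraMap O F (s⁻¹ : Oˣ) = (algebraMap O F s)⁻¹ := by
      refine eq_inv_of_mul_eq_one_left ?_
      rw [← map_mul]; simp
    rw [zpow_sub₀ hϖ0, Units.val_mul, map_mul, map_mul, map_mul, hs', map_pow, map_pow,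
      zpow_natCast, zpow_natCast]
    field_simp
  have hval : ∀ (n : ℤ) (u : Oˣ), w (algebraMap O F u * algebraMap O F ϖ ^ n) =
      w (algebraMap O F ϖ) ^ n := fun n u => by rw [map_mul, hunit, one_mul, map_zpow₀]
  refine ⟨w, ϖ, hϖ, P.isNonarchimedean_adicAbv hb, hϖ1, fun x => ⟨fun h => ?_, ?_⟩, hlt,
    fun x hx => ?_⟩
  · by_cases hx : x = 0
    · exact ⟨0, by simp [hx]⟩
    obtain ⟨n, u, rfl⟩ := hF x hx
    rw [hval, ← zpow_zero (w (algebraMap O F ϖ)), zpow_le_zpow_iff_right_of_lt_one₀ hq0 hϖ1] at h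
    lift n to ℕ using h
    exact ⟨u * ϖ ^ n, by simp⟩
  · rintro ⟨a, rfl⟩
    exact P.adicAbv_coe_le_one hb a
  · obtain ⟨n, u, rfl⟩ := hF x hx
    exact ⟨n, hval n u⟩

/-- Congruence modulo the `n`-th power of the maximal ideal is the inequality `w ≤ w ϖ ^ n`. After
subtraction of its first term, a rapidly convergent sequence lies in `O`, where adic completeness
provides the limit. -/
theorem completeSpace_of_isAdicComplete [IsAdicComplete (IsLocalRing.maximalIdeal O) O]
    {w : AbsoluteValue F ℝ} {ϖ : O} (hϖ : Irreducible ϖ) (hϖ1 : w (algebraMap O F ϖ) < 1)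
    (hw : ∀ x : F, w x ≤ 1 ↔ ∃ a, algebraMap O F a = x) :
    letI := w.toNormedField
    CompleteSpace F := by
  let := w.toNormedField
  have hϖ0 : algebraMap O F ϖ ≠ 0 := by simpa using hϖ.ne_zero
  have hq0 : 0 < w (algebraMap O F ϖ) := w.pos hϖ0
  have hdist : ∀ x y : F, dist x y = w (x - y) := fun x y => dist_eq_norm x y
  have hdvd : ∀ (a : O) (n : ℕ), w (algebraMap O F a) ≤ w (algebraMap O F ϖ) ^ n ↔ ϖ ^ n ∣ a := by
    intro a n
    constructor
    · intro h
      have h1 : w (algebraMap O F a / algebraMap O F ϖ ^ n) ≤ 1 := by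
        rw [map_div₀, map_pow, div_le_one (pow_pos hq0 n)]; exact h
      obtain ⟨b, hb⟩ := (hw _).1 h1
      refine ⟨b, IsFractionRing.injective O F ?_⟩
      rw [map_mul, map_pow, hb, mul_div_cancel₀ _ (pow_ne_zero n hϖ0)]
    · rintro ⟨b, rfl⟩
      rw [map_mul, map_mul, map_pow, map_pow]
      exact mul_le_of_le_one_right (pow_nonneg hq0.le n) ((hw _).2 ⟨b, rfl⟩)
  have hmod : ∀ (a b : O) (n : ℕ),
      a ≡ b [SMOD (IsLocalRing.maximalIdeal O ^ n • ⊤ : Submodule O O)] ↔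
        w (algebraMap O F a - algebraMap O F b) ≤ w (algebraMap O F ϖ) ^ n := by
    intro a b n
    rw [SModEq.sub_mem, smul_eq_mul, Ideal.mul_top, hϖ.maximalIdeal_eq, Ideal.span_singleton_pow,
      Ideal.mem_span_singleton, ← hdvd, map_sub]
  refine Metric.complete_of_convergent_controlled_sequences
    (fun n => w (algebraMap O F ϖ) ^ n) (fun n => pow_pos hq0 n) fun u hu => ?_
  have hu' : ∀ n, ∃ a, algebraMap O F a = u n - u 0 := by
    intro n
    refine (hw _).1 ?_
    have := hu 0 n 0 (Nat.zero_le n) le_rfl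
    rw [hdist, pow_zero] at this
    exact this.le
  choose f hf using hu'
  obtain ⟨l, hl⟩ := IsPrecomplete.prec (I := IsLocalRing.maximalIdeal O) (M := O) inferInstance
    (f := f) (fun {m n} hmn => by
      rw [hmod, hf, hf, sub_sub_sub_cancel_right, ← hdist]
      exact (hu m m n le_rfl hmn).le)
  refine ⟨u 0 + algebraMap O F l, ?_⟩
  rw [tendsto_iff_dist_tendsto_zero]
  refine squeeze_zero (fun n => dist_nonneg) (fun n => ?_)
    (tendsto_pow_atTop_nhds_zero_of_lt_one hq0.le hϖ1)
  have := (hmod _ _ n).1 (hl n)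
  rw [hf] at this
  rw [hdist, ← sub_sub]
  exact this

end AdicNorm

section Spectral

variable {F Ω : Type*} [NontriviallyNormedField F] [IsUltrametricDist F] [CompleteSpace F] [Field Ω]
  [Algebra F Ω] [Algebra.IsAlgebraic F Ω]

/-- The extension of the absolute value of `F` to an algebraic extension. -/
noncomputable def spectralAbv : AbsoluteValue Ω ℝ where
  toFun := spectralNorm F Ω
  map_mul' x y := map_mul (spectralMulAlgNorm F Ω) x y
  nonneg' := spectralNorm_nonneg
  eq_zero' _ := map_eq_zero_iff_eq_zero (spectralMulAlgNorm F Ω)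
  add_le' _ _ := isNonarchimedean_spectralNorm.add_le spectralNorm_nonneg

/-- A finite extension of a complete field is complete. By the ultrametric inequality the bound on
consecutive differences holds for all later terms, and so in the limit. -/
theorem exists_spectral_limit (M : IntermediateField F Ω) [FiniteDimensional F M] (u : ℕ → Ω)
    (ρ : ℝ) (hρ : 0 ≤ ρ) (hρ1 : ρ < 1) (hu : ∀ n, u n ∈ M)
    (h : ∀ n, spectralAbv (F := F) (u (n + 1) - u n) ≤ ρ ^ n) :
    ∃ l ∈ M, ∀ n, spectralAbv (F := F) (l - u n) ≤ ρ ^ n := by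
  let := spectralNorm.normedField F Ω
  let : NormedAlgebra F Ω := spectralNorm.normedAlgebra F Ω
  have hn : ∀ x : Ω, spectralAbv (F := F) x = ‖x‖ := fun x => rfl
  have hfin : FiniteDimensional F M.toSubalgebra.toSubmodule :=
    inferInstanceAs (FiniteDimensional F M)
  have hc : IsComplete (M.toSubalgebra.toSubmodule : Set Ω) :=
    Submodule.complete_of_finiteDimensional M.toSubalgebra.toSubmodule
  have hcs : CauchySeq u := by
    refine cauchySeq_of_le_geometric ρ 1 hρ1 fun n => ?_
    rw [one_mul, dist_comm, dist_eq_norm]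
    exact h n
  obtain ⟨l, hl, hlim⟩ := cauchySeq_tendsto_of_isComplete hc hu hcs
  refine ⟨l, hl, fun n => ?_⟩
  have hmn : ∀ k, spectralAbv (F := F) (u (n + k) - u n) ≤ ρ ^ n := by
    intro k
    induction k with
    | zero => simpa using pow_nonneg hρ n
    | succ k ih =>
      have h1 : u (n + (k + 1)) - u n = (u (n + k + 1) - u (n + k)) + (u (n + k) - u n) := by
        rw [← add_assoc]; ring
      rw [h1]
      refine (isNonarchimedean_spectralNorm (K := F) (L := Ω) _ _).trans (max_le ?_ ih)
      exact (h (n + k)).trans (pow_le_pow_of_le_one hρ hρ1.le (Nat.le_add_right n k))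
  have ht : Filter.Tendsto (fun k => ‖u (k + n) - u n‖) Filter.atTop (nhds ‖l - u n‖) :=
    (((Filter.tendsto_add_atTop_iff_nat n).2 hlim).sub_const (u n)).norm
  refine le_of_tendsto' ht fun k => ?_
  rw [add_comm]
  exact hmn k

end Spectral

/-- The valued closure attached to a complete discrete valuation ring. -/
theorem exists_valuedClosure (p : ℕ) [hp : Fact p.Prime] (O F Ω : Type*) [CommRing O] [IsDomain O]
    [IsDiscreteValuationRing O] [IsAdicComplete (IsLocalRing.maximalIdeal O) O]
    [Field F] [Algebra O F] [IsFractionRing O F] [CharP (IsLocalRing.ResidueField O) p]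
    [PerfectField (IsLocalRing.ResidueField O)] [Field Ω] [Algebra F Ω] [Algebra.IsAlgebraic F Ω]
    [Algebra O Ω] [IsScalarTower O F Ω] :
    ∃ D : ValuedClosure p F Ω, ∀ x : Ω, D.v x ≤ 1 ↔ IsIntegral O x := by
  obtain ⟨w, ϖ, hϖ, hna, hϖ1, hw, hlt, hzpow⟩ := exists_adic_absoluteValue (O := O) (F := F)
  have hcomp := completeSpace_of_isAdicComplete hϖ hϖ1 hw
  have hϖ0 : algebraMap O F ϖ ≠ 0 := by simpa using hϖ.ne_zero
  let : NontriviallyNormedField F :=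
    { w.toNormedField with
      non_trivial := ⟨(algebraMap O F ϖ)⁻¹, by
        change 1 < w (algebraMap O F ϖ)⁻¹
        rw [map_inv₀]
        exact (one_lt_inv₀ (w.pos hϖ0)).2 hϖ1⟩ }
  have hnorm : ∀ x : F, ‖x‖ = w x := fun x => rfl
  have : IsUltrametricDist F := IsUltrametricDist.isUltrametricDist_of_isNonarchimedean_norm hna
  have : CompleteSpace F := hcomp
  have hext : ∀ x : F, spectralAbv (F := F) (algebraMap F Ω x) = w x := fun x =>
    spectralNorm_extends x
  let D : ValuedClosure p F Ω :=
    { v := spectralAbv (F := F)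
      v_add_le := fun x y => isNonarchimedean_spectralNorm x y
      v_gal := fun g x => (spectralNorm_eq_of_equiv g x).symm
      unif := algebraMap O F ϖ
      unif_ne_zero := hϖ0
      v_unif_lt := by rw [hext]; exact hϖ1
      exists_zpow := fun x hx => by
        obtain ⟨n, hn⟩ := hzpow x hx
        exact ⟨n, by rw [hext, hext, hn]⟩
      complete := fun M _ u ρ h0 h1 hu h => exists_spectral_limit M u ρ h0 h1 hu h
      v_p_lt := by
        have h1 : ((p : ℕ) : Ω) = algebraMap F Ω (algebraMap O F p) := by simp
        rw [h1, hext, hlt, ← IsLocalRing.residue_eq_zero_iff, map_natCast]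
        exact CharP.cast_eq_zero _ p
      perfect := fun x hx => by
        rw [hext, hw] at hx
        obtain ⟨a, rfl⟩ := hx
        have : ExpChar (IsLocalRing.ResidueField O) p := ExpChar.prime hp.out
        have : PerfectRing (IsLocalRing.ResidueField O) p := PerfectField.toPerfectRing p
        obtain ⟨y, hy⟩ := surjective_frobenius (IsLocalRing.ResidueField O) p
          (IsLocalRing.residue O a)
        obtain ⟨b, rfl⟩ := IsLocalRing.residue_surjective y
        refine ⟨algebraMap O F b, ?_⟩
        rw [hext, ← map_pow, ← map_sub, hlt, ← IsLocalRing.residue_eq_zero_iff, map_sub, map_pow,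
          sub_eq_zero]
        exact hy }
  refine ⟨D, fun x => ⟨fun hx => ?_, fun hx => ?_⟩⟩
  -- The spectral norm is at most `1` exactly when the minimal polynomial has integral coefficients.
  · have h1 : spectralValue (minpoly F x) ≤ 1 := hx
    have hint : IsIntegral F x := (Algebra.IsAlgebraic.isAlgebraic x).isIntegral
    rw [spectralValue_le_one_iff (minpoly.monic hint)] at h1
    have hl : minpoly F x ∈ lifts (algebraMap O F) :=
      (lifts_iff_coeff_lifts _).2 fun n => (hw _).1 (h1 n)
    obtain ⟨q, hq, -, hqm⟩ := lifts_and_natDegree_eq_and_monic hl (minpoly.monic hint)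
    refine ⟨q, hqm, ?_⟩
    rw [IsScalarTower.algebraMap_eq O F Ω, ← eval₂_map, hq, ← aeval_def, minpoly.aeval]
  · obtain ⟨q, hqm, hq⟩ := hx
    let j : O →+* D.integers := (algebraMap O Ω).codRestrict D.integers fun a => by
      rw [ValuedClosure.mem_integers, IsScalarTower.algebraMap_apply O F Ω]
      change spectralAbv (F := F) _ ≤ 1
      rw [hext]
      exact (hw _).2 ⟨a, rfl⟩
    refine D.v_le_one_of_isRoot (hqm.map j) ?_
    rw [Polynomial.map_map, eval_map]
    exact hq

end PClassFieldTheory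

/-! ### Integers, units and prime elements in terms of the absolute value -/

namespace PClassFieldTheory

open IntermediateField IsLocalRing

instance isScalarTower_intermediateField {O F Ω : Type*} [CommRing O] [Field F] [Field Ω]
    [Algebra O F] [Algebra O Ω] [Algebra F Ω] [IsScalarTower O F Ω] (K : IntermediateField F Ω) :
    IsScalarTower O K Ω :=
  IsScalarTower.of_algebraMap_eq fun _ => rfl

namespace ValuedClosure

variable {p : ℕ} [hp : Fact p.Prime] {F Ω : Type*} [Field F] [Field Ω] [Algebra F Ω]
  {D : ValuedClosure p F Ω} {O : Type*} [CommRing O] [Algebra O Ω]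

section Integers

variable (hD : ∀ x : Ω, D.v x ≤ 1 ↔ IsIntegral O x) {E : Type*} [Field E] [Algebra O E]
  [Algebra E Ω] [IsScalarTower O E Ω]

include hD

theorem isIntegral_iff {x : E} : IsIntegral O x ↔ D.v (algebraMap E Ω x) ≤ 1 := by
  rw [hD, isIntegral_algebraMap_iff (algebraMap E Ω).injective]

theorem isUnit_integralClosure_iff {x : integralClosure O E} :
    IsUnit x ↔ D.v (algebraMap E Ω x) = 1 := by
  constructor
  · rintro ⟨w, rfl⟩
    have h1 := (isIntegral_iff hD).1 w.1.2
    have h2 := (isIntegral_iff hD).1 w.2.2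
    have h3 : D.v (algebraMap E Ω w.1) * D.v (algebraMap E Ω w.2) = 1 := by
      rw [← map_mul, ← map_mul, ← Subalgebra.coe_mul, w.val_inv]
      simp
    refine le_antisymm h1 ?_
    rw [← h3]
    exact mul_le_of_le_one_right (D.v.nonneg _) h2
  · intro h
    have hx0 : (x : E) ≠ 0 := by
      intro h0
      simp [h0] at h
    refine IsUnit.of_mul_eq_one ⟨(x : E)⁻¹, (isIntegral_iff hD).2 ?_⟩ ?_
    · simp [h]
    · ext
      simp [hx0]

theorem isLocalRing_integralClosure : IsLocalRing (integralClosure O E) := by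
  refine IsLocalRing.of_nonunits_add fun a b ha hb => ?_
  have key : ∀ c : integralClosure O E, c ∈ nonunits _ ↔ D.v (algebraMap E Ω c) < 1 := by
    intro c
    rw [mem_nonunits_iff, isUnit_integralClosure_iff hD]
    exact ⟨fun h => lt_of_le_of_ne ((isIntegral_iff hD).1 c.2) h, fun h => h.ne⟩
  rw [key] at *
  rw [Subalgebra.coe_add, map_add]
  exact D.v_add_lt ha hb

theorem mem_jacobson_iff {x : integralClosure O E} :
    x ∈ Ideal.jacobson (⊥ : Ideal (integralClosure O E)) ↔ D.v (algebraMap E Ω x) < 1 := by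
  have := isLocalRing_integralClosure hD (E := E)
  rw [jacobson_eq_maximalIdeal _ bot_ne_top, mem_maximalIdeal, mem_nonunits_iff,
    isUnit_integralClosure_iff hD]
  exact ⟨fun h => lt_of_le_of_ne ((isIntegral_iff hD).1 x.2) h, fun h => h.ne⟩

theorem mem_unitGroup_iff {u : Eˣ} : u ∈ unitGroup O E ↔ D.v (algebraMap E Ω u) = 1 := by
  constructor
  · rintro ⟨w, rfl⟩
    exact (isUnit_integralClosure_iff hD).1 w.isUnit
  · intro h
    obtain ⟨w, hw⟩ := (isUnit_integralClosure_iff hD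
      (x := ⟨(u : E), (isIntegral_iff hD).2 h.le⟩)).2 h
    exact ⟨w, Units.ext (congrArg Subtype.val hw)⟩

theorem mem_principalUnitGroup_iff {u : Eˣ} :
    u ∈ principalUnitGroup O E ↔ D.v (algebraMap E Ω u - 1) < 1 := by
  have key : ∀ w : (integralClosure O E)ˣ, w ∈ (Units.map (Ideal.Quotient.mk
      (Ideal.jacobson (⊥ : Ideal (integralClosure O E))) :
        integralClosure O E →* integralClosure O E ⧸
          Ideal.jacobson (⊥ : Ideal (integralClosure O E)))).ker ↔
      D.v (algebraMap E Ω w.1 - 1) < 1 := by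
    intro w
    rw [MonoidHom.mem_ker, ← Units.val_inj]
    have : (Ideal.Quotient.mk (Ideal.jacobson (⊥ : Ideal (integralClosure O E))) w.1 = 1) ↔
        w.1 - 1 ∈ Ideal.jacobson (⊥ : Ideal (integralClosure O E)) := by
      rw [← Ideal.Quotient.eq_zero_iff_mem, map_sub, map_one, sub_eq_zero]
    refine this.trans ?_
    rw [mem_jacobson_iff hD]
    simp
  constructor
  · rintro ⟨w, hw, rfl⟩
    exact (key w).1 hw
  · intro h
    have h1 : u ∈ unitGroup O E :=
      (mem_unitGroup_iff hD).2 (D.v_eq_one_of_sub_lt (map_one D.v) (by rwa [v_sub_comm]))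
    obtain ⟨w, rfl⟩ := h1
    exact ⟨w, (key w).2 h, rfl⟩

end Integers

variable [Algebra O F] [IsScalarTower O F Ω] [IsGalois F Ω] {K L : IntermediateField F Ω}
  {S : Subgroup Gal(Ω/F)} (hD : ∀ x : Ω, D.v x ≤ 1 ↔ IsIntegral O x)

include hD

/-- A generator `ρ` of the value group divides every non-unit, so an irreducible element is `ρ`
times a unit. Conversely, in a factorization of an element of exponent `1` one exponent is zero. -/
theorem isPrimeElement_iff (hS : IsOpen (S : Set Gal(Ω/F))) (hK : K = fixedField S) {π : Kˣ} :
    IsPrimeElement O K π ↔ D.IsUnif S (π : K) := by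
  subst hK
  have hmem : ∀ x : integralClosure O (fixedField S), ((x : fixedField S) : Ω) ∈ fixedField S :=
    fun x => x.1.2
  have hv : ∀ x : integralClosure O (fixedField S), D.v ((x : fixedField S) : Ω) ≤ 1 :=
    fun x => (isIntegral_iff hD).1 x.2
  have hunit : ∀ x : integralClosure O (fixedField S), IsUnit x ↔
      D.v ((x : fixedField S) : Ω) = 1 := fun x => isUnit_integralClosure_iff hD
  constructor
  · rintro ⟨ϖ, hϖ, h⟩
    obtain ⟨ρ, hρ⟩ := D.exists_isUnif hS
    have h' : ((π : fixedField S) : Ω) = ((ϖ : fixedField S) : Ω) := by rw [← h]; rfl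
    have hlt : D.v ((ϖ : fixedField S) : Ω) < 1 :=
      lt_of_le_of_ne (hv _) fun h1 => hϖ.not_isUnit ((hunit _).2 h1)
    have h0 : ((ϖ : fixedField S) : Ω) ≠ 0 := by
      rw [← h']
      simp
    have hle : D.v ((ϖ : fixedField S) : Ω) ≤ D.v ρ := by
      obtain ⟨n, hn⟩ := hρ.exists_zpow _ (hmem ϖ) h0
      rw [hn] at hlt ⊢
      have : 0 < n := by
        by_contra! hn0
        exact absurd hlt (not_lt.2 (one_le_zpow_of_nonpos₀ hρ.v_pos hρ.v_lt.le hn0))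
      simpa using zpow_le_zpow_right_of_le_one₀ hρ.v_pos hρ.v_lt.le (show 1 ≤ n by omega)
    let r : integralClosure O (fixedField S) := ⟨⟨ρ, hρ.mem⟩, (isIntegral_iff hD).2 hρ.v_lt.le⟩
    let s : integralClosure O (fixedField S) := ⟨ϖ.1 / r.1, (isIntegral_iff hD).2 (by
      rw [map_div₀, map_div₀]
      exact div_le_one_of_le₀ hle (D.v.nonneg _))⟩
    have hrs : ϖ = r * s := by
      ext
      simp only [r, s, Subalgebra.coe_mul, IntermediateField.coe_mul, IntermediateField.coe_div]
      field_simp [hρ.ne_zero]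
    have hsu : IsUnit s := (hϖ.isUnit_or_isUnit hrs).resolve_left fun hr =>
      hρ.v_lt.ne ((hunit _).1 hr)
    have hveq : D.v ((ϖ : fixedField S) : Ω) = D.v ρ := by
      rw [hrs]
      have := (hunit _).1 hsu
      simp only [Subalgebra.coe_mul, IntermediateField.coe_mul, map_mul, this, mul_one]
      rfl
    rw [h']
    exact ⟨hmem _, h0, hlt, by rw [hveq]; exact hρ.exists_zpow⟩
  · intro h
    refine ⟨⟨(π : fixedField S), (isIntegral_iff hD).2 h.v_lt.le⟩, ⟨fun hu => h.v_lt.ne ((hunit _).1 hu), ?_⟩, rfl⟩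
    intro a b hab
    have hab' : ((π : fixedField S) : Ω) = ((a : fixedField S) : Ω) * ((b : fixedField S) : Ω) := by
      have := congrArg (fun x : integralClosure O (fixedField S) => ((x : fixedField S) : Ω)) hab
      simpa using this
    have ha0 : ((a : fixedField S) : Ω) ≠ 0 := left_ne_zero_of_mul (hab' ▸ h.ne_zero)
    have hb0 : ((b : fixedField S) : Ω) ≠ 0 := right_ne_zero_of_mul (hab' ▸ h.ne_zero)
    obtain ⟨m, hm⟩ := h.exists_zpow _ (hmem a) ha0
    obtain ⟨n, hn⟩ := h.exists_zpow _ (hmem b) hb0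
    have hnonneg : ∀ k : ℤ, D.v ((π : fixedField S) : Ω) ^ k ≤ 1 → 0 ≤ k := by
      intro k hk
      by_contra! hk0
      exact absurd hk (not_le.2 (one_lt_zpow_of_neg₀ h.v_pos h.v_lt hk0))
    have hm0 := hnonneg m (hm ▸ hv a)
    have hn0 := hnonneg n (hn ▸ hv b)
    have hsum : m + n = 1 := by
      have h1 : D.v ((π : fixedField S) : Ω) ^ (m + n) = D.v ((π : fixedField S) : Ω) ^ (1 : ℤ) := by
        rw [zpow_add₀ h.v_pos.ne', ← hm, ← hn, ← map_mul, ← hab', zpow_one]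
      exact zpow_right_injective₀ h.v_pos h.v_lt.ne h1
    rcases (by omega : m = 0 ∨ n = 0) with h0 | h0
    · exact Or.inl ((hunit _).2 (by rw [hm, h0, zpow_zero]))
    · exact Or.inr ((hunit _).2 (by rw [hn, h0, zpow_zero]))

theorem exists_isPrimeElement (hS : IsOpen (S : Set Gal(Ω/F))) (hK : K = fixedField S) :
    ∃ π, IsPrimeElement O K π := by
  obtain ⟨ρ, hρ⟩ := D.exists_isUnif hS
  refine ⟨Units.mk0 ⟨ρ, hK ▸ hρ.mem⟩ fun h => hρ.ne_zero (congrArg Subtype.val h),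
    (isPrimeElement_iff hD hS hK).2 hρ⟩

/-- Every integer of `L` is congruent to an element of `O`, so all of `Gal(Ω/F)` fixes its residue,
and `mem_mul_inertia_of_fix_residues` applies to each automorphism. -/
theorem totRam_fixingSubgroup [FiniteDimensional F L] (hL : IsTotallyRamified O L) :
    D.TotRam L.fixingSubgroup := by
  refine ⟨L.fixingSubgroup_isOpen, fun g => ?_⟩
  refine D.mem_mul_inertia_of_fix_residues (Subgroup.isClosed_of_isOpen _ L.fixingSubgroup_isOpen)
    g fun x hx hfix => ?_
  have hxL : x ∈ L := by
    rw [← InfiniteGalois.fixedField_fixingSubgroup L]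
    exact mem_fixedField.2 hfix
  have hloc := isLocalRing_integralClosure hD (E := L)
  let y : integralClosure O L := ⟨⟨x, hxL⟩, (isIntegral_iff hD).2 hx⟩
  obtain ⟨a, ha⟩ := hL (maximalIdeal _) inferInstance (Ideal.Quotient.mk _ y)
  have hmem : algebraMap O (integralClosure O L) a - y ∈ maximalIdeal (integralClosure O L) := by
    rw [← Ideal.Quotient.eq_zero_iff_mem, map_sub, sub_eq_zero, ← ha]
    rfl
  rw [← jacobson_eq_maximalIdeal _ bot_ne_top, mem_jacobson_iff hD] at hmem
  have hlt : D.v (algebraMap F Ω (algebraMap O F a) - x) < 1 := by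
    rw [← IsScalarTower.algebraMap_apply]
    exact hmem
  have h2 := hlt
  rw [← D.v_gal g, map_sub, g.commutes] at h2
  have := D.v_sub_lt hlt h2
  rwa [show algebraMap F Ω (algebraMap O F a) - x - (algebraMap F Ω (algebraMap O F a) - g x)
    = g x - x by ring] at this

theorem pair_fixingSubgroup [FiniteDimensional F L] [IsGalois F L] (hpL : IsPGroup p Gal(L/F))
    (hL : IsTotallyRamified O L) : D.Pair ⊤ L.fixingSubgroup where
  le := le_top
  normal := fun s _ t ht => by
    have := (InfiniteGalois.normal_iff_isGalois L).2 inferInstance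
    exact this.conj_mem t ht s
  totRam := totRam_fixingSubgroup hD hL
  exists_pow := by
    obtain ⟨n, hn⟩ := IsPGroup.iff_card.1 hpL
    refine ⟨n, ?_⟩
    rw [Subgroup.relIndex_top_right, ← IntermediateField.finrank_eq_fixingSubgroup_index,
      ← IsGalois.card_aut_eq_finrank, hn]

end ValuedClosure

end PClassFieldTheory

/-! ### Unramified extensions and the inertia group -/

namespace PClassFieldTheory

open IntermediateField IsLocalRing

section Galois

variable {F Ω : Type*} [Field F] [Field Ω] [Algebra F Ω] [IsGalois F Ω] {N : Subgroup Gal(Ω/F)}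

theorem fixingSubgroup_fixedField_of_isOpen (hN : IsOpen (N : Set Gal(Ω/F))) :
    (fixedField N).fixingSubgroup = N :=
  InfiniteGalois.fixingSubgroup_fixedField ⟨N, Subgroup.isClosed_of_isOpen _ hN⟩

theorem finiteDimensional_fixedField (hN : IsOpen (N : Set Gal(Ω/F))) :
    FiniteDimensional F (fixedField N) := by
  rw [← InfiniteGalois.isOpen_iff_finite, fixingSubgroup_fixedField_of_isOpen hN]
  exact hN

theorem restrictNormalHom_eq_iff {K : IntermediateField F Ω} [Normal F K] {g h : Gal(Ω/F)} :
    AlgEquiv.restrictNormalHom K g = AlgEquiv.restrictNormalHom K h ↔ ∀ x ∈ K, g x = h x := by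
  constructor
  · intro e x hx
    have := congrArg (fun σ : Gal(K/F) => ((σ ⟨x, hx⟩ : K) : Ω)) e
    simpa [AlgEquiv.restrictNormalHom_apply] using this
  · intro e
    ext x
    simpa [AlgEquiv.restrictNormalHom_apply] using e x x.2

theorem isAbelianGalois_fixedField [N.Normal]
    (hcomm : ∀ a b : Gal(Ω/F), a * b * a⁻¹ * b⁻¹ ∈ N) : IsAbelianGalois F (fixedField N) := by
  refine { is_comm.comm := fun σ τ => ?_ }
  obtain ⟨a, rfl⟩ := AlgEquiv.restrictNormalHom_surjective (K₁ := fixedField N) Ω σ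
  obtain ⟨b, rfl⟩ := AlgEquiv.restrictNormalHom_surjective (K₁ := fixedField N) Ω τ
  rw [← map_mul, ← map_mul, restrictNormalHom_eq_iff]
  intro x hx
  have := mem_fixedField.1 hx _ (hcomm b⁻¹ a⁻¹)
  simp only [inv_inv] at this
  calc (a * b) x = (a * b) ((b⁻¹ * a⁻¹ * b * a) x) := by rw [this]
    _ = (b * a) x := by
      rw [← AlgEquiv.mul_apply]
      congr 1
      group

theorem isPGroup_fixedField {p : ℕ} [N.Normal] (hpow : ∀ g : Gal(Ω/F), ∃ n : ℕ, g ^ p ^ n ∈ N) :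
    IsPGroup p Gal(fixedField N/F) := by
  intro σ
  obtain ⟨a, rfl⟩ := AlgEquiv.restrictNormalHom_surjective (K₁ := fixedField N) Ω σ
  obtain ⟨n, hn⟩ := hpow a
  refine ⟨n, ?_⟩
  rw [← map_pow, ← map_one (AlgEquiv.restrictNormalHom (F := F) (K₁ := Ω) (fixedField N)), restrictNormalHom_eq_iff]
  intro x hx
  simpa using mem_fixedField.1 hx _ hn

end Galois

section Unramified

variable {p : ℕ} [hp : Fact p.Prime] {O F Ω : Type*} [CommRing O] [IsDomain O]
  [IsDiscreteValuationRing O] [Field F] [Algebra O F] [IsFractionRing O F]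
  [PerfectField (ResidueField O)] [Field Ω] [Algebra F Ω] [IsGalois F Ω] [Algebra O Ω]
  [IsScalarTower O F Ω] {D : ValuedClosure p F Ω} (hD : ∀ x : Ω, D.v x ≤ 1 ↔ IsIntegral O x)
  {K : IntermediateField F Ω} [FiniteDimensional F K]

theorem module_finite_integralClosure : Module.Finite O (integralClosure O K) :=
  IsIntegralClosure.finite O F K (integralClosure O K)

include hD

/-- Where inertia acts trivially, every value is already taken on `F`, so the maximal ideal of `O`
generates that of the integers of `K`. Perfectness of the residue field takes care of separability.
-/
theorem ValuedClosure.formallyUnramified_integralClosure (hK : K ≤ fixedField D.inertia) :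
    Algebra.FormallyUnramified O (integralClosure O K) := by
  have := ValuedClosure.isLocalRing_integralClosure hD (E := K)
  have := module_finite_integralClosure (O := O) (K := K)
  have : Algebra.IsIntegral O (integralClosure O K) := inferInstance
  have hinj : Function.Injective (algebraMap O (integralClosure O K)) := by
    refine Function.Injective.of_comp (f := algebraMap (integralClosure O K) Ω) ?_
    rw [← RingHom.coe_comp, ← IsScalarTower.algebraMap_eq, IsScalarTower.algebraMap_eq O F Ω]
    exact (algebraMap F Ω).injective.comp (IsFractionRing.injective O F)
  have : FaithfulSMul O (integralClosure O K) := (faithfulSMul_iff_algebraMap_injective _ _).2 hinj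
  have hv : ∀ x : integralClosure O K, x ∈ maximalIdeal _ ↔ D.v ((x : K) : Ω) < 1 := fun x => by
    rw [← jacobson_eq_maximalIdeal _ bot_ne_top, ValuedClosure.mem_jacobson_iff hD]
    rfl
  have hloc : IsLocalHom (algebraMap O (integralClosure O K)) :=
    Algebra.IsIntegral.isLocalHom O _
  refine Algebra.FormallyUnramified.of_map_maximalIdeal (le_antisymm ?_ ?_)
  · exact ((local_hom_TFAE (algebraMap O (integralClosure O K))).out 0 2 rfl rfl).mp hloc
  · intro x hx
    by_cases hx0 : ((x : K) : Ω) = 0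
    · have : x = 0 := by ext; exact hx0
      simp [this]
    have hxK : ((x : K) : Ω) ∈ fixedField (⊤ ⊓ D.inertia) := by
      rw [top_inf_eq]
      exact hK x.1.2
    obtain ⟨z, hz, hzv⟩ := D.exists_fixed_v_eq (S := ⊤) isOpen_univ hxK hx0
    obtain ⟨a, rfl⟩ := ValuedClosure.mem_fixedField_top_iff.1 hz
    have hx1 : D.v ((x : K) : Ω) < 1 := (hv x).1 hx
    have hint : IsIntegral O a := (ValuedClosure.isIntegral_iff hD).2 (by rw [hzv]; exact hx1.le)
    obtain ⟨a, rfl⟩ := IsIntegrallyClosed.isIntegral_iff.1 hint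
    have ha0 : algebraMap O Ω a ≠ 0 := by
      intro h0
      rw [← IsScalarTower.algebraMap_apply, h0, map_zero] at hzv
      exact hx0 (D.v.eq_zero.1 hzv.symm)
    rw [← IsScalarTower.algebraMap_apply] at hzv
    let b : integralClosure O K := ⟨(x : K) / algebraMap O K a, (ValuedClosure.isIntegral_iff hD).2 (by
      rw [map_div₀, ← IsScalarTower.algebraMap_apply, map_div₀, hzv]
      exact div_self_le_one _)⟩
    have hxb : x = b * algebraMap O (integralClosure O K) a := by
      ext
      change ((x : K) : Ω) = ((x : K) : Ω) / algebraMap O Ω a * algebraMap O Ω a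
      field_simp
    rw [hxb]
    refine Ideal.mul_mem_left _ _ (Ideal.mem_map_of_mem _ ?_)
    rw [mem_maximalIdeal, mem_nonunits_iff]
    intro hu
    have h1 := (ValuedClosure.isUnit_integralClosure_iff hD (E := K)).1
      (hu.map (algebraMap O (integralClosure O K)))
    change D.v (algebraMap O Ω a) = 1 at h1
    rw [hzv] at h1
    exact hx1.ne h1

/-- An inertia automorphism agrees with the identity modulo the maximal ideal. For a formally
unramified algebra such agreement propagates to all powers of the ideal, whose intersection is zero.
-/
theorem ValuedClosure.le_fixedField_inertia [Normal F K]
    (hK : Algebra.FormallyUnramified O (integralClosure O K)) : K ≤ fixedField D.inertia := by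
  have := ValuedClosure.isLocalRing_integralClosure hD (E := K)
  have : IsNoetherianRing (integralClosure O K) :=
    IsIntegralClosure.isNoetherianRing O F K (integralClosure O K)
  intro x hx
  rw [mem_fixedField]
  intro i hi
  let g : integralClosure O K →ₐ[O] integralClosure O K :=
    (((AlgEquiv.restrictNormalHom K i : K ≃ₐ[F] K) : K →ₐ[F] K).restrictScalars O).mapIntegralClosure
  have hg : g = AlgHom.id O _ := by
    refine Algebra.FormallyUnramified.ext_of_iInf (maximalIdeal (integralClosure O K))
      (Ideal.iInf_pow_eq_bot_of_isLocalRing _ (Ideal.IsPrime.ne_top inferInstance)) fun y => ?_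
    rw [Ideal.Quotient.eq, ← jacobson_eq_maximalIdeal _ bot_ne_top,
      ValuedClosure.mem_jacobson_iff hD]
    have := hi (y : K) ((ValuedClosure.isIntegral_iff hD).1 y.2)
    convert this using 2
    change (((AlgEquiv.restrictNormalHom K i) (y : K) : K) : Ω) - ((y : K) : Ω) = _
    rw [AlgEquiv.restrictNormalHom_apply]
  have key : ∀ y ∈ K, D.v y ≤ 1 → i y = y := by
    intro y hy hy1
    have := congrArg (fun f : integralClosure O K →ₐ[O] integralClosure O K =>
      ((f ⟨⟨y, hy⟩, (ValuedClosure.isIntegral_iff hD).2 hy1⟩ : K) : Ω)) hg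
    change (((AlgEquiv.restrictNormalHom K i) (⟨y, hy⟩ : K) : K) : Ω) = y at this
    rwa [AlgEquiv.restrictNormalHom_apply] at this
  rcases le_total (D.v x) 1 with h | h
  · exact key x hx h
  · have := key x⁻¹ (inv_mem hx) (by rw [map_inv₀]; exact inv_le_one_of_one_le₀ h)
    rwa [map_inv₀, inv_inj] at this

end Unramified

section MaxAbUnramified

variable {p : ℕ} [hp : Fact p.Prime] {O F Ω : Type*} [CommRing O] [IsDomain O]
  [IsDiscreteValuationRing O] [Field F] [Algebra O F] [IsFractionRing O F]
  [PerfectField (ResidueField O)] [Field Ω] [Algebra F Ω] [IsGalois F Ω] [Algebra O Ω]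
  [IsScalarTower O F Ω] {D : ValuedClosure p F Ω}

instance normal_maxAbUnramified : Normal F (maxAbUnramified p O F Ω) := by
  unfold maxAbUnramified
  exact IntermediateField.normal_iSup (h := fun K => K.2.2.1.toIsGalois.to_normal)

variable (hD : ∀ x : Ω, D.v x ≤ 1 ↔ IsIntegral O x)

include hD

theorem ValuedClosure.apply_eq_of_mem_inertia {i : Gal(Ω/F)} (hi : i ∈ D.inertia) {x : Ω}
    (hx : x ∈ maxAbUnramified p O F Ω) : i x = x := by
  refine mem_fixedField.1 ((iSup_le fun K => ?_ : maxAbUnramified p O F Ω ≤ _) hx) i hi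
  have := K.2.1
  have := K.2.2.1.toIsGalois.to_normal
  exact ValuedClosure.le_fixedField_inertia hD K.2.2.2.2

/-- The field fixed by the kernel of `f` is a finite abelian unramified `p`-extension, hence
contained in `F~`. This identifies unramified homomorphisms into abelian `p`-groups with
homomorphisms from `Gal(F~/F)`. -/
theorem ValuedClosure.Unramified.apply_eq_one_of_fix {X : Type*} [CommGroup X]
    (hX : IsPGroup p X) {f : Gal(Ω/F) →* X} (hf : D.Unramified f) {g : Gal(Ω/F)}
    (hg : ∀ x ∈ maxAbUnramified p O F Ω, g x = x) : f g = 1 := by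
  have hfin := finiteDimensional_fixedField hf.isOpen_ker
  have hle : fixedField f.ker ≤ maxAbUnramified p O F Ω := by
    refine le_iSup (fun K : {K : IntermediateField F Ω // FiniteDimensional F K ∧
      IsAbelianGalois F K ∧ IsPGroup p Gal(K/F) ∧
        Algebra.FormallyUnramified O (integralClosure O K)} => K.1) ⟨fixedField f.ker, hfin, ?_, ?_, ?_⟩
    · refine isAbelianGalois_fixedField fun a b => ?_
      rw [MonoidHom.mem_ker, map_mul, map_mul, map_mul, map_inv, map_inv]
      rw [mul_comm (f a), mul_inv_cancel_right, mul_inv_cancel]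
    · refine isPGroup_fixedField fun a => ?_
      obtain ⟨n, hn⟩ := hX (f a)
      exact ⟨n, by rw [MonoidHom.mem_ker, map_pow, hn]⟩
    · exact ValuedClosure.formallyUnramified_integralClosure hD
        fun x hx => fixedField_le (fun i hi => hf.apply_eq_one i hi) hx
  exact ValuedClosure.mem_of_forall_fixedField hf.isOpen_ker fun x hx => hg x (hle hx)

end MaxAbUnramified

end PClassFieldTheory

/-! ### The fields Σ_χ and the abelian part of L -/

namespace PClassFieldTheory

open IntermediateField IsLocalRing

section Norm

variable {F Ω : Type*} [Field F] [Field Ω] [Algebra F Ω] [IsGalois F Ω] {S : Subgroup Gal(Ω/F)}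

/-- Coset representatives restrict to the embeddings of `K`, each exactly once. Embeddings into an
algebraic closure of `Ω` have image in `Ω`, since `Ω/F` is normal. -/
theorem algebraMap_norm_eq_relNorm (hS : IsOpen (S : Set Gal(Ω/F))) {K : IntermediateField F Ω}
    (hK : K = fixedField S) (x : K) :
    algebraMap F Ω (Algebra.norm F x) = relNorm ⊤ S (x : Ω) := by
  have hfin : FiniteDimensional F K := by
    subst hK
    exact finiteDimensional_fixedField hS
  have hxS : (x : Ω) ∈ fixedField S := hK ▸ x.2
  obtain ⟨e, he⟩ := exists_isTransversal (relIndex_ne_zero_of_isOpen hS ⊤)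
  rw [relNorm_eq_prod he hxS]
  let j : Ω →ₐ[F] AlgebraicClosure Ω := IsScalarTower.toAlgHom F Ω _
  have hj : Function.Injective j := j.injective
  refine hj ?_
  rw [AlgHom.commutes, Algebra.norm_eq_prod_embeddings F (AlgebraicClosure Ω) x, map_prod]
  let θ : Fin (S.relIndex ⊤) → (K →ₐ[F] AlgebraicClosure Ω) :=
    fun i => (j.comp (e i : Ω →ₐ[F] Ω)).comp K.val
  refine (Fintype.prod_bijective θ ⟨?_, ?_⟩ _ _ fun i => rfl).symm
  · intro i i' hii
    refine he.eq_of_mem (ValuedClosure.mem_of_forall_fixedField hS fun y hy => ?_)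
    have h1 := hj (DFunLike.congr_fun hii ⟨y, hK ▸ hy⟩ : j (e i y) = j (e i' y))
    rw [AlgEquiv.mul_apply, ← h1, ← AlgEquiv.mul_apply, inv_mul_cancel, AlgEquiv.one_apply]
  · intro σ
    obtain ⟨τ, hτ⟩ := IsAlgClosed.surjective_domRestrict_of_isAlgebraic (K := F) (L := K) (E := Ω) σ
    have hg : ∀ y, j (τ.restrictNormal' Ω y) = τ y := τ.restrictNormal_commutes Ω
    obtain ⟨i, hi, -⟩ := he.existsUnique (τ.restrictNormal' Ω) (Subgroup.mem_top _)
    refine ⟨i, AlgHom.ext fun y => ?_⟩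
    have hy := mem_fixedField.1 (show (y : Ω) ∈ fixedField S from hK ▸ y.2) _ hi
    rw [← hτ]
    change j (e i y) = τ y
    rw [← hg, ← hy, ← AlgEquiv.mul_apply, mul_inv_cancel_left, hy]

end Norm

section Sigma

variable {p : ℕ} [hp : Fact p.Prime] {O F Ω : Type*} [CommRing O] [IsDomain O]
  [IsDiscreteValuationRing O] [Field F] [Algebra O F] [IsFractionRing O F]
  [PerfectField (ResidueField O)] [Field Ω] [Algebra F Ω] [IsGalois F Ω] [Algebra O Ω]
  [IsScalarTower O F Ω] {D : ValuedClosure p F Ω} {L : IntermediateField F Ω}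

theorem restrictNormalHom_eq_one_iff [Normal F L] {g : Gal(Ω/F)} :
    AlgEquiv.restrictNormalHom L g = 1 ↔ g ∈ L.fixingSubgroup := by
  rw [← L.restrictNormalHom_ker, MonoidHom.mem_ker]

variable [FiniteDimensional F L] [IsGalois F L]

/-- The homomorphism `Gal(Ω/F) → Gal(L/F)` induced by `χ`. -/
noncomputable def inflate {E : Type*} [Field E] [Algebra F E] (χ : GalTilde p O F Ω E) :
    Gal(Ω/F) →* Gal(E/F) :=
  χ.toMonoidHom.comp (AlgEquiv.restrictNormalHom (maxAbUnramified p O F Ω))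

theorem inflate_apply {E : Type*} [Field E] [Algebra F E] (χ : GalTilde p O F Ω E) (g : Gal(Ω/F)) :
    inflate χ g = χ (AlgEquiv.restrictNormalHom (maxAbUnramified p O F Ω) g) := rfl

theorem isOpen_ker_inflate {E : Type*} [Field E] [Algebra F E] [FiniteDimensional F E]
    (χ : GalTilde p O F Ω E) : IsOpen ((inflate χ).ker : Set Gal(Ω/F)) := by
  have hc : Continuous (inflate χ) :=
    χ.continuous_toFun.comp (InfiniteGalois.restrictNormalHom_continuous _)
  exact (isOpen_discrete ({1} : Set Gal(E/F))).preimage hc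

/-- The automorphisms of `Ω` that act on `L` through `χ`. -/
noncomputable def sigmaGroup (χ : GalTilde p O F Ω L) : Subgroup Gal(Ω/F) :=
  (AlgEquiv.restrictNormalHom L).eqLocus (inflate χ)

theorem mem_sigmaGroup {χ : GalTilde p O F Ω L} {g : Gal(Ω/F)} :
    g ∈ sigmaGroup χ ↔ AlgEquiv.restrictNormalHom L g = inflate χ g := Iff.rfl

theorem isOpen_sigmaGroup (χ : GalTilde p O F Ω L) :
    IsOpen (sigmaGroup χ : Set Gal(Ω/F)) := by
  refine Subgroup.isOpen_mono (H₁ := L.fixingSubgroup ⊓ (inflate χ).ker) ?_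
    (L.fixingSubgroup_isOpen.inter (isOpen_ker_inflate χ))
  rintro g ⟨h1, h2⟩
  rw [mem_sigmaGroup, restrictNormalHom_eq_one_iff.2 h1]
  exact h2.symm

/-- The condition that elements lie in `L F~` is automatic on the fixed field, because `sigmaGroup
χ` contains the automorphisms trivial on both `L` and `F~`. -/
theorem sigmaField_eq (χ : GalTilde p O F Ω L) : sigmaField χ = fixedField (sigmaGroup χ) := by
  ext α
  rw [mem_fixedField]
  constructor
  · rintro ⟨-, h⟩ g hg
    refine h (AlgEquiv.restrictNormalHom _ g) g (fun x => ?_) fun y => ?_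
    · rw [AlgEquiv.restrictNormalHom_apply]
    · rw [← inflate_apply, ← mem_sigmaGroup.1 hg, AlgEquiv.restrictNormalHom_apply]
  · intro h
    refine ⟨?_, fun φ τ h1 h2 => h τ ?_⟩
    · rw [← InfiniteGalois.fixedField_fixingSubgroup (L ⊔ maxAbUnramified p O F Ω), mem_fixedField]
      intro g hg
      refine h g (mem_sigmaGroup.2 ?_)
      rw [inflate_apply, restrictNormalHom_eq_one_iff.2
        (IntermediateField.fixingSubgroup_le le_sup_left hg), restrictNormalHom_eq_one_iff.2
        (IntermediateField.fixingSubgroup_le le_sup_right hg), map_one]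
    · have hφ : AlgEquiv.restrictNormalHom (maxAbUnramified p O F Ω) τ = φ := by
        ext x
        rw [AlgEquiv.restrictNormalHom_apply, h1]
      rw [mem_sigmaGroup, inflate_apply, hφ]
      ext y
      rw [AlgEquiv.restrictNormalHom_apply, h2]

theorem ValuedClosure.TotRam.exists_restrict_eq (hT : D.TotRam L.fixingSubgroup) (σ : Gal(L/F)) :
    ∃ i ∈ D.inertia, AlgEquiv.restrictNormalHom L i = σ := by
  obtain ⟨g, rfl⟩ := AlgEquiv.restrictNormalHom_surjective (K₁ := L) Ω σ
  obtain ⟨t, ht, i, hi, rfl⟩ := hT.exists_mul g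
  exact ⟨i, hi, by rw [map_mul, restrictNormalHom_eq_one_iff.2 ht, one_mul]⟩

section

variable (hD : ∀ x : Ω, D.v x ≤ 1 ↔ IsIntegral O x)

include hD

theorem ValuedClosure.inflate_eq_one {E : Type*} [Field E] [Algebra F E] (χ : GalTilde p O F Ω E)
    {i : Gal(Ω/F)} (hi : i ∈ D.inertia) : inflate χ i = 1 := by
  have : AlgEquiv.restrictNormalHom (maxAbUnramified p O F Ω) i = 1 :=
    restrictNormalHom_eq_one_iff.2 ((IntermediateField.mem_fixingSubgroup_iff _ _).2
      fun x hx => ValuedClosure.apply_eq_of_mem_inertia hD hi hx)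
  rw [inflate_apply, this, map_one]

/-- Inertia acts trivially on `F~`, so `χ` is invisible on it: `Σ_χ` and `L` coincide after base
change to the maximal unramified extension. -/
theorem ValuedClosure.sigmaGroup_inf (χ : GalTilde p O F Ω L) :
    sigmaGroup χ ⊓ D.inertia = L.fixingSubgroup ⊓ D.inertia := by
  ext g
  rw [Subgroup.mem_inf, Subgroup.mem_inf]
  refine and_congr_left fun hg => ?_
  rw [mem_sigmaGroup, ValuedClosure.inflate_eq_one hD χ hg, restrictNormalHom_eq_one_iff]

/-- Inertia surjects onto `Gal(L/F)`, so any automorphism can be corrected by an inertia element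
until it acts on `L` as `χ` prescribes. -/
theorem ValuedClosure.TotRam.sigmaGroup (hT : D.TotRam L.fixingSubgroup) (χ : GalTilde p O F Ω L) :
    D.TotRam (sigmaGroup χ) := by
  refine ⟨isOpen_sigmaGroup χ, fun g => ?_⟩
  obtain ⟨i, hi, h⟩ := hT.exists_restrict_eq ((inflate χ g)⁻¹ * AlgEquiv.restrictNormalHom L g)
  refine ⟨g * i⁻¹, mem_sigmaGroup.2 ?_, i, hi, by group⟩
  rw [map_mul, map_mul, map_inv, map_inv, ValuedClosure.inflate_eq_one hD χ hi, h]
  group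

end

end Sigma

section AbelianPart

variable {p : ℕ} [hp : Fact p.Prime] {F Ω : Type*} [Field F] [Field Ω] [Algebra F Ω] [IsGalois F Ω]
  {D : ValuedClosure p F Ω} {L : IntermediateField F Ω} {T : Subgroup Gal(Ω/F)}

theorem ValuedClosure.commutator_mem_twist (h : D.Pair ⊤ T) (a b : Gal(Ω/F)) :
    a * b * a⁻¹ * b⁻¹ ∈ ValuedClosure.twist h 1 := by
  have hn : T.Normal := ⟨fun t ht s => h.normal s (Subgroup.mem_top _) t ht⟩
  obtain ⟨t, ht, i, hi, rfl⟩ := h.totRam.exists_mul_of_mem' le_top (Subgroup.mem_top a)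
  obtain ⟨u, hu, j, hj, rfl⟩ := h.totRam.exists_mul_of_mem' le_top (Subgroup.mem_top b)
  refine ⟨Subgroup.mem_top _, ⟨i, hi⟩ * ⟨j, hj⟩ * ⟨i, hi⟩⁻¹ * ⟨j, hj⟩⁻¹, ?_, ?_⟩
  · rw [map_mul, map_mul, map_mul, map_inv, map_inv, mul_comm (D.mkQ ⊤ T ⟨i, hi⟩),
      mul_inv_cancel_right, mul_inv_cancel]
    rfl
  · rw [← QuotientGroup.eq]
    have ht' : (QuotientGroup.mk t : Gal(Ω/F) ⧸ T) = 1 := (QuotientGroup.eq_one_iff t).2 ht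
    have hu' : (QuotientGroup.mk u : Gal(Ω/F) ⧸ T) = 1 := (QuotientGroup.eq_one_iff u).2 hu
    simp [ht', hu']

variable [FiniteDimensional F L] [IsGalois F L]

/-- The restriction of automorphisms from `Ω` to `L ∩ F^ab`. -/
noncomputable def abRestrict (L : IntermediateField F Ω) [IsGalois F L] :
    Gal(Ω/F) →* Gal(abelianPart L/F) :=
  (AlgEquiv.restrictNormalHom (abelianPart L)).comp (AlgEquiv.restrictNormalHom L)

theorem abRestrict_surjective : Function.Surjective (abRestrict L) :=
  (AlgEquiv.restrictNormalHom_surjective L).comp (AlgEquiv.restrictNormalHom_surjective Ω)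

theorem abRestrict_eq_one_of_mem {g : Gal(Ω/F)} (hg : g ∈ L.fixingSubgroup) :
    abRestrict L g = 1 := by
  rw [abRestrict, MonoidHom.comp_apply, restrictNormalHom_eq_one_iff.2 hg, map_one]

theorem apply_eq_of_abRestrict_eq_one {g : Gal(Ω/F)} (hg : abRestrict L g = 1) {x : Ω}
    (hx : x ∈ L) (hx' : x ∈ maxAbelian F Ω) : g x = x := by
  have h1 := congrArg (fun σ : Gal(abelianPart L/F) =>
    (((σ ⟨⟨x, hx⟩, hx'⟩ : abelianPart L) : L) : Ω)) hg
  simpa [abRestrict, AlgEquiv.restrictNormalHom_apply] using h1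

open scoped IsMulCommutative in
/-- The abelianized inertia quotient is the Galois group of `L ∩ F^ab`. -/
noncomputable def ValuedClosure.Pair.galHom (_h : D.Pair ⊤ L.fixingSubgroup) :
    D.Q ⊤ L.fixingSubgroup →* Gal(abelianPart L/F) :=
  AbQuot.lift ((abRestrict L).comp (Subgroup.subtype _)) fun _ hb =>
    abRestrict_eq_one_of_mem hb.1

theorem ValuedClosure.Pair.galHom_mk (h : D.Pair ⊤ L.fixingSubgroup)
    (i : ↥((⊤ : Subgroup Gal(Ω/F)) ⊓ D.inertia)) :
    h.galHom (D.mkQ ⊤ L.fixingSubgroup i) = abRestrict L i := by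
  open scoped IsMulCommutative in
  exact AbQuot.lift_mk _ _ _

/-- The trivial twist is normal with abelian quotient, so its fixed field lies in `L ∩ F^ab`. An
inertia element acting trivially there is in the twist, hence trivial in the abelianized quotient.
Surjectivity is again `G = T·I`. -/
theorem ValuedClosure.Pair.galHom_bijective (h : D.Pair ⊤ L.fixingSubgroup) :
    Function.Bijective h.galHom := by
  constructor
  · rw [injective_iff_map_eq_one]
    intro q hq
    obtain ⟨i, rfl⟩ := AbQuot.mk_surjective q
    rw [ValuedClosure.Pair.galHom_mk] at hq
    have hopen := (ValuedClosure.totRam_twist h D.unramified_one).isOpen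
    have hnorm : (ValuedClosure.twist h 1).Normal := ⟨fun n hn g => by
      have := mul_mem (ValuedClosure.commutator_mem_twist h g n) hn
      rwa [inv_mul_cancel_right] at this⟩
    have hle : fixedField (ValuedClosure.twist h 1) ≤ maxAbelian F Ω :=
      le_iSup (fun K : {K : IntermediateField F Ω // IsAbelianGalois F K} => K.1)
        ⟨fixedField (ValuedClosure.twist h 1),
          isAbelianGalois_fixedField (ValuedClosure.commutator_mem_twist h)⟩
    have hmem : (i : Gal(Ω/F)) ∈ ValuedClosure.twist h 1 := by
      refine ValuedClosure.mem_of_forall_fixedField hopen fun x hx => ?_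
      refine apply_eq_of_abRestrict_eq_one hq ?_ (hle hx)
      rw [← InfiniteGalois.fixedField_fixingSubgroup L]
      refine fixedField_le (fun t ht => ?_) hx
      exact ⟨Subgroup.mem_top _, 1, by simp, by simpa using ht⟩
    obtain ⟨hi, h1⟩ := (ValuedClosure.mem_twist_inf h D.unramified_one).1 ⟨hmem, i.2.2⟩
    exact h1
  · intro σ
    obtain ⟨g, rfl⟩ := abRestrict_surjective σ
    obtain ⟨t, ht, i, hi, rfl⟩ := h.totRam.exists_mul g
    refine ⟨D.mkQ _ _ ⟨i, Subgroup.mem_top _, hi⟩, ?_⟩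
    rw [ValuedClosure.Pair.galHom_mk, map_mul, abRestrict_eq_one_of_mem ht, one_mul]

/-- The abelianized inertia quotient is isomorphic to the Galois group of `L ∩ F^ab`. -/
noncomputable def ValuedClosure.Pair.galEquiv (h : D.Pair ⊤ L.fixingSubgroup) :
    D.Q ⊤ L.fixingSubgroup ≃* Gal(abelianPart L/F) :=
  MulEquiv.ofBijective h.galHom h.galHom_bijective

theorem ValuedClosure.Pair.galEquiv_mk (h : D.Pair ⊤ L.fixingSubgroup)
    (i : ↥((⊤ : Subgroup Gal(Ω/F)) ⊓ D.inertia)) :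
    h.galEquiv (D.mkQ ⊤ L.fixingSubgroup i) = abRestrict L i := h.galHom_mk i

end AbelianPart

end PClassFieldTheory

/-! ### The symbol of a unit of the base field -/

namespace PClassFieldTheory

open IntermediateField

namespace ValuedClosure

variable {p : ℕ} [hp : Fact p.Prime] {F Ω : Type*} [Field F] [Field Ω] [Algebra F Ω]
  {D : ValuedClosure p F Ω} {S T : Subgroup Gal(Ω/F)} [IsGalois F Ω]

theorem IsSymbol.mul (h : D.Pair S T) {π β β' : Ω} (hπ : D.IsUnif T π) {f f' : Gal(Ω/F) →* D.Q S T}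
    (hf : D.IsSymbol S T π β f) (hf' : D.IsSymbol S T π β' f') :
    D.IsSymbol S T π (β * β') (f * f') := by
  intro φ hφ i hi
  obtain ⟨j, hj⟩ := AbQuot.mk_surjective (f φ)
  obtain ⟨j', hj'⟩ := AbQuot.mk_surjective (f' φ)
  refine h.mul_mem_Aug_of_mk_eq hπ (i := j * j') ?_ ?_
  · obtain ⟨a, ha, hmul⟩ := h.mul_apply_div j.2 j'.2.1 hπ.mem_inf hπ.ne_zero
    have := mul_mem (mul_mem (hf φ hφ j hj) (hf' φ hφ j' hj')) ha
    convert this using 1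
    rw [Subgroup.coe_mul, hmul, map_mul, mul_div_mul_comm]
    ring
  · rw [hi, map_mul, MonoidHom.mul_apply, ← hj, ← hj']

theorem IsSymbol.inv (h : D.Pair S T) {π β : Ω} (hπ : D.IsUnif T π) {f : Gal(Ω/F) →* D.Q S T}
    (hf : D.IsSymbol S T π β f) : D.IsSymbol S T π β⁻¹ f⁻¹ := by
  intro φ hφ i hi
  have h1 := hf φ hφ i⁻¹ (by rw [map_inv, hi, MonoidHom.inv_apply, inv_inv])
  obtain ⟨a, ha, hmul⟩ := h.mul_apply_div i.2 (S.inv_mem i.2.1) hπ.mem_inf hπ.ne_zero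
  rw [mul_inv_cancel, AlgEquiv.one_apply, div_self hπ.ne_zero] at hmul
  have := inv_mem_Aug (mul_mem h1 ha)
  convert this using 1
  rw [Subgroup.coe_inv, mul_assoc, mul_inv, map_inv₀, inv_div_inv, inv_div]
  congr 1
  refine eq_inv_of_mul_eq_one_left ?_
  rw [hmul, mul_assoc]

/-- Two uniformizers differ by a unit `w`, and `i w / w` belongs to `Aug`. -/
theorem IsSymbol.congr_unif (h : D.Pair S T) {π π' β : Ω} (hπ : D.IsUnif T π) (hπ' : D.IsUnif T π')
    {f : Gal(Ω/F) →* D.Q S T} (hf : D.IsSymbol S T π β f) : D.IsSymbol S T π' β f := by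
  intro φ hφ i hi
  have hw := h.div_unif_mem_U h.totRam rfl hπ hπ'
  have := mul_mem (hf φ hφ i hi) (apply_div_mem_Aug i.2 hw)
  convert this using 1
  have h0 := hπ.ne_zero
  have h0' := hπ'.ne_zero
  have h1 : i.1 π ≠ 0 := by simpa using h0
  rw [map_div₀]
  field_simp

variable (D) in
/-- The element `u` is the norm of a unit whose symbol is `f`. -/
def HasSymbol (S T : Subgroup Gal(Ω/F)) (u : Ω) (f : Gal(Ω/F) →* D.Q S T) : Prop :=
  ∃ π, D.IsUnif T π ∧ ∃ β ∈ D.U T, D.N S T β = u ∧ D.IsSymbol S T π β f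

theorem HasSymbol.mul (h : D.Pair S T) {u u' : Ω} {f f' : Gal(Ω/F) →* D.Q S T}
    (hf : D.HasSymbol S T u f) (hf' : D.HasSymbol S T u' f') :
    D.HasSymbol S T (u * u') (f * f') := by
  obtain ⟨π, hπ, β, hβ, rfl, hs⟩ := hf
  obtain ⟨π', hπ', β', hβ', rfl, hs'⟩ := hf'
  exact ⟨π, hπ, β * β', mul_mem hβ hβ', map_mul _ _ _, hs.mul h hπ (hs'.congr_unif h hπ' hπ)⟩

theorem HasSymbol.inv (h : D.Pair S T) {u : Ω} {f : Gal(Ω/F) →* D.Q S T}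
    (hf : D.HasSymbol S T u f) : D.HasSymbol S T u⁻¹ f⁻¹ := by
  obtain ⟨π, hπ, β, hβ, rfl, hs⟩ := hf
  exact ⟨π, hπ, β⁻¹, inv_mem_U hβ, map_inv₀ _ _, hs.inv h hπ⟩

theorem Pair.exists_hasSymbol_of_hom [IsSepClosed Ω] (h : D.Pair S T) {f : Gal(Ω/F) →* D.Q S T}
    (hf : D.Unramified f) : ∃ u ∈ fixedField S, D.v u = 1 ∧ D.HasSymbol S T u f := by
  obtain ⟨π, hπ⟩ := D.exists_isUnif h.totRam.isOpen
  obtain ⟨ζ, hζ, hN, hs⟩ := h.exists_of_hom hπ hf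
  exact ⟨_, hN, (h.totRam.N_mem_U hζ).2, π, hπ, ζ, hζ, rfl, hs⟩

theorem Pair.exists_hasSymbol [IsSepClosed Ω] (h : D.Pair S T) {u : Ω} (hu : u ∈ fixedField S)
    (hv : D.v u = 1) : ∃ f, D.Unramified f ∧ D.HasSymbol S T u f := by
  obtain ⟨π, hπ⟩ := D.exists_isUnif h.totRam.isOpen
  obtain ⟨β, hβ, rfl⟩ := h.exists_N_eq (α := u) ⟨fixedField_le inf_le_left hu, hv⟩
  obtain ⟨f, hf, hs⟩ := h.exists_symbol hπ hβ fun φ hφ => mem_fixedField.1 hu φ (h.le hφ)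
  exact ⟨f, hf, π, hπ, β, hβ, rfl, hs⟩

theorem HasSymbol.exists_N_eq [IsSepClosed Ω] (h : D.Pair S T) {u : Ω} (hu : u ∈ fixedField S)
    (hs : D.HasSymbol S T u 1) : ∃ γ ∈ fixedField T, D.v γ = 1 ∧ D.N S T γ = u := by
  obtain ⟨π, hπ, β, hβ, rfl, hs⟩ := hs
  refine h.exists_fixed_N_eq hπ hβ hu fun φ hφ => ?_
  have := hs φ hφ 1 (by rw [map_one]; rfl)
  simpa [hπ.ne_zero] using this

/-- If `β` and `γ` have the same norm, then `β` is `γ` divided by some `σ π / π`, modulo `Aug`. Both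
`γ` and `σ π / π` are fixed by `T`, and `Aug` is stable under `T`, so `φ β / β` is in `Aug`. -/
theorem HasSymbol.eq_one [IsSepClosed Ω] (h : D.Pair S T) {γ : Ω} (hγ : γ ∈ fixedField T)
    (hv : D.v γ = 1) {f : Gal(Ω/F) →* D.Q S T} (hf : D.Unramified f)
    (hs : D.HasSymbol S T (D.N S T γ) f) : f = 1 := by
  obtain ⟨π, hπ, β, hβ, hN, hs⟩ := hs
  have hγU : γ ∈ D.U T := ⟨fixedField_le inf_le_left hγ, hv⟩
  have hγ0 := ne_zero_of_mem_U hγU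
  have hβ0 := ne_zero_of_mem_U hβ
  have hNγ0 : D.N S T γ ≠ 0 := ne_zero_of_mem_U (h.totRam.N_mem_U hγU)
  obtain ⟨σ, hσ, ha⟩ := h.exists_mul_mem_Aug hπ (div_mem_U hβ hγU)
    (by rw [map_div₀, hN, div_self hNγ0])
  refine Unramified.eq_of_forall h.totRam hf D.unramified_one fun φ hφ => ?_
  have hA := div_mem_Aug (h.apply_mem_Aug h.refl_left (h.le hφ) ha) ha
  have hσπ : σ π ≠ 0 := by simpa using hπ.ne_zero
  have h1 : φ (σ π) = σ π := by
    rw [h.comm_apply hφ hσ hπ.mem_inf, mem_fixedField.1 hπ.mem φ hφ]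
  have h2 : φ β / β ∈ D.Aug S T := by
    convert hA using 1
    rw [map_mul, map_div₀, map_div₀, h1, mem_fixedField.1 hπ.mem φ hφ, mem_fixedField.1 hγ φ hφ]
    have := hπ.ne_zero
    field_simp
  obtain ⟨i, hi⟩ := AbQuot.mk_surjective (f φ)
  have h3 := h.mk_eq_of_mul_mem_Aug hπ (div_ne_zero (by simpa using hβ0) hβ0) (hs φ hφ i hi)
    (j := 1) (by simpa [hπ.ne_zero] using h2)
  rw [← hi]
  exact h3.trans (map_one _)

theorem HasSymbol.unique [IsSepClosed Ω] (h : D.Pair S T) {u u' γ : Ω} (hγ : γ ∈ fixedField T)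
    (hv : D.v γ = 1) {f f' : Gal(Ω/F) →* D.Q S T} (hf : D.Unramified f) (hf' : D.Unramified f')
    (hs : D.HasSymbol S T u f) (hs' : D.HasSymbol S T u' f') (huu : u⁻¹ * u' = D.N S T γ) :
    f = f' := by
  have h1 := (hs.inv h).mul h hs'
  rw [huu] at h1
  refine inv_mul_eq_one.1 (HasSymbol.eq_one h hγ hv ⟨fun i hi => ?_, ?_⟩ h1)
  · rw [MonoidHom.mul_apply, MonoidHom.inv_apply, hf.apply_eq_one i hi, hf'.apply_eq_one i hi,
      inv_one, one_mul]
  · refine Subgroup.isOpen_mono (H₁ := f.ker ⊓ f'.ker) ?_ (hf.isOpen_ker.inter hf'.isOpen_ker)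
    rintro g ⟨hg, hg'⟩
    rw [MonoidHom.mem_ker, MonoidHom.mul_apply, MonoidHom.inv_apply, MonoidHom.mem_ker.1 hg,
      MonoidHom.mem_ker.1 hg', inv_one, one_mul]

theorem HasSymbol.exists_N_eq_div [IsSepClosed Ω] (h : D.Pair S T) {u u' : Ω}
    (hu : u ∈ fixedField S) (hu' : u' ∈ fixedField S) {f : Gal(Ω/F) →* D.Q S T}
    (hs : D.HasSymbol S T u f) (hs' : D.HasSymbol S T u' f) :
    ∃ γ ∈ fixedField T, D.v γ = 1 ∧ D.N S T γ = u⁻¹ * u' := by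
  refine HasSymbol.exists_N_eq h (mul_mem (inv_mem hu) hu') ?_
  rw [← inv_mul_cancel f]
  exact (hs.inv h).mul h hs'

end ValuedClosure

end PClassFieldTheory

/-! ### Units modulo norms and principal units -/

namespace PClassFieldTheory

open IntermediateField IsLocalRing

section Units

variable {p : ℕ} [hp : Fact p.Prime] {O F Ω : Type*} [CommRing O] [Field F] [Algebra O F]
  [Field Ω] [Algebra F Ω] [IsGalois F Ω] [Algebra O Ω]
  [IsScalarTower O F Ω] {D : ValuedClosure p F Ω} {L : IntermediateField F Ω}
  [FiniteDimensional F L] (hD : ∀ x : Ω, D.v x ≤ 1 ↔ IsIntegral O x)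

theorem algebraMap_mem_fixedField_top (x : F) :
    algebraMap F Ω x ∈ fixedField (⊤ : Subgroup Gal(Ω/F)) :=
  ValuedClosure.mem_fixedField_top_iff.2 ⟨x, rfl⟩

theorem mem_fixedField_fixingSubgroup {x : Ω} : x ∈ fixedField L.fixingSubgroup ↔ x ∈ L := by
  rw [InfiniteGalois.fixedField_fixingSubgroup]

theorem ValuedClosure.TotRam.algebraMap_unitsNorm (hT : D.TotRam L.fixingSubgroup) (γ : Lˣ) :
    algebraMap F Ω (unitsNorm F L γ : Fˣ) = D.N ⊤ L.fixingSubgroup ((γ : L) : Ω) := by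
  rw [ValuedClosure.N, hT.relNorm_inf le_top (mem_fixedField_fixingSubgroup.2 γ.1.2)]
  exact algebraMap_norm_eq_relNorm hT.isOpen (InfiniteGalois.fixedField_fixingSubgroup L).symm γ.1

include hD

theorem ValuedClosure.TotRam.mk_eq_mk_iff (hT : D.TotRam L.fixingSubgroup)
    {u u' : unitGroup O F} :
    (QuotientGroup.mk u : UnitNormQuotient O F L) = QuotientGroup.mk u' ↔
      ∃ γ ∈ fixedField L.fixingSubgroup, D.v γ = 1 ∧ D.N ⊤ L.fixingSubgroup γ =
        (algebraMap F Ω (u : Fˣ))⁻¹ * algebraMap F Ω (u' : Fˣ) := by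
  rw [QuotientGroup.eq, Subgroup.mem_subgroupOf, Subgroup.mem_map]
  constructor
  · rintro ⟨γ, hγ, h⟩
    refine ⟨(γ : L), mem_fixedField_fixingSubgroup.2 γ.1.2,
      (ValuedClosure.mem_unitGroup_iff hD).1 hγ, ?_⟩
    rw [← hT.algebraMap_unitsNorm, h]
    simp
  · rintro ⟨γ, hγ, hv, h⟩
    have hγ0 : γ ≠ 0 := by
      rintro rfl
      simp at hv
    refine ⟨Units.mk0 ⟨γ, mem_fixedField_fixingSubgroup.1 hγ⟩ fun h0 =>
      hγ0 (congrArg Subtype.val h0), (ValuedClosure.mem_unitGroup_iff hD).2 hv, ?_⟩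
    refine Units.ext ((algebraMap F Ω).injective ?_)
    rw [hT.algebraMap_unitsNorm, Units.val_mk0, h]
    simp

end Units

section Principal

namespace ValuedClosure

variable {p : ℕ} [hp : Fact p.Prime] {F Ω : Type*} [Field F] [Field Ω] [Algebra F Ω]
  {D : ValuedClosure p F Ω} {S T : Subgroup Gal(Ω/F)} [IsGalois F Ω]

/-- All conjugates in the product are inertia conjugates, so they share the residue of `x`. -/
theorem v_N_sub_pow_lt (hT : IsOpen (T : Set Gal(Ω/F))) {x : Ω}
    (hx : x ∈ fixedField (T ⊓ D.inertia)) (hx1 : D.v x ≤ 1) :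
    D.v (D.N S T x - x ^ (T ⊓ D.inertia).relIndex (S ⊓ D.inertia)) < 1 := by
  obtain ⟨e, he⟩ := exists_isTransversal (relIndex_inf_ne_zero (D := D) (S := S) hT)
  rw [relNorm_eq_prod he hx]
  let y : D.integers := ⟨x, hx1⟩
  have h1 : D.res (∏ i, e i • y) = D.res (y ^ (T ⊓ D.inertia).relIndex (S ⊓ D.inertia)) := by
    rw [map_prod, map_pow, Finset.prod_congr rfl fun i _ =>
      (show D.res (e i • y) = D.res y from D.res_eq_iff.2 ((he.mem i).2 x hx1))]
    simp
  have h2 := D.res_eq_iff.1 h1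
  rw [SubmonoidClass.coe_finsetProd] at h2
  exact h2

theorem exists_pow_sub_lt (D : ValuedClosure p F Ω) (n : ℕ) (x : F)
    (hx : D.v (algebraMap F Ω x) ≤ 1) :
    ∃ y : F, D.v (algebraMap F Ω (y ^ p ^ n - x)) < 1 := by
  induction n generalizing x with
  | zero => exact ⟨x, by simp⟩
  | succ n ih =>
    have hle : ∀ {m : ℕ} {y z : F}, m ≠ 0 → D.v (algebraMap F Ω z) ≤ 1 →
        D.v (algebraMap F Ω (y ^ m - z)) < 1 → D.v (algebraMap F Ω y) ≤ 1 := by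
      intro m y z hm hz h
      have := D.v_add_le' h.le hz
      rw [← map_add, sub_add_cancel, map_pow, map_pow] at this
      exact (pow_le_one_iff_of_nonneg (D.v.nonneg _) hm).1 this
    obtain ⟨y, hy⟩ := D.perfect x hx
    have hy1 := hle hp.out.ne_zero hx hy
    obtain ⟨z, hz⟩ := ih y hy1
    have hz1 := hle (pow_ne_zero _ hp.out.ne_zero) hy1 hz
    refine ⟨z, ?_⟩
    have h1 := D.v_pow_sub_pow_le (a := algebraMap F Ω (z ^ p ^ n)) (b := algebraMap F Ω y)
      (by rw [map_pow, map_pow]; exact pow_le_one₀ (D.v.nonneg _) hz1) hy1 p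
    rw [← map_sub] at h1
    have h2 := D.v_add_lt (h1.trans_lt hz) hy
    rw [← map_pow, ← map_pow, ← map_sub, ← map_add] at h2
    rwa [sub_add_sub_cancel, ← pow_mul, ← pow_succ] at h2

theorem v_sub_one_lt_of_pow (D : ValuedClosure p F Ω) {n : ℕ} {x : Ω} (hx : D.v x ≤ 1)
    (h : D.v (x ^ p ^ n - 1) < 1) : D.v (x - 1) < 1 := by
  let y : D.integers := ⟨x, hx⟩
  have h1 : D.res (y ^ p ^ n) = D.res 1 := D.res_eq_iff.2 h
  have h2 : (D.res y - 1) ^ p ^ n = 0 := by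
    rw [sub_pow_char_pow, one_pow, ← map_pow, h1, map_one, sub_self]
  have h3 : D.res y = D.res 1 := by
    rw [map_one]
    exact sub_eq_zero.1 (pow_eq_zero_iff (pow_ne_zero _ hp.out.ne_zero) |>.1 h2)
  exact D.res_eq_iff.1 h3

end ValuedClosure

variable {p : ℕ} [hp : Fact p.Prime] {O F Ω : Type*} [CommRing O] [Field F] [Algebra O F]
  [Field Ω] [Algebra F Ω] [IsGalois F Ω] [Algebra O Ω]
  [IsScalarTower O F Ω] {D : ValuedClosure p F Ω} {L : IntermediateField F Ω}
  [FiniteDimensional F L] (hD : ∀ x : Ω, D.v x ≤ 1 ↔ IsIntegral O x)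

include hD

/-- The residue of the norm of `γ` is the residue of `γ` to the power `p ^ n`. If the former is `1`,
so is the latter, by injectivity of Frobenius. -/
theorem ValuedClosure.map_principalUnitGroup_le (h : D.Pair ⊤ L.fixingSubgroup) :
    (principalUnitGroup O L).map (unitsNorm F L) ≤ (unitGroup O L).map (unitsNorm F L) ∧
      ∀ u ∈ principalUnitGroup O F, u ∈ (unitGroup O L).map (unitsNorm F L) →
        u ∈ (principalUnitGroup O L).map (unitsNorm F L) := by
  refine ⟨Subgroup.map_mono (principalUnitGroup_le_unitGroup O L), ?_⟩
  rintro _ hu ⟨γ, hγ, rfl⟩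
  refine ⟨γ, (ValuedClosure.mem_principalUnitGroup_iff hD).2 ?_, rfl⟩
  obtain ⟨n, hn⟩ := h.exists_pow
  have hv : D.v ((γ : L) : Ω) = 1 := (ValuedClosure.mem_unitGroup_iff hD).1 hγ
  have h1 := (ValuedClosure.mem_principalUnitGroup_iff hD).1 hu
  rw [h.totRam.algebraMap_unitsNorm] at h1
  have h2 := ValuedClosure.v_N_sub_pow_lt (D := D) (S := ⊤) h.totRam.isOpen
    (fixedField_le inf_le_left (mem_fixedField_fixingSubgroup.2 γ.1.2)) hv.le
  rw [h.totRam.relIndex_inf le_top, hn] at h2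
  refine D.v_sub_one_lt_of_pow hv.le (n := n) ?_
  have h3 := D.v_sub_lt h1 h2
  rwa [sub_sub_sub_cancel_left] at h3

/-- By perfectness the residue of `u` is a `p ^ n`-th power of the residue of some `y ∈ F`, and `y ^
(p ^ n)` is the norm of `y` viewed in `L`. -/
theorem ValuedClosure.exists_principalUnit_mul (h : D.Pair ⊤ L.fixingSubgroup) {u : Fˣ}
    (hu : u ∈ unitGroup O F) :
    ∃ γ ∈ (unitGroup O L).map (unitsNorm F L), u * γ⁻¹ ∈ principalUnitGroup O F := by
  obtain ⟨n, hn⟩ := h.exists_pow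
  have hu1 := (ValuedClosure.mem_unitGroup_iff hD).1 hu
  obtain ⟨y, hy⟩ := D.exists_pow_sub_lt n u hu1.le
  rw [map_sub, map_pow, D.v_sub_comm] at hy
  have hyn := D.v_eq_one_of_sub_lt hu1 hy
  rw [map_pow] at hyn
  have hy1 : D.v (algebraMap F Ω y) = 1 :=
    (pow_eq_one_iff_of_nonneg (D.v.nonneg _) (pow_ne_zero _ hp.out.ne_zero)).1 hyn
  have hy0 : y ≠ 0 := by
    rintro rfl
    simp at hy1
  have hfin : Module.finrank F L = p ^ n := by
    rw [IntermediateField.finrank_eq_fixingSubgroup_index, ← hn, Subgroup.relIndex_top_right]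
  let γ : Lˣ := Units.map (algebraMap F L : F →* L) (Units.mk0 y hy0)
  have hγ : unitsNorm F L γ = Units.mk0 y hy0 ^ p ^ n := by
    refine Units.ext ?_
    change Algebra.norm F (algebraMap F L y) = _
    rw [Algebra.norm_algebraMap, hfin]
    rfl
  refine ⟨_, ⟨γ, (ValuedClosure.mem_unitGroup_iff hD).2 ?_, rfl⟩, ?_⟩
  · change D.v (algebraMap L Ω (algebraMap F L y)) = 1
    rwa [← IsScalarTower.algebraMap_apply]
  · rw [ValuedClosure.mem_principalUnitGroup_iff hD, hγ]
    have h0 : algebraMap F Ω y ≠ 0 := by simpa using hy0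
    have : algebraMap F Ω ((u * (Units.mk0 y hy0 ^ p ^ n)⁻¹ : Fˣ) : F) - 1 =
        (algebraMap F Ω u - algebraMap F Ω y ^ p ^ n) / algebraMap F Ω y ^ p ^ n := by
      simp only [Units.val_mul, Units.val_inv_eq_inv_val, Units.val_pow_eq_pow_val, Units.val_mk0,
        map_mul, map_inv₀, map_pow]
      field_simp
    rw [this, map_div₀, map_pow, hyn, div_one]
    exact hy

theorem ValuedClosure.exists_principal_equiv (h : D.Pair ⊤ L.fixingSubgroup) :
    ∃ Ψ : UnitNormQuotient O F L ≃* PrincipalUnitNormQuotient O F L,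
      ∀ u : principalUnitGroup O F,
        Ψ (QuotientGroup.mk (Subgroup.inclusion (principalUnitGroup_le_unitGroup O F) u)) =
          QuotientGroup.mk u := by
  obtain ⟨hle, hinj⟩ := ValuedClosure.map_principalUnitGroup_le hD h
  let j : PrincipalUnitNormQuotient O F L →* UnitNormQuotient O F L :=
    QuotientGroup.map _ _ (Subgroup.inclusion (principalUnitGroup_le_unitGroup O F))
      fun u hu => hle hu
  have hj : Function.Bijective j := by
    constructor
    · rw [injective_iff_map_eq_one]
      intro q hq
      obtain ⟨u, rfl⟩ := QuotientGroup.mk_surjective q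
      rw [QuotientGroup.eq_one_iff]
      exact hinj u u.2 ((QuotientGroup.eq_one_iff
        (Subgroup.inclusion (principalUnitGroup_le_unitGroup O F) u)).1 hq)
    · intro q
      obtain ⟨u, rfl⟩ := QuotientGroup.mk_surjective q
      obtain ⟨γ, hγ, hu⟩ := ValuedClosure.exists_principalUnit_mul hD h u.2
      refine ⟨QuotientGroup.mk ⟨_, hu⟩, ?_⟩
      change QuotientGroup.mk _ = _
      rw [QuotientGroup.eq, Subgroup.mem_subgroupOf]
      convert hγ using 1
      simp
  refine ⟨(MulEquiv.ofBijective j hj).symm, fun u => ?_⟩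
  rw [MulEquiv.symm_apply_eq]
  rfl

end Principal

end PClassFieldTheory

/-! ### Comparison of symbols with Υ and conclusion -/

namespace PClassFieldTheory

open IntermediateField IsLocalRing

variable {p : ℕ} [hp : Fact p.Prime] {O F Ω : Type*} [CommRing O] [IsDomain O]
  [IsDiscreteValuationRing O] [Field F] [Algebra O F] [IsFractionRing O F]
  [PerfectField (ResidueField O)] [Field Ω] [Algebra F Ω] [IsGalois F Ω] [Algebra O Ω]
  [IsScalarTower O F Ω] {D : ValuedClosure p F Ω} {L : IntermediateField F Ω}
  [FiniteDimensional F L] [IsGalois F L]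

/-- Restriction to `F~` is a continuous surjection of compact Hausdorff groups, hence a quotient
map, so continuity passes to the induced homomorphism. -/
theorem exists_inflate_eq {E : Type*} [Field E] [Algebra F E] [FiniteDimensional F E]
    {f : Gal(Ω/F) →* Gal(E/F)} (hf : IsOpen (f.ker : Set Gal(Ω/F)))
    (hker : ∀ g ∈ (maxAbUnramified p O F Ω).fixingSubgroup, f g = 1) :
    ∃ χ : GalTilde p O F Ω E, inflate χ = f := by
  have hsurj : Function.Surjective
      (AlgEquiv.restrictNormalHom (F := F) (K₁ := Ω) (maxAbUnramified p O F Ω)) :=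
    AlgEquiv.restrictNormalHom_surjective Ω
  let χ := MonoidHom.liftOfSurjective
    (AlgEquiv.restrictNormalHom (F := F) (K₁ := Ω) (maxAbUnramified p O F Ω)) hsurj
    ⟨f, fun g hg => hker g (restrictNormalHom_eq_one_iff.1 hg)⟩
  have hχ : χ.comp (AlgEquiv.restrictNormalHom (maxAbUnramified p O F Ω)) = f :=
    MonoidHom.liftOfRightInverse_comp _ _ _ _
  have hcont := InfiniteGalois.restrictNormalHom_continuous (k := F) (K := Ω)
    (maxAbUnramified p O F Ω)
  have hquot : Topology.IsQuotientMap
      (AlgEquiv.restrictNormalHom (F := F) (K₁ := Ω) (maxAbUnramified p O F Ω)) :=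
    hcont.isClosedMap.isQuotientMap hcont hsurj
  refine ⟨⟨χ, hquot.continuous_iff.2 ?_⟩, hχ⟩
  have hfc : Continuous f := continuous_of_continuousAt_one f (by
    rw [ContinuousAt, map_one, nhds_discrete Gal(E/F), Filter.tendsto_pure]
    exact hf.mem_nhds (map_one f))
  convert hfc using 1
  exact congrArg DFunLike.coe hχ

theorem inflate_injective {E : Type*} [Field E] [Algebra F E] {χ χ' : GalTilde p O F Ω E}
    (h : inflate χ = inflate χ') : χ = χ' := by
  ext1 φ
  obtain ⟨g, rfl⟩ := AlgEquiv.restrictNormalHom_surjective (K₁ := maxAbUnramified p O F Ω) Ω φ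
  exact DFunLike.congr_fun h g

namespace ValuedClosure

/-- The homomorphism to the abelianized inertia quotient given by `χ`. -/
noncomputable def Pair.toQ (h : D.Pair ⊤ L.fixingSubgroup) (χ : GalTilde p O F Ω (abelianPart L)) :
    Gal(Ω/F) →* D.Q ⊤ L.fixingSubgroup :=
  h.galEquiv.symm.toMonoidHom.comp (inflate χ)

theorem Pair.galEquiv_toQ (h : D.Pair ⊤ L.fixingSubgroup)
    (χ : GalTilde p O F Ω (abelianPart L)) (g : Gal(Ω/F)) :
    h.galEquiv (h.toQ χ g) = inflate χ g := h.galEquiv.apply_symm_apply _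

theorem Pair.toQ_injective (h : D.Pair ⊤ L.fixingSubgroup)
    {χ χ' : GalTilde p O F Ω (abelianPart L)} (hχ : h.toQ χ = h.toQ χ') : χ = χ' :=
  inflate_injective (MonoidHom.ext fun g => by rw [← h.galEquiv_toQ, hχ, h.galEquiv_toQ])

theorem Pair.toQ_mul (h : D.Pair ⊤ L.fixingSubgroup) (χ χ' : GalTilde p O F Ω (abelianPart L)) :
    h.toQ (χ * χ') = h.toQ χ * h.toQ χ' := by
  ext g
  refine h.galEquiv.injective ?_
  rw [MonoidHom.mul_apply, map_mul, h.galEquiv_toQ, h.galEquiv_toQ, h.galEquiv_toQ]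
  rfl

variable (hD : ∀ x : Ω, D.v x ≤ 1 ↔ IsIntegral O x)

include hD

theorem Pair.unramified_toQ (h : D.Pair ⊤ L.fixingSubgroup)
    (χ : GalTilde p O F Ω (abelianPart L)) : D.Unramified (h.toQ χ) := by
  refine ⟨fun i hi => h.galEquiv.injective ?_, ?_⟩
  · rw [h.galEquiv_toQ, inflate_eq_one hD χ hi, map_one]
  · refine Subgroup.isOpen_mono (fun g hg => ?_) (isOpen_ker_inflate χ)
    refine h.galEquiv.injective ?_
    rw [h.galEquiv_toQ, map_one]
    exact hg

theorem Pair.exists_toQ_eq (h : D.Pair ⊤ L.fixingSubgroup)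
    {f : Gal(Ω/F) →* D.Q ⊤ L.fixingSubgroup} (hf : D.Unramified f) :
    ∃ χ : GalTilde p O F Ω (abelianPart L), h.toQ χ = f := by
  obtain ⟨χ, hχ⟩ := exists_inflate_eq (p := p) (O := O)
    (f := h.galEquiv.toMonoidHom.comp f) (E := abelianPart L)
    (Subgroup.isOpen_mono (fun g hg => by
      rw [MonoidHom.mem_ker, MonoidHom.comp_apply, MonoidHom.mem_ker.1 hg, map_one]) hf.isOpen_ker)
    fun g hg => by
      rw [MonoidHom.comp_apply, Unramified.apply_eq_one_of_fix hD h.isPGroup_Q hf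
        ((IntermediateField.mem_fixingSubgroup_iff _ _).1 hg), map_one]
  refine ⟨χ, MonoidHom.ext fun g => h.galEquiv.injective ?_⟩
  rw [h.galEquiv_toQ, hχ]
  rfl

/-- For `φ ∈ T` choose an inertia element `j` acting on `L` as `χ` prescribes for `φ`. Then `j φ`
fixes `Σ_χ`, and the comparison of uniformizers gives the class of `j` as symbol. -/
theorem Pair.hasSymbol_div (h : D.Pair ⊤ L.fixingSubgroup) (χ : GalTilde p O F Ω L)
    {π π' : Ω} (hπ : D.IsUnif L.fixingSubgroup π) (hπ' : D.IsUnif (sigmaGroup χ) π') :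
    D.HasSymbol ⊤ L.fixingSubgroup
      (relNorm ⊤ (sigmaGroup χ) π' / relNorm ⊤ L.fixingSubgroup π)
      (h.toQ (galTildeRestrict p O L χ)) := by
  have hΔ := h.totRam.sigmaGroup hD χ
  have hinf := sigmaGroup_inf hD χ
  refine ⟨π, hπ, π' / π, h.div_unif_mem_U hΔ hinf hπ hπ', h.N_div_unif hΔ le_top hinf hπ hπ', ?_⟩
  intro φ hφ i hi
  obtain ⟨j, hj, hjχ⟩ := h.totRam.exists_restrict_eq (inflate χ φ)
  have hj' : j ∈ (⊤ : Subgroup Gal(Ω/F)) ⊓ D.inertia := ⟨Subgroup.mem_top _, hj⟩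
  refine h.mul_mem_Aug_of_mk_eq hπ (i := ⟨j, hj'⟩)
    (h.symbol_div_unif hΔ hinf hπ hπ' hφ hj' (mem_sigmaGroup.2 ?_)) ?_
  · rw [map_mul, map_mul, hjχ, inflate_eq_one hD χ hj, restrictNormalHom_eq_one_iff.2 hφ,
      one_mul, mul_one]
  · rw [hi]
    refine h.galEquiv.injective ?_
    rw [h.galEquiv_toQ, h.galEquiv_mk, abRestrict, MonoidHom.comp_apply, hjχ]
    rfl

variable [IsSepClosed Ω]

/-- `N_{Σ_χ/F} π_χ / N_{L/F} π_L` is a unit with symbol `χ`. -/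
theorem Pair.exists_isUpsilonUnit (h : D.Pair ⊤ L.fixingSubgroup) (χ : GalTilde p O F Ω L)
    {πχ : (sigmaField χ)ˣ} {πL : Lˣ} (hχ : IsPrimeElement O (sigmaField χ) πχ)
    (hL : IsPrimeElement O L πL) :
    ∃ u : unitGroup O F, IsUpsilonUnit χ πχ πL u ∧ D.HasSymbol ⊤ L.fixingSubgroup
      (algebraMap F Ω (u : Fˣ)) (h.toQ (galTildeRestrict p O L χ)) := by
  have hLT := (InfiniteGalois.fixedField_fixingSubgroup L).symm
  have hπ := (isPrimeElement_iff hD h.totRam.isOpen hLT).1 hL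
  have hπ' := (isPrimeElement_iff hD (isOpen_sigmaGroup χ) (sigmaField_eq χ)).1 hχ
  have hs := h.hasSymbol_div hD χ hπ hπ'
  have heq : algebraMap F Ω ((unitsNorm F (sigmaField χ) πχ / unitsNorm F L πL : Fˣ) : F) =
      relNorm ⊤ (sigmaGroup χ) ((πχ : sigmaField χ) : Ω) /
        relNorm ⊤ L.fixingSubgroup ((πL : L) : Ω) := by
    rw [Units.val_div_eq_div_val, map_div₀,
      ← algebraMap_norm_eq_relNorm (isOpen_sigmaGroup χ) (sigmaField_eq χ),
      ← algebraMap_norm_eq_relNorm h.totRam.isOpen hLT]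
    rfl
  rw [← heq] at hs
  refine ⟨⟨_, (mem_unitGroup_iff hD).2 ?_⟩, rfl, hs⟩
  obtain ⟨π, -, β, hβ, hN, -⟩ := hs
  rw [← hN]
  exact (h.totRam.N_mem_U hβ).2

/-- Every choice of prime elements yields a unit with the symbol of `χ`, and units with equal
symbols differ by a norm. This settles the independence of the choices as well. -/
theorem Pair.upsilon_eq (h : D.Pair ⊤ L.fixingSubgroup) (χ : GalTilde p O F Ω L)
    {u : unitGroup O F} (hu : D.HasSymbol ⊤ L.fixingSubgroup (algebraMap F Ω (u : Fˣ))
      (h.toQ (galTildeRestrict p O L χ))) : upsilon χ = QuotientGroup.mk u := by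
  have hLT := (InfiniteGalois.fixedField_fixingSubgroup L).symm
  obtain ⟨πχ, hχ⟩ := exists_isPrimeElement hD (isOpen_sigmaGroup χ) (sigmaField_eq χ)
  obtain ⟨πL, hL⟩ := exists_isPrimeElement hD h.totRam.isOpen hLT
  obtain ⟨w, hw, -⟩ := h.exists_isUpsilonUnit hD χ hχ hL
  have hex : ∃ u : unitGroup O F, ∃ (πχ : (sigmaField χ)ˣ) (πL : Lˣ),
      IsPrimeElement O (sigmaField χ) πχ ∧ IsPrimeElement O L πL ∧ IsUpsilonUnit χ πχ πL u :=
    ⟨w, πχ, πL, hχ, hL, hw⟩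
  rw [upsilon, dif_pos hex]
  obtain ⟨πχ', πL', hχ', hL', hu'⟩ := hex.choose_spec
  obtain ⟨w', hw', hs'⟩ := h.exists_isUpsilonUnit hD χ hχ' hL'
  have : hex.choose = w' := Subtype.ext (hu'.trans hw'.symm)
  rw [this, h.totRam.mk_eq_mk_iff hD]
  exact HasSymbol.exists_N_eq_div h (algebraMap_mem_fixedField_top _)
    (algebraMap_mem_fixedField_top _) hs' hu

/-- The isomorphism attached to the symbol. -/
theorem Pair.exists_equiv (h : D.Pair ⊤ L.fixingSubgroup) :
    ∃ Φ : GalTilde p O F Ω (abelianPart L) ≃* UnitNormQuotient O F L, ∀ χ : GalTilde p O F Ω L,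
      Φ (galTildeRestrict p O L χ) = upsilon χ := by
  -- The isomorphism sends `χ` to the class of any unit with that symbol, so `χ` need not be lifted
  -- to `Gal(L/F)`.
  have hex : ∀ χ : GalTilde p O F Ω (abelianPart L), ∃ u : unitGroup O F,
      D.HasSymbol ⊤ L.fixingSubgroup (algebraMap F Ω (u : Fˣ)) (h.toQ χ) := by
    intro χ
    obtain ⟨u, hu, hv, hs⟩ := h.exists_hasSymbol_of_hom (h.unramified_toQ hD χ)
    obtain ⟨a, rfl⟩ := mem_fixedField_top_iff.1 hu
    have ha : a ≠ 0 := by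
      rintro rfl
      simp at hv
    exact ⟨⟨Units.mk0 a ha, (mem_unitGroup_iff hD).2 hv⟩, hs⟩
  have huniq : ∀ {u u' : unitGroup O F} {f : Gal(Ω/F) →* D.Q ⊤ L.fixingSubgroup},
      D.HasSymbol ⊤ L.fixingSubgroup (algebraMap F Ω (u : Fˣ)) f →
      D.HasSymbol ⊤ L.fixingSubgroup (algebraMap F Ω (u' : Fˣ)) f →
      (QuotientGroup.mk u : UnitNormQuotient O F L) = QuotientGroup.mk u' := by
    intro u u' f hu hu'
    rw [h.totRam.mk_eq_mk_iff hD]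
    exact HasSymbol.exists_N_eq_div h (algebraMap_mem_fixedField_top _)
      (algebraMap_mem_fixedField_top _) hu hu'
  choose w hw using hex
  let Φ : GalTilde p O F Ω (abelianPart L) →* UnitNormQuotient O F L :=
    MonoidHom.mk' (fun χ => QuotientGroup.mk (w χ)) fun χ χ' => by
      rw [← QuotientGroup.mk_mul]
      refine huniq (hw _) ?_
      rw [h.toQ_mul, Subgroup.coe_mul, Units.val_mul, map_mul]
      exact (hw χ).mul h (hw χ')
  have hΦ : Function.Bijective Φ := by
    constructor
    · intro χ χ' hχ
      obtain ⟨γ, hγ, hv, hN⟩ := (h.totRam.mk_eq_mk_iff hD).1 hχ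
      exact h.toQ_injective (HasSymbol.unique h hγ hv (h.unramified_toQ hD χ)
        (h.unramified_toQ hD χ') (hw χ) (hw χ') hN.symm)
    · intro q
      obtain ⟨u, rfl⟩ := QuotientGroup.mk_surjective q
      obtain ⟨f, hf, hs⟩ := h.exists_hasSymbol
        (algebraMap_mem_fixedField_top (u : Fˣ).1) ((mem_unitGroup_iff hD).1 u.2)
      obtain ⟨χ, rfl⟩ := h.exists_toQ_eq hD hf
      exact ⟨χ, huniq (hw χ) hs⟩
  exact ⟨MulEquiv.ofBijective Φ hΦ, fun χ => (h.upsilon_eq hD χ (hw _)).symm⟩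

end ValuedClosure

end PClassFieldTheory

theorem mainTheorem1
    (p : ℕ) [Fact p.Prime]
    -- `F` is a complete discrete valuation field with ring of integers `O`
    {O F Ω : Type*} [CommRing O] [IsDomain O] [IsDiscreteValuationRing O]
    [IsAdicComplete (IsLocalRing.maximalIdeal O) O]
    [Field F] [Algebra O F] [IsFractionRing O F]
    -- the residue field `k` is perfect of characteristic `p`, and `℘(k) ≠ k`
    [CharP (IsLocalRing.ResidueField O) p] [PerfectField (IsLocalRing.ResidueField O)]
    (hk : Set.range (fun a : IsLocalRing.ResidueField O => a ^ p - a) ≠ Set.univ)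
    -- `Ω` is a separable closure of `F`
    [Field Ω] [Algebra F Ω] [IsSepClosure F Ω] [Algebra O Ω] [IsScalarTower O F Ω]
    -- `L` is a finite totally ramified Galois `p`-extension of `F`
    (L : IntermediateField F Ω) [FiniteDimensional F L] [IsGalois F L]
    (hp : IsPGroup p Gal(L/F)) (hL : IsTotallyRamified O L) :
    -- `Υ_{L/F}` is well defined
    (∀ χ : GalTilde p O F Ω L,
      (∃ πχ, IsPrimeElement O (sigmaField χ) πχ) ∧ (∃ πL, IsPrimeElement O L πL) ∧
      ∀ πχ πL, IsPrimeElement O (sigmaField χ) πχ → IsPrimeElement O L πL →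
        ∃ u : unitGroup O F, IsUpsilonUnit χ πχ πL u ∧ upsilon χ = QuotientGroup.mk u) ∧
    -- `Υ_{L/F}` is a homomorphism
    (∀ χ₁ χ₂ χ : GalTilde p O F Ω L, (∀ φ, χ φ = χ₁ φ * χ₂ φ) →
      upsilon χ = upsilon χ₁ * upsilon χ₂) ∧
    -- `Υ_{L/F}` induces the isomorphism `Gal(L ∩ F^ab/F)^~ ≅ U_F / N_{L/F} U_L`
    (∃ Φ : GalTilde p O F Ω (abelianPart L) ≃* UnitNormQuotient O F L,
      ∀ χ : GalTilde p O F Ω L, Φ (galTildeRestrict p O L χ) = upsilon χ) ∧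
    -- `U_F / N_{L/F} U_L ≅ U_{1,F} / N_{L/F} U_{1,L}`, the inverse of the map given by inclusion
    (∃ Ψ : UnitNormQuotient O F L ≃* PrincipalUnitNormQuotient O F L,
      ∀ u : principalUnitGroup O F,
        Ψ (QuotientGroup.mk (Subgroup.inclusion (principalUnitGroup_le_unitGroup O F) u)) =
          QuotientGroup.mk u) := by
  have hsep : IsSepClosed Ω := IsSepClosure.sep_closed F
  obtain ⟨D, hD⟩ := exists_valuedClosure p O F Ω
  have h : D.Pair ⊤ L.fixingSubgroup := ValuedClosure.pair_fixingSubgroup hD hp hL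
  obtain ⟨Φ, hΦ⟩ := h.exists_equiv hD
  refine ⟨fun χ => ⟨ValuedClosure.exists_isPrimeElement hD (isOpen_sigmaGroup χ) (sigmaField_eq χ),
    ValuedClosure.exists_isPrimeElement hD h.totRam.isOpen
      (InfiniteGalois.fixedField_fixingSubgroup L).symm, fun πχ πL hχ hL => ?_⟩,
    fun χ₁ χ₂ χ hχ => ?_, ⟨Φ, hΦ⟩, ValuedClosure.exists_principal_equiv hD h⟩
  · obtain ⟨u, hu, hs⟩ := h.exists_isUpsilonUnit hD χ hχ hL
    exact ⟨u, hu, h.upsilon_eq hD χ hs⟩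
  -- The values depend only on restrictions to `L ∩ F^ab`, where the pointwise product is the group
  -- law and `Φ` is multiplicative.
  · rw [← hΦ, ← hΦ, ← hΦ, ← map_mul]
    congr 1
    ext1 φ
    change AlgEquiv.restrictNormalHom (abelianPart L) (χ φ) =
      AlgEquiv.restrictNormalHom (abelianPart L) (χ₁ φ) *
        AlgEquiv.restrictNormalHom (abelianPart L) (χ₂ φ)
    rw [hχ, map_mul]
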